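/- Let $k,n,q_1,\dots,q_k\in\mathbb{N}$, let $\Sigma\subseteq\mathbb{R}^n$ and $\Omega_l\subseteq\mathbb{R}^{q_l}$ ($l=1,\dots,k$) be open, put $q=q_1+\dots+q_k$, $\Omega=\prod_{l=1}^k\Omega_l$, and $$K=(\overline{\mathbb{R}}_+)^k\times\Sigma\times\Omega,\qquad \operatorname{Int}K=(\mathbb{R}_+)^k\times\Sigma\times\Omega,$$ with variables $(r,x,y)$ and covariables $(\rho,\xi,\eta)\in\mathbb{R}^{k+n+q}$, where $y=(y_1,\dots,y_k)$, $\eta=(\eta_1,\dots,\eta_k)$ with $y_l\in\Omega_l$, $\eta_l\in\mathbb{R}^{q_l}$. For an open set $U\subseteq\mathbb{R}^N$ and $\mu\in\mathbb{R}$ let $S^\mu(U\times\mathbb{R}^N)$ be the space of all $a\in C^\infty(U\times\mathbb{R}^N)$ such that $|D_z^\alpha D_\zeta^\beta a(z,\zeta)|\le c\,(1+|\zeta|^2)^{(\mu-|\beta|)/2}$ for all $z\in L$, $\zeta\in\mathbb{R}^N$, for every compact $L\subset U$ and all $\alpha,\beta$, with $c=c(\alpha,\beta,L)$. Let $S^\mu_{\rm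 cl}(U\times\mathbb{R}^N)$ be the subspace of those $a$ for which there are $a_{(\mu-j)}\in C^\infty(U\times(\mathbb{R}^N\setminus\{0\}))$, positively homogeneous of order $\mu-j$ in $\zeta$, with $a-\chi(\zeta)\sum_{j=0}^{M}a_{(\mu-j)}\in S^{\mu-(M+1)}(U\times\mathbb{R}^N)$ for all $M\in\mathbb{N}$ and every excision function $\chi$ (smooth, zero near $0$, one near infinity). Let $S^\mu_{\rm cl}(K\times\mathbb{R}^{k+n+q})$ be the space of restrictions to $K$ of elements of $S^\mu_{\rm cl}\big((\mathbb{R}^k\times\Sigma\times\Omega)\times\mathbb{R}^{k+n+q}\big)$, with the restricted homogeneous components. For an open set $U\subseteq\mathbb{R}^N$, $L^{-\infty}(U)$ is the space of integral operators $C_0^\infty(U)\to C^\infty(U)$ with kernel in $C^\infty(U\times U)$, and $L^\mu_{\rm cl}(U)$ is the space of operators $A:C_0^\infty(U)\to C^\infty(U)$ of the form $A=\operatorname{Op}(a)$ mod $L^{-\infty}(U)$ with $a\in S^\mu_{\rm cl}(U\times\mathbb{R}^N)$, where $\operatorname{Op}(a)u(z)=(2\pi)^{-N}\int e^{iz\zeta}a(z,\zeta)\hat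 u(\zeta)\,d\zeta$, $\hat u(\zeta)=\int e^{-iz\zeta}u(z)\,dz$. Such an operator is called properly supported if both projections to $U$ of the support of its distributional kernel are proper maps. If $A$ or $B$ is properly supported, then $AB:C_0^\infty(U)\to C^\infty(U)$ is well defined ($B$ then maps $C_0^\infty(U)$ to itself, or $A$ extends to $C^\infty(U)$). Let $L^\mu_{\rm cl}(\operatorname{Int}K)_{\rm corner}$ be the set of all $A\in L^\mu_{\rm cl}(\operatorname{Int}K)$ of the form $A=\operatorname{Op}(a)$ mod $L^{-\infty}(\operatorname{Int}K)$ with $$a(r,x,y,\rho,\xi,\eta)=r_1^{-\mu}\cdots r_k^{-\mu}\;\tilde p(r,x,y,\tilde\rho,\xi,\tilde\eta),\quad \tilde\rho=(r_1\rho_1,\,r_1r_2\rho_2,\dots,r_1\cdots r_k\rho_k),\quad \tilde\eta=(r_1\eta_1,\,r_1r_2\eta_2,\dots,r_1\cdots r_k\eta_k),$$ for some $\tilde p(r,x,y,\tilde\rho,\xi,\tilde\eta)\in S^\mu_{\rm cl}(K\times\mathbb{R}^{k+n+q})$. Such an $A$ is called $\sigma_\psi$-elliptic if the homogeneous principal symbol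 satisfies $\tilde p_{(\mu)}(r,x,y,\tilde\rho,\xi,\tilde\eta)\neq0$ for all $(r,x,y)\in K$ and all $(\tilde\rho,\xi,\tilde\eta)\neq0$. Then, for all $\mu,\nu\in\mathbb{R}$: (i) If $A\in L^\mu_{\rm cl}(\operatorname{Int}K)_{\rm corner}$, $B\in L^\nu_{\rm cl}(\operatorname{Int}K)_{\rm corner}$, and $A$ or $B$ is properly supported, then $AB\in L^{\mu+\nu}_{\rm cl}(\operatorname{Int}K)_{\rm corner}$. (ii) If $A\in L^\mu_{\rm cl}(\operatorname{Int}K)_{\rm corner}$ is $\sigma_\psi$-elliptic, then there is a properly supported $P_0\in L^{-\mu}_{\rm cl}(\operatorname{Int}K)_{\rm corner}$ such that $I-P_0A$ and $I-AP_0$ belong to $L^{-\infty}(\operatorname{Int}K)$. -/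

import Mathlib

open scoped ContDiff Distributions
open TopologicalSpace

namespace CornerPsiDO

/-! ### Symbols over an open set -/

/-- The Japanese bracket `⟨ξ⟩ = (1 + |ξ|²)^{1/2}`. -/
noncomputable def bracket {ι : Type} [Fintype ι] (ξ : EuclideanSpace ℝ ι) : ℝ :=
  Real.sqrt (1 + ‖ξ‖ ^ 2)

/-- The partial derivative `∂a/∂x_i` of a function `a(x, ξ)`. -/
noncomputable def dx {ι : Type} [Fintype ι] [DecidableEq ι] (i : ι)
    (a : EuclideanSpace ℝ ι → EuclideanSpace ℝ ι → ℂ) :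
    EuclideanSpace ℝ ι → EuclideanSpace ℝ ι → ℂ :=
  fun x ξ => fderiv ℝ (fun x' => a x' ξ) x (EuclideanSpace.single i 1)

/-- The partial derivative `∂a/∂ξ_i` of a function `a(x, ξ)`. -/
noncomputable def dxi {ι : Type} [Fintype ι] [DecidableEq ι] (i : ι)
    (a : EuclideanSpace ℝ ι → EuclideanSpace ℝ ι → ℂ) :
    EuclideanSpace ℝ ι → EuclideanSpace ℝ ι → ℂ :=
  fun x ξ => fderiv ℝ (fun ξ' => a x ξ') ξ (EuclideanSpace.single i 1)

/-- `∂_x^α ∂_ξ^β a`; the multi-indices `α`, `β` are written as words of coordinate directions,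
so that `|α|`, `|β|` are the lengths of the words. -/
noncomputable def mixedDeriv {ι : Type} [Fintype ι] [DecidableEq ι] (α β : List ι)
    (a : EuclideanSpace ℝ ι → EuclideanSpace ℝ ι → ℂ) :
    EuclideanSpace ℝ ι → EuclideanSpace ℝ ι → ℂ :=
  α.foldr dx (β.foldr dxi a)

/-- Hörmander's class `S^m(U × ℝ^ι)`. Only the values `a x ξ` with `x ∈ U` matter. -/
def IsSymbol {ι : Type} [Fintype ι] [DecidableEq ι] (U : Opens (EuclideanSpace ℝ ι)) (m : ℝ)
    (a : EuclideanSpace ℝ ι → EuclideanSpace ℝ ι → ℂ) : Prop :=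
  ContDiffOn ℝ ∞ (fun p : EuclideanSpace ℝ ι × EuclideanSpace ℝ ι => a p.1 p.2)
    ((U : Set (EuclideanSpace ℝ ι)) ×ˢ Set.univ) ∧
  ∀ (α β : List ι) (L : Set (EuclideanSpace ℝ ι)), IsCompact L → L ⊆ U →
    ∃ c : ℝ, ∀ x ∈ L, ∀ ξ, ‖mixedDeriv α β a x ξ‖ ≤ c * bracket ξ ^ (m - (β.length : ℝ))

/-- Excision functions: smooth, zero near the origin, one near infinity. -/
def IsExcision {ι : Type} [Fintype ι] (χ : EuclideanSpace ℝ ι → ℂ) : Prop :=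
  ContDiff ℝ ∞ χ ∧ (∃ ε > 0, ∀ ξ, ‖ξ‖ ≤ ε → χ ξ = 0) ∧ ∃ R : ℝ, ∀ ξ, R ≤ ‖ξ‖ → χ ξ = 1

/-- `a` is a classical symbol of order `m` over `U` with homogeneous components
`h j = a_{(m - j)}`, smooth on `U × (ℝ^ι ∖ 0)`: for every `N` the difference
`a - χ ∑_{j < N} a_{(m - j)}` belongs to `S^{m - N}(U × ℝ^ι)`
(for `N = 0` this says that `a` belongs to `S^m(U × ℝ^ι)`). -/
def HasExpansion {ι : Type} [Fintype ι] [DecidableEq ι] (U : Opens (EuclideanSpace ℝ ι)) (m : ℝ)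
    (a : EuclideanSpace ℝ ι → EuclideanSpace ℝ ι → ℂ)
    (h : ℕ → EuclideanSpace ℝ ι → EuclideanSpace ℝ ι → ℂ) : Prop :=
  (∀ j, ContDiffOn ℝ ∞ (fun p : EuclideanSpace ℝ ι × EuclideanSpace ℝ ι => h j p.1 p.2)
    ((U : Set (EuclideanSpace ℝ ι)) ×ˢ {0}ᶜ)) ∧
  (∀ j, ∀ x ∈ U, ∀ ξ ≠ 0, ∀ t : ℝ, 0 < t →
    h j x (t • ξ) = ((t ^ (m - (j : ℝ)) : ℝ) : ℂ) * h j x ξ) ∧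
  ∀ χ : EuclideanSpace ℝ ι → ℂ, IsExcision χ → ∀ N : ℕ,
    IsSymbol U (m - (N : ℝ)) (fun x ξ => a x ξ - χ ξ * ∑ j ∈ Finset.range N, h j x ξ)

/-- The class `S^m_cl(U × ℝ^ι)` of classical symbols. -/
def IsClassicalSymbol {ι : Type} [Fintype ι] [DecidableEq ι] (U : Opens (EuclideanSpace ℝ ι))
    (m : ℝ) (a : EuclideanSpace ℝ ι → EuclideanSpace ℝ ι → ℂ) : Prop :=
  ∃ h, HasExpansion U m a h

/-! ### Operators `C_0^∞(Ω) → C^∞(Ω)` -/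

/-- The space `C^∞(Ω)`; a function on `Ω` is represented by its extension by zero. -/
def SmoothFun {ι : Type} [Fintype ι] (Ω : Opens (EuclideanSpace ℝ ι)) :
    Submodule ℂ (EuclideanSpace ℝ ι → ℂ) where
  carrier := {f | ContDiffOn ℝ ∞ f Ω ∧ ∀ x, x ∉ Ω → f x = 0}
  add_mem' := fun hf hg =>
    ⟨hf.1.add hg.1, fun x hx => by simp [hf.2 x hx, hg.2 x hx]⟩
  zero_mem' := ⟨contDiffOn_const, fun _ _ => rfl⟩
  smul_mem' := fun c f hf =>
    ⟨contDiffOn_const.smul hf.1, fun x hx => by simp [hf.2 x hx]⟩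

/-- Linear operators `C_0^∞(Ω) → C^∞(Ω)`. -/
abbrev Operator {ι : Type} [Fintype ι] (Ω : Opens (EuclideanSpace ℝ ι)) : Type :=
  𝓓(Ω, ℂ) →ₗ[ℂ] SmoothFun Ω

/-- The identity operator, that is, the inclusion of `C_0^∞(Ω)` in `C^∞(Ω)`. -/
noncomputable def idOp {ι : Type} [Fintype ι] (Ω : Opens (EuclideanSpace ℝ ι)) : Operator Ω where
  toFun u := ⟨u, u.contDiff.contDiffOn, fun _ hx =>
    image_eq_zero_of_notMem_tsupport fun h => hx (u.tsupport_subset h)⟩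
  map_add' _ _ := rfl
  map_smul' _ _ := rfl

/-- `L^{-∞}(Ω)`: integral operators with a kernel in `C^∞(Ω × Ω)`. -/
def IsSmoothing {ι : Type} [Fintype ι] {Ω : Opens (EuclideanSpace ℝ ι)} (A : Operator Ω) : Prop :=
  ∃ c : EuclideanSpace ℝ ι → EuclideanSpace ℝ ι → ℂ,
    ContDiffOn ℝ ∞ (fun p : EuclideanSpace ℝ ι × EuclideanSpace ℝ ι => c p.1 p.2)
      ((Ω : Set (EuclideanSpace ℝ ι)) ×ˢ (Ω : Set (EuclideanSpace ℝ ι))) ∧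
    ∀ (u : 𝓓(Ω, ℂ)), ∀ x ∈ Ω,
      (A u : EuclideanSpace ℝ ι → ℂ) x = ∫ y in (Ω : Set (EuclideanSpace ℝ ι)), c x y * u y

/-- The Fourier transform `û(ξ) = ∫ e^{-i y ξ} u(y) dy`. -/
noncomputable def fourierHat {ι : Type} [Fintype ι] (u : EuclideanSpace ℝ ι → ℂ)
    (ξ : EuclideanSpace ℝ ι) : ℂ :=
  ∫ y, Complex.exp (-(Complex.I * ((inner ℝ y ξ : ℝ) : ℂ))) * u y

/-- `(Op(a) u)(x) = (2π)^{-N} ∫ e^{i x ξ} a(x, ξ) û(ξ) dξ`, where `N` is the dimension. -/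
noncomputable def opLeft {ι : Type} [Fintype ι]
    (a : EuclideanSpace ℝ ι → EuclideanSpace ℝ ι → ℂ) (u : EuclideanSpace ℝ ι → ℂ)
    (x : EuclideanSpace ℝ ι) : ℂ :=
  (((2 * Real.pi) ^ Fintype.card ι : ℝ) : ℂ)⁻¹ *
    ∫ ξ, Complex.exp (Complex.I * ((inner ℝ x ξ : ℝ) : ℂ)) * a x ξ * fourierHat u ξ

/-- `A = Op(a) mod L^{-∞}(Ω)`. -/
def HasLeftSymbol {ι : Type} [Fintype ι] {Ω : Opens (EuclideanSpace ℝ ι)} (A : Operator Ω)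
    (a : EuclideanSpace ℝ ι → EuclideanSpace ℝ ι → ℂ) : Prop :=
  ∃ R : Operator Ω, IsSmoothing R ∧ ∀ (u : 𝓓(Ω, ℂ)), ∀ x ∈ Ω,
    (A u : EuclideanSpace ℝ ι → ℂ) x = opLeft a u x + (R u : EuclideanSpace ℝ ι → ℂ) x

/-- `L^m_cl(Ω)`: classical pseudo-differential operators of order `m` on `Ω`. -/
def IsClassicalPsiDO {ι : Type} [Fintype ι] [DecidableEq ι] {Ω : Opens (EuclideanSpace ℝ ι)}
    (m : ℝ) (A : Operator Ω) : Prop :=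
  ∃ a, IsClassicalSymbol Ω m a ∧ HasLeftSymbol A a

/-- The support of the distributional kernel of `A`, as a subset of `Ω × Ω`: a point `(x, y)`
is outside if and only if it has a neighbourhood `V × W` such that `A u = 0` on `V` for all
test functions `u` supported in `W`. -/
def kernelSupport {ι : Type} [Fintype ι] {Ω : Opens (EuclideanSpace ℝ ι)} (A : Operator Ω) :
    Set (EuclideanSpace ℝ ι × EuclideanSpace ℝ ι) :=
  {p | p.1 ∈ Ω ∧ p.2 ∈ Ω ∧ ∀ V W : Set (EuclideanSpace ℝ ι), IsOpen V → IsOpen W →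
    p.1 ∈ V → p.2 ∈ W →
    ∃ u : 𝓓(Ω, ℂ), tsupport u ⊆ W ∧ ∃ x ∈ V, (A u : EuclideanSpace ℝ ι → ℂ) x ≠ 0}

/-- `A` is properly supported: both projections from the support of its kernel to `Ω` are
proper maps. -/
def IsProperlySupported {ι : Type} [Fintype ι] {Ω : Opens (EuclideanSpace ℝ ι)}
    (A : Operator Ω) : Prop :=
  ∀ L : Set (EuclideanSpace ℝ ι), IsCompact L → L ⊆ Ω →
    IsCompact (kernelSupport A ∩ Prod.fst ⁻¹' L) ∧ IsCompact (kernelSupport A ∩ Prod.snd ⁻¹' L)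

/-- The test function `φ f` for `φ ∈ C_0^∞(Ω)` and `f ∈ C^∞(Ω)`. -/
noncomputable def cutMul {ι : Type} [Fintype ι] {Ω : Opens (EuclideanSpace ℝ ι)} (φ : 𝓓(Ω, ℂ))
    (f : SmoothFun Ω) : 𝓓(Ω, ℂ) where
  toFun x := φ x * (f : EuclideanSpace ℝ ι → ℂ) x
  contDiff' := by
    rw [contDiff_iff_contDiffAt]
    intro x
    by_cases hx : x ∈ tsupport φ
    · exact φ.contDiff.contDiffAt.mul
        ((f.2.1 x (φ.tsupport_subset hx)).contDiffAt (Ω.isOpen.mem_nhds (φ.tsupport_subset hx)))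
    · refine (contDiffAt_const (c := (0 : ℂ))).congr_of_eventuallyEq ?_
      filter_upwards [(isClosed_tsupport φ).isOpen_compl.mem_nhds hx] with y hy
      simp [image_eq_zero_of_notMem_tsupport hy]
  hasCompactSupport' := φ.hasCompactSupport.mul_right
  tsupport_subset' := (tsupport_mul_subset_left).trans φ.tsupport_subset

/-- `v` is the value at `x` of `A` applied to the smooth function `f`, which need not have compact
support: `A (φ f)(x) = v` for all cut-off functions `φ ∈ C_0^∞(Ω)` that are equal to one on a
sufficiently large compact subset of `Ω`. For `f ∈ C_0^∞(Ω)` this is the value of `A f` at `x`;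
if `A` is properly supported it is the value at `x` of the extension of `A` to `C^∞(Ω)`. -/
def HasValueAt {ι : Type} [Fintype ι] {Ω : Opens (EuclideanSpace ℝ ι)} (A : Operator Ω)
    (f : SmoothFun Ω) (x : EuclideanSpace ℝ ι) (v : ℂ) : Prop :=
  ∃ L : Set (EuclideanSpace ℝ ι), IsCompact L ∧ L ⊆ Ω ∧
    ∀ φ : 𝓓(Ω, ℂ), (∀ y ∈ L, φ y = 1) → (A (cutMul φ f) : EuclideanSpace ℝ ι → ℂ) x = v

/-- `C` is the composition `A B : C_0^∞(Ω) → C^∞(Ω)`. -/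
def IsComposition {ι : Type} [Fintype ι] {Ω : Opens (EuclideanSpace ℝ ι)}
    (A B C : Operator Ω) : Prop :=
  ∀ (u : 𝓓(Ω, ℂ)), ∀ x ∈ Ω, HasValueAt A (B u) x ((C u : EuclideanSpace ℝ ι → ℂ) x)

/-- The composition is unique. -/
theorem IsComposition.unique {ι : Type} [Fintype ι] {Ω : Opens (EuclideanSpace ℝ ι)}
    {A B C C' : Operator Ω} (h : IsComposition A B C) (h' : IsComposition A B C') : C = C' := by
  ext u x
  by_cases hx : x ∈ Ω
  · obtain ⟨L, hL, hLΩ, hv⟩ := h u x hx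
    obtain ⟨L', hL', hLΩ', hv'⟩ := h' u x hx
    obtain ⟨M, hM, hLM, hMΩ⟩ :=
      exists_compact_between (hL.union hL') Ω.isOpen (Set.union_subset hLΩ hLΩ')
    obtain ⟨f, hf1, hf0, -⟩ := exists_contMDiffMap_one_nhds_of_subset_interior (n := (⊤ : ℕ∞))
      (modelWithCornersSelf ℝ (EuclideanSpace ℝ ι)) (hL.union hL').isClosed hLM
    have hsupp : tsupport (fun y => ((f y : ℝ) : ℂ)) ⊆ M := by
      refine closure_minimal (fun y hy => ?_) hM.isClosed
      by_contra hyM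
      exact hy (by simp [hf0 y hyM])
    let φ : 𝓓(Ω, ℂ) := ⟨fun y => ((f y : ℝ) : ℂ),
      Complex.ofRealCLM.contDiff.comp f.contMDiff.contDiff,
      HasCompactSupport.of_support_subset_isCompact hM (subset_closure.trans hsupp),
      hsupp.trans hMΩ⟩
    have hφ : ∀ y ∈ L ∪ L', φ y = 1 := fun y hy => by
      have h1 : f y = 1 := hf1.self_of_nhdsSet y hy
      change ((f y : ℝ) : ℂ) = 1
      simp [h1]
    rw [← hv φ fun y hy => hφ y (Or.inl hy), ← hv' φ fun y hy => hφ y (Or.inr hy)]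
  · rw [(C u).2.2 x hx, (C' u).2.2 x hx]

/-! ### Corner-degenerate operators -/

/-- The coordinates of `ℝ^{k + n + q}`, `q = q_1 + ⋯ + q_k`, split as `(r, x, y)`
(and dually as `(ρ, ξ, η)`). -/
abbrev Coord (k n : ℕ) (q : Fin k → ℕ) : Type :=
  Fin k ⊕ (Fin n ⊕ (Σ l : Fin k, Fin (q l)))

/-- The component `r ∈ ℝ^k` of `(r, x, y)`. -/
def rPart {k n : ℕ} {q : Fin k → ℕ} (z : EuclideanSpace ℝ (Coord k n q)) (l : Fin k) : ℝ :=
  z (Sum.inl l)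

/-- The component `x ∈ ℝ^n` of `(r, x, y)`. -/
def xPart {k n : ℕ} {q : Fin k → ℕ} (z : EuclideanSpace ℝ (Coord k n q)) :
    EuclideanSpace ℝ (Fin n) :=
  WithLp.toLp 2 fun i => z (Sum.inr (Sum.inl i))

/-- The component `y_l ∈ ℝ^{q_l}` of `(r, x, y)`. -/
def yPart {k n : ℕ} {q : Fin k → ℕ} (z : EuclideanSpace ℝ (Coord k n q)) (l : Fin k) :
    EuclideanSpace ℝ (Fin (q l)) :=
  WithLp.toLp 2 fun i => z (Sum.inr (Sum.inr ⟨l, i⟩))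

theorem continuous_rPart {k n : ℕ} {q : Fin k → ℕ} (l : Fin k) :
    Continuous fun z : EuclideanSpace ℝ (Coord k n q) => rPart z l := by
  unfold rPart; fun_prop

theorem continuous_xPart {k n : ℕ} {q : Fin k → ℕ} :
    Continuous fun z : EuclideanSpace ℝ (Coord k n q) => xPart z := by
  unfold xPart; fun_prop

theorem continuous_yPart {k n : ℕ} {q : Fin k → ℕ} (l : Fin k) :
    Continuous fun z : EuclideanSpace ℝ (Coord k n q) => yPart z l := by
  unfold yPart; fun_prop

/-- The open set `ℝ^k × Σ × ∏ Ω_l`. -/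
def ambient {k n : ℕ} {q : Fin k → ℕ} (S : Opens (EuclideanSpace ℝ (Fin n)))
    (Y : (l : Fin k) → Opens (EuclideanSpace ℝ (Fin (q l)))) :
    Opens (EuclideanSpace ℝ (Coord k n q)) where
  carrier := {z | xPart z ∈ S ∧ ∀ l, yPart z l ∈ Y l}
  is_open' := by
    have h : IsOpen (⋂ l, (fun z : EuclideanSpace ℝ (Coord k n q) => yPart z l) ⁻¹' Y l) :=
      isOpen_iInter_of_finite fun l => (Y l).isOpen.preimage (continuous_yPart l)
    convert (S.isOpen.preimage (continuous_xPart (q := q))).inter h using 1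
    ext z
    simp

/-- The stretched corner `K = [0, ∞)^k × Σ × ∏ Ω_l`. -/
def corner {k n : ℕ} {q : Fin k → ℕ} (S : Opens (EuclideanSpace ℝ (Fin n)))
    (Y : (l : Fin k) → Opens (EuclideanSpace ℝ (Fin (q l)))) :
    Set (EuclideanSpace ℝ (Coord k n q)) :=
  {z | z ∈ ambient S Y ∧ ∀ l, 0 ≤ rPart z l}

/-- Its interior `Int K = (0, ∞)^k × Σ × ∏ Ω_l`. -/
def cornerInt {k n : ℕ} {q : Fin k → ℕ} (S : Opens (EuclideanSpace ℝ (Fin n)))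
    (Y : (l : Fin k) → Opens (EuclideanSpace ℝ (Fin (q l)))) :
    Opens (EuclideanSpace ℝ (Coord k n q)) where
  carrier := {z | z ∈ ambient S Y ∧ ∀ l, 0 < rPart z l}
  is_open' := by
    have h : IsOpen (⋂ l, {z : EuclideanSpace ℝ (Coord k n q) | 0 < rPart z l}) :=
      isOpen_iInter_of_finite fun l => isOpen_lt continuous_const (continuous_rPart l)
    convert (ambient S Y).isOpen.inter h using 1
    ext z
    simp

/-- `p ∈ S^m_cl(K × ℝ^{k+n+q})`, with homogeneous components `h j = p_{(m - j)}`: symbols over `K`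
are the restrictions to `K` of symbols over the open set `ℝ^k × Σ × ∏ Ω_l`. -/
def HasExpansionUpToCorner {k n : ℕ} {q : Fin k → ℕ} (S : Opens (EuclideanSpace ℝ (Fin n)))
    (Y : (l : Fin k) → Opens (EuclideanSpace ℝ (Fin (q l)))) (m : ℝ)
    (p : EuclideanSpace ℝ (Coord k n q) → EuclideanSpace ℝ (Coord k n q) → ℂ)
    (h : ℕ → EuclideanSpace ℝ (Coord k n q) → EuclideanSpace ℝ (Coord k n q) → ℂ) : Prop :=
  ∃ p' h', HasExpansion (ambient S Y) m p' h' ∧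
    (∀ z ∈ corner S Y, ∀ ζ, p z ζ = p' z ζ) ∧
    ∀ j, ∀ z ∈ corner S Y, ∀ ζ ≠ 0, h j z ζ = h' j z ζ

/-- The map `(ρ, ξ, η) ↦ (ρ̃, ξ, η̃)` with `ρ̃_l = r_1 ⋯ r_l ρ_l` and `η̃_l = r_1 ⋯ r_l η_l`. -/
noncomputable def degenerate {k n : ℕ} {q : Fin k → ℕ} (z ζ : EuclideanSpace ℝ (Coord k n q)) :
    EuclideanSpace ℝ (Coord k n q) :=
  WithLp.toLp 2 fun
    | Sum.inl l => (∏ j ∈ Finset.Iic l, rPart z j) * ζ (Sum.inl l)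
    | Sum.inr (Sum.inl i) => ζ (Sum.inr (Sum.inl i))
    | Sum.inr (Sum.inr ⟨l, i⟩) => (∏ j ∈ Finset.Iic l, rPart z j) * ζ (Sum.inr (Sum.inr ⟨l, i⟩))

/-- The corner-degenerate symbol
`a(r, x, y, ρ, ξ, η) = r_1^{-m} ⋯ r_k^{-m} p(r, x, y, ρ̃, ξ, η̃)` on `Int K`. -/
noncomputable def cornerSymbol {k n : ℕ} {q : Fin k → ℕ} (m : ℝ)
    (p : EuclideanSpace ℝ (Coord k n q) → EuclideanSpace ℝ (Coord k n q) → ℂ) :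
    EuclideanSpace ℝ (Coord k n q) → EuclideanSpace ℝ (Coord k n q) → ℂ :=
  fun z ζ => ((∏ l, rPart z l ^ (-m) : ℝ) : ℂ) * p z (degenerate z ζ)

/-- `L^m_cl(Int K)_corner`: the `A ∈ L^m_cl(Int K)` such that `A = Op(a) mod L^{-∞}(Int K)` with
`a` the corner-degenerate symbol of some `p ∈ S^m_cl(K × ℝ^{k+n+q})`. -/
def IsCornerPsiDO {k n : ℕ} {q : Fin k → ℕ} {S : Opens (EuclideanSpace ℝ (Fin n))}
    {Y : (l : Fin k) → Opens (EuclideanSpace ℝ (Fin (q l)))} (m : ℝ)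
    (A : Operator (cornerInt S Y)) : Prop :=
  IsClassicalPsiDO m A ∧
    ∃ p h, HasExpansionUpToCorner S Y m p h ∧ HasLeftSymbol A (cornerSymbol m p)

/-- `σ_ψ`-ellipticity of `A ∈ L^m_cl(Int K)_corner`: the homogeneous principal symbol `p_{(m)}`
does not vanish over `K`, the boundary included, for covariables different from zero. -/
def IsElliptic {k n : ℕ} {q : Fin k → ℕ} {S : Opens (EuclideanSpace ℝ (Fin n))}
    {Y : (l : Fin k) → Opens (EuclideanSpace ℝ (Fin (q l)))} (m : ℝ)
    (A : Operator (cornerInt S Y)) : Prop :=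
  ∃ p h, HasExpansionUpToCorner S Y m p h ∧ HasLeftSymbol A (cornerSymbol m p) ∧
    ∀ z ∈ corner S Y, ∀ ζ ≠ 0, h 0 z ζ ≠ 0

end CornerPsiDO

/-! Write `theta e p` for the symbol r^e p(z, ζ̃), where r^e is a monomial in r₁, …, r_k and ζ̃ is
the degenerate covariable, whose component c is ζ_c times a monomial r^{wt c}. The heart of the
matter is that these symbols are stable under differentiation. A derivative in ζ_i raises e by wt i
(`dxi_theta`). A derivative in z_i lowers e by wt i and replaces p by `degDeriv i e p` (`dx_theta`),
where `degDeriv i e` is a first order operator that preserves orders and whose coefficients are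
smooth up to r = 0: the weight of ρ_j is r₁⋯r_j, and its factor r_j cancels the pole of ∂ log r_j.
In a Leibniz term ∂_ζ^α a D_z^α b the two shifts of exponents cancel, so the l-th term of the
product of `theta e p` and `theta e' p'` is `theta (e + e')` of a term `twist l e' p p'` that lives
on the whole of ℝ^k × Σ × Ω (`leibTerm_theta`). Asymptotic sums are therefore formed for these
terms, boundary included, and then carried to the interior. There `theta e` maps S^m to S^m, because
all weights are bounded above and below on compact subsets (`IsSymbol.theta`).

What remains is the ordinary calculus on an open set U. Cutoffs reduce it to symbols with compact
support in x, for which Op(a) Op(b) = Op(a # b) with (a # b)(x, η) = (2π)^{-N} ∫ e^{ixζ} a(x, η + ζ)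
b̂(ζ, η) dζ (`opLeft_opLeft`). Taylor's formula in ζ, Peetre's inequality and the rapid decay of b̂
show that the remainder of the Leibniz expansion is a symbol of the expected order
(`sharpRem_isSymbol`). Symbols of order -∞ and smooth kernels correspond to each other between
cutoffs, and smoothness of a kernel can be tested locally (`isSmoothing_of_local`). Together these
give the composition theorem `HasLeftSymbol.comp`, and with the `twist` formula statement (i).

For (ii), the homogeneous components of an inverse are found recursively, since in each degree the
newest component occurs only in the product with the principal symbol (`exists_inverse_components`).
The principal symbol is invertible over K only, so its inverse is first extended to r ∈ ℝ^k in
`exists_elliptic_inverse`; the equations are then solved over K. Asymptotic summation yields a right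
and a left inverse symbol. Every symbol has a properly supported quantization
(`exists_properlySupported`), and the usual algebra P - P' = (1 - P'A)P - P'(1 - AP) shows that the
right and left parametrices P and P' differ by a smoothing operator, so that P is a two-sided
parametrix (`exists_parametrix`). -/

namespace CornerPsiDO

set_option linter.unusedSectionVars false

/-! ### The Japanese bracket -/

/-- The space `ℝ^ι` with its Euclidean norm. -/
abbrev Sp (ι : Type) : Type := EuclideanSpace ℝ ι

/-- Functions `a(x, ξ)`. -/
abbrev Fn (ι : Type) : Type := EuclideanSpace ℝ ι → EuclideanSpace ℝ ι → ℂ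

section Bracket

variable {ι : Type} [Fintype ι]

theorem bracket_sq (ξ : Sp ι) : bracket ξ ^ 2 = 1 + ‖ξ‖ ^ 2 := by
  unfold bracket
  rw [Real.sq_sqrt]; positivity

theorem one_le_bracket (ξ : Sp ι) : 1 ≤ bracket ξ := by
  unfold bracket
  rw [Real.one_le_sqrt]
  nlinarith [sq_nonneg ‖ξ‖]

theorem bracket_pos (ξ : Sp ι) : 0 < bracket ξ := zero_lt_one.trans_le (one_le_bracket ξ)

theorem norm_le_bracket (ξ : Sp ι) : ‖ξ‖ ≤ bracket ξ := by
  refine abs_le_of_sq_le_sq' ?_ (bracket_pos ξ).le |>.2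
  rw [bracket_sq]; linarith

theorem bracket_le_one_add (ξ : Sp ι) : bracket ξ ≤ 1 + ‖ξ‖ := by
  refine abs_le_of_sq_le_sq' ?_ (by positivity) |>.2
  rw [bracket_sq]; nlinarith [norm_nonneg ξ]

theorem continuous_bracket : Continuous (bracket : Sp ι → ℝ) := by
  unfold bracket; fun_prop

theorem bracket_mono {ξ η : Sp ι} (h : ‖ξ‖ ≤ ‖η‖) : bracket ξ ≤ bracket η := by
  unfold bracket
  gcongr

theorem bracket_neg (ξ : Sp ι) : bracket (-ξ) = bracket ξ := by
  unfold bracket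
  rw [norm_neg]

theorem bracket_add_le (ξ η : Sp ι) : bracket (ξ + η) ≤ 2 * bracket ξ * bracket η := by
  refine abs_le_of_sq_le_sq' ?_ (by have := bracket_pos ξ; have := bracket_pos η; positivity) |>.2
  rw [mul_pow, mul_pow, bracket_sq, bracket_sq, bracket_sq]
  have h := norm_add_le ξ η
  have h2 : ‖ξ + η‖ ^ 2 ≤ (‖ξ‖ + ‖η‖) ^ 2 := by gcongr
  nlinarith [sq_nonneg (‖ξ‖ - ‖η‖), mul_nonneg (sq_nonneg ‖ξ‖) (sq_nonneg ‖η‖), sq_nonneg ‖ξ‖,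
    sq_nonneg ‖η‖]

/-- Peetre's inequality. -/
theorem bracket_add_rpow_le (ξ η : Sp ι) (s : ℝ) :
    bracket (ξ + η) ^ s ≤ 2 ^ |s| * bracket ξ ^ s * bracket η ^ |s| := by
  have h1 := bracket_pos ξ
  have h2 := bracket_pos η
  have h3 := bracket_pos (ξ + η)
  rcases le_total 0 s with hs | hs
  · rw [abs_of_nonneg hs, ← Real.mul_rpow (by norm_num) h1.le,
      ← Real.mul_rpow (by positivity) h2.le]
    exact Real.rpow_le_rpow h3.le (bracket_add_le ξ η) hs
  · rw [abs_of_nonpos hs]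
    -- For negative exponents the roles are exchanged: ξ = (ξ + η) + (-η) bounds ⟨ξ⟩ by ⟨ξ + η⟩, and
    -- the power -s ≥ 0 may be taken.
    have h := bracket_add_le (ξ + η) (-η)
    rw [add_neg_cancel_right, bracket_neg] at h
    have h4 := Real.rpow_le_rpow h1.le h (neg_nonneg.2 hs)
    rw [Real.mul_rpow (by positivity) h2.le, Real.mul_rpow (by norm_num) h3.le] at h4
    have e1 : bracket ξ ^ s * bracket ξ ^ (-s) = 1 := by
      rw [← Real.rpow_add h1]; simp
    have e2 : bracket (ξ + η) ^ s * bracket (ξ + η) ^ (-s) = 1 := by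
      rw [← Real.rpow_add h3]; simp
    have p1 : 0 < bracket ξ ^ s := Real.rpow_pos_of_pos h1 _
    have p2 : 0 < bracket (ξ + η) ^ s := Real.rpow_pos_of_pos h3 _
    calc bracket (ξ + η) ^ s = bracket (ξ + η) ^ s * bracket ξ ^ s * bracket ξ ^ (-s) := by
          rw [mul_assoc, e1, mul_one]
      _ ≤ bracket (ξ + η) ^ s * bracket ξ ^ s *
          (2 ^ (-s) * bracket (ξ + η) ^ (-s) * bracket η ^ (-s)) := by gcongr
      _ = (bracket (ξ + η) ^ s * bracket (ξ + η) ^ (-s)) *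
          (2 ^ (-s) * bracket ξ ^ s * bracket η ^ (-s)) := by ring
      _ = _ := by rw [e2, one_mul]

theorem bracket_rpow_le_rpow (ξ : Sp ι) {s t : ℝ} (h : s ≤ t) : bracket ξ ^ s ≤ bracket ξ ^ t :=
  Real.rpow_le_rpow_of_exponent_le (one_le_bracket ξ) h

theorem bracket_rpow_pos (ξ : Sp ι) (s : ℝ) : 0 < bracket ξ ^ s :=
  Real.rpow_pos_of_pos (bracket_pos ξ) s

theorem continuous_bracket_rpow (s : ℝ) : Continuous fun ξ : Sp ι => bracket ξ ^ s :=
  continuous_bracket.rpow_const fun ξ => Or.inl (bracket_pos ξ).ne'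

theorem integrable_bracket_rpow {s : ℝ} (hs : (Fintype.card ι : ℝ) < -s) :
    MeasureTheory.Integrable fun ξ : Sp ι => bracket ξ ^ s := by
  have h := integrable_rpow_neg_one_add_norm_sq (E := Sp ι) (μ := MeasureTheory.volume)
    (r := -s) (by simpa using hs)
  refine h.congr (Filter.Eventually.of_forall fun ξ => ?_)
  simp only [neg_neg]
  rw [← bracket_sq, ← Real.rpow_natCast, ← Real.rpow_mul (bracket_pos ξ).le]
  congr 1
  push_cast; ring

end Bracket

/-! ### Partial derivatives of smooth functions on open subsets -/

section Partial

variable {ι : Type} [Fintype ι] [DecidableEq ι]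

/-- The function on the product corresponding to `a`. -/
def unc (a : Fn ι) : Sp ι × Sp ι → ℂ := fun p => a p.1 p.2

/-- Partial derivatives in all directions of the phase space. -/
noncomputable def pd : ι ⊕ ι → Fn ι → Fn ι
  | Sum.inl i => dx i
  | Sum.inr i => dxi i

/-- The coordinate directions of the phase space. -/
noncomputable def dir : ι ⊕ ι → Sp ι × Sp ι
  | Sum.inl i => (EuclideanSpace.single i 1, 0)
  | Sum.inr i => (0, EuclideanSpace.single i 1)

/-- The order gained by a differentiation. -/
def gain : ι ⊕ ι → ℝ
  | Sum.inl _ => 0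
  | Sum.inr _ => 1

/-- Smoothness on a subset of the phase space. -/
def Smooth (O : Set (Sp ι × Sp ι)) (a : Fn ι) : Prop := ContDiffOn ℝ ∞ (unc a) O

/-- The partial derivatives freeze one argument; under joint differentiability they are values of
one Fréchet derivative on phase space. All rules for `pd` are drawn from this. -/
theorem pd_eq_fderiv {a : Fn ι} {p : Sp ι × Sp ι} (h : DifferentiableAt ℝ (unc a) p) (d : ι ⊕ ι) :
    pd d a p.1 p.2 = fderiv ℝ (unc a) p (dir d) := by
  obtain ⟨x, ξ⟩ := p
  cases d with
  | inl i =>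
    have h1 : HasFDerivAt (fun x' : Sp ι => (x', ξ)) (ContinuousLinearMap.inl ℝ (Sp ι) (Sp ι)) x :=
      hasFDerivAt_prodMk_left x ξ
    have h2 := h.hasFDerivAt.comp x h1
    simp only [pd, dx, dir]
    rw [show (fun x' => a x' ξ) = unc a ∘ fun x' : Sp ι => (x', ξ) from rfl, h2.fderiv]
    rfl
  | inr i =>
    have h1 : HasFDerivAt (fun ξ' : Sp ι => (x, ξ')) (ContinuousLinearMap.inr ℝ (Sp ι) (Sp ι)) ξ :=
      hasFDerivAt_prodMk_right x ξ
    have h2 := h.hasFDerivAt.comp ξ h1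
    simp only [pd, dxi, dir]
    rw [show (fun ξ' => a x ξ') = unc a ∘ fun ξ' : Sp ι => (x, ξ') from rfl, h2.fderiv]
    rfl

theorem Smooth.contDiffAt {O : Set (Sp ι × Sp ι)} (hO : IsOpen O) {a : Fn ι} (h : Smooth O a)
    {p} (hp : p ∈ O) : ContDiffAt ℝ ∞ (unc a) p := ContDiffOn.contDiffAt h (hO.mem_nhds hp)

theorem Smooth.differentiableAt {O : Set (Sp ι × Sp ι)} (hO : IsOpen O) {a : Fn ι}
    (h : Smooth O a) {p} (hp : p ∈ O) : DifferentiableAt ℝ (unc a) p :=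
  (h.contDiffAt hO hp).differentiableAt (by simp)

theorem Smooth.congr {O : Set (Sp ι × Sp ι)} {a b : Fn ι} (h : Smooth O a)
    (hab : ∀ p ∈ O, b p.1 p.2 = a p.1 p.2) : Smooth O b :=
  ContDiffOn.congr h hab

theorem Smooth.pd {O : Set (Sp ι × Sp ι)} (hO : IsOpen O) {a : Fn ι} (h : Smooth O a)
    (d : ι ⊕ ι) : Smooth O (pd d a) := by
  have h1 : ContDiffOn ℝ ∞ (fderiv ℝ (unc a)) O := ContDiffOn.fderiv_of_isOpen h hO (by simp)
  have h2 : ContDiffOn ℝ ∞ (fun p => fderiv ℝ (unc a) p (dir d)) O :=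
    h1.clm_apply contDiffOn_const
  exact h2.congr fun p hp => pd_eq_fderiv (h.differentiableAt hO hp) d

theorem pd_congr {O : Set (Sp ι × Sp ι)} (hO : IsOpen O) {a b : Fn ι}
    (hab : ∀ p ∈ O, a p.1 p.2 = b p.1 p.2) (d : ι ⊕ ι) :
    ∀ p ∈ O, pd d a p.1 p.2 = pd d b p.1 p.2 := by
  rintro ⟨x, ξ⟩ hp
  have hn : O ∈ nhds (x, ξ) := hO.mem_nhds hp
  cases d with
  | inl i =>
    simp only [CornerPsiDO.pd, dx]
    have : (fun x' => a x' ξ) =ᶠ[nhds x] fun x' => b x' ξ := by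
      have hc : Filter.Tendsto (fun x' : Sp ι => (x', ξ)) (nhds x) (nhds (x, ξ)) :=
        (by fun_prop : Continuous fun x' : Sp ι => (x', ξ)).continuousAt
      filter_upwards [hc hn] with x' hx' using hab _ hx'
    rw [this.fderiv_eq]
  | inr i =>
    simp only [CornerPsiDO.pd, dxi]
    have : (fun ξ' => a x ξ') =ᶠ[nhds ξ] fun ξ' => b x ξ' := by
      have hc : Filter.Tendsto (fun ξ' : Sp ι => (x, ξ')) (nhds ξ) (nhds (x, ξ)) :=
        (by fun_prop : Continuous fun ξ' : Sp ι => (x, ξ')).continuousAt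
      filter_upwards [hc hn] with x' hx' using hab _ hx'
    rw [this.fderiv_eq]

theorem pd_zero (d : ι ⊕ ι) : pd d (fun _ _ => 0 : Fn ι) = fun _ _ => 0 := by
  cases d <;> ext x ξ <;> simp [pd, dx, dxi]

theorem Smooth.add {O : Set (Sp ι × Sp ι)} {a b : Fn ι} (ha : Smooth O a) (hb : Smooth O b) :
    Smooth O fun x ξ => a x ξ + b x ξ := ContDiffOn.add ha hb

theorem Smooth.sub {O : Set (Sp ι × Sp ι)} {a b : Fn ι} (ha : Smooth O a) (hb : Smooth O b) :
    Smooth O fun x ξ => a x ξ - b x ξ := ContDiffOn.sub ha hb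

theorem Smooth.mul {O : Set (Sp ι × Sp ι)} {a b : Fn ι} (ha : Smooth O a) (hb : Smooth O b) :
    Smooth O fun x ξ => a x ξ * b x ξ := ContDiffOn.mul ha hb

theorem Smooth.const {O : Set (Sp ι × Sp ι)} (c : ℂ) : Smooth O fun _ _ => c := contDiffOn_const

theorem Smooth.const_mul {O : Set (Sp ι × Sp ι)} {a : Fn ι} (c : ℂ) (ha : Smooth O a) :
    Smooth O fun x ξ => c * a x ξ := (Smooth.const c).mul ha

theorem Smooth.sum {O : Set (Sp ι × Sp ι)} {κ : Type*} {s : Finset κ} {a : κ → Fn ι}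
    (ha : ∀ j ∈ s, Smooth O (a j)) : Smooth O fun x ξ => ∑ j ∈ s, a j x ξ :=
  ContDiffOn.sum ha

theorem pd_add {O : Set (Sp ι × Sp ι)} (hO : IsOpen O) {a b : Fn ι} (ha : Smooth O a)
    (hb : Smooth O b) (d : ι ⊕ ι) : ∀ p ∈ O,
    pd d (fun x ξ => a x ξ + b x ξ) p.1 p.2 = pd d a p.1 p.2 + pd d b p.1 p.2 := by
  intro p hp
  have h1 := ha.differentiableAt hO hp
  have h2 := hb.differentiableAt hO hp
  rw [pd_eq_fderiv ((ha.add hb).differentiableAt hO hp), pd_eq_fderiv h1, pd_eq_fderiv h2,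
    show (unc fun x ξ => a x ξ + b x ξ) = fun p => unc a p + unc b p from rfl,
    fderiv_fun_add h1 h2]
  rfl

theorem pd_mul {O : Set (Sp ι × Sp ι)} (hO : IsOpen O) {a b : Fn ι} (ha : Smooth O a)
    (hb : Smooth O b) (d : ι ⊕ ι) : ∀ p ∈ O,
    pd d (fun x ξ => a x ξ * b x ξ) p.1 p.2 =
      pd d a p.1 p.2 * b p.1 p.2 + a p.1 p.2 * pd d b p.1 p.2 := by
  intro p hp
  have h1 := ha.differentiableAt hO hp
  have h2 := hb.differentiableAt hO hp
  rw [pd_eq_fderiv ((ha.mul hb).differentiableAt hO hp), pd_eq_fderiv h1, pd_eq_fderiv h2,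
    show (unc fun x ξ => a x ξ * b x ξ) = fun p => unc a p * unc b p from rfl,
    fderiv_fun_mul h1 h2]
  simp [unc]; ring

theorem pd_const_mul {O : Set (Sp ι × Sp ι)} (hO : IsOpen O) {a : Fn ι} (c : ℂ)
    (ha : Smooth O a) (d : ι ⊕ ι) : ∀ p ∈ O,
    pd d (fun x ξ => c * a x ξ) p.1 p.2 = c * pd d a p.1 p.2 := by
  intro p hp
  have h1 := ha.differentiableAt hO hp
  rw [pd_eq_fderiv ((ha.const_mul c).differentiableAt hO hp), pd_eq_fderiv h1,
    show (unc fun x ξ => c * a x ξ) = fun p => c * unc a p from rfl,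
    fderiv_const_mul h1]
  rfl

theorem pd_sub {O : Set (Sp ι × Sp ι)} (hO : IsOpen O) {a b : Fn ι} (ha : Smooth O a)
    (hb : Smooth O b) (d : ι ⊕ ι) : ∀ p ∈ O,
    pd d (fun x ξ => a x ξ - b x ξ) p.1 p.2 = pd d a p.1 p.2 - pd d b p.1 p.2 := by
  intro p hp
  have h1 := ha.differentiableAt hO hp
  have h2 := hb.differentiableAt hO hp
  rw [pd_eq_fderiv ((ha.sub hb).differentiableAt hO hp), pd_eq_fderiv h1, pd_eq_fderiv h2,
    show (unc fun x ξ => a x ξ - b x ξ) = fun p => unc a p - unc b p from rfl,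
    fderiv_fun_sub h1 h2]
  rfl

theorem pd_sum {O : Set (Sp ι × Sp ι)} (hO : IsOpen O) {κ : Type*} {s : Finset κ} {a : κ → Fn ι}
    (ha : ∀ j ∈ s, Smooth O (a j)) (d : ι ⊕ ι) : ∀ p ∈ O,
    pd d (fun x ξ => ∑ j ∈ s, a j x ξ) p.1 p.2 = ∑ j ∈ s, pd d (a j) p.1 p.2 := by
  intro p hp
  rw [pd_eq_fderiv ((Smooth.sum ha).differentiableAt hO hp),
    show (unc fun x ξ => ∑ j ∈ s, a j x ξ) = fun p => ∑ j ∈ s, unc (a j) p from rfl,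
    fderiv_fun_sum fun j hj => (ha j hj).differentiableAt hO hp, sum_apply]
  exact Finset.sum_congr rfl fun j hj => (pd_eq_fderiv ((ha j hj).differentiableAt hO hp) d).symm

/-- Symmetry of the second Fréchet derivative. Because of it, words of directions can serve as
multi-indices. -/
theorem pd_comm {O : Set (Sp ι × Sp ι)} (hO : IsOpen O) {a : Fn ι} (ha : Smooth O a)
    (d e : ι ⊕ ι) : ∀ p ∈ O, pd d (pd e a) p.1 p.2 = pd e (pd d a) p.1 p.2 := by
  have key : ∀ d e : ι ⊕ ι, ∀ p ∈ O,
      pd d (pd e a) p.1 p.2 = fderiv ℝ (fderiv ℝ (unc a)) p (dir d) (dir e) := by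
    intro d e p hp
    have h1 : ContDiffOn ℝ ∞ (fderiv ℝ (unc a)) O := ContDiffOn.fderiv_of_isOpen ha hO (by simp)
    have h2 : DifferentiableAt ℝ (fderiv ℝ (unc a)) p :=
      (h1.contDiffAt (hO.mem_nhds hp)).differentiableAt (by simp)
    rw [pd_eq_fderiv ((ha.pd hO e).differentiableAt hO hp)]
    have h3 : unc (pd e a) =ᶠ[nhds p] fun p => fderiv ℝ (unc a) p (dir e) := by
      filter_upwards [hO.mem_nhds hp] with q hq using pd_eq_fderiv (ha.differentiableAt hO hq) e
    rw [h3.fderiv_eq, fderiv_clm_apply h2 (differentiableAt_const _)]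
    simp
  intro p hp
  rw [key d e p hp, key e d p hp]
  have h := (ha.contDiffAt hO hp).isSymmSndFDerivAt
    (by rw [minSmoothness_of_isRCLikeNormedField]; exact WithTop.coe_le_coe.2 le_top)
  exact h _ _

/-- The derivative along a vector of the phase space in terms of the partial derivatives. -/
theorem fderiv_unc_apply {a : Fn ι} {p : Sp ι × Sp ι} (h : DifferentiableAt ℝ (unc a) p)
    (v : Sp ι × Sp ι) : fderiv ℝ (unc a) p v =
      (∑ i, (v.1 i : ℂ) * dx i a p.1 p.2) + ∑ i, (v.2 i : ℂ) * dxi i a p.1 p.2 := by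
  have hv : v = (∑ i, v.1 i • dir (Sum.inl i)) + ∑ i, v.2 i • dir (Sum.inr i) := by
    ext j
    · simp [dir, Prod.fst_sum, Pi.single_apply]
    · simp [dir, Prod.snd_sum, Pi.single_apply]
  conv_lhs => rw [hv]
  rw [map_add, map_sum, map_sum]
  congr 1
  · refine Finset.sum_congr rfl fun i _ => ?_
    rw [map_smul, ← pd_eq_fderiv h]; simp [pd]
  · refine Finset.sum_congr rfl fun i _ => ?_
    rw [map_smul, ← pd_eq_fderiv h]; simp [pd]

theorem smooth_foldr_pd {O : Set (Sp ι × Sp ι)} (hO : IsOpen O) {a : Fn ι} (ha : Smooth O a)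
    (w : List (ι ⊕ ι)) : Smooth O (w.foldr pd a) := by
  induction w with
  | nil => exact ha
  | cons d w ih => exact ih.pd hO d

theorem foldr_pd_congr {O : Set (Sp ι × Sp ι)} (hO : IsOpen O) {a b : Fn ι}
    (hab : ∀ p ∈ O, a p.1 p.2 = b p.1 p.2) (w : List (ι ⊕ ι)) :
    ∀ p ∈ O, w.foldr pd a p.1 p.2 = w.foldr pd b p.1 p.2 := by
  induction w with
  | nil => exact hab
  | cons d w ih => exact pd_congr hO ih d

theorem mixedDeriv_eq (α β : List ι) (a : Fn ι) :
    mixedDeriv α β a = (α.map Sum.inl ++ β.map Sum.inr).foldr pd a := by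
  rw [mixedDeriv, List.foldr_append, List.foldr_map, List.foldr_map]
  rfl

theorem foldr_pd_comm {O : Set (Sp ι × Sp ι)} (hO : IsOpen O) {a : Fn ι} (ha : Smooth O a)
    (w : List (ι ⊕ ι)) (d : ι ⊕ ι) :
    ∀ p ∈ O, w.foldr pd (pd d a) p.1 p.2 = pd d (w.foldr pd a) p.1 p.2 := by
  induction w with
  | nil => exact fun _ _ => rfl
  | cons e w ih =>
    intro p hp
    rw [List.foldr_cons, pd_congr hO ih e p hp, pd_comm hO (smooth_foldr_pd hO ha w) e d p hp]
    rfl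

theorem mixedDeriv_congr {O : Set (Sp ι × Sp ι)} (hO : IsOpen O) {a b : Fn ι}
    (hab : ∀ p ∈ O, a p.1 p.2 = b p.1 p.2) (α β : List ι) :
    ∀ p ∈ O, mixedDeriv α β a p.1 p.2 = mixedDeriv α β b p.1 p.2 := by
  simp_rw [mixedDeriv_eq]
  exact foldr_pd_congr hO hab _

end Partial

/-! ### Calculus of the classes S^m, also for families bounded uniformly in a parameter. -/

section Symbols

variable {ι : Type} [Fintype ι] [DecidableEq ι]

/-- The part of the phase space over `U`. -/
abbrev cyl (U : Opens (Sp ι)) : Set (Sp ι × Sp ι) := (U : Set (Sp ι)) ×ˢ Set.univ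

theorem isOpen_cyl (U : Opens (Sp ι)) : IsOpen (cyl U) := U.isOpen.prod isOpen_univ

/-- A family of symbols that is bounded in `S^m(U × ℝ^ι)`. -/
def SymBdd {T : Type} (U : Opens (Sp ι)) (m : ℝ) (a : T → Fn ι) : Prop :=
  (∀ t, Smooth (cyl U) (a t)) ∧
  ∀ (α β : List ι) (L : Set (Sp ι)), IsCompact L → L ⊆ U →
    ∃ c : ℝ, ∀ t, ∀ x ∈ L, ∀ ξ, ‖mixedDeriv α β (a t) x ξ‖ ≤ c * bracket ξ ^ (m - (β.length : ℝ))

theorem symBdd_unit {U : Opens (Sp ι)} {m : ℝ} {a : Fn ι} :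
    SymBdd U m (fun _ : Unit => a) ↔ IsSymbol U m a := by
  constructor
  · rintro ⟨h1, h2⟩
    refine ⟨h1 (), fun α β L hL hLU => ?_⟩
    obtain ⟨c, hc⟩ := h2 α β L hL hLU
    exact ⟨c, hc ()⟩
  · rintro ⟨h1, h2⟩
    refine ⟨fun _ => h1, fun α β L hL hLU => ?_⟩
    obtain ⟨c, hc⟩ := h2 α β L hL hLU
    exact ⟨c, fun _ => hc⟩

/-- A class of families of functions that is closed under differentiation and consists of smooth
functions with the basic symbol estimate consists of bounded families of symbols. -/
theorem symBdd_of_closed {T : Type} {U : Opens (Sp ι)} (P : ℝ → (T → Fn ι) → Prop)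
    (hs : ∀ m a, P m a → ∀ t, Smooth (cyl U) (a t))
    (hb : ∀ m a, P m a → ∀ L : Set (Sp ι), IsCompact L → L ⊆ U →
      ∃ c : ℝ, ∀ t, ∀ x ∈ L, ∀ ξ, ‖a t x ξ‖ ≤ c * bracket ξ ^ m)
    (hd : ∀ m a, P m a → ∀ d, P (m - gain d) fun t => pd d (a t))
    {m : ℝ} {a : T → Fn ι} (h : P m a) : SymBdd U m a := by
  refine ⟨hs m a h, fun α β L hL hLU => ?_⟩
  have h1 : P (m - (β.length : ℝ)) fun t => (β.map Sum.inr).foldr pd (a t) := by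
    induction β with
    | nil => simpa using h
    | cons i β ih =>
      have := hd _ _ ih (Sum.inr i)
      simp only [gain] at this
      rw [List.length_cons, Nat.cast_succ, ← sub_sub]
      exact this
  have h2 : P (m - (β.length : ℝ)) fun t => mixedDeriv α β (a t) := by
    simp_rw [mixedDeriv_eq]
    induction α with
    | nil => simpa using h1
    | cons i α ih =>
      have := hd _ _ ih (Sum.inl i)
      simp only [gain, sub_zero] at this
      exact this
  exact hb _ _ h2 L hL hLU

/-- The standard device for symbol estimates: only the undifferentiated bound is checked, for a
class of functions that differentiation maps into itself with the right loss of order. The work lies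
in the choice of the class. -/
theorem isSymbol_of_closed {U : Opens (Sp ι)} (P : ℝ → Fn ι → Prop)
    (hs : ∀ m a, P m a → Smooth (cyl U) a)
    (hb : ∀ m a, P m a → ∀ L : Set (Sp ι), IsCompact L → L ⊆ U →
      ∃ c : ℝ, ∀ x ∈ L, ∀ ξ, ‖a x ξ‖ ≤ c * bracket ξ ^ m)
    (hd : ∀ m a, P m a → ∀ d, P (m - gain d) (pd d a))
    {m : ℝ} {a : Fn ι} (h : P m a) : IsSymbol U m a := by
  rw [← symBdd_unit]
  refine symBdd_of_closed (T := Unit) (fun m a => P m (a ())) (fun m a h _ => hs m _ h)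
    (fun m a h L hL hLU => ?_) (fun m a h d => hd m _ h d) h
  obtain ⟨c, hc⟩ := hb m _ h L hL hLU
  exact ⟨c, fun _ => hc⟩

theorem IsSymbol.smooth {U : Opens (Sp ι)} {m : ℝ} {a : Fn ι} (h : IsSymbol U m a) :
    Smooth (cyl U) a := h.1

theorem SymBdd.bound {T : Type} {U : Opens (Sp ι)} {m : ℝ} {a : T → Fn ι} (h : SymBdd U m a)
    {L : Set (Sp ι)} (hL : IsCompact L) (hLU : L ⊆ U) :
    ∃ c : ℝ, 0 ≤ c ∧ ∀ t, ∀ x ∈ L, ∀ ξ, ‖a t x ξ‖ ≤ c * bracket ξ ^ m := by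
  obtain ⟨c, hc⟩ := h.2 [] [] L hL hLU
  refine ⟨|c|, abs_nonneg c, fun t x hx ξ => (hc t x hx ξ).trans ?_⟩
  simp only [List.length_nil, Nat.cast_zero, sub_zero]
  exact mul_le_mul_of_nonneg_right (le_abs_self c) (bracket_rpow_pos ξ m).le

theorem IsSymbol.bound {U : Opens (Sp ι)} {m : ℝ} {a : Fn ι} (h : IsSymbol U m a)
    {L : Set (Sp ι)} (hL : IsCompact L) (hLU : L ⊆ U) :
    ∃ c : ℝ, 0 ≤ c ∧ ∀ x ∈ L, ∀ ξ, ‖a x ξ‖ ≤ c * bracket ξ ^ m := by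
  obtain ⟨c, h0, hc⟩ := (symBdd_unit.2 h).bound hL hLU
  exact ⟨c, h0, hc ()⟩

theorem SymBdd.pd {T : Type} {U : Opens (Sp ι)} {m : ℝ} {a : T → Fn ι} (h : SymBdd U m a)
    (d : ι ⊕ ι) : SymBdd U (m - gain d) fun t => pd d (a t) := by
  refine ⟨fun t => (h.1 t).pd (isOpen_cyl U) d, fun α β L hL hLU => ?_⟩
  cases d with
  | inl i =>
    obtain ⟨c, hc⟩ := h.2 (i :: α) β L hL hLU
    refine ⟨c, fun t x hx ξ => ?_⟩
    have hp : (x, ξ) ∈ cyl U := ⟨hLU hx, trivial⟩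
    simp only [gain, sub_zero]
    rw [mixedDeriv_eq, foldr_pd_comm (isOpen_cyl U) (h.1 t) _ _ _ hp]
    have := hc t x hx ξ
    rwa [mixedDeriv_eq] at this
  | inr i =>
    obtain ⟨c, hc⟩ := h.2 α (β ++ [i]) L hL hLU
    refine ⟨c, fun t x hx ξ => ?_⟩
    have := hc t x hx ξ
    simp only [gain]
    rw [List.length_append, List.length_singleton, Nat.cast_add, Nat.cast_one, add_comm (β.length : ℝ),
      ← sub_sub, mixedDeriv, List.foldr_append] at this
    exact this

theorem IsSymbol.pd {U : Opens (Sp ι)} {m : ℝ} {a : Fn ι} (h : IsSymbol U m a)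
    (d : ι ⊕ ι) : IsSymbol U (m - gain d) (pd d a) :=
  symBdd_unit.1 ((symBdd_unit.2 h).pd d)

theorem IsSymbol.dx {U : Opens (Sp ι)} {m : ℝ} {a : Fn ι} (h : IsSymbol U m a)
    (i : ι) : IsSymbol U m (dx i a) := by
  simpa [gain, CornerPsiDO.pd] using h.pd (Sum.inl i)

theorem IsSymbol.dxi {U : Opens (Sp ι)} {m : ℝ} {a : Fn ι} (h : IsSymbol U m a)
    (i : ι) : IsSymbol U (m - 1) (dxi i a) := h.pd (Sum.inr i)

theorem SymBdd.congr {T : Type} {U : Opens (Sp ι)} {m : ℝ} {a b : T → Fn ι} (h : SymBdd U m a)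
    (hab : ∀ t, ∀ x ∈ U, ∀ ξ, b t x ξ = a t x ξ) : SymBdd U m b := by
  refine ⟨fun t => (h.1 t).congr fun p hp => hab t p.1 hp.1 p.2, fun α β L hL hLU => ?_⟩
  obtain ⟨c, hc⟩ := h.2 α β L hL hLU
  refine ⟨c, fun t x hx ξ => ?_⟩
  rw [mixedDeriv_congr (isOpen_cyl U) (fun p hp => hab t p.1 hp.1 p.2) α β (x, ξ)
    ⟨hLU hx, trivial⟩]
  exact hc t x hx ξ

theorem IsSymbol.congr {U : Opens (Sp ι)} {m : ℝ} {a b : Fn ι} (h : IsSymbol U m a)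
    (hab : ∀ x ∈ U, ∀ ξ, b x ξ = a x ξ) : IsSymbol U m b :=
  symBdd_unit.1 ((symBdd_unit.2 h).congr fun _ => hab)

theorem SymBdd.mono {T : Type} {U : Opens (Sp ι)} {m m' : ℝ} {a : T → Fn ι} (h : SymBdd U m a)
    (hm : m ≤ m') : SymBdd U m' a := by
  refine ⟨h.1, fun α β L hL hLU => ?_⟩
  obtain ⟨c, hc⟩ := h.2 α β L hL hLU
  refine ⟨|c|, fun t x hx ξ => (hc t x hx ξ).trans ?_⟩
  exact mul_le_mul (le_abs_self c) (bracket_rpow_le_rpow ξ (by linarith))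
    (bracket_rpow_pos ξ _).le (abs_nonneg c)

theorem IsSymbol.mono {U : Opens (Sp ι)} {m m' : ℝ} {a : Fn ι} (h : IsSymbol U m a)
    (hm : m ≤ m') : IsSymbol U m' a := symBdd_unit.1 ((symBdd_unit.2 h).mono hm)

theorem IsSymbol.restrict {U V : Opens (Sp ι)} {m : ℝ} {a : Fn ι} (h : IsSymbol U m a)
    (hVU : V ≤ U) : IsSymbol V m a :=
  ⟨ContDiffOn.mono h.1 (Set.prod_mono hVU subset_rfl),
    fun α β L hL hLV => h.2 α β L hL (hLV.trans hVU)⟩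

/-- Sums and products of bounded families of symbols. -/
inductive SymAlg {T : Type} (U : Opens (Sp ι)) : ℝ → (T → Fn ι) → Prop
  | mul {m₁ m₂ : ℝ} {a b : T → Fn ι} (ha : SymBdd U m₁ a) (hb : SymBdd U m₂ b) :
      SymAlg U (m₁ + m₂) fun t x ξ => a t x ξ * b t x ξ
  | add {m : ℝ} {a b : T → Fn ι} (ha : SymAlg U m a) (hb : SymAlg U m b) :
      SymAlg U m fun t x ξ => a t x ξ + b t x ξ
  | congr {m : ℝ} {a b : T → Fn ι} (ha : SymAlg U m a)
      (hab : ∀ t, ∀ x ∈ U, ∀ ξ, b t x ξ = a t x ξ) : SymAlg U m b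

theorem SymAlg.smooth {T : Type} {U : Opens (Sp ι)} {m : ℝ} {a : T → Fn ι} (h : SymAlg U m a)
    (t : T) : Smooth (cyl U) (a t) := by
  induction h with
  | mul ha hb => exact (ha.1 t).mul (hb.1 t)
  | add _ _ iha ihb => exact iha.add ihb
  | congr _ hab iha => exact iha.congr fun p hp => hab t p.1 hp.1 p.2

/-- The product rule turns one product into a sum of two, so the class must contain sums; since the
rule is only available over U, the class must also allow changes outside U. -/
theorem SymAlg.symBdd {T : Type} {U : Opens (Sp ι)} {m : ℝ} {a : T → Fn ι}
    (h : SymAlg U m a) : SymBdd U m a := by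
  refine symBdd_of_closed (SymAlg U) (fun m a h t => h.smooth t) ?_ ?_ h
  · intro m a h L hL hLU
    induction h with
    | @mul m₁ m₂ a b ha hb =>
      obtain ⟨c₁, h₁, hc₁⟩ := ha.bound hL hLU
      obtain ⟨c₂, h₂, hc₂⟩ := hb.bound hL hLU
      refine ⟨c₁ * c₂, fun t x hx ξ => ?_⟩
      rw [norm_mul, Real.rpow_add (bracket_pos ξ)]
      calc _ ≤ (c₁ * bracket ξ ^ m₁) * (c₂ * bracket ξ ^ m₂) :=
            mul_le_mul (hc₁ t x hx ξ) (hc₂ t x hx ξ) (norm_nonneg _)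
              (mul_nonneg h₁ (bracket_rpow_pos ξ _).le)
        _ = _ := by ring
    | add _ _ iha ihb =>
      obtain ⟨c₁, hc₁⟩ := iha
      obtain ⟨c₂, hc₂⟩ := ihb
      refine ⟨c₁ + c₂, fun t x hx ξ => (norm_add_le _ _).trans ?_⟩
      rw [add_mul]
      exact add_le_add (hc₁ t x hx ξ) (hc₂ t x hx ξ)
    | congr _ hab iha =>
      obtain ⟨c₁, hc₁⟩ := iha
      refine ⟨c₁, fun t x hx ξ => ?_⟩
      rw [hab t x (hLU hx)]
      exact hc₁ t x hx ξ
  · intro m a h d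
    induction h with
    | @mul m₁ m₂ a b ha hb =>
      have h1 := SymAlg.mul (ha.pd d) hb
      have h2 := SymAlg.mul ha (hb.pd d)
      rw [show m₁ - gain d + m₂ = m₁ + m₂ - gain d by ring] at h1
      rw [show m₁ + (m₂ - gain d) = m₁ + m₂ - gain d by ring] at h2
      exact (h1.add h2).congr fun t x hx ξ =>
        pd_mul (isOpen_cyl U) (ha.1 t) (hb.1 t) d (x, ξ) ⟨hx, trivial⟩
    | @add m a b ha hb iha ihb =>
      exact (iha.add ihb).congr fun t x hx ξ =>
        pd_add (isOpen_cyl U) (ha.smooth t) (hb.smooth t) d (x, ξ) ⟨hx, trivial⟩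
    | @congr m a b ha hab iha =>
      exact iha.congr fun t x hx ξ =>
        pd_congr (isOpen_cyl U) (fun p hp => hab t p.1 hp.1 p.2) d (x, ξ) ⟨hx, trivial⟩

theorem SymBdd.mul {T : Type} {U : Opens (Sp ι)} {m₁ m₂ : ℝ} {a b : T → Fn ι}
    (ha : SymBdd U m₁ a) (hb : SymBdd U m₂ b) :
    SymBdd U (m₁ + m₂) fun t x ξ => a t x ξ * b t x ξ := (SymAlg.mul ha hb).symBdd

theorem IsSymbol.mul {U : Opens (Sp ι)} {m₁ m₂ : ℝ} {a b : Fn ι}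
    (ha : IsSymbol U m₁ a) (hb : IsSymbol U m₂ b) :
    IsSymbol U (m₁ + m₂) fun x ξ => a x ξ * b x ξ :=
  symBdd_unit.1 ((symBdd_unit.2 ha).mul (symBdd_unit.2 hb))

/-- Symbols that do not depend on the covariable. -/
theorem isSymbol_of_fst {U : Opens (Sp ι)} {f : Sp ι → ℂ} (hf : ContDiffOn ℝ ∞ f U) :
    IsSymbol U 0 fun x _ => f x := by
  -- A derivative in the covariable kills the function and shifts the order; the alternative that f
  -- vanishes on U permits any order from then on.
  refine isSymbol_of_closed
    (P := fun m a => ∃ f : Sp ι → ℂ, ContDiffOn ℝ ∞ f U ∧ (∀ x ∈ U, ∀ ξ, a x ξ = f x) ∧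
      (m = 0 ∨ ∀ x ∈ U, f x = 0)) ?_ ?_ ?_ ⟨f, hf, fun _ _ _ => rfl, Or.inl rfl⟩
  · rintro m a ⟨f, hf, haf, -⟩
    exact Smooth.congr (a := fun x _ => f x) (hf.comp contDiffOn_fst fun p hp => hp.1)
      fun p hp => haf p.1 hp.1 p.2
  · rintro m a ⟨f, hf, haf, h⟩ L hL hLU
    rcases h with rfl | h
    · obtain ⟨c, hc⟩ := hL.exists_bound_of_continuousOn (hf.continuousOn.mono hLU)
      exact ⟨c, fun x hx ξ => by simpa [haf x (hLU hx)] using hc x hx⟩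
    · exact ⟨0, fun x hx ξ => by simp [haf x (hLU hx), h x (hLU hx)]⟩
  · rintro m a ⟨f, hf, haf, h⟩ d
    have hsm : Smooth (cyl U) fun x _ => f x := hf.comp contDiffOn_fst fun p hp => hp.1
    cases d with
    | inl i =>
      refine ⟨fun x => fderiv ℝ f x (EuclideanSpace.single i 1),
        (hf.fderiv_of_isOpen U.isOpen (by simp)).clm_apply contDiffOn_const, ?_, ?_⟩
      · intro x hx ξ
        exact pd_congr (isOpen_cyl U) (b := fun x _ => f x)
          (fun p hp => haf p.1 hp.1 p.2) (Sum.inl i) (x, ξ) ⟨hx, trivial⟩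
      · rcases h with rfl | h
        · left; simp [gain]
        · right
          intro x hx
          have : f =ᶠ[nhds x] fun _ => 0 := by
            filter_upwards [U.isOpen.mem_nhds hx] with y hy using h y hy
          change fderiv ℝ f x _ = 0
          rw [this.fderiv_eq]; simp
    | inr i =>
      refine ⟨fun _ => 0, contDiffOn_const, ?_, Or.inr fun _ _ => rfl⟩
      intro x hx ξ
      rw [pd_congr (isOpen_cyl U) (b := fun x _ => f x)
          (fun p hp => haf p.1 hp.1 p.2) (Sum.inr i) (x, ξ) ⟨hx, trivial⟩]
      simp [CornerPsiDO.pd, CornerPsiDO.dxi]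

theorem isSymbol_zero (U : Opens (Sp ι)) (m : ℝ) : IsSymbol U m fun _ _ => 0 := by
  refine isSymbol_of_closed (P := fun _ a => a = fun _ _ => 0) ?_ ?_ ?_ rfl
  · rintro m a rfl; exact Smooth.const 0
  · rintro m a rfl L - -; exact ⟨0, by simp⟩
  · rintro m a rfl d; exact pd_zero d

theorem IsSymbol.const_mul {U : Opens (Sp ι)} {m : ℝ} {a : Fn ι} (c : ℂ) (ha : IsSymbol U m a) :
    IsSymbol U m fun x ξ => c * a x ξ := by
  simpa using (isSymbol_of_fst (U := U) (f := fun _ => c) contDiffOn_const).mul ha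

theorem SymBdd.add {T : Type} {U : Opens (Sp ι)} {m : ℝ} {a b : T → Fn ι}
    (ha : SymBdd U m a) (hb : SymBdd U m b) :
    SymBdd U m fun t x ξ => a t x ξ + b t x ξ := by
  -- The generators of `SymAlg` are products, so each summand is written as a product with the
  -- constant symbol 1.
  have h1 : SymBdd U 0 fun (_ : T) (_ _ : Sp ι) => (1 : ℂ) := by
    have h := isSymbol_of_fst (U := U) (f := fun _ => 1) contDiffOn_const
    refine ⟨fun _ => h.1, fun α β L hL hLU => ?_⟩
    obtain ⟨c, hc⟩ := h.2 α β L hL hLU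
    exact ⟨c, fun _ => hc⟩
  have h2 := (SymAlg.mul h1 ha).add (SymAlg.mul h1 hb)
  simpa using h2.symBdd

theorem IsSymbol.add {U : Opens (Sp ι)} {m : ℝ} {a b : Fn ι}
    (ha : IsSymbol U m a) (hb : IsSymbol U m b) : IsSymbol U m fun x ξ => a x ξ + b x ξ :=
  symBdd_unit.1 ((symBdd_unit.2 ha).add (symBdd_unit.2 hb))

theorem IsSymbol.sub {U : Opens (Sp ι)} {m : ℝ} {a b : Fn ι}
    (ha : IsSymbol U m a) (hb : IsSymbol U m b) : IsSymbol U m fun x ξ => a x ξ - b x ξ := by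
  simpa [sub_eq_add_neg] using ha.add (hb.const_mul (-1))

theorem IsSymbol.sum {U : Opens (Sp ι)} {m : ℝ} {κ : Type*} {s : Finset κ} {a : κ → Fn ι}
    (ha : ∀ j ∈ s, IsSymbol U m (a j)) : IsSymbol U m fun x ξ => ∑ j ∈ s, a j x ξ := by
  classical
  induction s using Finset.induction_on with
  | empty => simpa using isSymbol_zero U m
  | insert j s hj ih =>
    simp_rw [Finset.sum_insert hj]
    exact (ha j (Finset.mem_insert_self j s)).add
      (ih fun i hi => ha i (Finset.mem_insert_of_mem hi))

theorem isSymbol_coord (U : Opens (Sp ι)) (i : ι) : IsSymbol U 1 fun _ ξ => (ξ i : ℂ) := by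
  refine isSymbol_of_closed
    (P := fun m a => (m = 1 ∧ a = fun _ ξ => (ξ i : ℂ)) ∨
      ∃ c : ℂ, (m = 0 ∨ c = 0) ∧ a = fun _ _ => c) ?_ ?_ ?_ (Or.inl ⟨rfl, rfl⟩)
  · rintro m a (⟨-, rfl⟩ | ⟨c, -, rfl⟩)
    · refine ContDiff.contDiffOn ?_
      change ContDiff ℝ ∞ fun p : Sp ι × Sp ι => Complex.ofRealCLM (p.2 i)
      fun_prop
    · exact Smooth.const c
  · rintro m a (⟨rfl, rfl⟩ | ⟨c, (rfl | rfl), rfl⟩) L - -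
    · refine ⟨1, fun x _ ξ => ?_⟩
      rw [Complex.norm_real, Real.rpow_one, one_mul]
      exact (PiLp.norm_apply_le ξ i).trans (norm_le_bracket ξ)
    · exact ⟨‖c‖, by simp⟩
    · exact ⟨0, by simp⟩
  · rintro m a (⟨rfl, rfl⟩ | ⟨c, -, rfl⟩) d
    · right
      cases d with
      | inl j =>
        refine ⟨0, Or.inr rfl, ?_⟩
        ext x ξ; simp [CornerPsiDO.pd, CornerPsiDO.dx]
      | inr j =>
        refine ⟨((Pi.single j (1 : ℝ) : ι → ℝ) i : ℂ), Or.inl (by simp [gain]), ?_⟩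
        ext x ξ
        have h : HasFDerivAt (fun ξ' : Sp ι => (ξ' i : ℂ))
            (Complex.ofRealCLM.comp (EuclideanSpace.proj i : Sp ι →L[ℝ] ℝ)) ξ :=
          (Complex.ofRealCLM.comp (EuclideanSpace.proj i : Sp ι →L[ℝ] ℝ)).hasFDerivAt
        simp only [CornerPsiDO.pd, CornerPsiDO.dxi]
        rw [h.fderiv]
        simp [Pi.single_apply]
    · right
      refine ⟨0, Or.inr rfl, ?_⟩
      cases d <;> ext x ξ <;> simp [CornerPsiDO.pd, CornerPsiDO.dx, CornerPsiDO.dxi]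

/-- Smooth functions that vanish for large covariables are symbols of every order. -/
theorem isSymbol_of_compact {U : Opens (Sp ι)} {a : Fn ι} (hs : Smooth (cyl U) a)
    (h : ∀ L : Set (Sp ι), IsCompact L → L ⊆ U → ∃ R : ℝ, ∀ x ∈ L, ∀ ξ, R ≤ ‖ξ‖ → a x ξ = 0)
    (m : ℝ) : IsSymbol U m a := by
  refine isSymbol_of_closed
    (P := fun _ a => Smooth (cyl U) a ∧ ∀ L : Set (Sp ι), IsCompact L → L ⊆ U → ∃ R : ℝ,
      ∀ x ∈ L, ∀ ξ, R ≤ ‖ξ‖ → a x ξ = 0) ?_ ?_ ?_ ⟨hs, h⟩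
  · rintro m a ⟨hs, -⟩; exact hs
  · rintro m a ⟨hs, h⟩ L hL hLU
    obtain ⟨R, hR⟩ := h L hL hLU
    have hK : IsCompact (L ×ˢ Metric.closedBall (0 : Sp ι) R) :=
      hL.prod (isCompact_closedBall 0 R)
    have hcont : ContinuousOn (fun p : Sp ι × Sp ι => ‖unc a p‖ * bracket p.2 ^ (-m))
        (L ×ˢ Metric.closedBall (0 : Sp ι) R) := by
      refine ContinuousOn.mul ?_ ((continuous_bracket_rpow (-m)).comp continuous_snd).continuousOn
      exact (ContDiffOn.continuousOn hs).norm.mono (Set.prod_mono hLU (Set.subset_univ _))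
    obtain ⟨c, hc⟩ := hK.exists_bound_of_continuousOn hcont
    refine ⟨|c|, fun x hx ξ => ?_⟩
    by_cases hξ : R ≤ ‖ξ‖
    · rw [hR x hx ξ hξ, norm_zero]
      exact mul_nonneg (abs_nonneg c) (bracket_rpow_pos ξ m).le
    · have h1 := hc (x, ξ) ⟨hx, by simpa using (not_le.1 hξ).le⟩
      rw [Real.norm_of_nonneg (mul_nonneg (norm_nonneg _) (bracket_rpow_pos _ _).le),
        Real.rpow_neg (bracket_pos _).le, ← div_eq_mul_inv, div_le_iff₀ (bracket_rpow_pos _ _)] at h1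
      exact h1.trans (mul_le_mul_of_nonneg_right (le_abs_self c) (bracket_rpow_pos ξ m).le)
  · rintro m a ⟨hs, h⟩ d
    refine ⟨hs.pd (isOpen_cyl U) d, fun L hL hLU => ?_⟩
    -- A derivative sees a neighbourhood of the point; hence the larger compact set and the radius R
    -- + 1.
    obtain ⟨M, hM, hLM, hMU⟩ := exists_compact_between hL U.isOpen hLU
    obtain ⟨R, hR⟩ := h M hM hMU
    refine ⟨R + 1, fun x hx ξ hξ => ?_⟩
    have hO : IsOpen (interior M ×ˢ {ξ : Sp ι | R < ‖ξ‖}) :=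
      isOpen_interior.prod (isOpen_lt continuous_const continuous_norm)
    rw [pd_congr hO (b := fun _ _ => 0) (fun p hp => hR _ (interior_subset hp.1) _
      (show R < ‖p.2‖ from hp.2).le) d (x, ξ) ⟨hLM hx, show R < ‖ξ‖ by linarith⟩, pd_zero]

/-- Uniform bounds for the iterated Fréchet derivatives of a symbol. -/
theorem IsSymbol.iteratedFDeriv_bound {U : Opens (Sp ι)} {L : Set (Sp ι)} (hL : IsCompact L)
    (hLU : L ⊆ U) (m : ℝ) (n : ℕ) : ∀ {a : Fn ι}, IsSymbol U m a →
    ∃ c : ℝ, 0 ≤ c ∧ ∀ x ∈ L, ∀ ξ, ‖iteratedFDeriv ℝ n (unc a) (x, ξ)‖ ≤ c * bracket ξ ^ m := by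
  induction n with
  | zero =>
    intro a ha
    obtain ⟨c, h0, hc⟩ := ha.bound hL hLU
    exact ⟨c, h0, fun x hx ξ => by simpa [unc] using hc x hx ξ⟩
  | succ n ih =>
    intro a ha
    have hpd : ∀ d, ∃ c : ℝ, 0 ≤ c ∧ ∀ x ∈ L, ∀ ξ,
        ‖iteratedFDeriv ℝ n (unc (CornerPsiDO.pd d a)) (x, ξ)‖ ≤ c * bracket ξ ^ m := fun d =>
      ih ((ha.pd d).mono (by cases d <;> simp [gain]))
    choose c h0 hc using hpd
    let co : ι ⊕ ι → ((Sp ι × Sp ι) →L[ℝ] ℝ) := fun d => match d with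
      | Sum.inl i => (EuclideanSpace.proj i).comp (ContinuousLinearMap.fst ℝ (Sp ι) (Sp ι))
      | Sum.inr i => (EuclideanSpace.proj i).comp (ContinuousLinearMap.snd ℝ (Sp ι) (Sp ι))
    let Λ : ι ⊕ ι → (ℂ →L[ℝ] ((Sp ι × Sp ι) →L[ℝ] ℂ)) := fun d =>
      ContinuousLinearMap.smulRightL ℝ (Sp ι × Sp ι) ℂ (co d)
    refine ⟨∑ d, ‖Λ d‖ * c d, Finset.sum_nonneg fun d _ => by have := h0 d; positivity,
      fun x hx ξ => ?_⟩
    have hO := isOpen_cyl U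
    have hp : (x, ξ) ∈ cyl U := ⟨hLU hx, trivial⟩
    -- The full derivative is a sum of partial derivatives composed with fixed linear maps, to which
    -- the induction hypothesis applies; the gain of order in ξ is given away.
    have hev : fderiv ℝ (unc a) =ᶠ[nhds (x, ξ)] fun p => ∑ d, Λ d (unc (CornerPsiDO.pd d a) p) := by
      filter_upwards [hO.mem_nhds hp] with p hp
      refine ContinuousLinearMap.ext fun v => ?_
      rw [fderiv_unc_apply (ha.smooth.differentiableAt hO hp) v]
      simp [Λ, co, unc, CornerPsiDO.pd]
    have hcd : ∀ d, ContDiffAt ℝ n (unc (CornerPsiDO.pd d a)) (x, ξ) := fun d =>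
      (((ha.pd d).smooth).contDiffAt hO hp).of_le (by exact_mod_cast le_top)
    rw [← norm_iteratedFDeriv_fderiv, (hev.iteratedFDeriv ℝ n).self_of_nhds,
      iteratedFDeriv_fun_sum_apply (f := fun d p => Λ d (unc (CornerPsiDO.pd d a) p))
        fun d _ => (Λ d).contDiff.contDiffAt.comp _ (hcd d),
      Finset.sum_mul]
    refine (norm_sum_le _ _).trans (Finset.sum_le_sum fun d _ => ?_)
    refine ((Λ d).norm_iteratedFDeriv_comp_left (hcd d) le_rfl).trans ?_
    rw [mul_assoc]
    exact mul_le_mul_of_nonneg_left (hc d x hx ξ) (norm_nonneg _)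

end Symbols

open MeasureTheory

/-! ### Integrals depending smoothly on parameters -/

section Param

variable {ι : Type} [Fintype ι]
variable {X : Type} [NormedAddCommGroup X] [NormedSpace ℝ X]

/-- Integrands that are smooth and whose derivatives in the parameter are dominated locally
uniformly. -/
structure DomInt {G : Type} [NormedAddCommGroup G] [NormedSpace ℝ G] (F : X → Sp ι → G) :
    Prop where
  smooth : ContDiff ℝ ∞ fun p : X × Sp ι => F p.1 p.2
  dom : ∀ (n : ℕ) (x : X), ∃ V ∈ nhds x, ∃ g : Sp ι → ℝ, Integrable g ∧
    ∀ x' ∈ V, ∀ ζ, ‖iteratedFDeriv ℝ n (fun y => F y ζ) x'‖ ≤ g ζ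

variable {G : Type} [NormedAddCommGroup G] [NormedSpace ℝ G]

theorem DomInt.smooth_left {F : X → Sp ι → G} (h : DomInt F) (ζ : Sp ι) :
    ContDiff ℝ ∞ fun y => F y ζ := h.smooth.comp (contDiff_id.prodMk contDiff_const)

theorem DomInt.continuous_right {F : X → Sp ι → G} (h : DomInt F) (x : X) :
    Continuous (F x) := h.smooth.continuous.comp (by fun_prop : Continuous fun ζ : Sp ι => (x, ζ))

theorem fderiv_left_eq {F : X → Sp ι → G} (h : ContDiff ℝ ∞ fun p : X × Sp ι => F p.1 p.2)
    (x : X) (ζ : Sp ι) : fderiv ℝ (fun y => F y ζ) x =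
      (fderiv ℝ (fun p : X × Sp ι => F p.1 p.2) (x, ζ)).comp
        (ContinuousLinearMap.inl ℝ X (Sp ι)) := by
  have h1 : HasFDerivAt (fun x' : X => (x', ζ)) (ContinuousLinearMap.inl ℝ X (Sp ι)) x :=
    hasFDerivAt_prodMk_left x ζ
  have h2 := ((h.differentiable (by simp)) (x, ζ)).hasFDerivAt.comp x h1
  exact h2.fderiv

theorem DomInt.fderiv {F : X → Sp ι → G} (h : DomInt F) :
    DomInt fun x ζ => fderiv ℝ (fun y => F y ζ) x where
  smooth := by
    simp_rw [fderiv_left_eq h.smooth]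
    exact (h.smooth.fderiv_right (m := ∞) (by simp)).clm_comp contDiff_const
  dom n x := by
    obtain ⟨V, hV, g, hg, hb⟩ := h.dom (n + 1) x
    refine ⟨V, hV, g, hg, fun x' hx' ζ => ?_⟩
    rw [show (fun y => _root_.fderiv ℝ (fun y => F y ζ) y) = _root_.fderiv ℝ (fun y => F y ζ)
      from rfl, norm_iteratedFDeriv_fderiv]
    exact hb x' hx' ζ

theorem DomInt.integrable {F : X → Sp ι → G} (h : DomInt F) (x : X) : Integrable (F x) := by
  obtain ⟨V, hV, g, hg, hb⟩ := h.dom 0 x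
  refine hg.mono' (h.continuous_right x).aestronglyMeasurable (Filter.Eventually.of_forall fun ζ => ?_)
  simpa using hb x (mem_of_mem_nhds hV) ζ

theorem DomInt.hasFDerivAt {F : X → Sp ι → G} (h : DomInt F) (x : X) :
    HasFDerivAt (fun x => ∫ ζ, F x ζ) (∫ ζ, _root_.fderiv ℝ (fun y => F y ζ) x) x := by
  obtain ⟨V, hV, g, hg, hb⟩ := h.dom 1 x
  refine hasFDerivAt_integral_of_dominated_of_fderiv_le (bound := g)
    (F' := fun x ζ => _root_.fderiv ℝ (fun y => F y ζ) x) hV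
    (Filter.Eventually.of_forall fun x' => (h.continuous_right x').aestronglyMeasurable)
    (h.integrable x) ((h.fderiv.continuous_right x).aestronglyMeasurable) ?_ hg ?_
  · refine Filter.Eventually.of_forall fun ζ x' hx' => ?_
    have := hb x' hx' ζ
    rwa [← zero_add 1, ← norm_iteratedFDeriv_fderiv, norm_iteratedFDeriv_zero] at this
  · exact Filter.Eventually.of_forall fun ζ x' _ =>
      ((h.smooth_left ζ).differentiable (by simp) x').hasFDerivAt

/-- Differentiation under the integral, iterated. The induction runs over all target spaces at once,
since the derivative of the integrand takes values in a space of continuous linear maps. -/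
theorem DomInt.integral_aux (n : ℕ) : ∀ {G : Type} [NormedAddCommGroup G] [NormedSpace ℝ G]
    {F : X → Sp ι → G}, DomInt F → ContDiff ℝ n (fun x => ∫ ζ, F x ζ) ∧
      ∀ x, ‖iteratedFDeriv ℝ n (fun x => ∫ ζ, F x ζ) x‖ ≤
        ∫ ζ, ‖iteratedFDeriv ℝ n (fun y => F y ζ) x‖ := by
  induction n with
  | zero =>
    intro G _ _ F h
    refine ⟨contDiff_zero.2 (continuous_iff_continuousAt.2 fun x =>
      (h.hasFDerivAt x).continuousAt), fun x => ?_⟩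
    simp only [norm_iteratedFDeriv_zero]
    exact norm_integral_le_integral_norm _
  | succ n ih =>
    intro G _ _ F h
    have hf : _root_.fderiv ℝ (fun x => ∫ ζ, F x ζ) =
        fun x => ∫ ζ, _root_.fderiv ℝ (fun y => F y ζ) x :=
      funext fun x => (h.hasFDerivAt x).fderiv
    obtain ⟨h1, h2⟩ := ih h.fderiv
    refine ⟨?_, fun x => ?_⟩
    · rw [Nat.cast_succ, contDiff_succ_iff_fderiv]
      refine ⟨fun x => (h.hasFDerivAt x).differentiableAt, by simp, ?_⟩
      rw [hf]
      exact h1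
    · rw [← norm_iteratedFDeriv_fderiv, hf]
      refine (h2 x).trans_eq (integral_congr_ae (Filter.Eventually.of_forall fun ζ => ?_))
      exact norm_iteratedFDeriv_fderiv

theorem DomInt.contDiff_integral {F : X → Sp ι → G} (h : DomInt F) :
    ContDiff ℝ ∞ fun x => ∫ ζ, F x ζ := contDiff_infty.2 fun n => (h.integral_aux n).1

/-- Integrands whose derivatives in the parameter grow at most polynomially. -/
structure Moderate (F : X → Sp ι → ℂ) : Prop where
  smooth : ContDiff ℝ ∞ fun p : X × Sp ι => F p.1 p.2
  bound : ∀ (n : ℕ) (x : X), ∃ k : ℝ, ∃ V ∈ nhds x, ∃ c : ℝ, 0 ≤ c ∧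
    ∀ x' ∈ V, ∀ ζ, ‖iteratedFDeriv ℝ n (fun y => F y ζ) x'‖ ≤ c * bracket ζ ^ k

/-- Integrands whose derivatives in the parameter decay rapidly. -/
structure Rapid (F : X → Sp ι → ℂ) : Prop where
  smooth : ContDiff ℝ ∞ fun p : X × Sp ι => F p.1 p.2
  bound : ∀ (n : ℕ) (x : X) (k : ℝ), ∃ V ∈ nhds x, ∃ c : ℝ, 0 ≤ c ∧
    ∀ x' ∈ V, ∀ ζ, ‖iteratedFDeriv ℝ n (fun y => F y ζ) x'‖ ≤ c * bracket ζ ^ k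

theorem Rapid.domInt {F : X → Sp ι → ℂ} (h : Rapid F) : DomInt F where
  smooth := h.smooth
  dom n x := by
    obtain ⟨V, hV, c, -, hc⟩ := h.bound n x (-(Fintype.card ι : ℝ) - 1)
    exact ⟨V, hV, _, (integrable_bracket_rpow (by linarith)).const_mul c, hc⟩

theorem contDiff_left {F : X → Sp ι → ℂ} (h : ContDiff ℝ ∞ fun p : X × Sp ι => F p.1 p.2)
    (ζ : Sp ι) : ContDiff ℝ ∞ fun y => F y ζ := h.comp (contDiff_id.prodMk contDiff_const)

/-- Leibniz' formula: if the j-th derivative of the first factor grows like ⟨ζ⟩^{kF j}, the second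
factor is asked for the exponent k - kF j, which is at its disposal. -/
theorem Moderate.mul_rapid {F H : X → Sp ι → ℂ} (hF : Moderate F) (hH : Rapid H) :
    Rapid fun x ζ => F x ζ * H x ζ where
  smooth := hF.smooth.mul hH.smooth
  bound n x k := by
    choose kF VF hVF cF h0F hcF using fun j : ℕ => hF.bound j x
    choose VH hVH cH h0H hcH using fun j : ℕ => hH.bound (n - j) x (k - kF j)
    refine ⟨⋂ j ∈ Finset.range (n + 1), (VF j ∩ VH j), ?_,
      ∑ j ∈ Finset.range (n + 1), (n.choose j : ℝ) * (cF j * cH j),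
      Finset.sum_nonneg fun j _ => by have := h0F j; have := h0H j; positivity,
      fun x' hx' ζ => ?_⟩
    · exact (Filter.biInter_finset_mem _).2 fun j _ => Filter.inter_mem (hVF j) (hVH j)
    · refine (norm_iteratedFDeriv_mul_le (contDiff_left hF.smooth ζ) (contDiff_left hH.smooth ζ)
        x' (n := n) (by exact_mod_cast le_top)).trans ?_
      rw [Finset.sum_mul]
      refine Finset.sum_le_sum fun j hj => ?_
      have hx2 := Set.mem_iInter₂.1 hx' j hj
      have e : bracket ζ ^ k = bracket ζ ^ kF j * bracket ζ ^ (k - kF j) := by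
        rw [← Real.rpow_add (bracket_pos ζ)]; congr 1; ring
      rw [e, mul_assoc]
      calc _ ≤ (n.choose j : ℝ) * ((cF j * bracket ζ ^ kF j) *
            (cH j * bracket ζ ^ (k - kF j))) := by
            refine mul_le_mul_of_nonneg_left ?_ (by positivity)
            exact mul_le_mul (hcF j x' hx2.1 ζ) (hcH j x' hx2.2 ζ) (norm_nonneg _)
              (mul_nonneg (h0F j) (bracket_rpow_pos ζ _).le)
        _ = _ := by ring

/-- The oscillating exponential `e^{i x ξ}`. -/
noncomputable def osc (x ξ : Sp ι) : ℂ := Complex.exp (Complex.I * ((inner ℝ x ξ : ℝ) : ℂ))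

theorem norm_osc (x ξ : Sp ι) : ‖osc x ξ‖ = 1 := by
  rw [osc, mul_comm, Complex.norm_exp_ofReal_mul_I]

theorem osc_add (x y ξ : Sp ι) : osc (x + y) ξ = osc x ξ * osc y ξ := by
  simp [osc, inner_add_left, mul_add, Complex.exp_add]

theorem osc_add_right (x ξ η : Sp ι) : osc x (ξ + η) = osc x ξ * osc x η := by
  simp [osc, inner_add_right, mul_add, Complex.exp_add]

theorem osc_neg_eq (x ξ : Sp ι) : Complex.exp (-(Complex.I * ((inner ℝ x ξ : ℝ) : ℂ))) =
    osc x (-ξ) := by simp [osc]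

theorem osc_neg_left (x ξ : Sp ι) : osc (-x) ξ = osc x (-ξ) := by simp [osc]

theorem osc_comm (x ξ : Sp ι) : osc x ξ = osc ξ x := by simp [osc, real_inner_comm]

theorem contDiff_osc : ContDiff ℝ ∞ fun p : Sp ι × Sp ι => osc p.1 p.2 := by
  unfold osc
  have : ContDiff ℝ ∞ fun p : Sp ι × Sp ι => (inner ℝ p.1 p.2 : ℝ) :=
    contDiff_fst.inner ℝ contDiff_snd
  exact (contDiff_const.mul (Complex.ofRealCLM.contDiff.comp this)).cexp

theorem continuous_osc : Continuous fun p : Sp ι × Sp ι => osc p.1 p.2 := contDiff_osc.continuous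

theorem norm_iteratedDeriv_exp_I (n : ℕ) (t : ℝ) :
    ‖iteratedFDeriv ℝ n (fun t : ℝ => Complex.exp (Complex.I * (t : ℂ))) t‖ = 1 := by
  rw [norm_iteratedFDeriv_eq_norm_iteratedDeriv]
  have : ∀ n : ℕ, iteratedDeriv n (fun t : ℝ => Complex.exp (Complex.I * (t : ℂ))) =
      fun t : ℝ => Complex.I ^ n * Complex.exp (Complex.I * (t : ℂ)) := by
    intro n
    induction n with
    | zero => simp
    | succ n ih =>
      rw [iteratedDeriv_succ, ih]
      funext t
      have h1 : HasDerivAt (fun t : ℝ => Complex.exp (Complex.I * (t : ℂ)))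
          (Complex.exp (Complex.I * (t : ℂ)) * (Complex.I * 1)) t :=
        ((Complex.ofRealCLM.hasDerivAt (x := t)).const_mul Complex.I).cexp
      rw [(h1.const_mul _).deriv]
      ring
  rw [this, norm_mul, norm_pow, Complex.norm_I, one_pow, one_mul, mul_comm,
    Complex.norm_exp_ofReal_mul_I]

/-- The phase is linear in the parameter with norm at most ‖L‖ ‖ζ‖, and all derivatives of t ↦
e^{it} have norm 1; so n derivatives cost ⟨ζ⟩^n. -/
theorem moderate_osc (L : X →L[ℝ] Sp ι) : Moderate fun x ζ => osc (L x) ζ where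
  smooth := contDiff_osc.comp ((L.contDiff.comp contDiff_fst).prodMk contDiff_snd)
  bound n x := by
    refine ⟨n, Set.univ, Filter.univ_mem, ‖L‖ ^ n, by positivity, fun x' _ ζ => ?_⟩
    let ℓ : X →L[ℝ] ℝ := (innerSL ℝ ζ).comp L
    have h1 : (fun y => osc (L y) ζ) = (fun t : ℝ => Complex.exp (Complex.I * (t : ℂ))) ∘ ℓ := by
      funext y
      simp [osc, ℓ, real_inner_comm]
    have hs : ContDiff ℝ ∞ fun t : ℝ => Complex.exp (Complex.I * (t : ℂ)) :=
      (contDiff_const.mul Complex.ofRealCLM.contDiff).cexp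
    rw [h1, ℓ.iteratedFDeriv_comp_right hs x' (i := n) (by exact_mod_cast le_top)]
    refine (ContinuousMultilinearMap.norm_compContinuousLinearMap_le _ _).trans ?_
    rw [norm_iteratedDeriv_exp_I, one_mul, Finset.prod_const, Finset.card_univ, Fintype.card_fin,
      Real.rpow_natCast, ← mul_pow]
    refine pow_le_pow_left₀ (norm_nonneg _) ?_ n
    refine (ContinuousLinearMap.opNorm_comp_le _ _).trans ?_
    rw [innerSL_apply_norm, mul_comm]
    exact mul_le_mul_of_nonneg_left (norm_le_bracket ζ) (norm_nonneg _)

/-- Rapidly decreasing functions of the integration variable. -/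
theorem rapid_of_snd {f : Sp ι → ℂ} (hf : ContDiff ℝ ∞ f)
    (hb : ∀ k : ℝ, ∃ c : ℝ, ∀ ζ, ‖f ζ‖ ≤ c * bracket ζ ^ k) : Rapid fun (_ : X) ζ => f ζ where
  smooth := hf.comp contDiff_snd
  bound n x k := by
    obtain ⟨c, hc⟩ := hb k
    refine ⟨Set.univ, Filter.univ_mem, |c|, abs_nonneg c, fun x' _ ζ => ?_⟩
    have hc' : ‖f ζ‖ ≤ |c| * bracket ζ ^ k := (hc ζ).trans
      (mul_le_mul_of_nonneg_right (le_abs_self c) (bracket_rpow_pos ζ k).le)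
    rcases n with _ | n
    · simpa using hc'
    · rw [iteratedFDeriv_succ_const]
      simpa using (norm_nonneg _).trans hc'

end Param

/-! ### Symbols as integrands depending on parameters. -/

section Param2

variable {ι : Type} [Fintype ι] [DecidableEq ι]
variable {X : Type} [NormedAddCommGroup X] [NormedSpace ℝ X]

theorem contDiff_unc {m : ℝ} {a : Fn ι} (ha : IsSymbol ⊤ m a) : ContDiff ℝ ∞ (unc a) := by
  have h := ha.1
  rwa [show ((⊤ : Opens (Sp ι)) : Set (Sp ι)) ×ˢ (Set.univ : Set (Sp ι)) = Set.univ by simp,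
    contDiffOn_univ] at h

/-- On the unit ball around x the point L₁ x' stays in a fixed compact set, and Peetre's inequality
replaces ⟨L₂ x' + ζ⟩^m by a constant times ⟨ζ⟩^m. Suitable linear maps L₁, L₂ cover all the
evaluations of symbols that occur below. -/
theorem symbol_comp_bound {m : ℝ} {a : Fn ι} (ha : IsSymbol ⊤ m a) (L₁ L₂ : X →L[ℝ] Sp ι)
    (n : ℕ) (x : X) : ∃ V ∈ nhds x, ∃ c : ℝ, 0 ≤ c ∧
    ∀ x' ∈ V, ∀ ζ, ‖iteratedFDeriv ℝ n (fun y => a (L₁ y) (L₂ y + ζ)) x'‖ ≤ c * bracket ζ ^ m := by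
  obtain ⟨c, h0, hc⟩ := IsSymbol.iteratedFDeriv_bound (U := ⊤) (isCompact_closedBall (0 : Sp ι)
    (‖L₁‖ * (‖x‖ + 1))) (Set.subset_univ _) m n ha
  have hR : ∀ x' ∈ Metric.ball x 1, ‖x'‖ ≤ ‖x‖ + 1 := fun x' hx' => by
    have := norm_le_norm_add_norm_sub' x' x
    rw [mem_ball_iff_norm] at hx'
    linarith
  refine ⟨Metric.ball x 1, Metric.ball_mem_nhds x one_pos,
    c * (2 ^ |m| * (1 + ‖L₂‖ * (‖x‖ + 1)) ^ |m|) * ‖L₁.prod L₂‖ ^ n, by positivity,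
    fun x' hx' ζ => ?_⟩
  have h1 : (fun y => a (L₁ y) (L₂ y + ζ)) =
      (fun p => unc a (p + (0, ζ))) ∘ (L₁.prod L₂) := by
    funext y; simp [unc]
  have hs : ContDiff ℝ ∞ fun p => unc a (p + ((0 : Sp ι), ζ)) :=
    (contDiff_unc ha).comp (contDiff_id.add contDiff_const)
  rw [h1, (L₁.prod L₂).iteratedFDeriv_comp_right hs x' (i := n) (by exact_mod_cast le_top)]
  refine (ContinuousMultilinearMap.norm_compContinuousLinearMap_le _ _).trans ?_
  rw [Finset.prod_const, Finset.card_univ, Fintype.card_fin, iteratedFDeriv_comp_add_right,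
    mul_right_comm]
  refine mul_le_mul_of_nonneg_right ?_ (by positivity)
  have h2 : (L₁.prod L₂) x' + ((0 : Sp ι), ζ) = (L₁ x', L₂ x' + ζ) := by simp
  rw [h2]
  have h3 : L₁ x' ∈ Metric.closedBall (0 : Sp ι) (‖L₁‖ * (‖x‖ + 1)) := by
    rw [mem_closedBall_zero_iff]
    exact (L₁.le_opNorm x').trans (mul_le_mul_of_nonneg_left (hR x' hx') (norm_nonneg _))
  refine (hc _ h3 _).trans ?_
  rw [mul_assoc]
  refine mul_le_mul_of_nonneg_left ?_ h0
  rw [add_comm]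
  refine (bracket_add_rpow_le ζ (L₂ x') m).trans ?_
  rw [mul_right_comm]
  refine mul_le_mul_of_nonneg_right ?_ (bracket_rpow_pos ζ m).le
  refine mul_le_mul_of_nonneg_left ?_ (by positivity)
  refine Real.rpow_le_rpow (bracket_pos _).le ((bracket_le_one_add _).trans ?_) (abs_nonneg m)
  have := (L₂.le_opNorm x').trans (mul_le_mul_of_nonneg_left (hR x' hx') (norm_nonneg _))
  linarith

theorem symbol_comp_smooth {m : ℝ} {a : Fn ι} (ha : IsSymbol ⊤ m a) (L₁ L₂ : X →L[ℝ] Sp ι) :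
    ContDiff ℝ ∞ fun p : X × Sp ι => a (L₁ p.1) (L₂ p.1 + p.2) :=
  (contDiff_unc ha).comp ((L₁.contDiff.comp contDiff_fst).prodMk
    ((L₂.contDiff.comp contDiff_fst).add contDiff_snd))

theorem moderate_symbol {m : ℝ} {a : Fn ι} (ha : IsSymbol ⊤ m a) (L₁ L₂ : X →L[ℝ] Sp ι) :
    Moderate fun x ζ => a (L₁ x) (L₂ x + ζ) where
  smooth := symbol_comp_smooth ha L₁ L₂
  bound n x := ⟨m, symbol_comp_bound ha L₁ L₂ n x⟩

theorem rapid_symbol {a : Fn ι} (ha : ∀ m, IsSymbol ⊤ m a) (L₁ L₂ : X →L[ℝ] Sp ι) :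
    Rapid fun x ζ => a (L₁ x) (L₂ x + ζ) where
  smooth := symbol_comp_smooth (ha 0) L₁ L₂
  bound n x k := symbol_comp_bound (ha k) L₁ L₂ n x

end Param2

theorem natCast_le_infty (n : ℕ) : ((n : ℕ) : WithTop ℕ∞) ≤ ∞ := by exact_mod_cast le_top

/-! ### Symbols with compact support in the space variable -/

section Global

variable {ι : Type} [Fintype ι] [DecidableEq ι]

/-- Symbols over the whole space with compact support in the space variable. -/
structure IsGlobal (m : ℝ) (a : Fn ι) : Prop where
  symbol : IsSymbol ⊤ m a
  supp : ∃ K : Set (Sp ι), IsCompact K ∧ ∀ x ∉ K, ∀ ξ, a x ξ = 0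

namespace IsGlobal

variable {m m' : ℝ} {a b : Fn ι}

theorem smooth (ha : IsGlobal m a) : Smooth Set.univ a := by
  have h := contDiff_unc ha.symbol
  exact h.contDiffOn

theorem contDiff (ha : IsGlobal m a) : ContDiff ℝ ∞ (unc a) := contDiff_unc ha.symbol

theorem pd (ha : IsGlobal m a) (d : ι ⊕ ι) : IsGlobal (m - gain d) (pd d a) where
  symbol := ha.symbol.pd d
  supp := by
    obtain ⟨K, hK, h⟩ := ha.supp
    refine ⟨K, hK, fun x hx ξ => ?_⟩
    rw [pd_congr (hK.isClosed.isOpen_compl.prod isOpen_univ) (b := fun _ _ => 0)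
      (fun p hp => h _ hp.1 _) d (x, ξ) ⟨hx, trivial⟩, pd_zero]

theorem dx (ha : IsGlobal m a) (i : ι) : IsGlobal m (dx i a) := by
  simpa [gain, CornerPsiDO.pd] using ha.pd (Sum.inl i)

theorem dxi (ha : IsGlobal m a) (i : ι) : IsGlobal (m - 1) (dxi i a) := ha.pd (Sum.inr i)

theorem symbol_mul (ha : IsSymbol ⊤ m a) (hb : IsGlobal m' b) :
    IsGlobal (m + m') fun x ξ => a x ξ * b x ξ where
  symbol := ha.mul hb.symbol
  supp := by
    obtain ⟨K, hK, h⟩ := hb.supp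
    exact ⟨K, hK, fun x hx ξ => by simp [h x hx]⟩

theorem const_mul (c : ℂ) (ha : IsGlobal m a) : IsGlobal m fun x ξ => c * a x ξ where
  symbol := ha.symbol.const_mul c
  supp := by
    obtain ⟨K, hK, h⟩ := ha.supp
    exact ⟨K, hK, fun x hx ξ => by simp [h x hx]⟩

theorem add (ha : IsGlobal m a) (hb : IsGlobal m b) : IsGlobal m fun x ξ => a x ξ + b x ξ where
  symbol := ha.symbol.add hb.symbol
  supp := by
    obtain ⟨K, hK, h⟩ := ha.supp
    obtain ⟨K', hK', h'⟩ := hb.supp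
    refine ⟨K ∪ K', hK.union hK', fun x hx ξ => ?_⟩
    rw [Set.mem_union, not_or] at hx
    simp [h x hx.1, h' x hx.2]

theorem zero (m : ℝ) : IsGlobal m fun _ _ : Sp ι => 0 :=
  ⟨isSymbol_zero _ m, ∅, isCompact_empty, fun _ _ _ => rfl⟩

theorem sub (ha : IsGlobal m a) (hb : IsGlobal m b) : IsGlobal m fun x ξ => a x ξ - b x ξ := by
  simpa [sub_eq_add_neg] using ha.add (hb.const_mul (-1))

theorem sum {κ : Type*} {s : Finset κ} {a : κ → Fn ι}
    (ha : ∀ j ∈ s, IsGlobal m (a j)) : IsGlobal m fun x ξ => ∑ j ∈ s, a j x ξ := by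
  classical
  induction s using Finset.induction_on with
  | empty => simpa using zero m
  | insert j s hj ih =>
    simp_rw [Finset.sum_insert hj]
    exact (ha j (Finset.mem_insert_self j s)).add
      (ih fun i hi => ha i (Finset.mem_insert_of_mem hi))

theorem iteratedFDeriv_bound (ha : IsGlobal m a) (n : ℕ) : ∃ c : ℝ, 0 ≤ c ∧ ∀ x ξ,
    ‖iteratedFDeriv ℝ n (unc a) (x, ξ)‖ ≤ c * bracket ξ ^ m := by
  obtain ⟨K, hK, h⟩ := ha.supp
  obtain ⟨c, h0, hc⟩ := IsSymbol.iteratedFDeriv_bound (U := ⊤) hK (Set.subset_univ _) m n ha.symbol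
  refine ⟨c, h0, fun x ξ => ?_⟩
  by_cases hx : x ∈ K
  · exact hc x hx ξ
  · have : unc a =ᶠ[nhds (x, ξ)] fun _ => 0 := by
      have hO : IsOpen (Kᶜ ×ˢ (Set.univ : Set (Sp ι))) := hK.isClosed.isOpen_compl.prod isOpen_univ
      filter_upwards [hO.mem_nhds ⟨hx, trivial⟩] with p hp using h _ hp.1 _
    rw [(this.iteratedFDeriv ℝ n).self_of_nhds]
    simpa using mul_nonneg h0 (bracket_rpow_pos ξ m).le

theorem bound (ha : IsGlobal m a) : ∃ c : ℝ, 0 ≤ c ∧ ∀ x ξ, ‖a x ξ‖ ≤ c * bracket ξ ^ m := by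
  obtain ⟨c, h0, hc⟩ := ha.iteratedFDeriv_bound 0
  exact ⟨c, h0, fun x ξ => by simpa [unc] using hc x ξ⟩

/-- A symbol multiplied by a smooth function of compact support is global. -/
theorem of_cutoff {U : Opens (Sp ι)} (ha : IsSymbol U m a) {φ : Sp ι → ℂ} (hφ : ContDiff ℝ ∞ φ)
    (hc : HasCompactSupport φ) (hU : tsupport φ ⊆ U) : IsGlobal m fun x ξ => φ x * a x ξ := by
  refine ⟨?_, tsupport φ, hc, fun x hx ξ => by simp [image_eq_zero_of_notMem_tsupport hx]⟩
  have h1 : IsSymbol U m fun x ξ => φ x * a x ξ := by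
    simpa using (isSymbol_of_fst hφ.contDiffOn).mul ha
  have hO : IsOpen ((tsupport φ)ᶜ ×ˢ (Set.univ : Set (Sp ι))) :=
    (isClosed_tsupport φ).isOpen_compl.prod isOpen_univ
  have hz : ∀ p ∈ (tsupport φ)ᶜ ×ˢ (Set.univ : Set (Sp ι)), φ p.1 * a p.1 p.2 = 0 := fun p hp => by
    simp [image_eq_zero_of_notMem_tsupport hp.1]
  refine ⟨?_, fun α β L hL _ => ?_⟩
  · intro p _
    by_cases hp : p.1 ∈ tsupport φ
    · exact (h1.smooth.contDiffAt (isOpen_cyl U) ⟨hU hp, trivial⟩).contDiffWithinAt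
    · refine ContDiffAt.contDiffWithinAt ?_
      refine (contDiffAt_const (c := (0 : ℂ))).congr_of_eventuallyEq ?_
      filter_upwards [hO.mem_nhds ⟨hp, trivial⟩] with q hq using hz q hq
  · obtain ⟨c, hc'⟩ := h1.2 α β _ (hL.inter hc) (Set.inter_subset_right.trans hU)
    refine ⟨|c|, fun x hx ξ => ?_⟩
    by_cases hp : x ∈ tsupport φ
    · exact (hc' x ⟨hx, hp⟩ ξ).trans
        (mul_le_mul_of_nonneg_right (le_abs_self c) (bracket_rpow_pos ξ _).le)
    · rw [mixedDeriv_congr hO (b := fun _ _ => 0) hz α β (x, ξ) ⟨hp, trivial⟩]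
      have h0 : ∀ w : List (ι ⊕ ι), w.foldr CornerPsiDO.pd (fun _ _ => 0 : Fn ι) = fun _ _ => 0 := by
        intro w
        induction w with
        | nil => rfl
        | cons d w ih => rw [List.foldr_cons, ih, pd_zero]
      rw [mixedDeriv_eq, h0]
      simpa using mul_nonneg (abs_nonneg c) (bracket_rpow_pos ξ _).le

/-- Smooth functions of compact support as symbols. -/
theorem of_fun {φ : Sp ι → ℂ} (hφ : ContDiff ℝ ∞ φ) (hc : HasCompactSupport φ) :
    IsGlobal 0 fun x _ => φ x :=
  ⟨isSymbol_of_fst hφ.contDiffOn, tsupport φ, hc,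
    fun _ hx _ => image_eq_zero_of_notMem_tsupport hx⟩

theorem hasCompactSupport (ha : IsGlobal m a) (ξ : Sp ι) : HasCompactSupport fun x => a x ξ := by
  obtain ⟨K, hK, h⟩ := ha.supp
  exact HasCompactSupport.intro hK fun x hx => h x hx ξ

/-- A global symbol as an integrand in its first variable. -/
theorem rapid_left {X : Type} [NormedAddCommGroup X] [NormedSpace ℝ X] (ha : IsGlobal m a)
    (L : X →L[ℝ] Sp ι) : Rapid fun x w => a w (L x) where
  smooth := ha.contDiff.comp (contDiff_snd.prodMk (L.contDiff.comp contDiff_fst))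
  bound n x k := by
    obtain ⟨K, hK, h⟩ := ha.supp
    obtain ⟨c, h0, hc⟩ := ha.iteratedFDeriv_bound n
    -- Decay in w comes for free: w is confined to the compact set K, on which every power of ⟨w⟩ is
    -- bounded below.
    obtain ⟨B, hB⟩ := (hK.image (continuous_bracket_rpow (-k))).bddAbove
    have hVc : ∃ V ∈ nhds x, ∃ M : ℝ, 0 ≤ M ∧ ∀ x' ∈ V, bracket (L x') ^ m ≤ M := by
      have hcont : Continuous fun x' => bracket (L x') ^ m :=
        (continuous_bracket_rpow m).comp L.continuous
      refine ⟨{x' | bracket (L x') ^ m < bracket (L x) ^ m + 1},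
        (isOpen_lt hcont continuous_const).mem_nhds (lt_add_one (bracket (L x) ^ m)),
        bracket (L x) ^ m + 1, by have := bracket_rpow_pos (L x) m; linarith,
        fun x' hx' => le_of_lt hx'⟩
    obtain ⟨V, hV, M, hM, hVM⟩ := hVc
    refine ⟨V, hV, c * M * ‖L‖ ^ n * |B|, by positivity, fun x' hx' w => ?_⟩
    let L' : X →L[ℝ] Sp ι × Sp ι := (ContinuousLinearMap.inr ℝ (Sp ι) (Sp ι)).comp L
    have hL' : ‖L'‖ ≤ ‖L‖ := by
      refine ContinuousLinearMap.opNorm_le_bound _ (norm_nonneg _) fun y => ?_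
      simpa [L', Prod.norm_def] using L.le_opNorm y
    have h1 : (fun y => a w (L y)) = (fun p => unc a (p + (w, 0))) ∘ L' := by
      funext y; simp [unc, L']
    have hs : ContDiff ℝ ∞ fun p => unc a (p + (w, (0 : Sp ι))) :=
      ha.contDiff.comp (contDiff_id.add contDiff_const)
    by_cases hw : w ∈ K
    · rw [h1, L'.iteratedFDeriv_comp_right hs x' (i := n) (by exact_mod_cast le_top)]
      refine (ContinuousMultilinearMap.norm_compContinuousLinearMap_le _ _).trans ?_
      rw [Finset.prod_const, Finset.card_univ, Fintype.card_fin, iteratedFDeriv_comp_add_right]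
      have h2 : L' x' + (w, (0 : Sp ι)) = (w, L x') := by simp [L']
      rw [h2]
      have hBw : 1 ≤ |B| * bracket w ^ k := by
        have h3 : bracket w ^ (-k) ≤ |B| := (hB ⟨w, hw, rfl⟩).trans (le_abs_self B)
        rw [Real.rpow_neg (bracket_pos w).le] at h3
        exact (inv_le_iff_one_le_mul₀ (bracket_rpow_pos w k)).1 h3
      calc _ ≤ (c * M) * ‖L‖ ^ n := by
            refine mul_le_mul ((hc _ _).trans (mul_le_mul_of_nonneg_left (hVM x' hx') h0))
              (pow_le_pow_left₀ (norm_nonneg _) hL' n) (by positivity) (by positivity)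
        _ ≤ (c * M) * ‖L‖ ^ n * (|B| * bracket w ^ k) :=
            le_mul_of_one_le_right (by positivity) hBw
        _ = _ := by ring
    · have : (fun y => a w (L y)) = fun _ => 0 := funext fun y => h w hw _
      rw [this]
      simpa using (by have := bracket_rpow_pos w k; positivity :
        0 ≤ c * M * ‖L‖ ^ n * |B| * bracket w ^ k)

end IsGlobal

/-! ### The Fourier transform of a symbol in the space variable -/

/-- The Fourier transform of `b(x, η)` with respect to `x`. -/
noncomputable def hat (b : Fn ι) : Fn ι := fun ζ η => fourierHat (fun x => b x η) ζ

theorem fourierHat_eq (u : Sp ι → ℂ) (ξ : Sp ι) : fourierHat u ξ = ∫ y, osc (-ξ) y * u y := by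
  unfold fourierHat
  simp_rw [osc_neg_eq, osc_comm]

theorem hat_eq (b : Fn ι) (ζ η : Sp ι) : hat b ζ η = ∫ y, osc (-ζ) y * b y η :=
  fourierHat_eq _ _

theorem hat_apply (b : Fn ι) (ζ η : Sp ι) : hat b ζ η = fourierHat (fun x => b x η) ζ := rfl

attribute [irreducible] hat

theorem IsGlobal.rapid_hat_integrand {m : ℝ} {b : Fn ι} (hb : IsGlobal m b) :
    Rapid fun (p : Sp ι × Sp ι) w => osc (-p.1) w * b w p.2 :=
  (moderate_osc (-ContinuousLinearMap.fst ℝ (Sp ι) (Sp ι))).mul_rapid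
    (hb.rapid_left (ContinuousLinearMap.snd ℝ (Sp ι) (Sp ι)))

theorem IsGlobal.smooth_hat {m : ℝ} {b : Fn ι} (hb : IsGlobal m b) : ContDiff ℝ ∞ (unc (hat b)) := by
  have h := hb.rapid_hat_integrand.domInt.contDiff_integral
  rwa [show unc (hat b) = fun p => ∫ w, osc (-p.1) w * b w p.2 from funext fun p => hat_eq b _ _]

theorem osc_hasFDerivAt (ζ w : Sp ι) : HasFDerivAt (fun ζ' => osc (-ζ') w)
    ((osc (-ζ) w * (-Complex.I)) • (Complex.ofRealCLM.comp (innerSL ℝ w))) ζ := by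
  have h1 : HasFDerivAt (fun ζ' : Sp ι => (inner ℝ (-ζ') w : ℝ)) (-(innerSL ℝ w)) ζ := by
    have : (fun ζ' : Sp ι => (inner ℝ (-ζ') w : ℝ)) = fun ζ' => (-(innerSL ℝ w)) ζ' := by
      funext ζ'; simp [real_inner_comm]
    rw [this]
    exact ContinuousLinearMap.hasFDerivAt _
  have h2 : HasFDerivAt (fun ζ' : Sp ι => ((inner ℝ (-ζ') w : ℝ) : ℂ))
      (Complex.ofRealCLM.comp (-(innerSL ℝ w))) ζ := Complex.ofRealCLM.hasFDerivAt.comp ζ h1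
  have h3 := (h2.const_mul Complex.I).cexp
  refine h3.congr_fderiv ?_
  ext v
  simp [osc, mul_assoc]

/-- Multiplication by a coordinate. -/
theorem IsGlobal.coord_mul {m : ℝ} {b : Fn ι} (hb : IsGlobal m b) (i : ι) :
    IsGlobal m fun x ξ => (x i : ℂ) * b x ξ := by
  have h : IsSymbol (⊤ : Opens (Sp ι)) 0 fun x _ => (x i : ℂ) := by
    refine isSymbol_of_fst (ContDiff.contDiffOn ?_)
    change ContDiff ℝ ∞ fun x : Sp ι => Complex.ofRealCLM (x i)
    fun_prop
  simpa using IsGlobal.symbol_mul h hb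

theorem fderiv_hat_apply {m : ℝ} {b : Fn ι} (hb : IsGlobal m b) (p v : Sp ι × Sp ι) :
    fderiv ℝ (unc (hat b)) p v = ∫ w, (osc (-p.1) w * (-Complex.I * (inner ℝ w v.1 : ℝ)) * b w p.2 +
      osc (-p.1) w * fderiv ℝ (unc b) (w, p.2) (0, v.2)) := by
  have hD := hb.rapid_hat_integrand.domInt
  have h1 : HasFDerivAt (unc (hat b))
      (∫ w, fderiv ℝ (fun q : Sp ι × Sp ι => osc (-q.1) w * b w q.2) p) p := by
    have h := hD.hasFDerivAt p
    rwa [show (fun p => ∫ w, osc (-p.1) w * b w p.2) = unc (hat b) from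
      funext fun p => (hat_eq b _ _).symm] at h
  rw [h1.fderiv, ContinuousLinearMap.integral_apply (hD.fderiv.integrable p)]
  refine integral_congr_ae (Filter.Eventually.of_forall fun w => ?_)
  have h2 : HasFDerivAt (fun q : Sp ι × Sp ι => osc (-q.1) w)
      (((osc (-p.1) w * (-Complex.I)) • (Complex.ofRealCLM.comp (innerSL ℝ w))).comp
        (ContinuousLinearMap.fst ℝ (Sp ι) (Sp ι))) p :=
    (osc_hasFDerivAt p.1 w).comp p hasFDerivAt_fst
  have h3 : HasFDerivAt (fun q : Sp ι × Sp ι => b w q.2) ((fderiv ℝ (unc b) (w, p.2)).comp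
      ((ContinuousLinearMap.inr ℝ (Sp ι) (Sp ι)).comp (ContinuousLinearMap.snd ℝ (Sp ι) (Sp ι)))) p := by
    have h4 : HasFDerivAt (fun q : Sp ι × Sp ι => (w, q.2))
        ((ContinuousLinearMap.inr ℝ (Sp ι) (Sp ι)).comp
          (ContinuousLinearMap.snd ℝ (Sp ι) (Sp ι))) p :=
      (hasFDerivAt_prodMk_right w p.2).comp p hasFDerivAt_snd
    exact ((hb.contDiff.differentiable (by simp)) (w, p.2)).hasFDerivAt.comp p h4
  simp only
  rw [(h2.fun_mul h3).fderiv]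
  simp
  ring

theorem dx_hat {m : ℝ} {b : Fn ι} (hb : IsGlobal m b) (i : ι) :
    dx i (hat b) = hat fun x ξ => -Complex.I * ((x i : ℂ) * b x ξ) := by
  ext ζ η
  have h := pd_eq_fderiv (p := (ζ, η)) (hb.smooth_hat.differentiable (by simp) _) (Sum.inl i)
  simp only [pd] at h
  rw [h, fderiv_hat_apply hb, hat_eq]
  refine integral_congr_ae (Filter.Eventually.of_forall fun w => ?_)
  have : fderiv ℝ (unc b) (w, η) (0, 0) = 0 := by
    rw [← Prod.zero_eq_mk, map_zero]
  simp [dir, this, EuclideanSpace.inner_single_right]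
  ring

theorem dxi_hat {m : ℝ} {b : Fn ι} (hb : IsGlobal m b) (i : ι) :
    dxi i (hat b) = hat (dxi i b) := by
  ext ζ η
  have h := pd_eq_fderiv (p := (ζ, η)) (hb.smooth_hat.differentiable (by simp) _) (Sum.inr i)
  simp only [pd] at h
  rw [h, fderiv_hat_apply hb, hat_eq]
  refine integral_congr_ae (Filter.Eventually.of_forall fun w => ?_)
  have h2 := pd_eq_fderiv (p := (w, η)) (hb.contDiff.differentiable (by simp) _) (Sum.inr i)
  simp only [pd, dir] at h2
  simp [dir, h2]

theorem IsGlobal.integrable_hat {m : ℝ} {b : Fn ι} (hb : IsGlobal m b) (ζ η : Sp ι) :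
    Integrable fun w => osc (-ζ) w * b w η :=
  hb.rapid_hat_integrand.domInt.integrable (ζ, η)

/-- Integration by parts in the space variable, without boundary terms by compact support. -/
theorem hat_dx {m : ℝ} {b : Fn ι} (hb : IsGlobal m b) (i : ι) (ζ η : Sp ι) :
    hat (dx i b) ζ η = Complex.I * (ζ i : ℂ) * hat b ζ η := by
  set e : Sp ι := EuclideanSpace.single i 1 with he
  have hder : ∀ w, HasFDerivAt (fun w : Sp ι => osc (-ζ) w)
      ((osc (-ζ) w * (-Complex.I)) • (Complex.ofRealCLM.comp (innerSL ℝ ζ))) w := by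
    intro w
    have h := osc_hasFDerivAt w ζ
    have e1 : (fun w : Sp ι => osc (-ζ) w) = fun w => osc (-w) ζ := by
      funext w; rw [osc_neg_left, osc_neg_left, osc_comm]; simp [osc]
    have e2 : osc (-ζ) w = osc (-w) ζ := congrFun e1 w
    rwa [e1, e2]
  have hfd : ∀ w, fderiv ℝ (fun w : Sp ι => osc (-ζ) w) w e =
      -(Complex.I * (ζ i : ℂ)) * osc (-ζ) w := by
    intro w
    rw [(hder w).fderiv]
    simp [he, EuclideanSpace.inner_single_right]; ring
  have hb1 := hb.integrable_hat ζ η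
  have hb2 := (hb.dx i).integrable_hat ζ η
  rw [hat_eq, hat_eq]
  have hg : Differentiable ℝ fun w => b w η :=
    (hb.contDiff.comp (by fun_prop : ContDiff ℝ ∞ fun w : Sp ι => (w, η))).differentiable (by simp)
  have key := integral_mul_fderiv_eq_neg_fderiv_mul_of_integrable (μ := volume) (v := e)
    (f := fun w : Sp ι => osc (-ζ) w) (g := fun w => b w η) ?_ hb2 hb1
    (fun w _ => (hder w).differentiableAt) (fun w _ => hg w)
  · have e3 : ∀ w, fderiv ℝ (fun w => b w η) w e = dx i b w η := fun w => rfl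
    simp_rw [e3, hfd] at key
    rw [key, ← integral_neg, ← integral_const_mul]
    refine integral_congr_ae (Filter.Eventually.of_forall fun w => ?_)
    simp only; ring
  · simp_rw [hfd, mul_assoc]
    exact hb1.const_mul _

theorem hat_add {m m' : ℝ} {a b : Fn ι} (ha : IsGlobal m a) (hb : IsGlobal m' b) (ζ η : Sp ι) :
    hat (fun x ξ => a x ξ + b x ξ) ζ η = hat a ζ η + hat b ζ η := by
  simp_rw [hat_eq, mul_add]
  exact integral_add (ha.integrable_hat ζ η) (hb.integrable_hat ζ η)

theorem hat_const_mul (b : Fn ι) (c : ℂ) (ζ η : Sp ι) :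
    hat (fun x ξ => c * b x ξ) ζ η = c * hat b ζ η := by
  simp_rw [hat_eq, ← integral_const_mul]
  congr 1; funext w; ring

theorem hat_sum {κ : Type*} {s : Finset κ} {m : ℝ} {b : κ → Fn ι}
    (hb : ∀ j ∈ s, IsGlobal m (b j)) (ζ η : Sp ι) :
    hat (fun x ξ => ∑ j ∈ s, b j x ξ) ζ η = ∑ j ∈ s, hat (b j) ζ η := by
  simp_rw [hat_eq, Finset.mul_sum]
  exact integral_finsetSum _ fun j hj => (hb j hj).integrable_hat ζ η

/-- The operator `1 - Δ` in the space variable. -/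
noncomputable def oneSubLaplace (b : Fn ι) : Fn ι :=
  fun x ξ => b x ξ + (-1) * ∑ i, dx i (dx i b) x ξ

theorem IsGlobal.oneSubLaplace {m : ℝ} {b : Fn ι} (hb : IsGlobal m b) :
    IsGlobal m (oneSubLaplace b) :=
  hb.add ((IsGlobal.sum fun i _ => (hb.dx i).dx i).const_mul (-1))

theorem hat_oneSubLaplace {m : ℝ} {b : Fn ι} (hb : IsGlobal m b) (ζ η : Sp ι) :
    hat (oneSubLaplace b) ζ η = ((bracket ζ ^ 2 : ℝ) : ℂ) * hat b ζ η := by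
  have h1 : IsGlobal m fun x ξ => ∑ i, CornerPsiDO.dx i (CornerPsiDO.dx i b) x ξ :=
    IsGlobal.sum fun i _ => (hb.dx i).dx i
  unfold CornerPsiDO.oneSubLaplace
  rw [hat_add hb (h1.const_mul (-1)), hat_const_mul, hat_sum fun i _ => (hb.dx i).dx i]
  simp_rw [hat_dx (hb.dx _), hat_dx hb]
  have e : ∀ i, Complex.I * (ζ i : ℂ) * (Complex.I * (ζ i : ℂ) * hat b ζ η) =
      -((ζ i : ℂ) ^ 2 * hat b ζ η) := fun i => by
    linear_combination (ζ i : ℂ) ^ 2 * hat b ζ η * Complex.I_mul_I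
  simp_rw [e]
  rw [Finset.sum_neg_distrib, ← Finset.sum_mul, bracket_sq, EuclideanSpace.norm_sq_eq]
  push_cast
  have e2 : ∀ i, ((‖ζ i‖ : ℝ) : ℂ) ^ 2 = (ζ i : ℂ) ^ 2 := fun i => by
    rw [Real.norm_eq_abs]; norm_cast; rw [sq_abs]
  simp_rw [e2]
  ring

theorem IsGlobal.iterate_oneSubLaplace {m : ℝ} {b : Fn ι} (hb : IsGlobal m b) (K : ℕ) :
    IsGlobal m (CornerPsiDO.oneSubLaplace^[K] b) ∧ ∀ ζ η, hat (CornerPsiDO.oneSubLaplace^[K] b) ζ η =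
      (((bracket ζ ^ 2) ^ K : ℝ) : ℂ) * hat b ζ η := by
  induction K with
  | zero => exact ⟨hb, by simp⟩
  | succ K ih =>
    rw [Function.iterate_succ_apply']
    refine ⟨ih.1.oneSubLaplace, fun ζ η => ?_⟩
    rw [hat_oneSubLaplace ih.1, ih.2, pow_succ]
    push_cast; ring

/-- With `hat_oneSubLaplace`, the number K of applications of 1 - Δ in x that produces the decay
⟨ζ⟩^k. -/
theorem exists_bracket_pow_le (k : ℝ) : ∃ K : ℕ, ∀ ζ : Sp ι, 1 ≤ bracket ζ ^ k * (bracket ζ ^ 2) ^ K := by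
  obtain ⟨K, hK⟩ := exists_nat_ge (-k)
  refine ⟨K, fun ζ => ?_⟩
  rw [← pow_mul, ← Real.rpow_natCast, ← Real.rpow_add (bracket_pos ζ)]
  refine Real.one_le_rpow (one_le_bracket ζ) ?_
  push_cast
  have : (0 : ℝ) ≤ K := by positivity
  linarith

/-- The Fourier transform of a global symbol decreases rapidly. -/
theorem IsGlobal.hat_bound {m : ℝ} {b : Fn ι} (hb : IsGlobal m b) (k : ℝ) :
    ∃ c : ℝ, 0 ≤ c ∧ ∀ ζ η, ‖hat b ζ η‖ ≤ c * bracket ζ ^ k * bracket η ^ m := by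
  have h0 : ∀ {b : Fn ι}, IsGlobal m b → ∃ c : ℝ, 0 ≤ c ∧ ∀ ζ η, ‖hat b ζ η‖ ≤ c * bracket η ^ m := by
    intro b hb
    obtain ⟨K, hK, h⟩ := hb.supp
    obtain ⟨c, h0, hc⟩ := hb.bound
    refine ⟨volume.real K * c, by positivity, fun ζ η => ?_⟩
    rw [hat_eq, ← setIntegral_eq_integral_of_forall_compl_eq_zero (s := K)
      (fun w hw => by rw [h w hw, mul_zero])]
    refine (norm_setIntegral_le_of_norm_le_const (C := c * bracket η ^ m) hK.measure_lt_top
      fun w _ => ?_).trans_eq (by ring)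
    rw [norm_mul, norm_osc, one_mul]
    exact hc w η
  -- The bound `h0`, without decay, is applied to (1 - Δ)^K b, a symbol of the same order whose
  -- transform is ⟨ζ⟩^{2K} b̂.
  obtain ⟨K, hK⟩ := exists_bracket_pow_le (ι := ι) k
  obtain ⟨h1, h2⟩ := hb.iterate_oneSubLaplace K
  obtain ⟨c, hc0, hc⟩ := h0 h1
  refine ⟨c, hc0, fun ζ η => ?_⟩
  have h3 := hc ζ η
  rw [h2, norm_mul, Complex.norm_real, Real.norm_of_nonneg (by positivity)] at h3
  calc ‖hat b ζ η‖ ≤ (bracket ζ ^ k * (bracket ζ ^ 2) ^ K) * ‖hat b ζ η‖ :=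
        le_mul_of_one_le_left (norm_nonneg _) (hK ζ)
    _ = bracket ζ ^ k * ((bracket ζ ^ 2) ^ K * ‖hat b ζ η‖) := by ring
    _ ≤ bracket ζ ^ k * (c * bracket η ^ m) :=
        mul_le_mul_of_nonneg_left h3 (bracket_rpow_pos ζ k).le
    _ = _ := by ring

theorem moderate_osc_snd {X : Type} [NormedAddCommGroup X] [NormedSpace ℝ X] (ζ : Sp ι) :
    Moderate fun (_ : X) (w : Sp ι) => osc (-ζ) w where
  smooth := by
    have h : ContDiff ℝ ∞ fun w : Sp ι => osc (-ζ) w :=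
      contDiff_osc.comp (contDiff_const.prodMk contDiff_id)
    exact h.comp contDiff_snd
  bound n x := by
    refine ⟨0, Set.univ, Filter.univ_mem, 1, zero_le_one, fun x' _ w => ?_⟩
    rcases n with _ | n
    · simp [norm_osc]
    · rw [iteratedFDeriv_succ_const]; simp

/-- The oscillating factor does not depend on the parameter y, so derivatives fall on b alone and
the constant is uniform in ζ. Powers of 1 - Δ then add decay, as in `hat_bound`. -/
theorem IsGlobal.iteratedFDeriv_hat_bound {X : Type} [NormedAddCommGroup X] [NormedSpace ℝ X]
    {m : ℝ} {b : Fn ι} (hb : IsGlobal m b) (L : X →L[ℝ] Sp ι) (n : ℕ) (x : X) :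
    ∃ V ∈ nhds x, ∃ c : ℝ, 0 ≤ c ∧ ∀ x' ∈ V, ∀ ζ,
        ‖iteratedFDeriv ℝ n (fun y => hat b ζ (L y)) x'‖ ≤ c := by
  obtain ⟨V, hV, c, h0, hc⟩ := (hb.rapid_left L).bound n x (-(Fintype.card ι : ℝ) - 1)
  have hint : Integrable fun w : Sp ι => bracket w ^ (-(Fintype.card ι : ℝ) - 1) :=
    integrable_bracket_rpow (by linarith)
  refine ⟨V, hV, ∫ w : Sp ι, c * bracket w ^ (-(Fintype.card ι : ℝ) - 1),
    integral_nonneg fun w => mul_nonneg h0 (bracket_rpow_pos w _).le, fun x' hx' ζ => ?_⟩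
  have hD : DomInt fun y w => osc (-ζ) w * b w (L y) :=
    ((moderate_osc_snd (X := X) ζ).mul_rapid (hb.rapid_left L)).domInt
  have h1 := (hD.integral_aux n).2 x'
  have h3 : (fun y => hat b ζ (L y)) = fun y => ∫ w, osc (-ζ) w * b w (L y) :=
    funext fun y => hat_eq b ζ (L y)
  rw [h3]
  refine h1.trans (integral_mono_of_nonneg
    (Filter.Eventually.of_forall fun _ => norm_nonneg _) (hint.const_mul c)
    (Filter.Eventually.of_forall fun w => ?_))
  have h2 : (fun y => osc (-ζ) w * b w (L y)) = osc (-ζ) w • fun y => b w (L y) := by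
    funext y; simp
  have h5 : ContDiff ℝ ∞ fun y => b w (L y) := contDiff_left (F := fun y w => b w (L y)) (hb.rapid_left L).smooth w
  have h4 : ContDiffAt ℝ n (fun y => b w (L y)) x' := h5.contDiffAt.of_le (natCast_le_infty n)
  change ‖iteratedFDeriv ℝ n (fun y => osc (-ζ) w * b w (L y)) x'‖ ≤ _
  rw [h2, iteratedFDeriv_const_smul_apply h4, norm_smul, norm_osc, one_mul]
  exact hc x' hx' w

theorem rapid_hat_smooth {X : Type} [NormedAddCommGroup X] [NormedSpace ℝ X] {m : ℝ} {b : Fn ι}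
    (hb : IsGlobal m b) (L : X →L[ℝ] Sp ι) :
    ContDiff ℝ ∞ fun p : X × Sp ι => hat b p.2 (L p.1) := by
  have h : ContDiff ℝ ∞ fun p : X × Sp ι => (p.2, L p.1) :=
    contDiff_snd.prodMk (L.contDiff.comp contDiff_fst)
  have h2 := hb.smooth_hat
  have h3 := h2.comp h
  exact h3

theorem bracket_absorb {ζ : Sp ι} {k c A : ℝ} {K : ℕ} (hA : 0 ≤ A)
    (hK : 1 ≤ bracket ζ ^ k * (bracket ζ ^ 2) ^ K) (h : (bracket ζ ^ 2) ^ K * A ≤ c) :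
    A ≤ c * bracket ζ ^ k := by
  calc A ≤ (bracket ζ ^ k * (bracket ζ ^ 2) ^ K) * A := le_mul_of_one_le_left hA hK
    _ = bracket ζ ^ k * ((bracket ζ ^ 2) ^ K * A) := by ring
    _ ≤ bracket ζ ^ k * c := mul_le_mul_of_nonneg_left h (bracket_rpow_pos ζ k).le
    _ = _ := mul_comm _ _

theorem IsGlobal.rapid_hat {X : Type} [NormedAddCommGroup X] [NormedSpace ℝ X] {m : ℝ} {b : Fn ι}
    (hb : IsGlobal m b) (L : X →L[ℝ] Sp ι) : Rapid fun x ζ => hat b ζ (L x) where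
  smooth := rapid_hat_smooth hb L
  bound n x k := by
    obtain ⟨K, hK⟩ := exists_bracket_pow_le (ι := ι) k
    obtain ⟨h1, h2⟩ := hb.iterate_oneSubLaplace K
    obtain ⟨V, hV, c, hc0, hc⟩ := h1.iteratedFDeriv_hat_bound L n x
    refine ⟨V, hV, c, hc0, fun x' hx' ζ => ?_⟩
    have h3 := hc x' hx' ζ
    have h4 : (fun y => hat (CornerPsiDO.oneSubLaplace^[K] b) ζ (L y)) =
        (((bracket ζ ^ 2) ^ K : ℝ) : ℂ) • fun y => hat b ζ (L y) := by
      funext y; rw [h2]; rfl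
    have hsm : ContDiff ℝ ∞ fun y => hat b ζ (L y) := by
      have h : ContDiff ℝ ∞ fun y : X => (ζ, L y) := contDiff_const.prodMk L.contDiff
      exact hb.smooth_hat.comp h
    rw [h4, iteratedFDeriv_const_smul_apply (hsm.contDiffAt.of_le (natCast_le_infty n)),
      norm_smul, Complex.norm_real, Real.norm_of_nonneg (by positivity)] at h3
    exact bracket_absorb (norm_nonneg _) (hK ζ) h3

/-! ### Fourier inversion -/

/-- The constant `(2π)^{-N}`. -/
noncomputable def cN (ι : Type) [Fintype ι] : ℂ := (((2 * Real.pi) ^ Fintype.card ι : ℝ) : ℂ)⁻¹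

theorem opLeft_eq (a : Fn ι) (u : Sp ι → ℂ) (x : Sp ι) :
    opLeft a u x = cN ι * ∫ ξ, osc x ξ * a x ξ * fourierHat u ξ := rfl

open scoped FourierTransform in
theorem fourier_eq_fourierHat (u : Sp ι → ℂ) (w : Sp ι) :
    𝓕 u w = fourierHat u ((2 * Real.pi) • w) := by
  rw [Real.fourier_eq', fourierHat]
  congr 1
  funext v
  rw [smul_eq_mul, inner_smul_right]
  congr 2
  push_cast; ring

theorem fourierHat_bound {u : Sp ι → ℂ} (hu : ContDiff ℝ ∞ u) (hc : HasCompactSupport u) (k : ℝ) :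
    ∃ c : ℝ, 0 ≤ c ∧ ∀ ξ, ‖fourierHat u ξ‖ ≤ c * bracket ξ ^ k := by
  obtain ⟨c, h0, h⟩ := (IsGlobal.of_fun hu hc).hat_bound k
  exact ⟨c, h0, fun ξ => by simpa [hat_apply] using h ξ 0⟩

theorem contDiff_fourierHat {u : Sp ι → ℂ} (hu : ContDiff ℝ ∞ u) (hc : HasCompactSupport u) :
    ContDiff ℝ ∞ (fourierHat u) := by
  have h := (IsGlobal.of_fun hu hc).smooth_hat.comp
    (by fun_prop : ContDiff ℝ ∞ fun ξ : Sp ι => (ξ, (0 : Sp ι)))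
  rwa [show unc (hat fun x _ => u x) ∘ (fun ξ : Sp ι => (ξ, (0 : Sp ι))) = fourierHat u from
    funext fun ξ => hat_apply _ _ _] at h

theorem integrable_fourierHat {u : Sp ι → ℂ} (hu : ContDiff ℝ ∞ u) (hc : HasCompactSupport u) :
    Integrable (fourierHat u) := by
  obtain ⟨c, -, h⟩ := fourierHat_bound hu hc (-(Fintype.card ι : ℝ) - 1)
  exact ((integrable_bracket_rpow (by linarith)).const_mul c).mono'
    (contDiff_fourierHat hu hc).continuous.aestronglyMeasurable (Filter.Eventually.of_forall h)

open scoped FourierTransform in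
theorem fourierHat_inversion {u : Sp ι → ℂ} (hu : ContDiff ℝ ∞ u) (hc : HasCompactSupport u)
    (x : Sp ι) : cN ι * ∫ ξ, osc x ξ * fourierHat u ξ = u x := by
  have hF : 𝓕 u = fun w => fourierHat u ((2 * Real.pi) • w) :=
    funext fun w => fourier_eq_fourierHat u w
  have hpi : (2 * Real.pi) ≠ 0 := by positivity
  have h1 : Integrable (𝓕 u) := by
    rw [hF]
    exact (integrable_fourierHat hu hc).comp_smul hpi
  have h := congrFun (hu.continuous.fourierInv_fourier_eq
    (hu.continuous.integrable_of_hasCompactSupport hc) h1) x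
  rw [Real.fourierInv_eq'] at h
  rw [← h]
  have h2 : ∀ w : Sp ι, Complex.exp (((2 * Real.pi * inner ℝ w x : ℝ) : ℂ) * Complex.I) • 𝓕 u w =
      (fun ξ => osc x ξ * fourierHat u ξ) ((2 * Real.pi) • w) := by
    intro w
    simp only [smul_eq_mul]
    rw [hF, osc, inner_smul_right, real_inner_comm, mul_comm Complex.I]
  simp_rw [h2]
  -- Substitution ξ = 2π w; the Jacobian is the constant `cN` of the present normalization.
  rw [Measure.integral_comp_smul volume (fun ξ => osc x ξ * fourierHat u ξ) (2 * Real.pi),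
    finrank_euclideanSpace, abs_of_nonneg (by positivity), cN, Complex.real_smul]
  push_cast
  rfl

end Global

/-! ### Composition of global symbols -/

section Sharp

variable {ι : Type} [Fintype ι] [DecidableEq ι]

/-- The left symbol of the composition `Op(a) Op(b)`. -/
noncomputable def sharp (a b : Fn ι) : Fn ι :=
  fun x η => cN ι * ∫ ζ, osc x ζ * (a x (η + ζ) * hat b ζ η)

theorem rapid_sharp_integrand {m m' : ℝ} {a b : Fn ι} (ha : IsGlobal m a) (hb : IsGlobal m' b) :
    Rapid fun (p : Sp ι × Sp ι) ζ => osc p.1 ζ * (a p.1 (p.2 + ζ) * hat b ζ p.2) :=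
  (moderate_osc (ContinuousLinearMap.fst ℝ (Sp ι) (Sp ι))).mul_rapid
    ((moderate_symbol ha.symbol (ContinuousLinearMap.fst ℝ (Sp ι) (Sp ι))
      (ContinuousLinearMap.snd ℝ (Sp ι) (Sp ι))).mul_rapid
      (hb.rapid_hat (ContinuousLinearMap.snd ℝ (Sp ι) (Sp ι))))

theorem integrable_sharp_integrand {m m' : ℝ} {a b : Fn ι} (ha : IsGlobal m a)
    (hb : IsGlobal m' b) (x η : Sp ι) :
    Integrable fun ζ => osc x ζ * (a x (η + ζ) * hat b ζ η) :=
  (rapid_sharp_integrand ha hb).domInt.integrable (x, η)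

theorem smooth_sharp {m m' : ℝ} {a b : Fn ι} (ha : IsGlobal m a) (hb : IsGlobal m' b) :
    ContDiff ℝ ∞ (unc (sharp a b)) := by
  have h := (rapid_sharp_integrand ha hb).domInt.contDiff_integral
  exact contDiff_const.mul h

theorem pd_integral {F : Sp ι × Sp ι → Sp ι → ℂ} (hF : DomInt F) (d : ι ⊕ ι) (x η : Sp ι) :
    pd d (fun x η => ∫ ζ, F (x, η) ζ) x η = ∫ ζ, pd d (fun x η => F (x, η) ζ) x η := by
  have h1 := hF.hasFDerivAt (x, η)
  have e : (fun p => ∫ ζ, F p ζ) = unc fun x η => ∫ ζ, F (x, η) ζ := rfl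
  rw [e] at h1
  rw [pd_eq_fderiv (p := (x, η)) h1.differentiableAt, h1.fderiv,
    ContinuousLinearMap.integral_apply (hF.fderiv.integrable (x, η))]
  refine integral_congr_ae (Filter.Eventually.of_forall fun ζ => ?_)
  exact (pd_eq_fderiv (a := fun x η => F (x, η) ζ) (p := (x, η))
    ((hF.smooth_left ζ).differentiable (by simp) _) d).symm

theorem pd_shift {a : Fn ι} (ha : ContDiff ℝ ∞ (unc a)) (d : ι ⊕ ι) (ζ x η : Sp ι) :
    pd d (fun x η => a x (η + ζ)) x η = pd d a x (η + ζ) := by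
  have h1 : unc (fun x η => a x (η + ζ)) = fun p => unc a (p + (0, ζ)) := by
    funext p; simp [unc]
  have h2 : ContDiff ℝ ∞ (unc fun x η => a x (η + ζ)) := by
    rw [h1]; exact ha.comp (contDiff_id.add contDiff_const)
  rw [pd_eq_fderiv (p := (x, η)) (h2.differentiable (by simp) _), h1, fderiv_comp_add_right,
    pd_eq_fderiv (p := (x, η + ζ)) (ha.differentiable (by simp) _)]
  simp

theorem pd_osc (d : ι ⊕ ι) (ζ x η : Sp ι) : pd d (fun x _ => osc x ζ) x η =
    (match d with | Sum.inl i => Complex.I * (ζ i : ℂ) | Sum.inr _ => 0) * osc x ζ := by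
  cases d with
  | inr i => simp [pd, dxi]
  | inl i =>
    have h := (osc_hasFDerivAt x (-ζ)).fderiv
    have e : (fun x' : Sp ι => osc (-x') (-ζ)) = fun x' => osc x' ζ := by
      funext x'; simp [osc]
    rw [e] at h
    simp only [pd, dx]
    rw [h]
    simp [osc, EuclideanSpace.inner_single_right]
    ring

/-- A derivative in x falls on a or on the exponential; in the second case it yields the factor
iζ_i, which turns b̂ into the transform of ∂b/∂x_i. A derivative in the covariable falls on a or on
b̂ directly. So # obeys the product rule in all directions. -/
theorem pd_sharp {m m' : ℝ} {a b : Fn ι} (ha : IsGlobal m a) (hb : IsGlobal m' b) (d : ι ⊕ ι) :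
    pd d (sharp a b) = fun x η => sharp (pd d a) b x η + sharp a (pd d b) x η := by
  have hR := rapid_sharp_integrand ha hb
  have hu := isOpen_univ (X := Sp ι × Sp ι)
  have hint : Smooth Set.univ fun x η => ∫ ζ, osc x ζ * (a x (η + ζ) * hat b ζ η) :=
    hR.domInt.contDiff_integral.contDiffOn
  funext x η
  have h1 : pd d (sharp a b) x η =
      cN ι * pd d (fun x η => ∫ ζ, osc x ζ * (a x (η + ζ) * hat b ζ η)) x η :=
    pd_const_mul hu (cN ι) hint d (x, η) trivial
  rw [h1, pd_integral hR.domInt d x η]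
  simp only [sharp]
  rw [← mul_add, ← integral_add (integrable_sharp_integrand (ha.pd d) hb x η)
    (integrable_sharp_integrand ha (hb.pd d) x η)]
  congr 1
  refine integral_congr_ae (Filter.Eventually.of_forall fun ζ => ?_)
  have s1 : Smooth Set.univ fun x _ : Sp ι => osc x ζ := by
    have : ContDiff ℝ ∞ fun p : Sp ι × Sp ι => osc p.1 ζ :=
      contDiff_osc.comp (contDiff_fst.prodMk contDiff_const)
    exact this.contDiffOn
  have s2 : Smooth Set.univ fun x η : Sp ι => a x (η + ζ) := by
    have : ContDiff ℝ ∞ fun p : Sp ι × Sp ι => unc a (p.1, p.2 + ζ) :=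
      ha.contDiff.comp (contDiff_fst.prodMk (contDiff_snd.add contDiff_const))
    exact this.contDiffOn
  have s3 : Smooth Set.univ fun _ η : Sp ι => hat b ζ η := by
    have : ContDiff ℝ ∞ fun p : Sp ι × Sp ι => unc (hat b) (ζ, p.2) :=
      hb.smooth_hat.comp (contDiff_const.prodMk contDiff_snd)
    exact this.contDiffOn
  have e1 := pd_mul hu s1 (s2.mul s3) d (x, η) trivial
  have e2 := pd_mul hu s2 s3 d (x, η) trivial
  simp only at e1 e2 ⊢
  rw [e1, e2, pd_osc, pd_shift ha.contDiff]
  cases d with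
  | inl i =>
    have e3 : pd (Sum.inl i) (fun _ η : Sp ι => hat b ζ η) x η = 0 := by simp [pd, dx]
    have e4 : hat (pd (Sum.inl i) b) ζ η = Complex.I * (ζ i : ℂ) * hat b ζ η := hat_dx hb i ζ η
    rw [e3, e4]
    ring
  | inr i =>
    have e3 : pd (Sum.inr i) (fun _ η : Sp ι => hat b ζ η) x η = hat (pd (Sum.inr i) b) ζ η :=
      congrFun (congrFun (dxi_hat hb i) ζ) η
    rw [e3]
    ring

/-- The sum over all words `w` of length `l` of `∂_ξ^w a D_x^w b`. -/
noncomputable def leibTerm : ℕ → Fn ι → Fn ι → Fn ι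
  | 0, a, b => fun x ξ => a x ξ * b x ξ
  | l + 1, a, b => fun x ξ => ∑ i, leibTerm l (dxi i a) (fun x ξ => -Complex.I * dx i b x ξ) x ξ

theorem leibTerm_smooth {O : Set (Sp ι × Sp ι)} (hO : IsOpen O) (l : ℕ) : ∀ {a b : Fn ι},
    Smooth O a → Smooth O b → Smooth O (leibTerm l a b) := by
  induction l with
  | zero => exact fun ha hb => ha.mul hb
  | succ l ih =>
    exact fun ha hb => Smooth.sum fun i _ =>
      ih (ha.pd hO (Sum.inr i)) ((hb.pd hO (Sum.inl i)).const_mul _)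

theorem leibTerm_congr {O : Set (Sp ι × Sp ι)} (hO : IsOpen O) (l : ℕ) : ∀ {a b a' b' : Fn ι},
    (∀ p ∈ O, a p.1 p.2 = a' p.1 p.2) → (∀ p ∈ O, b p.1 p.2 = b' p.1 p.2) →
    ∀ p ∈ O, leibTerm l a b p.1 p.2 = leibTerm l a' b' p.1 p.2 := by
  induction l with
  | zero => intro a b a' b' h h' p hp; simp only [leibTerm]; rw [h p hp, h' p hp]
  | succ l ih =>
    intro a b a' b' h h' p hp
    simp only [leibTerm]
    refine Finset.sum_congr rfl fun i _ => ih (fun p hp => pd_congr hO h (Sum.inr i) p hp)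
      (fun p hp => ?_) p hp
    have h2 : dx i b p.1 p.2 = dx i b' p.1 p.2 := pd_congr hO h' (Sum.inl i) p hp
    rw [h2]

/-- Leibniz terms obey the same product rule as `sharp`; hence so does the remainder, and its symbol
estimates reduce to the undifferentiated one. -/
theorem pd_leibTerm (d : ι ⊕ ι) (l : ℕ) : ∀ {a b : Fn ι},
    Smooth Set.univ a → Smooth Set.univ b → pd d (leibTerm l a b) =
      fun x ξ => leibTerm l (pd d a) b x ξ + leibTerm l a (pd d b) x ξ := by
  have hu := isOpen_univ (X := Sp ι × Sp ι)
  induction l with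
  | zero =>
    intro a b ha hb
    funext x ξ
    exact pd_mul hu ha hb d (x, ξ) trivial
  | succ l ih =>
    intro a b ha hb
    funext x ξ
    have h1 : ∀ i, Smooth Set.univ (dxi i a) := fun i => ha.pd hu (Sum.inr i)
    have h2 : ∀ i, Smooth Set.univ fun x ξ => -Complex.I * dx i b x ξ :=
      fun i => (hb.pd hu (Sum.inl i)).const_mul _
    have e0 := pd_sum hu (s := Finset.univ) (a := fun i => leibTerm l (dxi i a)
      fun x ξ => -Complex.I * dx i b x ξ) (fun i _ => leibTerm_smooth hu l (h1 i) (h2 i)) d (x, ξ)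
      trivial
    simp only [leibTerm] at e0 ⊢
    rw [e0, ← Finset.sum_add_distrib]
    refine Finset.sum_congr rfl fun i _ => ?_
    rw [ih (h1 i) (h2 i)]
    have e1 : pd d (dxi i a) = dxi i (pd d a) := by
      funext x ξ; exact pd_comm hu ha d (Sum.inr i) (x, ξ) trivial
    have e2 : pd d (fun x ξ => -Complex.I * dx i b x ξ) =
        fun x ξ => -Complex.I * dx i (pd d b) x ξ := by
      funext x ξ
      have e3 := pd_comm hu hb d (Sum.inl i) (x, ξ) trivial
      have e4 := pd_const_mul hu (-Complex.I) (hb.pd hu (Sum.inl i)) d (x, ξ) trivial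
      simp only [pd] at e3 e4 ⊢
      rw [e4]
      rw [e3]
    rw [e1, e2]

/-- The remainder of the expansion of the composition. -/
noncomputable def sharpRem (M : ℕ) (a b : Fn ι) : Fn ι :=
  -- A multi-index α of length l arises from l!/α! words, so the factor 1/l! reproduces the usual
  -- 1/α!.
  fun x η => sharp a b x η - ∑ l ∈ Finset.range M, ((l.factorial : ℂ))⁻¹ * leibTerm l a b x η

theorem smooth_sharpRem {m m' : ℝ} {a b : Fn ι} (ha : IsGlobal m a) (hb : IsGlobal m' b) (M : ℕ) :
    Smooth Set.univ (sharpRem M a b) :=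
  Smooth.sub (smooth_sharp ha hb).contDiffOn
    (Smooth.sum fun l _ => (leibTerm_smooth isOpen_univ l ha.smooth hb.smooth).const_mul _)

theorem pd_sharpRem {m m' : ℝ} {a b : Fn ι} (ha : IsGlobal m a) (hb : IsGlobal m' b) (M : ℕ)
    (d : ι ⊕ ι) : pd d (sharpRem M a b) =
      fun x η => sharpRem M (pd d a) b x η + sharpRem M a (pd d b) x η := by
  have hu := isOpen_univ (X := Sp ι × Sp ι)
  funext x η
  have hl : ∀ l, Smooth Set.univ (leibTerm l a b) := fun l => leibTerm_smooth hu l ha.smooth hb.smooth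
  have h1 := pd_sub hu (a := sharp a b) (b := fun x η => ∑ l ∈ Finset.range M,
    ((l.factorial : ℂ))⁻¹ * leibTerm l a b x η) (smooth_sharp ha hb).contDiffOn
    (Smooth.sum fun l _ => (hl l).const_mul _) d (x, η) trivial
  have h2 := pd_sum hu (s := Finset.range M) (a := fun l x η =>
    ((l.factorial : ℂ))⁻¹ * leibTerm l a b x η) (fun l _ => (hl l).const_mul _) d (x, η) trivial
  have h3 : ∀ l, pd d (fun x η => ((l.factorial : ℂ))⁻¹ * leibTerm l a b x η) x η =
      ((l.factorial : ℂ))⁻¹ * (leibTerm l (pd d a) b x η + leibTerm l a (pd d b) x η) := fun l => by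
    have h4 := pd_const_mul hu ((l.factorial : ℂ))⁻¹ (hl l) d (x, η) trivial
    rw [pd_leibTerm d l ha.smooth hb.smooth] at h4
    exact h4
  simp only [h3] at h2
  simp only at h1
  simp only [sharpRem]
  rw [h2, pd_sharp ha hb] at h1
  refine h1.trans ?_
  simp only [mul_add, Finset.sum_add_distrib]
  ring

/-- The `l`-th derivative of `a(x, ·)` in the direction `ζ`. -/
noncomputable def covDeriv : ℕ → Fn ι → Sp ι → Fn ι
  | 0, a, _ => a
  | l + 1, a, ζ => fun x ξ => ∑ i, (ζ i : ℂ) * covDeriv l (dxi i a) ζ x ξ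

theorem covDeriv_bound (l : ℕ) : ∀ {m : ℝ} {a : Fn ι}, IsGlobal m a →
    ∃ c : ℝ, 0 ≤ c ∧ ∀ ζ x ξ, ‖covDeriv l a ζ x ξ‖ ≤ c * bracket ζ ^ l * bracket ξ ^ (m - l) := by
  induction l with
  | zero =>
    intro m a ha
    obtain ⟨c, h0, hc⟩ := ha.bound
    exact ⟨c, h0, fun ζ x ξ => by simpa [covDeriv] using hc x ξ⟩
  | succ l ih =>
    intro m a ha
    choose c h0 hc using fun i => ih (ha.dxi i)
    refine ⟨∑ i, c i, Finset.sum_nonneg fun i _ => h0 i, fun ζ x ξ => ?_⟩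
    rw [covDeriv, Finset.sum_mul, Finset.sum_mul]
    refine (norm_sum_le _ _).trans (Finset.sum_le_sum fun i _ => ?_)
    rw [norm_mul, Complex.norm_real]
    have h1 : ‖ζ i‖ ≤ bracket ζ := (PiLp.norm_apply_le ζ i).trans (norm_le_bracket ζ)
    have e : m - 1 - (l : ℝ) = m - ((l + 1 : ℕ) : ℝ) := by push_cast; ring
    have h2 := hc i ζ x ξ
    rw [e] at h2
    have := bracket_rpow_pos ξ (m - ((l + 1 : ℕ) : ℝ))
    have := h0 i
    have := bracket_pos ζ
    calc _ ≤ bracket ζ * (c i * bracket ζ ^ l * bracket ξ ^ (m - ((l + 1 : ℕ) : ℝ))) :=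
          mul_le_mul h1 h2 (norm_nonneg _) (bracket_pos ζ).le
      _ = _ := by rw [pow_succ]; ring

theorem continuous_covDeriv (l : ℕ) : ∀ {m : ℝ} {a : Fn ι}, IsGlobal m a → ∀ x ξ,
    Continuous fun ζ => covDeriv l a ζ x ξ := by
  induction l with
  | zero => intro m a ha x ξ; exact continuous_const
  | succ l ih =>
    intro m a ha x ξ
    refine continuous_finsetSum _ fun i _ => Continuous.mul ?_ (ih (ha.dxi i) x ξ)
    exact Complex.continuous_ofReal.comp (by fun_prop)

theorem hasDerivAt_covDeriv (l : ℕ) : ∀ {m : ℝ} {a : Fn ι}, IsGlobal m a → ∀ (ζ x ξ : Sp ι) (t : ℝ),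
    HasDerivAt (fun t : ℝ => covDeriv l a ζ x (ξ + t • ζ)) (covDeriv (l + 1) a ζ x (ξ + t • ζ)) t := by
  induction l with
  | zero =>
    intro m a ha ζ x ξ t
    have h1 : HasDerivAt (fun t : ℝ => (x, ξ + t • ζ)) ((0 : Sp ι), ζ) t := by
      refine (hasDerivAt_const t x).prodMk ?_
      simpa using ((hasDerivAt_id t).smul_const ζ).const_add ξ
    have hd := ha.contDiff.differentiable (by simp) (x, ξ + t • ζ)
    have h2 := hd.hasFDerivAt.comp_hasDerivAt t h1
    rw [fderiv_unc_apply hd] at h2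
    simpa [covDeriv, unc, Function.comp_def] using h2
  | succ l ih =>
    intro m a ha ζ x ξ t
    have h := HasDerivAt.fun_sum (u := Finset.univ) fun i _ =>
      (ih (ha.dxi i) ζ x ξ t).const_mul (ζ i : ℂ)
    exact h

/-- Taylor's formula with a bound of the remainder. -/
theorem taylor_bound (M : ℕ) : ∀ {f : ℕ → ℝ → ℂ} {C : ℝ}, (∀ l t, HasDerivAt (f l) (f (l + 1) t) t) →
    (∀ t ∈ Set.Icc (0 : ℝ) 1, ‖f M t‖ ≤ C) → ∀ t ∈ Set.Icc (0 : ℝ) 1,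
    ‖f 0 t - ∑ l ∈ Finset.range M, ((l.factorial : ℂ))⁻¹ * (t : ℂ) ^ l * f l 0‖ ≤ C := by
  induction M with
  | zero => intro f C _ hC t ht; simpa using hC t ht
  | succ M ih =>
    intro f C hf hC t ht
    set g : ℝ → ℂ := fun t => f 0 t - ∑ l ∈ Finset.range (M + 1),
      ((l.factorial : ℂ))⁻¹ * (t : ℂ) ^ l * f l 0 with hg
    -- The derivative of the Taylor remainder is the remainder of the shifted sequence with one term
    -- less. As g vanishes at 0 and t ≤ 1, the bound C passes from g' to g.
    set g' : ℝ → ℂ := fun t => f 1 t - ∑ l ∈ Finset.range M,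
      ((l.factorial : ℂ))⁻¹ * (t : ℂ) ^ l * f (l + 1) 0 with hg'
    have hC0 : 0 ≤ C := (norm_nonneg _).trans (hC 0 (by simp))
    have hder : ∀ t, HasDerivAt g (g' t) t := by
      intro t
      refine (hf 0 t).sub ?_
      have h1 : ∀ l : ℕ, HasDerivAt (fun t : ℝ => ((l.factorial : ℂ))⁻¹ * (t : ℂ) ^ l * f l 0)
          (((l.factorial : ℂ))⁻¹ * (l * (t : ℂ) ^ (l - 1)) * f l 0) t := by
        intro l
        have h2 : HasDerivAt (fun t : ℝ => (t : ℂ) ^ l) (l * (t : ℂ) ^ (l - 1)) t := by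
          have h := (Complex.ofRealCLM.hasDerivAt (x := t)).fun_pow l
          simpa using h
        exact (h2.const_mul _).mul_const _
      have h3 := HasDerivAt.fun_sum (u := Finset.range (M + 1)) fun l _ => h1 l
      refine h3.congr_deriv ?_
      rw [Finset.sum_range_succ']
      simp only [Nat.cast_zero, zero_mul, mul_zero, add_zero]
      refine Finset.sum_congr rfl fun l _ => ?_
      rw [Nat.factorial_succ]
      have : ((l : ℂ) + 1) ≠ 0 := by exact_mod_cast Nat.succ_ne_zero l
      have : (l.factorial : ℂ) ≠ 0 := by exact_mod_cast Nat.factorial_ne_zero l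
      push_cast
      field_simp
    have hb : ∀ t ∈ Set.Icc (0 : ℝ) 1, ‖g' t‖ ≤ C := by
      have := ih (f := fun l => f (l + 1)) (C := C) (fun l t => hf (l + 1) t) hC
      simpa [hg'] using this
    have h0 : g 0 = 0 := by
      simp only [hg]
      rw [Finset.sum_range_succ']
      simp
    have h4 := norm_image_sub_le_of_norm_deriv_le_segment' (f := g) (f' := g') (C := C) (a := 0)
      (b := 1) (fun t _ => (hder t).hasDerivWithinAt) (fun t ht => hb t ⟨ht.1, ht.2.le⟩) t ht
    rw [h0, sub_zero, sub_zero] at h4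
    exact h4.trans (mul_le_of_le_one_right hC0 ht.2)

theorem integrable_osc_mul_hat {m : ℝ} {b : Fn ι} (hb : IsGlobal m b) (x η : Sp ι)
    {f : Sp ι → ℂ} (hf : Continuous f) {c k : ℝ} (hc : ∀ ζ, ‖f ζ‖ ≤ c * bracket ζ ^ k) :
    Integrable fun ζ => osc x ζ * (f ζ * hat b ζ η) := by
  obtain ⟨c', h0, hc'⟩ := hb.hat_bound (-k - (Fintype.card ι : ℝ) - 1)
  have hcont : Continuous fun ζ => osc x ζ * (f ζ * hat b ζ η) := by
    have h1 : Continuous fun ζ => osc x ζ :=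
      continuous_osc.comp (by fun_prop : Continuous fun ζ : Sp ι => (x, ζ))
    have h2 : Continuous fun ζ => hat b ζ η :=
      hb.smooth_hat.continuous.comp (by fun_prop : Continuous fun ζ : Sp ι => (ζ, η))
    exact h1.mul (hf.mul h2)
  refine (((integrable_bracket_rpow (ι := ι) (s := -(Fintype.card ι : ℝ) - 1)
    (by linarith)).const_mul (c * (c' * bracket η ^ m)))).mono' hcont.aestronglyMeasurable
    (Filter.Eventually.of_forall fun ζ => ?_)
  rw [norm_mul, norm_osc, one_mul, norm_mul]
  have e : bracket ζ ^ (-(Fintype.card ι : ℝ) - 1) =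
      bracket ζ ^ k * bracket ζ ^ (-k - (Fintype.card ι : ℝ) - 1) := by
    rw [← Real.rpow_add (bracket_pos ζ)]; congr 1; ring
  rw [e]
  calc _ ≤ (c * bracket ζ ^ k) * (c' * bracket ζ ^ (-k - (Fintype.card ι : ℝ) - 1) *
        bracket η ^ m) := mul_le_mul (hc ζ) (hc' ζ η) (norm_nonneg _) ((norm_nonneg _).trans (hc ζ))
    _ = _ := by ring

theorem integrable_covDeriv {m m' : ℝ} {a b : Fn ι} (ha : IsGlobal m a) (hb : IsGlobal m' b)
    (l : ℕ) (x η : Sp ι) : Integrable fun ζ => osc x ζ * (covDeriv l a ζ x η * hat b ζ η) := by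
  obtain ⟨c, h0, hc⟩ := covDeriv_bound l ha
  refine integrable_osc_mul_hat hb x η (continuous_covDeriv l ha x η)
    (c := c * bracket η ^ (m - l)) (k := l) fun ζ => (hc ζ x η).trans_eq ?_
  rw [Real.rpow_natCast]; ring

/-- Each factor ζ_i is absorbed into b̂ as -i ∂/∂x_i of b; when none is left, Fourier inversion
recovers b(x, η). -/
theorem integral_covDeriv (l : ℕ) : ∀ {m m' : ℝ} {a b : Fn ι}, IsGlobal m a → IsGlobal m' b →
    ∀ x η, cN ι * ∫ ζ, osc x ζ * (covDeriv l a ζ x η * hat b ζ η) = leibTerm l a b x η := by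
  induction l with
  | zero =>
    intro m m' a b ha hb x η
    have hs : ContDiff ℝ ∞ fun x => b x η :=
      hb.contDiff.comp (by fun_prop : ContDiff ℝ ∞ fun x : Sp ι => (x, η))
    have h := fourierHat_inversion hs (hb.hasCompactSupport η) x
    simp only [covDeriv, leibTerm]
    rw [← h]
    have e : ∀ ζ, osc x ζ * (a x η * hat b ζ η) =
        a x η * (osc x ζ * fourierHat (fun x => b x η) ζ) := fun ζ => by
      rw [hat_apply]; ring
    simp_rw [e]
    rw [integral_const_mul]
    ring
  | succ l ih =>
    intro m m' a b ha hb x η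
    simp only [leibTerm]
    have hb' : ∀ i, IsGlobal m' fun x ξ => -Complex.I * dx i b x ξ := fun i => (hb.dx i).const_mul _
    have e : ∀ ζ, osc x ζ * (covDeriv (l + 1) a ζ x η * hat b ζ η) =
        ∑ i, osc x ζ * (covDeriv l (dxi i a) ζ x η *
          hat (fun x ξ => -Complex.I * dx i b x ξ) ζ η) := by
      intro ζ
      rw [covDeriv, Finset.sum_mul, Finset.mul_sum]
      refine Finset.sum_congr rfl fun i _ => ?_
      rw [hat_const_mul, hat_dx hb]
      linear_combination ((osc x ζ * (ζ i : ℂ) * covDeriv l (dxi i a) ζ x η * hat b ζ η)) *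
        Complex.I_mul_I
    simp_rw [e]
    rw [integral_finsetSum _ fun i _ => integrable_covDeriv (ha.dxi i) (hb' i) l x η,
      Finset.mul_sum]
    exact Finset.sum_congr rfl fun i _ => ih (ha.dxi i) (hb' i) x η

theorem sharpRem_eq {m m' : ℝ} {a b : Fn ι} (ha : IsGlobal m a) (hb : IsGlobal m' b) (M : ℕ)
    (x η : Sp ι) : sharpRem M a b x η = cN ι * ∫ ζ, osc x ζ * ((a x (η + ζ) -
      ∑ l ∈ Finset.range M, ((l.factorial : ℂ))⁻¹ * covDeriv l a ζ x η) * hat b ζ η) := by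
  rw [sharpRem, sharp]
  simp_rw [← integral_covDeriv _ ha hb]
  have e : ∀ ζ, osc x ζ * ((a x (η + ζ) -
      ∑ l ∈ Finset.range M, ((l.factorial : ℂ))⁻¹ * covDeriv l a ζ x η) * hat b ζ η) =
      osc x ζ * (a x (η + ζ) * hat b ζ η) - ∑ l ∈ Finset.range M, ((l.factorial : ℂ))⁻¹ *
        (osc x ζ * (covDeriv l a ζ x η * hat b ζ η)) := by
    intro ζ
    rw [sub_mul, mul_sub, Finset.sum_mul, Finset.mul_sum]
    congr 1
    exact Finset.sum_congr rfl fun l _ => by ring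
  simp_rw [e]
  rw [integral_sub (integrable_sharp_integrand ha hb x η)
    (integrable_finsetSum _ fun l _ => (integrable_covDeriv ha hb l x η).const_mul _),
    integral_finsetSum _ fun l _ => (integrable_covDeriv ha hb l x η).const_mul _, mul_sub,
    Finset.mul_sum]
  congr 1
  refine Finset.sum_congr rfl fun l _ => ?_
  rw [integral_const_mul]
  ring

/-- By Taylor's formula the integrand contains the M-th derivative of a at η + tζ, of size ⟨ζ⟩^M ⟨η
+ tζ⟩^{m - M}. Peetre's inequality trades the shift for powers of ⟨ζ⟩, and these are paid by the
decay of b̂. -/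
theorem sharpRem_bound {m m' : ℝ} {a b : Fn ι} (ha : IsGlobal m a) (hb : IsGlobal m' b) (M : ℕ) :
    ∃ c : ℝ, ∀ x η, ‖sharpRem M a b x η‖ ≤ c * bracket η ^ (m + m' - M) := by
  obtain ⟨c, h0, hc⟩ := covDeriv_bound M ha
  set s : ℝ := m - M with hs
  -- The decay of b̂ cancels ⟨ζ⟩^{M + |s|} and leaves ⟨ζ⟩^{-N - 1}, which is integrable over ℝ^N.
  obtain ⟨c', h0', hc'⟩ := hb.hat_bound (-(M + |s|) - (Fintype.card ι : ℝ) - 1)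
  set J : ℝ := ∫ ζ : Sp ι, bracket ζ ^ (-(Fintype.card ι : ℝ) - 1)
  refine ⟨‖cN ι‖ * (c * 2 ^ |s| * c' * J), fun x η => ?_⟩
  have hT : ∀ ζ, ‖a x (η + ζ) - ∑ l ∈ Finset.range M, ((l.factorial : ℂ))⁻¹ *
      covDeriv l a ζ x η‖ ≤ c * 2 ^ |s| * bracket ζ ^ (M + |s|) * bracket η ^ s := by
    intro ζ
    have h := taylor_bound M (f := fun l t => covDeriv l a ζ x (η + t • ζ))
      (C := c * 2 ^ |s| * bracket ζ ^ (M + |s|) * bracket η ^ s)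
      (fun l t => hasDerivAt_covDeriv l ha ζ x η t) ?_ 1 (by simp)
    · simpa [covDeriv] using h
    · intro t ht
      refine (hc ζ x _).trans ?_
      have h1 := bracket_add_rpow_le η (t • ζ) s
      have h2 : bracket (t • ζ) ≤ bracket ζ := by
        refine bracket_mono ?_
        rw [norm_smul, Real.norm_of_nonneg ht.1]
        exact mul_le_of_le_one_left (norm_nonneg _) ht.2
      have h3 : bracket (t • ζ) ^ |s| ≤ bracket ζ ^ |s| :=
        Real.rpow_le_rpow (bracket_pos _).le h2 (abs_nonneg _)
      have p1 := bracket_pos ζ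
      have p2 := bracket_rpow_pos η s
      calc c * bracket ζ ^ M * bracket (η + t • ζ) ^ (m - M)
          ≤ c * bracket ζ ^ M * (2 ^ |s| * bracket η ^ s * bracket ζ ^ |s|) := by
            refine mul_le_mul_of_nonneg_left (h1.trans ?_) (by positivity)
            exact mul_le_mul_of_nonneg_left h3 (by positivity)
        _ = _ := by rw [Real.rpow_add p1, Real.rpow_natCast]; ring
  rw [sharpRem_eq ha hb, norm_mul, mul_assoc]
  refine mul_le_mul_of_nonneg_left ?_ (norm_nonneg _)
  have hint : Integrable fun ζ : Sp ι => (c * 2 ^ |s| * c' * bracket η ^ (m + m' - M)) *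
      bracket ζ ^ (-(Fintype.card ι : ℝ) - 1) :=
    (integrable_bracket_rpow (by linarith)).const_mul _
  refine (norm_integral_le_integral_norm _).trans ((integral_mono_of_nonneg
    (Filter.Eventually.of_forall fun _ => norm_nonneg _) hint
    (Filter.Eventually.of_forall fun ζ => ?_)).trans_eq ?_)
  · simp only
    rw [norm_mul, norm_osc, one_mul, norm_mul]
    have p1 := bracket_pos ζ
    refine (mul_le_mul (hT ζ) (hc' ζ η) (norm_nonneg _) ((norm_nonneg _).trans (hT ζ))).trans_eq ?_
    have e1 : bracket η ^ (m + m' - M) = bracket η ^ s * bracket η ^ m' := by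
      rw [← Real.rpow_add (bracket_pos η)]; congr 1; rw [hs]; ring
    have e2 : bracket ζ ^ (-(Fintype.card ι : ℝ) - 1) = bracket ζ ^ (M + |s|) *
        bracket ζ ^ (-(M + |s|) - (Fintype.card ι : ℝ) - 1) := by
      rw [← Real.rpow_add p1]; congr 1; ring
    rw [e1, e2]; ring
  · rw [integral_const_mul]; ring

/-- Finite sums of remainders. -/
inductive RemAlg (M : ℕ) : ℝ → Fn ι → Prop
  | rem {m m' : ℝ} {a b : Fn ι} (ha : IsGlobal m a) (hb : IsGlobal m' b) :
      RemAlg M (m + m' - M) (sharpRem M a b)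
  | add {m : ℝ} {a b : Fn ι} (ha : RemAlg M m a) (hb : RemAlg M m b) :
      RemAlg M m fun x ξ => a x ξ + b x ξ

theorem RemAlg.smooth {M : ℕ} {m : ℝ} {a : Fn ι} (h : RemAlg M m a) : Smooth Set.univ a := by
  induction h with
  | rem ha hb => exact smooth_sharpRem ha hb M
  | add _ _ iha ihb => exact iha.add ihb

/-- By `pd_sharpRem` the derivative of a remainder is a sum of two remainders of the order lowered
by `gain`, so sums of remainders form a class closed under differentiation. -/
theorem sharpRem_isSymbol {m m' : ℝ} {a b : Fn ι} (ha : IsGlobal m a) (hb : IsGlobal m' b) (M : ℕ) :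
    IsSymbol ⊤ (m + m' - M) (sharpRem M a b) := by
  refine isSymbol_of_closed (RemAlg M) (fun m a h => ContDiffOn.mono h.smooth (Set.subset_univ _))
    ?_ ?_ (RemAlg.rem ha hb)
  · intro m a h L _ _
    induction h with
    | rem ha hb =>
      obtain ⟨c, hc⟩ := sharpRem_bound ha hb M
      exact ⟨c, fun x _ ξ => hc x ξ⟩
    | add _ _ iha ihb =>
      obtain ⟨c, hc⟩ := iha
      obtain ⟨c', hc'⟩ := ihb
      refine ⟨c + c', fun x hx ξ => (norm_add_le _ _).trans ?_⟩
      rw [add_mul]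
      exact add_le_add (hc x hx ξ) (hc' x hx ξ)
  · intro m a h d
    induction h with
    | @rem m m' a b ha hb =>
      rw [pd_sharpRem ha hb]
      have h1 := RemAlg.rem (M := M) (ha.pd d) hb
      have h2 := RemAlg.rem (M := M) ha (hb.pd d)
      rw [show m - gain d + m' - M = m + m' - M - gain d by ring] at h1
      rw [show m + (m' - gain d) - M = m + m' - M - gain d by ring] at h2
      exact h1.add h2
    | @add m a b ha hb iha ihb =>
      have : pd d (fun x ξ => a x ξ + b x ξ) = fun x ξ => pd d a x ξ + pd d b x ξ := by
        funext x ξ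
        exact pd_add isOpen_univ ha.smooth hb.smooth d (x, ξ) trivial
      rw [this]
      exact iha.add ihb

theorem IsGlobal.sharp {m m' : ℝ} {a b : Fn ι} (ha : IsGlobal m a) (hb : IsGlobal m' b) :
    IsGlobal (m + m') (sharp a b) where
  symbol := by
    -- For M = 0 the remainder is a # b itself.
    have h := sharpRem_isSymbol ha hb 0
    rw [Nat.cast_zero, sub_zero] at h
    exact h.congr fun x _ ξ => by simp [sharpRem]
  supp := by
    obtain ⟨K, hK, h⟩ := ha.supp
    refine ⟨K, hK, fun x hx ξ => ?_⟩
    simp [CornerPsiDO.sharp, h x hx]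

/-! ### Composition of operators with global symbols -/

theorem integrable_opLeft {m : ℝ} {a : Fn ι} (ha : IsGlobal m a) {u : Sp ι → ℂ}
    (hu : ContDiff ℝ ∞ u) (hc : HasCompactSupport u) (x : Sp ι) :
    Integrable fun ξ => osc x ξ * a x ξ * fourierHat u ξ := by
  have hR : Rapid fun (x : Sp ι) ξ => osc x ξ * (a x ((0 : Sp ι →L[ℝ] Sp ι) x + ξ) * fourierHat u ξ) :=
    (moderate_osc (ContinuousLinearMap.id ℝ (Sp ι))).mul_rapid
      ((moderate_symbol ha.symbol (ContinuousLinearMap.id ℝ (Sp ι)) 0).mul_rapid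
        (rapid_of_snd (contDiff_fourierHat hu hc) fun k =>
          let ⟨c, _, h⟩ := fourierHat_bound hu hc k; ⟨c, h⟩))
  have h := hR.domInt.integrable x
  simpa [mul_assoc] using h

theorem smooth_opLeft {m : ℝ} {a : Fn ι} (ha : IsGlobal m a) {u : Sp ι → ℂ}
    (hu : ContDiff ℝ ∞ u) (hc : HasCompactSupport u) : ContDiff ℝ ∞ (opLeft a u) := by
  have hR : Rapid fun (x : Sp ι) ξ => osc x ξ * (a x ((0 : Sp ι →L[ℝ] Sp ι) x + ξ) * fourierHat u ξ) :=
    (moderate_osc (ContinuousLinearMap.id ℝ (Sp ι))).mul_rapid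
      ((moderate_symbol ha.symbol (ContinuousLinearMap.id ℝ (Sp ι)) 0).mul_rapid
        (rapid_of_snd (contDiff_fourierHat hu hc) fun k =>
          let ⟨c, _, h⟩ := fourierHat_bound hu hc k; ⟨c, h⟩))
  have h := contDiff_const (c := cN ι).mul hR.domInt.contDiff_integral
  have e : opLeft a u = fun x => cN ι * ∫ ξ, osc x ξ *
      (a x ((0 : Sp ι →L[ℝ] Sp ι) x + ξ) * fourierHat u ξ) := by
    funext x
    simp [mul_assoc, opLeft_eq]
  rw [e]
  exact h

theorem fourierHat_opLeft {m : ℝ} {b : Fn ι} (hb : IsGlobal m b) {u : Sp ι → ℂ}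
    (hu : ContDiff ℝ ∞ u) (hc : HasCompactSupport u) (ξ : Sp ι) :
    fourierHat (opLeft b u) ξ = cN ι * ∫ η, hat b (ξ - η) η * fourierHat u η := by
  rw [fourierHat_eq]
  simp_rw [opLeft_eq]
  have e : ∀ y : Sp ι, osc (-ξ) y * (cN ι * ∫ η, osc y η * b y η * fourierHat u η) =
      cN ι * ∫ η, osc (-ξ) y * (osc y η * b y η * fourierHat u η) := fun y => by
    rw [integral_const_mul]; ring
  simp_rw [e]
  rw [integral_const_mul, integral_integral_swap]
  · congr 1
    refine integral_congr_ae (Filter.Eventually.of_forall fun η => ?_)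
    simp only
    rw [hat_eq, ← integral_mul_const]
    refine integral_congr_ae (Filter.Eventually.of_forall fun y => ?_)
    simp only
    rw [neg_sub, sub_eq_neg_add, osc_add, osc_comm η y]
    ring
  · obtain ⟨K, hK, hsupp⟩ := hb.supp
    obtain ⟨c, h0, hcb⟩ := hb.bound
    obtain ⟨c', h0', hcu⟩ := fourierHat_bound hu hc (-m - (Fintype.card ι : ℝ) - 1)
    have h1 : Integrable (K.indicator fun _ : Sp ι => c) :=
      (integrable_indicator_iff hK.measurableSet).2 (integrableOn_const hK.measure_lt_top.ne)
    have h2 : Integrable fun η : Sp ι => c' * bracket η ^ (-(Fintype.card ι : ℝ) - 1) :=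
      (integrable_bracket_rpow (by linarith)).const_mul c'
    have hcont : Continuous fun p : Sp ι × Sp ι =>
        osc (-ξ) p.1 * (osc p.1 p.2 * b p.1 p.2 * fourierHat u p.2) := by
      have c1 : Continuous fun p : Sp ι × Sp ι => osc (-ξ) p.1 :=
        continuous_osc.comp (by fun_prop : Continuous fun p : Sp ι × Sp ι => (-ξ, p.1))
      exact c1.mul ((continuous_osc.mul hb.contDiff.continuous).mul
        ((contDiff_fourierHat hu hc).continuous.comp continuous_snd))
    refine (h1.mul_prod h2).mono' hcont.aestronglyMeasurable
      (Filter.Eventually.of_forall fun p => ?_)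
    rw [Function.uncurry, norm_mul, norm_osc, one_mul, norm_mul, norm_mul, norm_osc, one_mul]
    by_cases hp : p.1 ∈ K
    · rw [Set.indicator_of_mem hp]
      have e : bracket p.2 ^ (-(Fintype.card ι : ℝ) - 1) =
          bracket p.2 ^ m * bracket p.2 ^ (-m - (Fintype.card ι : ℝ) - 1) := by
        rw [← Real.rpow_add (bracket_pos _)]; congr 1; ring
      rw [e]
      calc _ ≤ (c * bracket p.2 ^ m) * (c' * bracket p.2 ^ (-m - (Fintype.card ι : ℝ) - 1)) :=
            mul_le_mul (hcb _ _) (hcu _) (norm_nonneg _) ((norm_nonneg _).trans (hcb p.1 p.2))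
        _ = _ := by ring
    · rw [Set.indicator_of_notMem hp, hsupp _ hp]
      simp

theorem opLeft_opLeft {m m' : ℝ} {a b : Fn ι} (ha : IsGlobal m a) (hb : IsGlobal m' b)
    {u : Sp ι → ℂ} (hu : ContDiff ℝ ∞ u) (hc : HasCompactSupport u) (x : Sp ι) :
    opLeft a (opLeft b u) x = opLeft (sharp a b) u x := by
  rw [opLeft_eq, opLeft_eq]
  congr 1
  simp_rw [fourierHat_opLeft hb hu hc]
  have e1 : ∀ ξ : Sp ι, osc x ξ * a x ξ * (cN ι * ∫ η, hat b (ξ - η) η * fourierHat u η) =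
      cN ι * ∫ η, osc x ξ * a x ξ * (hat b (ξ - η) η * fourierHat u η) := fun ξ => by
    rw [integral_const_mul]; ring
  simp_rw [e1]
  rw [integral_const_mul, integral_integral_swap]
  · rw [← integral_const_mul]
    refine integral_congr_ae (Filter.Eventually.of_forall fun η => ?_)
    simp only [sharp]
    -- The substitution ξ = ζ + η brings out the integral that defines a # b.
    rw [← integral_add_right_eq_self _ η]
    have e2 : ∀ ζ : Sp ι, osc x (ζ + η) * a x (ζ + η) *
        (hat b (ζ + η - η) η * fourierHat u η) =
        osc x η * fourierHat u η * (osc x ζ * (a x (η + ζ) * hat b ζ η)) := fun ζ => by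
      rw [add_sub_cancel_right, osc_add_right, add_comm ζ η]; ring
    simp_rw [e2]
    rw [integral_const_mul]
    ring
  · obtain ⟨c, h0, hca⟩ := ha.bound
    obtain ⟨c₁, h1, hcb⟩ := hb.hat_bound (-|m| - (Fintype.card ι : ℝ) - 1)
    obtain ⟨c₂, h2, hcu⟩ := fourierHat_bound hu hc (-m - m' - (Fintype.card ι : ℝ) - 1)
    have hg : Integrable fun η : Sp ι => bracket η ^ (-(Fintype.card ι : ℝ) - 1) :=
      integrable_bracket_rpow (by linarith)
    -- Peetre's inequality splits ⟨ξ⟩^m into powers of ⟨η⟩ and ⟨ξ - η⟩; this gives a majorant of the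
    -- form g(η) g(ξ - η), integrable as for convolutions.
    have hconv := (hg.convolution_integrand (ContinuousLinearMap.mul ℝ ℝ) hg).const_mul
      (c * 2 ^ |m| * c₁ * c₂)
    have hcont : Continuous fun p : Sp ι × Sp ι =>
        osc x p.1 * a x p.1 * (hat b (p.1 - p.2) p.2 * fourierHat u p.2) := by
      have k1 : Continuous fun p : Sp ι × Sp ι => osc x p.1 :=
        continuous_osc.comp (by fun_prop : Continuous fun p : Sp ι × Sp ι => (x, p.1))
      have k2 : Continuous fun p : Sp ι × Sp ι => a x p.1 :=
        ha.contDiff.continuous.comp (by fun_prop : Continuous fun p : Sp ι × Sp ι => (x, p.1))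
      have k3 : Continuous fun p : Sp ι × Sp ι => hat b (p.1 - p.2) p.2 :=
        hb.smooth_hat.continuous.comp
          (by fun_prop : Continuous fun p : Sp ι × Sp ι => (p.1 - p.2, p.2))
      exact (k1.mul k2).mul (k3.mul ((contDiff_fourierHat hu hc).continuous.comp continuous_snd))
    refine hconv.mono' hcont.aestronglyMeasurable (Filter.Eventually.of_forall fun p => ?_)
    obtain ⟨ξ, η⟩ := p
    rw [Function.uncurry, norm_mul, norm_mul, norm_osc, one_mul, norm_mul]
    simp only [ContinuousLinearMap.mul_apply']
    have h3 : ‖a x ξ‖ ≤ c * (2 ^ |m| * bracket η ^ m * bracket (ξ - η) ^ |m|) := by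
      refine (hca x ξ).trans (mul_le_mul_of_nonneg_left ?_ h0)
      simpa using bracket_add_rpow_le η (ξ - η) m
    have p1 := bracket_rpow_pos η m
    have p2 := bracket_rpow_pos (ξ - η) |m|
    have h4 := mul_le_mul h3 (mul_le_mul (hcb (ξ - η) η) (hcu η) (norm_nonneg _)
      ((norm_nonneg _).trans (hcb (ξ - η) η))) (by positivity) (by positivity)
    refine h4.trans_eq ?_
    have e3 : bracket (ξ - η) ^ (-(Fintype.card ι : ℝ) - 1) = bracket (ξ - η) ^ |m| *
        bracket (ξ - η) ^ (-|m| - (Fintype.card ι : ℝ) - 1) := by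
      rw [← Real.rpow_add (bracket_pos _)]; congr 1; ring
    have e4 : bracket η ^ (-(Fintype.card ι : ℝ) - 1) = bracket η ^ m * bracket η ^ m' *
        bracket η ^ (-m - m' - (Fintype.card ι : ℝ) - 1) := by
      rw [← Real.rpow_add (bracket_pos _), ← Real.rpow_add (bracket_pos _)]; congr 1; ring
    rw [e3, e4]
    ring

end Sharp

/-! ### Smoothing operators and symbols of order `-∞` -/

section Kernels

variable {ι : Type} [Fintype ι] [DecidableEq ι]

/-- The kernel of the operator with a symbol of order `-∞`. -/
noncomputable def kernelOf (σ : Fn ι) : Fn ι := fun x y => cN ι * ∫ ξ, osc (x - y) ξ * σ x ξ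

theorem smooth_kernelOf {σ : Fn ι} (hσ : ∀ m, IsGlobal m σ) : ContDiff ℝ ∞ (unc (kernelOf σ)) := by
  have hR : Rapid fun (p : Sp ι × Sp ι) ξ =>
      osc ((ContinuousLinearMap.fst ℝ (Sp ι) (Sp ι) - ContinuousLinearMap.snd ℝ (Sp ι) (Sp ι)) p) ξ *
      σ (ContinuousLinearMap.fst ℝ (Sp ι) (Sp ι) p) ((0 : Sp ι × Sp ι →L[ℝ] Sp ι) p + ξ) :=
    (moderate_osc _).mul_rapid (rapid_symbol (fun m => (hσ m).symbol) _ _)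
  have h := contDiff_const (c := cN ι).mul hR.domInt.contDiff_integral
  have e : unc (kernelOf σ) = fun p => cN ι * ∫ ξ,
      osc ((ContinuousLinearMap.fst ℝ (Sp ι) (Sp ι) - ContinuousLinearMap.snd ℝ (Sp ι) (Sp ι)) p) ξ *
      σ (ContinuousLinearMap.fst ℝ (Sp ι) (Sp ι) p) ((0 : Sp ι × Sp ι →L[ℝ] Sp ι) p + ξ) := by
    funext p
    simp [unc, kernelOf]
  rw [e]
  exact h

theorem opLeft_eq_kernelOf {σ : Fn ι} (hσ : ∀ m, IsGlobal m σ) {u : Sp ι → ℂ}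
    (hu : Continuous u) (hc : HasCompactSupport u) (x : Sp ι) :
    opLeft σ u x = ∫ y, kernelOf σ x y * u y := by
  have hui := hu.integrable_of_hasCompactSupport (μ := volume) hc
  rw [opLeft_eq]
  simp_rw [fourierHat_eq]
  have e1 : ∀ ξ : Sp ι, osc x ξ * σ x ξ * ∫ y, osc (-ξ) y * u y =
      ∫ y, osc x ξ * σ x ξ * (osc (-ξ) y * u y) := fun ξ => by rw [integral_const_mul]
  simp_rw [e1]
  rw [integral_integral_swap, ← integral_const_mul]
  · refine integral_congr_ae (Filter.Eventually.of_forall fun y => ?_)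
    simp only [kernelOf]
    rw [mul_assoc, ← integral_mul_const]
    congr 1
    refine integral_congr_ae (Filter.Eventually.of_forall fun ξ => ?_)
    simp only
    have h1 : osc (-y) ξ = osc (-ξ) y := by simp [osc, inner_neg_left, real_inner_comm]
    rw [sub_eq_add_neg, osc_add, h1]
    ring
  · obtain ⟨c, h0, hcb⟩ := (hσ (-(Fintype.card ι : ℝ) - 1)).bound
    have h2 : Integrable fun ξ : Sp ι => c * bracket ξ ^ (-(Fintype.card ι : ℝ) - 1) :=
      (integrable_bracket_rpow (by linarith)).const_mul c
    have hcont : Continuous fun p : Sp ι × Sp ι =>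
        osc x p.1 * σ x p.1 * (osc (-p.1) p.2 * u p.2) := by
      have k1 : Continuous fun p : Sp ι × Sp ι => osc x p.1 :=
        continuous_osc.comp (by fun_prop : Continuous fun p : Sp ι × Sp ι => (x, p.1))
      have k2 : Continuous fun p : Sp ι × Sp ι => σ x p.1 :=
        (hσ 0).contDiff.continuous.comp (by fun_prop : Continuous fun p : Sp ι × Sp ι => (x, p.1))
      have k3 : Continuous fun p : Sp ι × Sp ι => osc (-p.1) p.2 :=
        continuous_osc.comp (by fun_prop : Continuous fun p : Sp ι × Sp ι => (-p.1, p.2))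
      exact (k1.mul k2).mul (k3.mul (hu.comp continuous_snd))
    refine (h2.mul_prod hui.norm).mono' hcont.aestronglyMeasurable
      (Filter.Eventually.of_forall fun p => ?_)
    rw [Function.uncurry, norm_mul, norm_mul, norm_osc, one_mul, norm_mul, norm_osc, one_mul]
    exact mul_le_mul_of_nonneg_right (hcb _ _) (norm_nonneg _)

/-- The symbol of the operator with the kernel `k` of compact support. -/
noncomputable def symbolOf (k : Fn ι) : Fn ι := fun x ξ => hat (fun w x => k x (x + w)) (-ξ) x

/-- With the two variables exchanged, the rapid decay of the Fourier transform becomes decay in the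
covariable. A derivative in ξ multiplies b by a coordinate, one in x differentiates the second
argument; both preserve the hypothesis on b. -/
theorem isGlobal_swap_hat {b : Fn ι} (hb : ∀ m, IsGlobal m b) (m : ℝ) :
    IsSymbol ⊤ m fun x ξ => hat b (-ξ) x := by
  refine isSymbol_of_closed (P := fun _ f => ∃ b : Fn ι, (∀ m, IsGlobal m b) ∧
    f = fun x ξ => hat b (-ξ) x) ?_ ?_ ?_ ⟨b, hb, rfl⟩
  · rintro m f ⟨b, hb, rfl⟩
    have h : ContDiff ℝ ∞ fun p : Sp ι × Sp ι => (-p.2, p.1) := contDiff_snd.neg.prodMk contDiff_fst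
    have h2 := (hb 0).smooth_hat.comp h
    exact h2.contDiffOn
  · rintro m f ⟨b, hb, rfl⟩ L - -
    obtain ⟨c, -, hc⟩ := (hb 0).hat_bound m
    exact ⟨c, fun x _ ξ => by simpa [bracket_neg] using hc (-ξ) x⟩
  · rintro m f ⟨b, hb, rfl⟩ d
    cases d with
    | inl i =>
      refine ⟨dxi i b, fun m => by simpa using (hb (m + 1)).dxi i, ?_⟩
      rw [← dxi_hat (hb 0)]
      rfl
    | inr i =>
      refine ⟨fun x ξ => Complex.I * ((x i : ℂ) * b x ξ),
        fun m => ((hb m).coord_mul i).const_mul _, ?_⟩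
      funext x ξ
      have h1 := congrFun (congrFun (dx_hat (hb 0) i) (-ξ)) x
      rw [hat_const_mul] at h1 ⊢
      simp only [pd, dxi]
      have h2 : HasFDerivAt (fun ξ' => hat b ξ' x) (fderiv ℝ (fun ξ' => hat b ξ' x) (-ξ)) (-ξ) :=
        ((contDiff_left (F := hat b) (hb 0).smooth_hat x).differentiable (by simp) _).hasFDerivAt
      have h3 : HasFDerivAt (fun ξ' : Sp ι => -ξ') (-ContinuousLinearMap.id ℝ (Sp ι)) ξ :=
        (hasFDerivAt_id ξ).neg
      have h4 := (h2.comp ξ h3).fderiv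
      simp only [Function.comp_def] at h4
      rw [h4]
      simp only [ContinuousLinearMap.comp_apply, _root_.neg_apply,
        ContinuousLinearMap.id_apply, map_neg]
      simp only [dx] at h1
      rw [h1]
      ring

theorem isGlobal_symbolOf {k : Fn ι} (hk : ContDiff ℝ ∞ (unc k)) {K₁ K₂ : Set (Sp ι)}
    (h₁ : IsCompact K₁) (h₂ : IsCompact K₂) (hz₁ : ∀ x ∉ K₁, ∀ y, k x y = 0)
    (hz₂ : ∀ x, ∀ y ∉ K₂, k x y = 0) :
    (∀ m, IsGlobal m fun w x => k x (x + w)) ∧ ∀ m, IsGlobal m (symbolOf k) := by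
  have hb : ∀ m, IsGlobal m fun w x => k x (x + w) := by
    intro m
    refine ⟨isSymbol_of_compact ?_ ?_ m, (fun p : Sp ι × Sp ι => p.1 - p.2) '' (K₂ ×ˢ K₁),
      (h₂.prod h₁).image (by fun_prop), fun w hw x => ?_⟩
    · have h : ContDiff ℝ ∞ fun p : Sp ι × Sp ι => (p.2, p.2 + p.1) :=
        contDiff_snd.prodMk (contDiff_snd.add contDiff_fst)
      exact (hk.comp h).contDiffOn
    · intro L _ _
      obtain ⟨R, hR⟩ := h₁.isBounded.exists_norm_le
      refine ⟨R + 1, fun w _ x hx => hz₁ x (fun hxK => ?_) _⟩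
      have := hR x hxK
      linarith
    · by_contra h
      refine hw ⟨(x + w, x), ⟨?_, ?_⟩, by simp⟩
      · by_contra h'; exact h (hz₂ _ _ h')
      · by_contra h'; exact h (hz₁ _ h' _)
  refine ⟨hb, fun m => ⟨isGlobal_swap_hat hb m, K₁, h₁, fun x hx ξ => ?_⟩⟩
  simp [symbolOf, hat_eq, hz₁ x hx]

/-- With w = y - x the symbol is the Fourier integral of k(x, x + w); after Fubini the integral over
ξ is Fourier inversion for v at y. -/
theorem opLeft_symbolOf {k : Fn ι} (hk : ContDiff ℝ ∞ (unc k)) {K₂ : Set (Sp ι)}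
    (h₂ : IsCompact K₂) (hz₂ : ∀ x, ∀ y ∉ K₂, k x y = 0) {v : Sp ι → ℂ} (hv : ContDiff ℝ ∞ v)
    (hc : HasCompactSupport v) (x : Sp ι) : opLeft (symbolOf k) v x = ∫ y, k x y * v y := by
  rw [opLeft_eq]
  have e1 : ∀ ξ, osc x ξ * symbolOf k x ξ * fourierHat v ξ =
      ∫ y, k x y * (osc y ξ * fourierHat v ξ) := by
    intro ξ
    rw [symbolOf, hat_eq, ← integral_sub_right_eq_self _ x, ← integral_const_mul,
      ← integral_mul_const]
    refine integral_congr_ae (Filter.Eventually.of_forall fun y => ?_)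
    simp only [neg_neg, add_sub_cancel]
    rw [osc_comm ξ, sub_eq_add_neg, osc_add]
    have : osc x ξ * osc (-x) ξ = 1 := by rw [← osc_add]; simp [osc]
    linear_combination (osc y ξ * k x y * fourierHat v ξ) * this
  simp_rw [e1]
  have kc : Continuous fun y => k x y :=
    hk.continuous.comp (by fun_prop : Continuous fun y : Sp ι => (x, y))
  have ki : Integrable fun y => k x y :=
    kc.integrable_of_hasCompactSupport (HasCompactSupport.intro h₂ fun y hy => hz₂ x y hy)
  rw [integral_integral_swap, ← integral_const_mul]
  · refine integral_congr_ae (Filter.Eventually.of_forall fun y => ?_)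
    simp only
    rw [integral_const_mul, ← fourierHat_inversion hv hc y]
    ring
  · have hcont : Continuous fun p : Sp ι × Sp ι => k x p.2 * (osc p.2 p.1 * fourierHat v p.1) := by
      have k3 : Continuous fun p : Sp ι × Sp ι => osc p.2 p.1 :=
        continuous_osc.comp (by fun_prop : Continuous fun p : Sp ι × Sp ι => (p.2, p.1))
      exact (kc.comp continuous_snd).mul
        (k3.mul ((contDiff_fourierHat hv hc).continuous.comp continuous_fst))
    refine ((integrable_fourierHat hv hc).norm.mul_prod ki.norm).mono' hcont.aestronglyMeasurable
      (Filter.Eventually.of_forall fun p => ?_)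
    rw [Function.uncurry, norm_mul, norm_mul, norm_osc, one_mul, mul_comm]

theorem opLeft_add {m m' : ℝ} {a b : Fn ι} (ha : IsGlobal m a) (hb : IsGlobal m' b)
    {u : Sp ι → ℂ} (hu : ContDiff ℝ ∞ u) (hc : HasCompactSupport u) (x : Sp ι) :
    opLeft (fun x ξ => a x ξ + b x ξ) u x = opLeft a u x + opLeft b u x := by
  rw [opLeft_eq, opLeft_eq, opLeft_eq, ← mul_add,
    ← integral_add (integrable_opLeft ha hu hc x) (integrable_opLeft hb hu hc x)]
  congr 2
  funext ξ; ring

theorem opLeft_fun_mul (φ : Sp ι → ℂ) (a : Fn ι) (u : Sp ι → ℂ) (x : Sp ι) :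
    opLeft (fun x ξ => φ x * a x ξ) u x = φ x * opLeft a u x := by
  rw [opLeft_eq, opLeft_eq]
  have e : ∀ ξ, osc x ξ * (φ x * a x ξ) * fourierHat u ξ =
      φ x * (osc x ξ * a x ξ * fourierHat u ξ) := fun ξ => by ring
  simp_rw [e]
  rw [integral_const_mul]; ring

theorem opLeft_congr {a b : Fn ι} (u : Sp ι → ℂ) {x : Sp ι} (h : ∀ ξ, a x ξ = b x ξ) :
    opLeft a u x = opLeft b u x := by
  rw [opLeft_eq, opLeft_eq]
  simp_rw [h]

theorem opLeft_fun {φ u : Sp ι → ℂ} (hu : ContDiff ℝ ∞ u)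
    (hc : HasCompactSupport u) (x : Sp ι) : opLeft (fun x _ => φ x) u x = φ x * u x := by
  have h := opLeft_fun_mul φ (fun _ _ => 1) u x
  simp only [mul_one] at h
  rw [h, opLeft_eq]
  simp_rw [mul_one]
  rw [fourierHat_inversion hu hc x]

end Kernels

/-! ### Test functions -/

section Test

variable {ι : Type} [Fintype ι] [DecidableEq ι] {U : Opens (Sp ι)}

theorem exists_cutoff {L V : Set (Sp ι)} (hL : IsCompact L) (hV : IsOpen V) (hLV : L ⊆ V)
    (hVU : V ⊆ U) : ∃ φ : 𝓓(U, ℂ), tsupport φ ⊆ V ∧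
      ∃ W : Set (Sp ι), IsOpen W ∧ L ⊆ W ∧ ∀ y ∈ W, φ y = 1 := by
  obtain ⟨M, hM, hLM, hMV⟩ := exists_compact_between hL hV hLV
  obtain ⟨f, hf1, hf0, -⟩ := exists_contMDiffMap_one_nhds_of_subset_interior (n := (⊤ : ℕ∞))
    (modelWithCornersSelf ℝ (EuclideanSpace ℝ ι)) hL.isClosed hLM
  have hsupp : tsupport (fun y => ((f y : ℝ) : ℂ)) ⊆ M := by
    refine closure_minimal (fun y hy => ?_) hM.isClosed
    by_contra hyM
    exact hy (by simp [hf0 y hyM])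
  let φ : 𝓓(U, ℂ) := ⟨fun y => ((f y : ℝ) : ℂ),
    Complex.ofRealCLM.contDiff.comp f.contMDiff.contDiff,
    HasCompactSupport.of_support_subset_isCompact hM (subset_closure.trans hsupp),
    (hsupp.trans hMV).trans hVU⟩
  obtain ⟨W, hW, hLW, h1⟩ := mem_nhdsSet_iff_exists.1 hf1
  refine ⟨φ, hsupp.trans hMV, W, hW, hLW, fun y hy => ?_⟩
  have : f y = 1 := h1 hy
  change ((f y : ℝ) : ℂ) = 1
  simp [this]

/-- The product of a smooth function and a test function. -/
noncomputable def mulTest (f : Sp ι → ℂ) (hf : ContDiff ℝ ∞ f) (v : 𝓓(U, ℂ)) : 𝓓(U, ℂ) where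
  toFun x := f x * v x
  contDiff' := hf.mul v.contDiff
  hasCompactSupport' := v.hasCompactSupport.mul_left
  tsupport_subset' := tsupport_mul_subset_right.trans v.tsupport_subset

theorem mulTest_apply (f : Sp ι → ℂ) (hf : ContDiff ℝ ∞ f) (v : 𝓓(U, ℂ)) (x : Sp ι) :
    mulTest f hf v x = f x * v x := rfl

theorem test_eq_zero_of_notMem (v : 𝓓(U, ℂ)) {x : Sp ι} (hx : x ∉ U) : v x = 0 :=
  image_eq_zero_of_notMem_tsupport fun h => hx (v.tsupport_subset h)

/-- A linear functional that vanishes locally near the support of a test function vanishes on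
this test function. -/
theorem functional_eq_zero (ℓ : 𝓓(U, ℂ) →ₗ[ℂ] ℂ) (u : 𝓓(U, ℂ))
    (h : ∀ y ∈ tsupport u, ∃ W, IsOpen W ∧ y ∈ W ∧ ∀ v : 𝓓(U, ℂ), tsupport v ⊆ W → ℓ v = 0) :
    ℓ u = 0 := by
  have hc : IsCompact (tsupport u) := u.hasCompactSupport
  suffices H : ∃ W, IsOpen W ∧ tsupport u ⊆ W ∧ ∀ v : 𝓓(U, ℂ), tsupport v ⊆ W → ℓ v = 0 by
    obtain ⟨W, -, hW, hv⟩ := H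
    exact hv u hW
  refine hc.induction_on (p := fun s => ∃ W, IsOpen W ∧ s ⊆ W ∧
    ∀ v : 𝓓(U, ℂ), tsupport v ⊆ W → ℓ v = 0) ?_ ?_ ?_ ?_
  · refine ⟨∅, isOpen_empty, subset_rfl, fun v hv => ?_⟩
    have : v = 0 := by
      ext x
      exact image_eq_zero_of_notMem_tsupport fun hx => hv hx
    rw [this, map_zero]
  · rintro s t hst ⟨W, hW, htW, hv⟩
    exact ⟨W, hW, hst.trans htW, hv⟩
  · rintro s t ⟨W₁, hW₁, hs, hv₁⟩ ⟨W₂, hW₂, ht, hv₂⟩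
    refine ⟨W₁ ∪ W₂, hW₁.union hW₂, Set.union_subset_union hs ht, fun v hv => ?_⟩
    -- A cutoff θ with support in W₁ that is one near the part of the support outside W₂ splits v
    -- into a piece supported in W₁ and one supported in W₂.
    have hK : IsCompact (tsupport v \ W₂) := v.hasCompactSupport.isCompact.diff hW₂
    obtain ⟨θ, hθ, W', hW', hKW', h1⟩ := exists_cutoff (U := U) hK (hW₁.inter U.isOpen)
      (fun y hy => ⟨(hv hy.1).resolve_right hy.2, v.tsupport_subset hy.1⟩) Set.inter_subset_right
    have e : v = mulTest θ θ.contDiff v + (v - mulTest θ θ.contDiff v) := by abel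
    rw [e, map_add, hv₁, hv₂, add_zero]
    · have hsub : tsupport (v - mulTest θ θ.contDiff v : 𝓓(U, ℂ)) ⊆ tsupport v \ W' := by
        refine closure_minimal (fun y hy => ?_) ((isClosed_tsupport v).sdiff hW')
        have h3 : (v - mulTest θ θ.contDiff v : 𝓓(U, ℂ)) y = v y - θ y * v y := rfl
        rw [Function.mem_support, h3] at hy
        refine ⟨?_, fun hyW => hy (by rw [h1 y hyW]; ring)⟩
        by_contra hyv
        exact hy (by rw [image_eq_zero_of_notMem_tsupport hyv]; ring)
      intro y hy
      by_contra hy2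
      exact (hsub hy).2 (hKW' ⟨(hsub hy).1, hy2⟩)
    · exact (tsupport_mul_subset_left.trans hθ).trans Set.inter_subset_left
  · intro y hy
    obtain ⟨W, hW, hyW, hv⟩ := h y hy
    exact ⟨W, mem_nhdsWithin_of_mem_nhds (hW.mem_nhds hyW), W, hW, subset_rfl, hv⟩

theorem cutMul_apply (φ : 𝓓(U, ℂ)) (f : SmoothFun U) (x : Sp ι) :
    cutMul φ f x = φ x * (f : Sp ι → ℂ) x := rfl

/-- Continuous functions are determined by their integrals against test functions. -/
theorem eqOn_of_integral_eq {W : Set (Sp ι)} (hW : IsOpen W) (hWU : W ⊆ U) {f g : Sp ι → ℂ}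
    (hf : Continuous f) (hg : Continuous g)
    (h : ∀ u : 𝓓(U, ℂ), tsupport u ⊆ W → ∫ y, f y * u y = ∫ y, g y * u y) :
    Set.EqOn f g W := by
  have h1 : ∀ᵐ y ∂(volume : Measure (Sp ι)), y ∈ W → f y - g y = 0 := by
    refine hW.ae_eq_zero_of_integral_contDiff_smul_eq_zero
      ((hf.sub hg).locallyIntegrable.locallyIntegrableOn W) fun φ hφ hc hs => ?_
    let u : 𝓓(U, ℂ) := ⟨fun y => ((φ y : ℝ) : ℂ), Complex.ofRealCLM.contDiff.comp hφ,
      hc.comp_left (g := fun t : ℝ => (t : ℂ)) (by simp),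
      ((tsupport_comp_subset (g := fun t : ℝ => (t : ℂ)) (by simp) φ).trans hs).trans hWU⟩
    have h2 := h u ((tsupport_comp_subset (g := fun t : ℝ => (t : ℂ)) (by simp) φ).trans hs)
    have i1 : Integrable fun y => f y * u y :=
      (hf.mul u.continuous).integrable_of_hasCompactSupport u.hasCompactSupport.mul_left
    have i2 : Integrable fun y => g y * u y :=
      (hg.mul u.continuous).integrable_of_hasCompactSupport u.hasCompactSupport.mul_left
    rw [← sub_eq_zero, ← integral_sub i1 i2] at h2
    rw [← h2]
    refine integral_congr_ae (Filter.Eventually.of_forall fun y => ?_)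
    have : u y = ((φ y : ℝ) : ℂ) := rfl
    simp only [this, Complex.real_smul]
    ring
  refine Measure.eqOn_open_of_ae_eq (μ := volume) ?_ hW hf.continuousOn hg.continuousOn
  rw [Filter.EventuallyEq, ae_restrict_iff' hW.measurableSet]
  filter_upwards [h1] with y hy hyW using sub_eq_zero.1 (hy hyW)

/-- Smoothing operators can be recognized locally. -/
theorem isSmoothing_of_local (R : Operator U)
    (h : ∀ x₀ ∈ U, ∀ y₀ ∈ U, ∃ V W : Set (Sp ι), IsOpen V ∧ IsOpen W ∧ x₀ ∈ V ∧ y₀ ∈ W ∧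
      V ⊆ U ∧ W ⊆ U ∧ ∃ k : Fn ι, ContDiff ℝ ∞ (unc k) ∧
      ∀ u : 𝓓(U, ℂ), tsupport u ⊆ W → ∀ x ∈ V, (R u : Sp ι → ℂ) x = ∫ y, k x y * u y) :
    IsSmoothing R := by
  classical
  choose! V W hV hW hxV hyW hVU hWU k hk hR using h
  have kcont : ∀ x₀ ∈ U, ∀ y₀ ∈ U, ∀ x, Continuous fun y => k x₀ y₀ x y := fun x₀ hx₀ y₀ hy₀ x =>
    (hk x₀ hx₀ y₀ hy₀).continuous.comp (by fun_prop : Continuous fun y : Sp ι => (x, y))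
  have huniq : ∀ x₁ ∈ U, ∀ y₁ ∈ U, ∀ x₂ ∈ U, ∀ y₂ ∈ U, ∀ x ∈ V x₁ y₁ ∩ V x₂ y₂,
      ∀ y ∈ W x₁ y₁ ∩ W x₂ y₂, k x₁ y₁ x y = k x₂ y₂ x y := by
    intro x₁ hx₁ y₁ hy₁ x₂ hx₂ y₂ hy₂ x hx y hy
    refine eqOn_of_integral_eq (U := U) ((hW x₁ hx₁ y₁ hy₁).inter (hW x₂ hx₂ y₂ hy₂))
      (Set.inter_subset_left.trans (hWU x₁ hx₁ y₁ hy₁)) (kcont x₁ hx₁ y₁ hy₁ x)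
      (kcont x₂ hx₂ y₂ hy₂ x) (fun u hu => ?_) hy
    rw [← hR x₁ hx₁ y₁ hy₁ u (hu.trans Set.inter_subset_left) x hx.1,
      ← hR x₂ hx₂ y₂ hy₂ u (hu.trans Set.inter_subset_right) x hx.2]
  -- Local kernels are determined by the operator, so they agree on overlaps (`huniq`); evaluating
  -- at (x, y) the kernel chosen for that same point glues them smoothly.
  let c : Fn ι := fun x y => k x y x y
  have hloc : ∀ x₀ ∈ U, ∀ y₀ ∈ U, ∀ x ∈ V x₀ y₀, ∀ y ∈ W x₀ y₀, c x y = k x₀ y₀ x y := by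
    intro x₀ hx₀ y₀ hy₀ x hx y hy
    have hxU := hVU x₀ hx₀ y₀ hy₀ hx
    have hyU := hWU x₀ hx₀ y₀ hy₀ hy
    exact huniq x hxU y hyU x₀ hx₀ y₀ hy₀ x ⟨hxV x hxU y hyU, hx⟩ y ⟨hyW x hxU y hyU, hy⟩
  have hcs : ContDiffOn ℝ ∞ (fun p : Sp ι × Sp ι => c p.1 p.2) ((U : Set (Sp ι)) ×ˢ (U : Set (Sp ι))) := by
    rintro ⟨x₀, y₀⟩ ⟨hx₀, hy₀⟩
    refine ContDiffAt.contDiffWithinAt ?_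
    refine (hk x₀ hx₀ y₀ hy₀).contDiffAt.congr_of_eventuallyEq ?_
    filter_upwards [((hV x₀ hx₀ y₀ hy₀).prod (hW x₀ hx₀ y₀ hy₀)).mem_nhds
      ⟨hxV x₀ hx₀ y₀ hy₀, hyW x₀ hx₀ y₀ hy₀⟩] with p hp using hloc x₀ hx₀ y₀ hy₀ _ hp.1 _ hp.2
  refine ⟨c, hcs, fun u x hx => ?_⟩
  have hint : ∀ u : 𝓓(U, ℂ), Integrable fun y => c x y * u y := by
    intro u
    have hc1 : ContinuousOn (fun y => c x y) (tsupport u) := by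
      have h1 : ContinuousOn (fun y : Sp ι => (x, y)) (tsupport u) := by fun_prop
      exact hcs.continuousOn.comp h1 fun y hy => ⟨hx, u.tsupport_subset hy⟩
    have h2 : IntegrableOn (fun y => c x y * u y) (tsupport u) :=
      (hc1.mul u.continuous.continuousOn).integrableOn_compact u.hasCompactSupport
    refine (integrableOn_iff_integrable_of_support_subset fun y hy => ?_).1 h2
    by_contra hyu
    exact hy (by simp [image_eq_zero_of_notMem_tsupport hyu])
  -- The defect at a fixed x is a linear functional of u that vanishes on test functions with small
  -- support.
  let ℓ : 𝓓(U, ℂ) →ₗ[ℂ] ℂ :=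
    { toFun := fun u => (R u : Sp ι → ℂ) x - ∫ y, c x y * u y
      map_add' := fun u v => by
        have e : ∀ y, c x y * (u + v) y = c x y * u y + c x y * v y := fun y => mul_add _ _ _
        simp_rw [e]
        rw [integral_add (hint u) (hint v), map_add]
        change (R u : Sp ι → ℂ) x + (R v : Sp ι → ℂ) x - _ = _
        ring
      map_smul' := fun r u => by
        have e : ∀ y, c x y * (r • u) y = r * (c x y * u y) := fun y => by
          change c x y * (r * u y) = _
          ring
        simp_rw [e]
        rw [integral_const_mul, map_smul]
        change r * (R u : Sp ι → ℂ) x - _ = r * _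
        ring }
  have h0 : ℓ u = 0 := by
    refine functional_eq_zero ℓ u fun y₀ hy₀ => ?_
    have hy₀U := u.tsupport_subset hy₀
    refine ⟨W x y₀, hW x hx y₀ hy₀U, hyW x hx y₀ hy₀U, fun v hv => ?_⟩
    change (R v : Sp ι → ℂ) x - ∫ y, c x y * v y = 0
    rw [hR x hx y₀ hy₀U v hv x (hxV x hx y₀ hy₀U), sub_eq_zero]
    refine integral_congr_ae (Filter.Eventually.of_forall fun y => ?_)
    simp only
    by_cases hy : y ∈ tsupport v
    · rw [hloc x hx y₀ hy₀U x (hxV x hx y₀ hy₀U) y (hv hy)]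
    · rw [image_eq_zero_of_notMem_tsupport hy]; simp
  rw [setIntegral_eq_integral_of_forall_compl_eq_zero fun y hy => by
    rw [test_eq_zero_of_notMem u hy, mul_zero]]
  exact sub_eq_zero.1 h0

end Test

/-! ### Operators on open sets -/

section Operators

variable {ι : Type} [Fintype ι] [DecidableEq ι] {U : Opens (Sp ι)}

theorem integrable_osc_mul {u : Sp ι → ℂ} (hu : Continuous u) (hc : HasCompactSupport u)
    (ξ : Sp ι) : Integrable fun y => osc (-ξ) y * u y := by
  have h : Continuous fun y => osc (-ξ) y :=
    continuous_osc.comp (by fun_prop : Continuous fun y : Sp ι => (-ξ, y))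
  exact (h.mul hu).integrable_of_hasCompactSupport hc.mul_left

theorem fourierHat_add {u v : Sp ι → ℂ} (hu : Continuous u) (hc : HasCompactSupport u)
    (hv : Continuous v) (hd : HasCompactSupport v) (ξ : Sp ι) :
    fourierHat (fun y => u y + v y) ξ = fourierHat u ξ + fourierHat v ξ := by
  rw [fourierHat_eq, fourierHat_eq, fourierHat_eq, ← integral_add (integrable_osc_mul hu hc ξ)
    (integrable_osc_mul hv hd ξ)]
  simp_rw [mul_add]

theorem fourierHat_const_mul (u : Sp ι → ℂ) (c : ℂ) (ξ : Sp ι) :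
    fourierHat (fun y => c * u y) ξ = c * fourierHat u ξ := by
  rw [fourierHat_eq, fourierHat_eq, ← integral_const_mul]
  simp_rw [mul_left_comm]

theorem opLeft_add_right {m : ℝ} {a : Fn ι} (ha : IsGlobal m a)
    {u v : Sp ι → ℂ} (hu : ContDiff ℝ ∞ u) (hc : HasCompactSupport u)
    (hv : ContDiff ℝ ∞ v) (hd : HasCompactSupport v) (x : Sp ι) :
    opLeft a (fun y => u y + v y) x = opLeft a u x + opLeft a v x := by
  rw [opLeft_eq, opLeft_eq, opLeft_eq, ← mul_add,
    ← integral_add (integrable_opLeft ha hu hc x) (integrable_opLeft ha hv hd x)]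
  simp_rw [fourierHat_add hu.continuous hc hv.continuous hd, mul_add]

theorem opLeft_const_mul_right (a : Fn ι) (u : Sp ι → ℂ) (c : ℂ) (x : Sp ι) :
    opLeft a (fun y => c * u y) x = c * opLeft a u x := by
  have e : ∀ ξ, osc x ξ * a x ξ * fourierHat (fun y => c * u y) ξ =
      c * (osc x ξ * a x ξ * fourierHat u ξ) := fun ξ => by rw [fourierHat_const_mul]; ring
  rw [opLeft_eq, opLeft_eq]
  simp_rw [e]
  rw [integral_const_mul]
  ring

theorem hasCompactSupport_opLeft {m : ℝ} {a : Fn ι} (ha : IsGlobal m a) (u : Sp ι → ℂ) :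
    HasCompactSupport (opLeft a u) := by
  obtain ⟨K, hK, h⟩ := ha.supp
  refine HasCompactSupport.intro hK fun x hx => ?_
  rw [opLeft_eq]
  simp [h x hx]

theorem IsSymbol.cut {m : ℝ} {a : Fn ι} (ha : IsSymbol U m a) (φ : 𝓓(U, ℂ)) :
    IsGlobal m fun x ξ => φ x * a x ξ :=
  IsGlobal.of_cutoff ha φ.contDiff φ.hasCompactSupport φ.tsupport_subset

theorem exists_cutoff_nhds {x : Sp ι} (hx : x ∈ U) :
    ∃ φ : 𝓓(U, ℂ), ∃ W : Set (Sp ι), IsOpen W ∧ x ∈ W ∧ ∀ y ∈ W, φ y = 1 := by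
  obtain ⟨φ, -, W, hW, hxW, h1⟩ := exists_cutoff (U := U) (isCompact_singleton (x := x)) U.isOpen
    (by simpa using hx) subset_rfl
  exact ⟨φ, W, hW, hxW rfl, h1⟩

theorem opLeft_cut (a : Fn ι) (u : Sp ι → ℂ) {φ : Sp ι → ℂ} {x : Sp ι} (h : φ x = 1) :
    opLeft (fun x ξ => φ x * a x ξ) u x = opLeft a u x :=
  opLeft_congr u fun ξ => by rw [h, one_mul]

/-- The operator on `U` with a given left symbol. -/
noncomputable def opOn {m : ℝ} (a : Fn ι) (ha : IsSymbol U m a) : Operator U where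
  toFun u := ⟨Set.indicator U (opLeft a u), by
    refine ⟨fun x hx => ?_, fun x hx => Set.indicator_of_notMem hx _⟩
    -- Near x the symbol may be multiplied by a cutoff equal to one there, which reduces smoothness
    -- to global symbols.
    obtain ⟨φ, W, hW, hxW, h1⟩ := exists_cutoff_nhds hx
    refine ((smooth_opLeft (ha.cut φ) u.contDiff u.hasCompactSupport).contDiffAt.congr_of_eventuallyEq
      ?_).contDiffWithinAt
    filter_upwards [(hW.inter U.isOpen).mem_nhds ⟨hxW, hx⟩] with y hy
    rw [Set.indicator_of_mem hy.2, opLeft_cut a u (h1 y hy.1)]⟩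
  map_add' u v := by
    ext x
    change Set.indicator U (opLeft a _) x = Set.indicator U (opLeft a _) x +
      Set.indicator U (opLeft a _) x
    by_cases hx : x ∈ U
    · obtain ⟨φ, W, hW, hxW, h1⟩ := exists_cutoff_nhds hx
      have h1x := h1 x hxW
      rw [Set.indicator_of_mem hx, Set.indicator_of_mem hx, Set.indicator_of_mem hx,
        ← opLeft_cut a _ h1x, ← opLeft_cut a _ h1x, ← opLeft_cut a _ h1x]
      exact opLeft_add_right (ha.cut φ) u.contDiff u.hasCompactSupport v.contDiff
        v.hasCompactSupport x
    · simp [Set.indicator_of_notMem (show x ∉ (U : Set (Sp ι)) from hx)]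
  map_smul' c u := by
    ext x
    change Set.indicator U (opLeft a _) x = c * Set.indicator U (opLeft a _) x
    by_cases hx : x ∈ U
    · rw [Set.indicator_of_mem hx, Set.indicator_of_mem hx]
      exact opLeft_const_mul_right a u c x
    · simp [Set.indicator_of_notMem (show x ∉ (U : Set (Sp ι)) from hx)]

theorem opOn_apply {m : ℝ} {a : Fn ι} (ha : IsSymbol U m a) (u : 𝓓(U, ℂ)) {x : Sp ι} (hx : x ∈ U) :
    (opOn a ha u : Sp ι → ℂ) x = opLeft a u x := Set.indicator_of_mem hx _

theorem sub_apply_op (A B : Operator U) (u : 𝓓(U, ℂ)) (x : Sp ι) :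
    ((A - B) u : Sp ι → ℂ) x = (A u : Sp ι → ℂ) x - (B u : Sp ι → ℂ) x := rfl

theorem add_apply_op (A B : Operator U) (u : 𝓓(U, ℂ)) (x : Sp ι) :
    ((A + B) u : Sp ι → ℂ) x = (A u : Sp ι → ℂ) x + (B u : Sp ι → ℂ) x := rfl

theorem hasLeftSymbol_iff {m : ℝ} {A : Operator U} {a : Fn ι} (ha : IsSymbol U m a) :
    HasLeftSymbol A a ↔ IsSmoothing (A - opOn a ha) := by
  constructor
  · rintro ⟨R, ⟨c, hc, hR⟩, h⟩
    refine ⟨c, hc, fun u x hx => ?_⟩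
    rw [sub_apply_op, opOn_apply ha u hx, h u x hx, ← hR u x hx]
    ring
  · intro h
    refine ⟨_, h, fun u x hx => ?_⟩
    rw [sub_apply_op, opOn_apply ha u hx]
    ring

theorem IsSmoothing.integrable {c : Fn ι} (hcs : ContDiffOn ℝ ∞ (fun p : Sp ι × Sp ι => c p.1 p.2)
    ((U : Set (Sp ι)) ×ˢ (U : Set (Sp ι)))) {x : Sp ι} (hx : x ∈ U) (u : 𝓓(U, ℂ)) :
    Integrable fun y => c x y * u y := by
  have hc1 : ContinuousOn (fun y => c x y) (tsupport u) := by
    have h1 : ContinuousOn (fun y : Sp ι => (x, y)) (tsupport u) := by fun_prop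
    exact hcs.continuousOn.comp h1 fun y hy => ⟨hx, u.tsupport_subset hy⟩
  have h2 : IntegrableOn (fun y => c x y * u y) (tsupport u) :=
    (hc1.mul u.continuous.continuousOn).integrableOn_compact u.hasCompactSupport
  refine (integrableOn_iff_integrable_of_support_subset fun y hy => ?_).1 h2
  by_contra hyu
  exact hy (by simp [image_eq_zero_of_notMem_tsupport hyu])

theorem IsSmoothing.add {A B : Operator U} (hA : IsSmoothing A) (hB : IsSmoothing B) :
    IsSmoothing (A + B) := by
  obtain ⟨c, hc, h⟩ := hA
  obtain ⟨d, hd, h'⟩ := hB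
  refine ⟨fun x y => c x y + d x y, hc.add hd, fun u x hx => ?_⟩
  rw [add_apply_op, h u x hx, h' u x hx, ← integral_add (IsSmoothing.integrable hc hx u).integrableOn
    (IsSmoothing.integrable hd hx u).integrableOn]
  simp_rw [add_mul]

theorem IsSmoothing.sub {A B : Operator U} (hA : IsSmoothing A) (hB : IsSmoothing B) :
    IsSmoothing (A - B) := by
  obtain ⟨c, hc, h⟩ := hA
  obtain ⟨d, hd, h'⟩ := hB
  refine ⟨fun x y => c x y - d x y, hc.sub hd, fun u x hx => ?_⟩
  rw [sub_apply_op, h u x hx, h' u x hx, ← integral_sub (IsSmoothing.integrable hc hx u).integrableOn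
    (IsSmoothing.integrable hd hx u).integrableOn]
  simp_rw [sub_mul]

theorem isSmoothing_iff_hasLeftSymbol_zero {A : Operator U} :
    IsSmoothing A ↔ HasLeftSymbol A fun _ _ => 0 := by
  have h0 : ∀ (u : Sp ι → ℂ) x, opLeft (fun _ _ => 0 : Fn ι) u x = 0 := fun u x => by
    rw [opLeft_eq]; simp
  constructor
  · exact fun h => ⟨A, h, fun u x hx => by rw [h0, zero_add]⟩
  · rintro ⟨R, ⟨c, hc, hR⟩, h⟩
    refine ⟨c, hc, fun u x hx => ?_⟩
    rw [h u x hx, h0, zero_add, hR u x hx]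

theorem HasLeftSymbol.congr {A : Operator U} {a b : Fn ι} (h : HasLeftSymbol A a)
    (hab : ∀ x ∈ U, ∀ ξ, a x ξ = b x ξ) : HasLeftSymbol A b := by
  obtain ⟨R, hR, h⟩ := h
  exact ⟨R, hR, fun u x hx => by rw [h u x hx, opLeft_congr u (hab x hx)]⟩

theorem HasLeftSymbol.add_smoothing {A B : Operator U} {a : Fn ι} (h : HasLeftSymbol A a)
    (hAB : IsSmoothing (B - A)) : HasLeftSymbol B a := by
  obtain ⟨R, hR, h⟩ := h
  refine ⟨R + (B - A), hR.add hAB, fun u x hx => ?_⟩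
  rw [add_apply_op, sub_apply_op, h u x hx]
  ring

/-- Between cutoffs, an operator with a left symbol acts through a global symbol. -/
theorem HasLeftSymbol.local {A : Operator U} {a : Fn ι} (hA : HasLeftSymbol A a) (φ₁ φ₂ : 𝓓(U, ℂ)) :
    ∃ σ : Fn ι, (∀ m', IsGlobal m' σ) ∧ ∀ v : 𝓓(U, ℂ), (∀ y, φ₂ y * v y = v y) → ∀ x,
      φ₁ x * (A v : Sp ι → ℂ) x = φ₁ x * opLeft a v x + opLeft σ v x := by
  obtain ⟨R, ⟨c, hc, hR⟩, h⟩ := hA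
  let k : Fn ι := fun x y => φ₁ x * c x y * φ₂ y
  have hz₁ : ∀ x ∉ tsupport φ₁, ∀ y, k x y = 0 := fun x hx y => by
    simp [k, image_eq_zero_of_notMem_tsupport hx]
  have hz₂ : ∀ x, ∀ y ∉ tsupport φ₂, k x y = 0 := fun x y hy => by
    simp [k, image_eq_zero_of_notMem_tsupport hy]
  have hk : ContDiff ℝ ∞ (unc k) := by
    rw [contDiff_iff_contDiffAt]
    rintro ⟨x, y⟩
    by_cases hx : x ∈ tsupport φ₁
    · by_cases hy : y ∈ tsupport φ₂
      · have h1 : ContDiffAt ℝ ∞ (fun p : Sp ι × Sp ι => c p.1 p.2) (x, y) :=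
          hc.contDiffAt ((U.isOpen.prod U.isOpen).mem_nhds
            ⟨φ₁.tsupport_subset hx, φ₂.tsupport_subset hy⟩)
        exact ((φ₁.contDiff.comp contDiff_fst).contDiffAt.mul h1).mul
          (φ₂.contDiff.comp contDiff_snd).contDiffAt
      · refine (contDiffAt_const (c := (0 : ℂ))).congr_of_eventuallyEq ?_
        filter_upwards [((isClosed_tsupport φ₂).isOpen_compl.preimage continuous_snd).mem_nhds hy]
          with p hp using hz₂ _ _ hp
    · refine (contDiffAt_const (c := (0 : ℂ))).congr_of_eventuallyEq ?_
      filter_upwards [((isClosed_tsupport φ₁).isOpen_compl.preimage continuous_fst).mem_nhds hx]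
        with p hp using hz₁ _ hp _
  refine ⟨symbolOf k, (isGlobal_symbolOf hk φ₁.hasCompactSupport φ₂.hasCompactSupport hz₁ hz₂).2,
    fun v hv x => ?_⟩
  rw [opLeft_symbolOf hk φ₂.hasCompactSupport hz₂ v.contDiff v.hasCompactSupport]
  by_cases hx : x ∈ U
  · rw [h v x hx, hR v x hx, mul_add, ← integral_const_mul,
      setIntegral_eq_integral_of_forall_compl_eq_zero fun y hy => by
        rw [test_eq_zero_of_notMem v hy, mul_zero, mul_zero]]
    congr 1
    refine integral_congr_ae (Filter.Eventually.of_forall fun y => ?_)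
    simp only [k]
    conv_lhs => rw [← hv y]
    ring
  · have : φ₁ x = 0 := test_eq_zero_of_notMem φ₁ hx
    simp [k, this]

/-! ### Compositions -/

/-- The condition that makes the composition `A B` well defined, locally uniformly. -/
def LocComposable (A B : Operator U) : Prop :=
  ∀ x₀ ∈ U, ∀ M : Set (Sp ι), IsCompact M → M ⊆ U → ∃ V : Set (Sp ι), IsOpen V ∧ x₀ ∈ V ∧
    V ⊆ U ∧ ∃ L : Set (Sp ι), IsCompact L ∧ L ⊆ U ∧ ∀ u : 𝓓(U, ℂ), tsupport u ⊆ M →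
    ∀ φ φ' : 𝓓(U, ℂ), (∀ y ∈ L, φ y = 1) → (∀ y ∈ L, φ' y = 1) → ∀ x ∈ V,
    (A (cutMul φ (B u)) : Sp ι → ℂ) x = (A (cutMul φ' (B u)) : Sp ι → ℂ) x

theorem eq_zero_of_kernelSupport (A : Operator U) (u : 𝓓(U, ℂ)) {x : Sp ι} (hx : x ∈ U)
    (h : ∀ y ∈ tsupport u, (x, y) ∉ kernelSupport A) : (A u : Sp ι → ℂ) x = 0 := by
  let ℓ : 𝓓(U, ℂ) →ₗ[ℂ] ℂ :=
    { toFun := fun u => (A u : Sp ι → ℂ) x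
      map_add' := fun u v => by rw [map_add]; rfl
      map_smul' := fun r u => by rw [map_smul]; rfl }
  refine functional_eq_zero ℓ u fun y hy => ?_
  by_contra hcon
  refine h y hy ⟨hx, u.tsupport_subset hy, fun V W hV hW hxV hyW => ?_⟩
  by_contra hV0
  push Not at hV0
  exact hcon ⟨W, hW, hyW, fun v hv => hV0 v hv x hxV⟩

/-- The function B u vanishes outside the projection of the kernel support over M, which is compact;
cutoffs equal to one there leave B u unchanged, whatever x is. -/
theorem locComposable_of_right (A : Operator U) {B : Operator U} (hB : IsProperlySupported B) :
    LocComposable A B := by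
  intro x₀ hx₀ M hM hMU
  refine ⟨U, U.isOpen, hx₀, subset_rfl, Prod.fst '' (kernelSupport B ∩ Prod.snd ⁻¹' M),
    (hB M hM hMU).2.image continuous_fst, ?_, fun u hu φ φ' h h' x hx => ?_⟩
  · rintro _ ⟨p, hp, rfl⟩
    exact hp.1.1
  · have : cutMul φ (B u) = cutMul φ' (B u) := by
      ext y
      rw [cutMul_apply, cutMul_apply]
      by_cases hy : y ∈ Prod.fst '' (kernelSupport B ∩ Prod.snd ⁻¹' M)
      · rw [h y hy, h' y hy]
      · have h0 : (B u : Sp ι → ℂ) y = 0 := by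
          by_cases hyU : y ∈ U
          · refine eq_zero_of_kernelSupport B u hyU fun z hz hyz => hy ⟨(y, z), ⟨hyz, hu hz⟩, rfl⟩
          · exact (B u).2.2 y hyU
        rw [h0, mul_zero, mul_zero]
    rw [this]

/-- For x in a compact neighbourhood N of x₀, the operator A only sees the projection of its kernel
support over N. The set L is a neighbourhood of this compact set, so the difference of two cutoff
versions is supported away from it. -/
theorem locComposable_of_left {A : Operator U} (hA : IsProperlySupported A) (B : Operator U) :
    LocComposable A B := by
  intro x₀ hx₀ M hM hMU
  obtain ⟨N, hN, hxN, hNU⟩ := exists_compact_subset U.isOpen hx₀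
  have hK := (hA N hN hNU).1.image continuous_snd
  have hKU : Prod.snd '' (kernelSupport A ∩ Prod.fst ⁻¹' N) ⊆ U := by
    rintro _ ⟨p, hp, rfl⟩
    exact hp.1.2.1
  obtain ⟨L, hL, hKL, hLU⟩ := exists_compact_between hK U.isOpen hKU
  refine ⟨interior N, isOpen_interior, hxN, interior_subset.trans hNU, L, hL, hLU,
    fun u hu φ φ' h h' x hx => ?_⟩
  rw [← sub_eq_zero]
  change ((A (cutMul φ (B u)) - A (cutMul φ' (B u)) : SmoothFun U) : Sp ι → ℂ) x = 0
  rw [← map_sub]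
  refine eq_zero_of_kernelSupport A _ (hNU (interior_subset hx)) fun y hy hxy => ?_
  have hyL : y ∈ interior L := hKL ⟨(x, y), ⟨hxy, interior_subset (s := N) hx⟩, rfl⟩
  have hsub : tsupport (cutMul φ (B u) - cutMul φ' (B u) : 𝓓(U, ℂ)) ⊆ (interior L)ᶜ := by
    refine closure_minimal (fun z hz hzL => hz ?_) isOpen_interior.isClosed_compl
    change φ z * (B u : Sp ι → ℂ) z - φ' z * (B u : Sp ι → ℂ) z = 0
    rw [h z (interior_subset hzL), h' z (interior_subset hzL), sub_self]
  exact hsub hy hyL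

theorem exists_cutoff_one {L : Set (Sp ι)} (hL : IsCompact L) (hLU : L ⊆ U) :
    ∃ φ : 𝓓(U, ℂ), ∀ y ∈ L, φ y = 1 := by
  obtain ⟨φ, -, W, -, hLW, h1⟩ := exists_cutoff (U := U) hL U.isOpen hLU subset_rfl
  exact ⟨φ, fun y hy => h1 y (hLW hy)⟩

theorem cutMul_add (φ : 𝓓(U, ℂ)) (f g : SmoothFun U) :
    cutMul φ (f + g) = cutMul φ f + cutMul φ g := by
  ext x
  exact mul_add _ _ _

theorem cutMul_smul (φ : 𝓓(U, ℂ)) (c : ℂ) (f : SmoothFun U) :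
    cutMul φ (c • f) = c • cutMul φ f := by
  ext x
  exact mul_left_comm _ _ _

/-- The value at x is defined with a cutoff that depends on u and x. Local uniformity lets one
cutoff serve near x₀, which gives smoothness; a common cutoff for several functions gives linearity.
-/
theorem LocComposable.exists_isComposition {A B : Operator U} (h : LocComposable A B) :
    ∃ C, IsComposition A B C := by
  classical
  have h1 : ∀ u : 𝓓(U, ℂ), ∀ x₀ ∈ U, ∃ V : Set (Sp ι), IsOpen V ∧ x₀ ∈ V ∧ V ⊆ U ∧
      ∃ L : Set (Sp ι), IsCompact L ∧ L ⊆ U ∧ ∀ φ φ' : 𝓓(U, ℂ), (∀ y ∈ L, φ y = 1) →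
      (∀ y ∈ L, φ' y = 1) → ∀ x ∈ V,
      (A (cutMul φ (B u)) : Sp ι → ℂ) x = (A (cutMul φ' (B u)) : Sp ι → ℂ) x := by
    intro u x₀ hx₀
    obtain ⟨V, hV, hxV, hVU, L, hL, hLU, hu⟩ :=
      h x₀ hx₀ (tsupport u) u.hasCompactSupport u.tsupport_subset
    exact ⟨V, hV, hxV, hVU, L, hL, hLU, hu u subset_rfl⟩
  choose! V hV hxV hVU L hL hLU hA using h1
  choose! θ hθ using fun u x₀ (hx₀ : x₀ ∈ U) => exists_cutoff_one (hL u x₀ hx₀) (hLU u x₀ hx₀)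
  let F : 𝓓(U, ℂ) → Sp ι → ℂ := fun u =>
    Set.indicator U fun x => (A (cutMul (θ u x) (B u)) : Sp ι → ℂ) x
  have hF : ∀ u, ∀ x ∈ U, ∀ φ : 𝓓(U, ℂ), (∀ y ∈ L u x, φ y = 1) →
      F u x = (A (cutMul φ (B u)) : Sp ι → ℂ) x := by
    intro u x hx φ hφ
    simp only [F]
    rw [Set.indicator_of_mem hx]
    exact hA u x hx _ _ (hθ u x hx) hφ x (hxV u x hx)
  have hF0 : ∀ u, ∀ x ∉ U, F u x = 0 := fun u x hx => Set.indicator_of_notMem hx _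
  have hs : ∀ u, F u ∈ SmoothFun U := by
    refine fun u => ⟨fun x₀ hx₀ => ?_, hF0 u⟩
    have h2 : ContDiffAt ℝ ∞ (A (cutMul (θ u x₀) (B u)) : Sp ι → ℂ) x₀ :=
      (A (cutMul (θ u x₀) (B u))).2.1.contDiffAt (U.isOpen.mem_nhds hx₀)
    refine (h2.congr_of_eventuallyEq ?_).contDiffWithinAt
    filter_upwards [(hV u x₀ hx₀).mem_nhds (hxV u x₀ hx₀)] with x hx
    have hxU := hVU u x₀ hx₀ hx
    obtain ⟨φ, hφ⟩ := exists_cutoff_one ((hL u x₀ hx₀).union (hL u x hxU))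
      (Set.union_subset (hLU u x₀ hx₀) (hLU u x hxU))
    rw [hF u x hxU φ fun y hy => hφ y (Or.inr hy)]
    exact hA u x₀ hx₀ _ _ (fun y hy => hφ y (Or.inl hy)) (hθ u x₀ hx₀) x hx
  let C : Operator U :=
    { toFun := fun u => ⟨F u, hs u⟩
      map_add' := fun u v => by
        ext x
        change F (u + v) x = F u x + F v x
        by_cases hx : x ∈ U
        · obtain ⟨φ, hφ⟩ := exists_cutoff_one
            (((hL u x hx).union (hL v x hx)).union (hL (u + v) x hx))
            (Set.union_subset (Set.union_subset (hLU u x hx) (hLU v x hx)) (hLU (u + v) x hx))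
          rw [hF u x hx φ fun y hy => hφ y (Or.inl (Or.inl hy)),
            hF v x hx φ fun y hy => hφ y (Or.inl (Or.inr hy)),
            hF (u + v) x hx φ fun y hy => hφ y (Or.inr hy), map_add, cutMul_add, map_add]
          rfl
        · rw [hF0 _ x hx, hF0 _ x hx, hF0 _ x hx, add_zero]
      map_smul' := fun c u => by
        ext x
        change F (c • u) x = c * F u x
        by_cases hx : x ∈ U
        · obtain ⟨φ, hφ⟩ := exists_cutoff_one ((hL u x hx).union (hL (c • u) x hx))
            (Set.union_subset (hLU u x hx) (hLU (c • u) x hx))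
          rw [hF u x hx φ fun y hy => hφ y (Or.inl hy),
            hF (c • u) x hx φ fun y hy => hφ y (Or.inr hy), map_smul, cutMul_smul, map_smul]
          rfl
        · rw [hF0 _ x hx, hF0 _ x hx, mul_zero] }
  exact ⟨C, fun u x hx => ⟨L u x, hL u x hx, hLU u x hx, fun φ hφ => (hF u x hx φ hφ).symm⟩⟩

/-- Replaces the pointwise definition of the composition by a single set L that serves all u
supported in M and all x near x₀. -/
theorem IsComposition.eq_cutMul {A B C : Operator U} (hC : IsComposition A B C)
    (h : LocComposable A B) {x₀ : Sp ι} (hx₀ : x₀ ∈ U) {M : Set (Sp ι)} (hM : IsCompact M)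
    (hMU : M ⊆ U) : ∃ V : Set (Sp ι), IsOpen V ∧ x₀ ∈ V ∧
    V ⊆ U ∧ ∃ L : Set (Sp ι), IsCompact L ∧ L ⊆ U ∧ ∀ u : 𝓓(U, ℂ), tsupport u ⊆ M →
    ∀ φ : 𝓓(U, ℂ), (∀ y ∈ L, φ y = 1) → ∀ x ∈ V,
    (C u : Sp ι → ℂ) x = (A (cutMul φ (B u)) : Sp ι → ℂ) x := by
  obtain ⟨V, hV, hxV, hVU, L, hL, hLU, hA⟩ := h x₀ hx₀ M hM hMU
  refine ⟨V, hV, hxV, hVU, L, hL, hLU, fun u hu φ hφ x hx => ?_⟩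
  obtain ⟨L', hL', hLU', hv⟩ := hC u x (hVU hx)
  obtain ⟨ψ, hψ⟩ := exists_cutoff_one (hL.union hL') (Set.union_subset hLU hLU')
  rw [← hv ψ fun y hy => hψ y (Or.inr hy)]
  exact hA u hu _ _ (fun y hy => hψ y (Or.inl hy)) hφ x hx

/-! ### The symbol of a composition -/

theorem leibTerm_fun_mul (l : ℕ) : ∀ (φ : Sp ι → ℂ) (a b : Fn ι), leibTerm l
    (fun x ξ => φ x * a x ξ) b = fun x ξ => φ x * leibTerm l a b x ξ := by
  induction l with
  | zero => intro φ a b; funext x ξ; simp only [leibTerm]; ring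
  | succ l ih =>
    intro φ a b
    funext x ξ
    simp only [leibTerm]
    rw [Finset.mul_sum]
    refine Finset.sum_congr rfl fun i _ => ?_
    have : dxi i (fun x ξ => φ x * a x ξ) = fun x ξ => φ x * dxi i a x ξ := by
      funext x ξ
      have h := fderiv_const_smul_field (𝕜 := ℝ) (f := fun ξ' => a x ξ') (φ x)
      have h2 := congrArg (fun L => L ξ (EuclideanSpace.single i 1)) h
      exact h2
    rw [this, ih]

/-- If two symbols agree to infinite order, up to cutoffs, then so do the composed symbols. -/
theorem IsGlobal.sharp_sub {m m' : ℝ} {a b c : Fn ι} (ha : IsSymbol U m a)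
    (φ : 𝓓(U, ℂ)) {W : Set (Sp ι)} (hW : IsOpen W) (hφW : tsupport φ ⊆ W)
    {b' : Fn ι} (hb' : IsGlobal m' b') (hbb : ∀ x ∈ W, ∀ ξ, b' x ξ = b x ξ)
    (hc : ∀ N : ℕ, IsSymbol U (m + m' - N) fun x ξ => c x ξ -
      ∑ l ∈ Finset.range N, ((l.factorial : ℂ))⁻¹ * leibTerm l a b x ξ) (s : ℝ) :
    IsGlobal s fun x ξ => CornerPsiDO.sharp (fun x ξ => φ x * a x ξ) b' x ξ - φ x * c x ξ := by
  -- So many Leibniz terms are subtracted that both remainders have order at most s. The terms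
  -- themselves agree, since b' = b on the neighbourhood W of the support of φ.
  obtain ⟨N, hN⟩ := exists_nat_ge (m + m' - s)
  have hg := ha.cut φ
  have h1 : IsGlobal (m + m') fun x ξ => φ x * c x ξ := by
    have h := hc 0
    simp only [Finset.range_zero, Finset.sum_empty, sub_zero, Nat.cast_zero] at h
    exact h.cut φ
  refine ⟨?_, ((hg.sharp hb').sub h1).supp⟩
  have h2 := (sharpRem_isSymbol hg hb' N).sub ((hc N).cut φ).symbol
  refine (h2.mono (by linarith)).congr fun x _ ξ => ?_
  simp only [sharpRem]
  have e : ∀ l, leibTerm l (fun x ξ => φ x * a x ξ) b' x ξ = φ x * leibTerm l a b x ξ := by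
    intro l
    rw [leibTerm_fun_mul]
    simp only
    by_cases hx : x ∈ W
    · rw [leibTerm_congr (O := W ×ˢ Set.univ) (hW.prod isOpen_univ) l (fun _ _ => rfl)
        (fun p hp => hbb p.1 hp.1 p.2) (x, ξ) ⟨hx, trivial⟩]
    · rw [image_eq_zero_of_notMem_tsupport fun h => hx (hφW h), zero_mul, zero_mul]
  simp_rw [e]
  rw [mul_sub, Finset.mul_sum]
  simp_rw [mul_left_comm]
  ring

/-- The composition theorem on an open set; c is any asymptotic sum of the Leibniz terms. Near (x₀,
y₀) one has C u = φ₁ A φ B u for suitable cutoffs, and both factors act through global symbols up to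
symbols of order -∞. Every resulting product except the main one has a factor of order -∞, and the
main one equals φ₁ c up to order -∞ by `sharp_sub`; so C - Op(c) has a smooth kernel locally. -/
theorem HasLeftSymbol.comp {A B C : Operator U} {m m' : ℝ} {a b c : Fn ι} (hA : HasLeftSymbol A a)
    (hB : HasLeftSymbol B b) (ha : IsSymbol U m a) (hb : IsSymbol U m' b)
    (hC : IsComposition A B C) (hAB : LocComposable A B)
    (hc : ∀ N : ℕ, IsSymbol U (m + m' - N) fun x ξ => c x ξ -
      ∑ l ∈ Finset.range N, ((l.factorial : ℂ))⁻¹ * leibTerm l a b x ξ) : HasLeftSymbol C c := by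
  have hcs : IsSymbol U (m + m') c := by
    have h := hc 0
    simpa only [Finset.range_zero, Finset.sum_empty, sub_zero, Nat.cast_zero] using h
  rw [hasLeftSymbol_iff hcs]
  refine isSmoothing_of_local _ fun x₀ hx₀ y₀ hy₀ => ?_
  obtain ⟨M, hM, hyM, hMU⟩ := exists_compact_subset U.isOpen hy₀
  obtain ⟨V, hV, hxV, hVU, L, hL, hLU, hCA⟩ := hC.eq_cutMul hAB hx₀ hM hMU
  obtain ⟨φ₁, V₁, hV₁, hxV₁, h₁⟩ := exists_cutoff_nhds hx₀
  -- The cutoff φ is one on L, so that it computes C u, and near the support of φ₁, so that it does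
  -- not affect the Leibniz terms there.
  obtain ⟨φ, -, W, hW, hLW, hφ⟩ := exists_cutoff (U := U) (hL.union φ₁.hasCompactSupport.isCompact)
    U.isOpen (Set.union_subset hLU φ₁.tsupport_subset) subset_rfl
  obtain ⟨φ₂, hφ₂⟩ := exists_cutoff_one φ.hasCompactSupport.isCompact φ.tsupport_subset
  obtain ⟨φ₃, hφ₃⟩ := exists_cutoff_one hM hMU
  obtain ⟨σ₁, hσ₁, hAσ⟩ := hA.local φ₁ φ₂
  obtain ⟨σ₂, hσ₂, hBσ⟩ := hB.local φ φ₃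
  have hga := ha.cut φ₁
  have hgb := hb.cut φ
  -- The symbol of the error: main product minus φ₁ c, and the three products with σ₁ or σ₂.
  let τ : Fn ι := fun x ξ => (sharp (fun x ξ => φ₁ x * a x ξ) (fun x ξ => φ x * b x ξ) x ξ -
    φ₁ x * c x ξ) + (sharp (fun x ξ => φ₁ x * a x ξ) σ₂ x ξ +
      (sharp σ₁ (fun x ξ => φ x * b x ξ) x ξ + sharp σ₁ σ₂ x ξ))
  have i1 := IsGlobal.sharp_sub ha φ₁ hW (Set.subset_union_right.trans hLW) hgb
    (fun x hx ξ => by rw [hφ x hx, one_mul]) hc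
  have i2 : ∀ s, IsGlobal s (sharp (fun x ξ => φ₁ x * a x ξ) σ₂) := fun s => by
    have := hga.sharp (hσ₂ (s - m))
    rwa [add_sub_cancel] at this
  have i3 : ∀ s, IsGlobal s (sharp σ₁ (fun x ξ => φ x * b x ξ)) := fun s => by
    have := (hσ₁ (s - m')).sharp hgb
    rwa [sub_add_cancel] at this
  have i4 : ∀ s, IsGlobal s (sharp σ₁ σ₂) := fun s => by
    have := (hσ₁ s).sharp (hσ₂ 0)
    rwa [add_zero] at this
  have hτ : ∀ s, IsGlobal s τ := fun s => (i1 s).add ((i2 s).add ((i3 s).add (i4 s)))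
  refine ⟨V ∩ V₁, interior M, hV.inter hV₁, isOpen_interior, ⟨hxV, hxV₁⟩, hyM,
    Set.inter_subset_left.trans hVU, interior_subset.trans hMU, kernelOf τ, smooth_kernelOf hτ,
    fun u hu x hx => ?_⟩
  have hu1 := u.contDiff
  have hu2 := u.hasCompactSupport
  have hxU := hVU hx.1
  have h1x := h₁ x hx.2
  rw [← opLeft_eq_kernelOf hτ hu1.continuous hu2, sub_apply_op, opOn_apply hcs u hxU,
    hCA u (hu.trans interior_subset) φ (fun y hy => hφ y (hLW (Or.inl hy))) x hx.1]
  have hv1 : ∀ y, φ₂ y * cutMul φ (B u) y = cutMul φ (B u) y := by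
    intro y
    rw [cutMul_apply]
    by_cases hy : y ∈ tsupport φ
    · rw [hφ₂ y hy, one_mul]
    · rw [image_eq_zero_of_notMem_tsupport hy]; simp
  have hv2 : (cutMul φ (B u) : Sp ι → ℂ) = fun y =>
      opLeft (fun x ξ => φ x * b x ξ) u y + opLeft σ₂ u y := by
    funext y
    rw [cutMul_apply, hBσ u _ y, opLeft_fun_mul]
    intro y
    by_cases hy : y ∈ tsupport u
    · rw [hφ₃ y (interior_subset (hu hy)), one_mul]
    · rw [image_eq_zero_of_notMem_tsupport hy, mul_zero]
  have e1 := hAσ _ hv1 x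
  rw [h1x, one_mul, one_mul, ← opLeft_cut a _ h1x, hv2] at e1
  have s1 := smooth_opLeft hgb hu1 hu2
  have s2 := hasCompactSupport_opLeft hgb u
  have s3 := smooth_opLeft (hσ₂ 0) hu1 hu2
  have s4 := hasCompactSupport_opLeft (hσ₂ 0) u
  rw [opLeft_add_right hga s1 s2 s3 s4, opLeft_add_right (hσ₁ 0) s1 s2 s3 s4,
    opLeft_opLeft hga hgb hu1 hu2, opLeft_opLeft hga (hσ₂ 0) hu1 hu2,
    opLeft_opLeft (hσ₁ 0) hgb hu1 hu2, opLeft_opLeft (hσ₁ 0) (hσ₂ 0) hu1 hu2] at e1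
  have e2 : opLeft (sharp (fun x ξ => φ₁ x * a x ξ) (fun x ξ => φ x * b x ξ)) u x =
      opLeft (fun x ξ => sharp (fun x ξ => φ₁ x * a x ξ) (fun x ξ => φ x * b x ξ) x ξ -
        φ₁ x * c x ξ) u x + opLeft c u x := by
    rw [← opLeft_cut c _ h1x, ← opLeft_add (i1 0) (hcs.cut φ₁) hu1 hu2]
    exact opLeft_congr _ fun ξ => by ring
  rw [e1, e2, opLeft_add (i1 0) ((i2 0).add ((i3 0).add (i4 0))) hu1 hu2,
    opLeft_add (i2 0) ((i3 0).add (i4 0)) hu1 hu2, opLeft_add (i3 0) (i4 0) hu1 hu2]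
  ring

end Operators

/-! ### Exhaustions and properly supported operators -/

section Proper

variable {ι : Type} [Fintype ι] [DecidableEq ι] {U : Opens (Sp ι)}

/-- A smooth exhaustion function of `U`. -/
structure IsExhaustion (U : Opens (Sp ι)) (κ : Sp ι → ℝ) : Prop where
  smooth : ContDiffOn ℝ ∞ κ U
  nonneg : ∀ x ∈ U, 0 ≤ κ x
  compact : ∀ r, IsCompact {x | x ∈ U ∧ κ x ≤ r}

/-- Take κ = (1 + |x|²) / f, where f is smooth with values in [0, 1] and positive exactly on U. The
sublevel sets {1 + |x|² ≤ r f} are closed in the whole space, bounded, and contained in U. -/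
theorem exists_isExhaustion (U : Opens (Sp ι)) : ∃ κ, IsExhaustion U κ := by
  obtain ⟨f, hfs, hf, hf0⟩ := U.isOpen.exists_contDiff_support_eq (n := ⊤)
  have hf0' : ∀ x, 0 ≤ f x := fun x => (hf0 ⟨x, rfl⟩).1
  have hf1 : ∀ x, f x ≤ 1 := fun x => (hf0 ⟨x, rfl⟩).2
  have hpos : ∀ x ∈ U, 0 < f x := fun x hx => by
    have : x ∈ Function.support f := by rw [hfs]; exact hx
    exact lt_of_le_of_ne (hf0' x) (Ne.symm this)
  refine ⟨fun x => (1 + ‖x‖ ^ 2) / f x, ?_, ?_, fun r => ?_⟩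
  · have h1 : ContDiff ℝ ∞ fun x : Sp ι => 1 + ‖x‖ ^ 2 := contDiff_const.add (contDiff_norm_sq ℝ)
    exact h1.contDiffOn.div hf.contDiffOn fun x hx => (hpos x hx).ne'
  · intro x hx
    have := hpos x hx
    positivity
  · have e : {x | x ∈ U ∧ (1 + ‖x‖ ^ 2) / f x ≤ r} = {x | 1 + ‖x‖ ^ 2 ≤ r * f x} := by
      ext x
      constructor
      · rintro ⟨hx, h⟩
        exact (div_le_iff₀ (hpos x hx)).1 h
      · intro h
        have h' : 1 + ‖x‖ ^ 2 ≤ r * f x := h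
        have hx : x ∈ U := by
          have h2 : f x ≠ 0 := fun h0 => by
            rw [h0, mul_zero] at h'
            nlinarith [sq_nonneg ‖x‖]
          have h3 : x ∈ Function.support f := h2
          rw [hfs] at h3
          exact h3
        exact ⟨hx, (div_le_iff₀ (hpos x hx)).2 h'⟩
    rw [e]
    refine Metric.isCompact_of_isClosed_isBounded ?_ ?_
    · exact isClosed_le (by fun_prop) (continuous_const.mul hf.continuous)
    · refine (Metric.isBounded_closedBall (x := (0 : Sp ι)) (r := |r| + 1)).subset fun x hx => ?_
      have h' : 1 + ‖x‖ ^ 2 ≤ r * f x := hx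
      have h2 : r * f x ≤ |r| := by
        calc r * f x ≤ |r| * f x := mul_le_mul_of_nonneg_right (le_abs_self r) (hf0' x)
          _ ≤ |r| * 1 := mul_le_mul_of_nonneg_left (hf1 x) (abs_nonneg r)
          _ = |r| := mul_one _
      rw [mem_closedBall_zero_iff]
      nlinarith [sq_nonneg (‖x‖ - 1), norm_nonneg x]

/-- The test function `g ∘ κ` for an exhaustion function `κ`. -/
noncomputable def IsExhaustion.test {κ : Sp ι → ℝ} (hκ : IsExhaustion U κ) (g : ℝ → ℝ)
    (hg : ContDiff ℝ ∞ g) (R : ℝ) (hR : ∀ t, R ≤ t → g t = 0) : 𝓓(U, ℂ) where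
  toFun := Set.indicator U fun x => ((g (κ x) : ℝ) : ℂ)
  contDiff' := by
    rw [contDiff_iff_contDiffAt]
    intro x
    by_cases hx : x ∈ {x | x ∈ U ∧ κ x ≤ R}
    · have h1 : ContDiffAt ℝ ∞ (fun x => ((g (κ x) : ℝ) : ℂ)) x :=
        Complex.ofRealCLM.contDiff.contDiffAt.comp x
          (hg.contDiffAt.comp x (hκ.smooth.contDiffAt (U.isOpen.mem_nhds hx.1)))
      refine h1.congr_of_eventuallyEq ?_
      filter_upwards [U.isOpen.mem_nhds hx.1] with y hy using Set.indicator_of_mem hy _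
    · refine (contDiffAt_const (c := (0 : ℂ))).congr_of_eventuallyEq ?_
      filter_upwards [(hκ.compact R).isClosed.isOpen_compl.mem_nhds hx] with y hy
      by_cases hyU : y ∈ U
      · rw [Set.indicator_of_mem (show y ∈ (U : Set (Sp ι)) from hyU), hR]
        · simp
        · by_contra hlt
          exact hy ⟨hyU, (not_le.1 hlt).le⟩
      · exact Set.indicator_of_notMem hyU _
  hasCompactSupport' := by
    refine HasCompactSupport.intro (hκ.compact R) fun x hx => ?_
    by_cases hxU : x ∈ U
    · rw [Set.indicator_of_mem (show x ∈ (U : Set (Sp ι)) from hxU), hR]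
      · simp
      · by_contra hlt
        exact hx ⟨hxU, (not_le.1 hlt).le⟩
    · exact Set.indicator_of_notMem hxU _
  tsupport_subset' := by
    refine subset_trans (closure_minimal (t := {x | x ∈ U ∧ κ x ≤ R}) (fun x hx => ?_)
      (hκ.compact R).isClosed) fun x hx => hx.1
    by_contra hn
    refine hx ?_
    by_cases hxU : x ∈ U
    · rw [Set.indicator_of_mem (show x ∈ (U : Set (Sp ι)) from hxU), hR]
      · simp
      · by_contra hlt
        exact hn ⟨hxU, (not_le.1 hlt).le⟩
    · exact Set.indicator_of_notMem hxU _

theorem IsExhaustion.test_apply {κ : Sp ι → ℝ} (hκ : IsExhaustion U κ) (g : ℝ → ℝ)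
    (hg : ContDiff ℝ ∞ g) (R : ℝ) (hR : ∀ t, R ≤ t → g t = 0) {x : Sp ι} (hx : x ∈ U) :
    hκ.test g hg R hR x = ((g (κ x) : ℝ) : ℂ) := by
  change Set.indicator U (fun x => ((g (κ x) : ℝ) : ℂ)) x = _
  exact Set.indicator_of_mem (show x ∈ (U : Set (Sp ι)) from hx) _

theorem IsExhaustion.tsupport_test {κ : Sp ι → ℝ} (hκ : IsExhaustion U κ) (g : ℝ → ℝ)
    (hg : ContDiff ℝ ∞ g) (R : ℝ) (hR : ∀ t, R ≤ t → g t = 0) {s : Set ℝ} (hs : IsClosed s)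
    (h : ∀ t ∉ s, g t = 0) : ∀ x ∈ tsupport (hκ.test g hg R hR), κ x ∈ s := by
  intro x hx
  have hxU := (hκ.test g hg R hR).tsupport_subset hx
  by_contra hxs
  have h1 : ContinuousAt κ x := hκ.smooth.continuousOn.continuousAt (U.isOpen.mem_nhds hxU)
  have h2 : hκ.test g hg R hR =ᶠ[nhds x] 0 := by
    filter_upwards [h1 (hs.isOpen_compl.mem_nhds hxs), U.isOpen.mem_nhds hxU] with y hy hyU
    rw [hκ.test_apply g hg R hR hyU, h _ hy]
    simp
  exact notMem_tsupport_iff_eventuallyEq.2 h2 hx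

/-- A smooth step of a partition of unity on the line. -/
noncomputable def stepFun (a b : ℝ) (t : ℝ) : ℝ :=
  Real.smoothTransition (t - a) - Real.smoothTransition (t - b)

theorem contDiff_stepFun (a b : ℝ) : ContDiff ℝ ∞ (stepFun a b) :=
  (Real.smoothTransition.contDiff.comp (contDiff_id.sub contDiff_const)).sub
    (Real.smoothTransition.contDiff.comp (contDiff_id.sub contDiff_const))

theorem stepFun_eq_zero_left {a b t : ℝ} (hab : a ≤ b) (h : t ≤ a) : stepFun a b t = 0 := by
  rw [stepFun, Real.smoothTransition.zero_of_nonpos (by linarith),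
    Real.smoothTransition.zero_of_nonpos (by linarith), sub_zero]

theorem stepFun_eq_zero_right {a b t : ℝ} (hab : a ≤ b) (h : b + 1 ≤ t) : stepFun a b t = 0 := by
  rw [stepFun, Real.smoothTransition.one_of_one_le (by linarith),
    Real.smoothTransition.one_of_one_le (by linarith), sub_self]

theorem stepFun_eq_one {a b t : ℝ} (h : a + 1 ≤ t) (h' : t ≤ b) : stepFun a b t = 1 := by
  rw [stepFun, Real.smoothTransition.one_of_one_le (by linarith),
    Real.smoothTransition.zero_of_nonpos (by linarith), sub_zero]

theorem sum_stepFun {t : ℝ} (ht : 0 ≤ t) {N : ℕ} (hN : t + 1 ≤ N) :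
    ∑ j ∈ Finset.range N, stepFun ((j : ℝ) - 1) j t = 1 := by
  -- The sum telescopes.
  have h : ∀ N : ℕ, ∑ j ∈ Finset.range N, stepFun ((j : ℝ) - 1) j t =
      Real.smoothTransition (t + 1) - Real.smoothTransition (t + 1 - N) := by
    intro N
    induction N with
    | zero => simp
    | succ N ih =>
      rw [Finset.sum_range_succ, ih, stepFun]
      push_cast
      rw [show t - ((N : ℝ) - 1) = t + 1 - N by ring, show t + 1 - ((N : ℝ) + 1) = t - N by ring]
      ring
  rw [h, Real.smoothTransition.one_of_one_le (by linarith),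
    Real.smoothTransition.zero_of_nonpos (by linarith), sub_zero]

variable {κ : Sp ι → ℝ} (hκ : IsExhaustion U κ)

/-- The partition of unity subordinate to the shells of an exhaustion. -/
noncomputable def IsExhaustion.shell (j : ℕ) : 𝓓(U, ℂ) :=
  hκ.test (stepFun ((j : ℝ) - 1) j) (contDiff_stepFun _ _) (j + 1)
    fun _ h => stepFun_eq_zero_right (by linarith) h

/-- Cutoff functions that are one near the shells of an exhaustion. -/
noncomputable def IsExhaustion.wide (j : ℕ) : 𝓓(U, ℂ) :=
  hκ.test (stepFun ((j : ℝ) - 3) (j + 2)) (contDiff_stepFun _ _) (j + 2 + 1)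
    fun _ h => stepFun_eq_zero_right (by linarith) h

theorem IsExhaustion.shell_eq_zero {j : ℕ} {x : Sp ι} (hx : x ∈ U) (h : κ x + 1 ≤ j) :
    hκ.shell j x = 0 := by
  rw [shell, hκ.test_apply _ _ _ _ hx, stepFun_eq_zero_left (by linarith) (by linarith)]
  simp

theorem IsExhaustion.sum_shell {x : Sp ι} (hx : x ∈ U) {N : ℕ} (hN : κ x + 1 ≤ N) :
    ∑ j ∈ Finset.range N, hκ.shell j x = 1 := by
  have := sum_stepFun (hκ.nonneg x hx) hN
  have h2 := congrArg (fun t : ℝ => (t : ℂ)) this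
  simp only [Complex.ofReal_sum, Complex.ofReal_one] at h2
  rw [← h2]
  exact Finset.sum_congr rfl fun j _ => hκ.test_apply _ _ _ _ hx

theorem IsExhaustion.wide_eq_one {j : ℕ} {x : Sp ι} (hx : x ∈ U) (h : (j : ℝ) - 2 ≤ κ x)
    (h' : κ x ≤ j + 2) : hκ.wide j x = 1 := by
  rw [wide, hκ.test_apply _ _ _ _ hx, stepFun_eq_one (by linarith) h']
  simp

theorem IsExhaustion.tsupport_shell {j : ℕ} {x : Sp ι} (hx : x ∈ tsupport (hκ.shell j)) :
    (j : ℝ) - 1 ≤ κ x ∧ κ x ≤ j + 1 := by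
  refine hκ.tsupport_test _ _ _ _ (isClosed_Icc (a := (j : ℝ) - 1) (b := j + 1)) (fun t ht => ?_) x hx
  by_cases h : t ≤ (j : ℝ) - 1
  · exact stepFun_eq_zero_left (by linarith) h
  · refine stepFun_eq_zero_right (by linarith) ?_
    by_contra h2
    exact ht ⟨(not_le.1 h).le, (not_le.1 h2).le⟩

theorem IsExhaustion.tsupport_wide {j : ℕ} {x : Sp ι} (hx : x ∈ tsupport (hκ.wide j)) :
    (j : ℝ) - 3 ≤ κ x ∧ κ x ≤ j + 3 := by
  refine hκ.tsupport_test _ _ _ _ (isClosed_Icc (a := (j : ℝ) - 3) (b := j + 3)) (fun t ht => ?_) x hx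
  by_cases h : t ≤ (j : ℝ) - 3
  · exact stepFun_eq_zero_left (by linarith) h
  · refine stepFun_eq_zero_right (by linarith) ?_
    by_contra h2
    exact ht ⟨(not_le.1 h).le, by linarith [(not_le.1 h2).le]⟩

theorem IsExhaustion.isOpen_sublevel (hκ : IsExhaustion U κ) (r : ℝ) :
    IsOpen {x | x ∈ U ∧ κ x < r} := by
  have := hκ.smooth.continuousOn.isOpen_inter_preimage U.isOpen (isOpen_Iio (a := r))
  exact this

/-- The values of `properPart`. -/
noncomputable def IsExhaustion.properFun (A : Operator U) (u : 𝓓(U, ℂ)) : Sp ι → ℂ :=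
  Set.indicator U fun x => ∑ j ∈ Finset.range (⌈κ x⌉₊ + 1),
    hκ.shell j x * (A (mulTest (hκ.wide j) (hκ.wide j).contDiff u) : Sp ι → ℂ) x

/-- The operator `∑ⱼ φⱼ A χⱼ` with the partition of unity `φⱼ` and the wider cutoffs `χⱼ`. -/
noncomputable def IsExhaustion.properPart (A : Operator U) : Operator U where
  toFun u := ⟨hκ.properFun A u, by
    refine ⟨fun x hx => ?_, fun x hx => Set.indicator_of_notMem hx _⟩
    -- The number of summands depends on the point, but near x all shells with j ≥ N vanish, so the
    -- sum is locally one fixed finite sum of smooth functions.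
    obtain ⟨N, hN⟩ := exists_nat_gt (κ x + 1)
    refine ContDiffAt.contDiffWithinAt (ContDiffAt.congr_of_eventuallyEq
      (f := fun x => ∑ j ∈ Finset.range N,
        hκ.shell j x * (A (mulTest (hκ.wide j) (hκ.wide j).contDiff u) : Sp ι → ℂ) x) ?_ ?_)
    · refine ContDiffAt.sum fun j _ => ?_
      exact (hκ.shell j).contDiff.contDiffAt.mul
        ((A (mulTest (hκ.wide j) (hκ.wide j).contDiff u)).2.1.contDiffAt (U.isOpen.mem_nhds hx))
    · filter_upwards [(hκ.isOpen_sublevel (N - 1)).mem_nhds ⟨hx, by linarith⟩] with y hy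
      rw [properFun, Set.indicator_of_mem (show y ∈ (U : Set (Sp ι)) from hy.1)]
      have h1 : κ y < N - 1 := hy.2
      have h2 : κ y ≤ ⌈κ y⌉₊ := Nat.le_ceil _
      have h3 : ⌈κ y⌉₊ + 1 ≤ N := by
        have : ⌈κ y⌉₊ ≤ N - 1 := Nat.ceil_le.2 (by
          rw [Nat.cast_sub (by
            have := hκ.nonneg y hy.1
            have : (1 : ℝ) ≤ N := by linarith
            exact_mod_cast this)]
          simpa using h1.le)
        have : (1 : ℝ) ≤ N := by
          have := hκ.nonneg y hy.1
          linarith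
        have : 1 ≤ N := by exact_mod_cast this
        omega
      refine Finset.sum_subset (Finset.range_mono h3) fun j _ hj => ?_
      rw [hκ.shell_eq_zero hy.1, zero_mul]
      have : ⌈κ y⌉₊ + 1 ≤ j := by simpa using hj
      have : ((⌈κ y⌉₊ + 1 : ℕ) : ℝ) ≤ j := by exact_mod_cast this
      push_cast at this
      linarith⟩
  map_add' u v := by
    ext x
    change hκ.properFun A (u + v) x = hκ.properFun A u x + hκ.properFun A v x
    rw [properFun, properFun, properFun]
    by_cases hx : x ∈ (U : Set (Sp ι))
    · rw [Set.indicator_of_mem hx, Set.indicator_of_mem hx, Set.indicator_of_mem hx,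
        ← Finset.sum_add_distrib]
      refine Finset.sum_congr rfl fun j _ => ?_
      have : mulTest (hκ.wide j) (hκ.wide j).contDiff (u + v) =
          mulTest (hκ.wide j) (hκ.wide j).contDiff u +
          mulTest (hκ.wide j) (hκ.wide j).contDiff v := by
        ext y; exact mul_add _ _ _
      rw [this, map_add, ← mul_add]
      rfl
    · simp [Set.indicator_of_notMem hx]
  map_smul' c u := by
    ext x
    change hκ.properFun A (c • u) x = c * hκ.properFun A u x
    rw [properFun, properFun]
    by_cases hx : x ∈ (U : Set (Sp ι))
    · rw [Set.indicator_of_mem hx, Set.indicator_of_mem hx, Finset.mul_sum]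
      refine Finset.sum_congr rfl fun j _ => ?_
      have : mulTest (hκ.wide j) (hκ.wide j).contDiff (c • u) =
          c • mulTest (hκ.wide j) (hκ.wide j).contDiff u := by
        ext y; exact mul_left_comm _ _ _
      rw [this, map_smul, mul_left_comm]
      rfl
    · simp [Set.indicator_of_notMem hx]

theorem IsExhaustion.properPart_apply (A : Operator U) (u : 𝓓(U, ℂ)) {x : Sp ι} (hx : x ∈ U)
    {N : ℕ} (hN : κ x + 2 ≤ N) : (hκ.properPart A u : Sp ι → ℂ) x = ∑ j ∈ Finset.range N,
      hκ.shell j x * (A (mulTest (hκ.wide j) (hκ.wide j).contDiff u) : Sp ι → ℂ) x := by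
  have e : (hκ.properPart A u : Sp ι → ℂ) x = ∑ j ∈ Finset.range (⌈κ x⌉₊ + 1),
      hκ.shell j x * (A (mulTest (hκ.wide j) (hκ.wide j).contDiff u) : Sp ι → ℂ) x := by
    change hκ.properFun A u x = _
    exact Set.indicator_of_mem (show x ∈ (U : Set (Sp ι)) from hx) _
  rw [e]
  have h1 : ⌈κ x⌉₊ + 1 ≤ N := by
    have := Nat.ceil_lt_add_one (hκ.nonneg x hx)
    have h2 : ((⌈κ x⌉₊ + 1 : ℕ) : ℝ) < N := by push_cast; linarith
    exact_mod_cast h2.le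
  refine Finset.sum_subset (Finset.range_mono h1) fun j _ hj => ?_
  rw [hκ.shell_eq_zero hx, zero_mul]
  have : ⌈κ x⌉₊ + 1 ≤ j := by simpa using hj
  have : ((⌈κ x⌉₊ + 1 : ℕ) : ℝ) ≤ j := by exact_mod_cast this
  push_cast at this
  linarith [Nat.le_ceil (κ x)]

theorem isOpen_compl_kernelSupport (A : Operator U) :
    IsOpen {p : Sp ι × Sp ι | p.1 ∈ U ∧ p.2 ∈ U ∧ p ∉ kernelSupport A} := by
  rw [isOpen_iff_mem_nhds]
  rintro ⟨x, y⟩ ⟨hx, hy, h⟩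
  simp only [kernelSupport, Set.mem_ofPred_eq, not_and, not_forall] at h
  obtain ⟨V, W, hV, hW, hxV, hyW, hu⟩ := h hx hy
  filter_upwards [((hV.inter U.isOpen).prod (hW.inter U.isOpen)).mem_nhds
    ⟨⟨hxV, hx⟩, ⟨hyW, hy⟩⟩] with p hp
  exact ⟨hp.1.2, hp.2.2, fun hk => hu (hk.2.2 V W hV hW hp.1.1 hp.2.1)⟩

theorem isCompact_kernelSupport_inter (A : Operator U) {K : Set (Sp ι × Sp ι)} (hK : IsCompact K)
    (hKU : K ⊆ (U : Set (Sp ι)) ×ˢ (U : Set (Sp ι))) : IsCompact (kernelSupport A ∩ K) := by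
  have e : kernelSupport A ∩ K =
      K \ {p : Sp ι × Sp ι | p.1 ∈ U ∧ p.2 ∈ U ∧ p ∉ kernelSupport A} := by
    ext p
    constructor
    · rintro ⟨h1, h2⟩
      exact ⟨h2, fun h => h.2.2 h1⟩
    · rintro ⟨h1, h2⟩
      refine ⟨?_, h1⟩
      by_contra h3
      exact h2 ⟨(hKU h1).1, (hKU h1).2, h3⟩
  rw [e]
  exact hK.diff (isOpen_compl_kernelSupport A)

/-- In the j-th term κ(x) lies in [j - 1, j + 1] and κ(y) in [j - 3, j + 3], so the values differ by
at most 4; the bound 5 leaves some room. Such a strip over a compact set is compact, which yields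
proper support. -/
theorem IsExhaustion.kernelSupport_properPart (A : Operator U) {p : Sp ι × Sp ι}
    (hp : p ∈ kernelSupport (hκ.properPart A)) : |κ p.1 - κ p.2| ≤ 5 := by
  obtain ⟨hx, hy, h⟩ := hp
  by_contra hlt
  have c1 : ContinuousOn (fun q : Sp ι × Sp ι => |κ q.1 - κ q.2|)
      ((U : Set (Sp ι)) ×ˢ (U : Set (Sp ι))) :=
    ((hκ.smooth.continuousOn.comp continuousOn_fst fun q hq => hq.1).sub
      (hκ.smooth.continuousOn.comp continuousOn_snd fun q hq => hq.2)).abs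
  have hO := c1.isOpen_inter_preimage (U.isOpen.prod U.isOpen) (isOpen_Ioi (a := (5 : ℝ)))
  obtain ⟨V, W, hV, hW, hxV, hyW, hVW⟩ := isOpen_prod_iff.1 hO p.1 p.2 ⟨⟨hx, hy⟩, not_le.1 hlt⟩
  obtain ⟨u, hu, x, hxV', hne⟩ := h V W hV hW hxV hyW
  have hxU : x ∈ U := (hVW (show (x, p.2) ∈ V ×ˢ W from ⟨hxV', hyW⟩)).1.1
  obtain ⟨N, hN⟩ := exists_nat_ge (κ x + 2)
  refine hne ?_
  rw [hκ.properPart_apply A u hxU hN]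
  refine Finset.sum_eq_zero fun j _ => ?_
  by_cases hj : x ∈ tsupport (hκ.shell j)
  · have h1 := hκ.tsupport_shell hj
    have : mulTest (hκ.wide j) (hκ.wide j).contDiff u = 0 := by
      ext y
      change hκ.wide j y * u y = 0
      by_cases hyu : y ∈ tsupport u
      · by_cases hyj : y ∈ tsupport (hκ.wide j)
        · have h2 := hκ.tsupport_wide hyj
          have h3 : 5 < |κ x - κ y| := (hVW (show (x, y) ∈ V ×ˢ W from ⟨hxV', hu hyu⟩)).2
          exfalso
          rcases lt_abs.1 h3 with h4 | h4 <;> linarith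
        · rw [image_eq_zero_of_notMem_tsupport hyj, zero_mul]
      · rw [image_eq_zero_of_notMem_tsupport hyu, mul_zero]
    rw [this, map_zero]
    exact mul_zero _
  · rw [image_eq_zero_of_notMem_tsupport hj, zero_mul]

theorem IsExhaustion.isProperlySupported_properPart (A : Operator U) :
    IsProperlySupported (hκ.properPart A) := by
  intro L hL hLU
  obtain ⟨C, hC⟩ := hL.bddAbove_image (hκ.smooth.continuousOn.mono hLU)
  have hC' : ∀ x ∈ L, κ x ≤ C := fun x hx => hC ⟨x, hx, rfl⟩
  constructor
  · have e : kernelSupport (hκ.properPart A) ∩ Prod.fst ⁻¹' L =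
        kernelSupport (hκ.properPart A) ∩ (L ×ˢ {x | x ∈ U ∧ κ x ≤ C + 5}) := by
      ext p
      refine ⟨fun h => ⟨h.1, h.2, h.1.2.1, ?_⟩, fun h => ⟨h.1, h.2.1⟩⟩
      have h1 := hκ.kernelSupport_properPart A h.1
      have h2 := hC' _ h.2
      linarith [neg_abs_le (κ p.1 - κ p.2)]
    rw [e]
    exact isCompact_kernelSupport_inter _ (hL.prod (hκ.compact _))
      (Set.prod_mono hLU fun x hx => hx.1)
  · have e : kernelSupport (hκ.properPart A) ∩ Prod.snd ⁻¹' L =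
        kernelSupport (hκ.properPart A) ∩ ({x | x ∈ U ∧ κ x ≤ C + 5} ×ˢ L) := by
      ext p
      refine ⟨fun h => ⟨h.1, ⟨h.1.1, ?_⟩, h.2⟩, fun h => ⟨h.1, h.2.2⟩⟩
      have h1 := hκ.kernelSupport_properPart A h.1
      have h2 := hC' _ h.2
      change κ p.1 ≤ C + 5
      linarith [le_abs_self (κ p.1 - κ p.2)]
    rw [e]
    exact isCompact_kernelSupport_inter _ ((hκ.compact _).prod hL)
      (Set.prod_mono (fun x hx => hx.1) hLU)

theorem leibTerm_zero_right (l : ℕ) : ∀ a : Fn ι, leibTerm l a (fun _ _ => 0) = fun _ _ => 0 := by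
  induction l with
  | zero => intro a; funext x ξ; simp [leibTerm]
  | succ l ih =>
    intro a
    have h : ∀ i : ι, (fun x ξ => -Complex.I * dx i (fun _ _ => 0 : Fn ι) x ξ) = fun _ _ => 0 := by
      intro i
      have := pd_zero (Sum.inl i)
      simp only [pd] at this
      rw [this]
      simp
    simp only [leibTerm, h, ih, Finset.sum_const_zero]

theorem continuous_right {k : Fn ι} (hk : ContDiff ℝ ∞ (unc k)) (x : Sp ι) :
    Continuous fun y => k x y :=
  hk.continuous.comp (by fun_prop : Continuous fun y : Sp ι => (x, y))

/-- Every left symbol is the left symbol of a properly supported operator. -/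
theorem exists_properlySupported {m : ℝ} {a : Fn ι} (ha : IsSymbol U m a) :
    ∃ P : Operator U, IsProperlySupported P ∧ HasLeftSymbol P a := by
  obtain ⟨κ, hκ⟩ := exists_isExhaustion U
  refine ⟨hκ.properPart (opOn a ha), hκ.isProperlySupported_properPart _, ?_⟩
  rw [hasLeftSymbol_iff ha]
  refine isSmoothing_of_local _ fun x₀ hx₀ y₀ hy₀ => ?_
  obtain ⟨φ, W, hW, hyW, hφ⟩ := exists_cutoff_nhds hy₀
  obtain ⟨N, hN⟩ := exists_nat_gt (κ x₀ + 2)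
  let b : ℕ → Sp ι → ℂ := fun j x => (hκ.wide j x - 1) * φ x
  have hbs : ∀ j, ContDiff ℝ ∞ (b j) := fun j =>
    ((hκ.wide j).contDiff.sub contDiff_const).mul φ.contDiff
  have hbc : ∀ j, HasCompactSupport (b j) := fun j => φ.hasCompactSupport.mul_left
  have hbg : ∀ j, IsGlobal 0 fun x _ => b j x := fun j => IsGlobal.of_fun (hbs j) (hbc j)
  -- The error of the j-th term is φ_j a # (χ_j - 1)φ, where φ = 1 near y₀. As χ_j = 1 near the
  -- support of φ_j, all Leibniz terms vanish there and τ j has order -∞.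
  let τ : ℕ → Fn ι := fun j => sharp (fun x ξ => hκ.shell j x * a x ξ) fun x _ => b j x
  have hτ : ∀ j s, IsGlobal s (τ j) := by
    intro j s
    have h := IsGlobal.sharp_sub (b := fun _ _ => 0) (c := fun _ _ => 0) ha (hκ.shell j)
      (hκ.isOpen_sublevel (j + 2) |>.inter
        (hκ.smooth.continuousOn.isOpen_inter_preimage U.isOpen (isOpen_Ioi (a := (j : ℝ) - 2))))
      ?_ (hbg j) ?_ ?_ s
    · simpa using h
    · intro x hx
      have := hκ.tsupport_shell hx
      have hxU := (hκ.shell j).tsupport_subset hx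
      exact ⟨⟨hxU, by linarith⟩, hxU, show (j : ℝ) - 2 < κ x by linarith⟩
    · rintro x ⟨⟨hx, h1⟩, -, h2⟩ ξ
      have h2' : (j : ℝ) - 2 < κ x := h2
      simp only [b]
      rw [hκ.wide_eq_one hx h2'.le h1.le, sub_self, zero_mul]
    · intro n
      refine (isSymbol_zero U _).congr fun x _ ξ => ?_
      simp [leibTerm_zero_right]
  refine ⟨{x | x ∈ U ∧ κ x < N - 2}, W ∩ U, hκ.isOpen_sublevel _, hW.inter U.isOpen,
    ⟨hx₀, by linarith⟩, ⟨hyW, hy₀⟩, fun x hx => hx.1, Set.inter_subset_right,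
    fun x y => ∑ j ∈ Finset.range N, kernelOf (τ j) x y, ?_, fun u hu x hx => ?_⟩
  · exact ContDiff.sum fun j _ => smooth_kernelOf (hτ j)
  · have hxN : κ x + 2 ≤ N := by linarith [hx.2]
    have hu1 := u.contDiff
    have hu2 := u.hasCompactSupport
    rw [sub_apply_op, hκ.properPart_apply _ u hx.1 hxN, opOn_apply ha u hx.1]
    -- The partition of unity is inserted in front of Op(a), to compare term by term.
    have e1 : opLeft a u x = ∑ j ∈ Finset.range N, hκ.shell j x * opLeft a u x := by
      rw [← Finset.sum_mul, hκ.sum_shell hx.1 (by linarith), one_mul]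
    rw [e1, ← Finset.sum_sub_distrib]
    have hint : ∀ j, Integrable fun y => kernelOf (τ j) x y * u y := fun j => by
      have h1 := continuous_right (smooth_kernelOf (hτ j)) x
      exact (h1.mul hu1.continuous).integrable_of_hasCompactSupport hu2.mul_left
    simp_rw [Finset.sum_mul]
    rw [integral_finsetSum _ fun j _ => hint j]
    refine Finset.sum_congr rfl fun j _ => ?_
    rw [← opLeft_eq_kernelOf (hτ j) hu1.continuous hu2, opOn_apply ha _ hx.1]
    have hg := ha.cut (hκ.shell j)
    rw [← opLeft_opLeft hg (hbg j) hu1 hu2, ← opLeft_fun_mul, ← opLeft_fun_mul]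
    have e2 : opLeft (fun x _ => b j x) u = fun y => b j y * u y :=
      funext fun y => opLeft_fun hu1 hu2 y
    have e3 : (mulTest (hκ.wide j) (hκ.wide j).contDiff u : Sp ι → ℂ) =
        fun y => b j y * u y + u y := by
      funext y
      rw [mulTest_apply]
      simp only [b]
      by_cases hy : y ∈ tsupport u
      · rw [hφ y (hu hy).1]; ring
      · rw [image_eq_zero_of_notMem_tsupport hy]; ring
    rw [e2, e3, opLeft_add_right hg ((hbs j).mul hu1) hu2.mul_left hu1 hu2]
    ring

end Proper

/-! ### Symbols near infinity and homogeneous functions -/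

section Tail

variable {ι : Type} [Fintype ι] [DecidableEq ι] {U : Opens (Sp ι)}

/-- `b` agrees with a symbol of order `m` for large covariables. -/
def TailSym (U : Opens (Sp ι)) (m : ℝ) (b : Fn ι) : Prop :=
  ∃ a, IsSymbol U m a ∧ ∀ L : Set (Sp ι), IsCompact L → L ⊆ U →
    ∃ R : ℝ, ∀ x ∈ L, ∀ ξ, R ≤ ‖ξ‖ → b x ξ = a x ξ

theorem IsSymbol.tail {m : ℝ} {a : Fn ι} (ha : IsSymbol U m a) : TailSym U m a :=
  ⟨a, ha, fun _ _ _ => ⟨0, fun _ _ _ _ => rfl⟩⟩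

/-- Two smooth functions that agree for large covariables, locally uniformly in x, differ by a
symbol of every order. Thus homogeneous functions, singular at ξ = 0, can be handled through their
tails without excision functions. -/
theorem TailSym.isSymbol {m : ℝ} {b : Fn ι} (hb : TailSym U m b) (hs : Smooth (cyl U) b) :
    IsSymbol U m b := by
  obtain ⟨a, ha, h⟩ := hb
  have h1 : IsSymbol U m fun x ξ => b x ξ - a x ξ := by
    refine isSymbol_of_compact (hs.sub ha.smooth) (fun L hL hLU => ?_) m
    obtain ⟨R, hR⟩ := h L hL hLU
    exact ⟨R, fun x hx ξ hξ => by rw [hR x hx ξ hξ, sub_self]⟩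
  exact (ha.add h1).congr fun x _ ξ => by ring

theorem TailSym.congr {m : ℝ} {b b' : Fn ι} (hb : TailSym U m b)
    (h : ∀ L : Set (Sp ι), IsCompact L → L ⊆ U →
      ∃ R : ℝ, ∀ x ∈ L, ∀ ξ, R ≤ ‖ξ‖ → b' x ξ = b x ξ) : TailSym U m b' := by
  obtain ⟨a, ha, h1⟩ := hb
  refine ⟨a, ha, fun L hL hLU => ?_⟩
  obtain ⟨R, hR⟩ := h L hL hLU
  obtain ⟨R', hR'⟩ := h1 L hL hLU
  exact ⟨max R R', fun x hx ξ hξ => (hR x hx ξ ((le_max_left _ _).trans hξ)).trans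
    (hR' x hx ξ ((le_max_right _ _).trans hξ))⟩

theorem TailSym.congr' {m : ℝ} {b b' : Fn ι} (hb : TailSym U m b)
    (h : ∀ x ∈ U, ∀ ξ ≠ 0, b' x ξ = b x ξ) : TailSym U m b' :=
  hb.congr fun _ _ hLU => ⟨1, fun x hx ξ hξ => h x (hLU hx) ξ fun h0 => by
    rw [h0, norm_zero] at hξ
    linarith⟩

theorem TailSym.mono {m m' : ℝ} {b : Fn ι} (hb : TailSym U m b) (h : m ≤ m') : TailSym U m' b := by
  obtain ⟨a, ha, h1⟩ := hb
  exact ⟨a, ha.mono h, h1⟩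

theorem TailSym.restrict {V : Opens (Sp ι)} {m : ℝ} {b : Fn ι} (hb : TailSym U m b) (h : V ≤ U) :
    TailSym V m b := by
  obtain ⟨a, ha, h1⟩ := hb
  exact ⟨a, ha.restrict h, fun L hL hLV => h1 L hL (hLV.trans h)⟩

theorem TailSym.op₂ {m₁ m₂ m : ℝ} {b₁ b₂ : Fn ι} (h₁ : TailSym U m₁ b₁) (h₂ : TailSym U m₂ b₂)
    (f : ℂ → ℂ → ℂ) (hf : ∀ a₁ a₂ : Fn ι, IsSymbol U m₁ a₁ → IsSymbol U m₂ a₂ →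
      IsSymbol U m fun x ξ => f (a₁ x ξ) (a₂ x ξ)) :
    TailSym U m fun x ξ => f (b₁ x ξ) (b₂ x ξ) := by
  obtain ⟨a₁, ha₁, h₁⟩ := h₁
  obtain ⟨a₂, ha₂, h₂⟩ := h₂
  refine ⟨_, hf a₁ a₂ ha₁ ha₂, fun L hL hLU => ?_⟩
  obtain ⟨R, hR⟩ := h₁ L hL hLU
  obtain ⟨R', hR'⟩ := h₂ L hL hLU
  exact ⟨max R R', fun x hx ξ hξ => by
    simp only
    rw [hR x hx ξ ((le_max_left _ _).trans hξ), hR' x hx ξ ((le_max_right _ _).trans hξ)]⟩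

theorem TailSym.add {m : ℝ} {a b : Fn ι} (ha : TailSym U m a) (hb : TailSym U m b) :
    TailSym U m fun x ξ => a x ξ + b x ξ :=
  ha.op₂ hb (· + ·) fun _ _ h h' => h.add h'

theorem TailSym.sub {m : ℝ} {a b : Fn ι} (ha : TailSym U m a) (hb : TailSym U m b) :
    TailSym U m fun x ξ => a x ξ - b x ξ :=
  ha.op₂ hb (· - ·) fun _ _ h h' => h.sub h'

theorem TailSym.mul {m m' : ℝ} {a b : Fn ι} (ha : TailSym U m a) (hb : TailSym U m' b) :
    TailSym U (m + m') fun x ξ => a x ξ * b x ξ :=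
  ha.op₂ hb (· * ·) fun _ _ h h' => h.mul h'

theorem TailSym.sum {m : ℝ} {κ : Type*} {s : Finset κ} {a : κ → Fn ι}
    (ha : ∀ j ∈ s, TailSym U m (a j)) : TailSym U m fun x ξ => ∑ j ∈ s, a j x ξ := by
  classical
  induction s using Finset.induction_on with
  | empty => simpa using (isSymbol_zero U m).tail
  | insert j s hj ih =>
    simp only [Finset.sum_insert hj]
    exact (ha j (Finset.mem_insert_self j s)).add (ih fun i hi => ha i (Finset.mem_insert_of_mem hi))

theorem TailSym.pd {m : ℝ} {b : Fn ι} (hb : TailSym U m b) (d : ι ⊕ ι) :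
    TailSym U (m - gain d) (pd d b) := by
  obtain ⟨a, ha, h⟩ := hb
  refine ⟨_, ha.pd d, fun L hL hLU => ?_⟩
  obtain ⟨L', hL', hLL', hLU'⟩ := exists_compact_between hL U.isOpen hLU
  obtain ⟨R, hR⟩ := h L' hL' hLU'
  refine ⟨R + 1, fun x hx ξ hξ => ?_⟩
  have hO : IsOpen (interior L' ×ˢ {ξ : Sp ι | R < ‖ξ‖}) :=
    isOpen_interior.prod (isOpen_lt continuous_const continuous_norm)
  exact pd_congr hO (fun p hp => hR p.1 (interior_subset hp.1) p.2 (le_of_lt hp.2)) d (x, ξ)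
    ⟨hLL' hx, show R < ‖ξ‖ by linarith⟩

/-- The phase space without the zero section. -/
abbrev pcyl (U : Opens (Sp ι)) : Set (Sp ι × Sp ι) := (U : Set (Sp ι)) ×ˢ {0}ᶜ

theorem isOpen_pcyl (U : Opens (Sp ι)) : IsOpen (pcyl U) := U.isOpen.prod isOpen_compl_singleton

theorem pcyl_subset (U : Opens (Sp ι)) : pcyl U ⊆ cyl U :=
  Set.prod_mono subset_rfl (Set.subset_univ _)

theorem Smooth.mono {O O' : Set (Sp ι × Sp ι)} {a : Fn ι} (h : Smooth O a) (hO : O' ⊆ O) :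
    Smooth O' a := ContDiffOn.mono h hO

/-- Functions that are homogeneous in the covariables, smooth away from the zero section. -/
structure Hom (U : Opens (Sp ι)) (m : ℝ) (h : Fn ι) : Prop where
  smooth : Smooth (pcyl U) h
  hom : ∀ x ∈ U, ∀ ξ ≠ 0, ∀ t : ℝ, 0 < t → h x (t • ξ) = ((t ^ m : ℝ) : ℂ) * h x ξ

theorem Hom.of_fst {f : Sp ι → ℂ} (hf : ContDiffOn ℝ ∞ f U) : Hom U 0 fun x _ => f x where
  smooth := (isSymbol_of_fst hf).smooth.mono (pcyl_subset U)
  hom x _ ξ _ t _ := by simp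

theorem Hom.coord (i : ι) : Hom U 1 fun _ ξ => (ξ i : ℂ) where
  smooth := (isSymbol_coord U i).smooth.mono (pcyl_subset U)
  hom x _ ξ _ t _ := by simp

theorem Hom.add {m : ℝ} {a b : Fn ι} (ha : Hom U m a) (hb : Hom U m b) :
    Hom U m fun x ξ => a x ξ + b x ξ where
  smooth := ha.smooth.add hb.smooth
  hom x hx ξ hξ t ht := by rw [ha.hom x hx ξ hξ t ht, hb.hom x hx ξ hξ t ht, mul_add]

theorem Hom.mul {m m' : ℝ} {a b : Fn ι} (ha : Hom U m a) (hb : Hom U m' b) :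
    Hom U (m + m') fun x ξ => a x ξ * b x ξ where
  smooth := ha.smooth.mul hb.smooth
  hom x hx ξ hξ t ht := by
    rw [ha.hom x hx ξ hξ t ht, hb.hom x hx ξ hξ t ht, Real.rpow_add ht]
    push_cast
    ring

theorem Hom.zero (m : ℝ) : Hom U m fun _ _ => 0 where
  smooth := Smooth.const 0
  hom _ _ _ _ _ _ := by simp

theorem Hom.const_mul {m : ℝ} {a : Fn ι} (c : ℂ) (ha : Hom U m a) :
    Hom U m fun x ξ => c * a x ξ := by
  have := (Hom.of_fst (U := U) (f := fun _ => c) contDiffOn_const).mul ha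
  rwa [zero_add] at this

theorem Hom.sum {m : ℝ} {κ : Type*} {s : Finset κ} {a : κ → Fn ι}
    (ha : ∀ j ∈ s, Hom U m (a j)) : Hom U m fun x ξ => ∑ j ∈ s, a j x ξ := by
  classical
  induction s using Finset.induction_on with
  | empty => simpa using Hom.zero m
  | insert j s hj ih =>
    simp only [Finset.sum_insert hj]
    exact (ha j (Finset.mem_insert_self j s)).add (ih fun i hi => ha i (Finset.mem_insert_of_mem hi))

theorem Hom.congr {m : ℝ} {a b : Fn ι} (ha : Hom U m a)
    (h : ∀ x ∈ U, ∀ ξ ≠ 0, b x ξ = a x ξ) : Hom U m b where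
  smooth := ha.smooth.congr fun p hp => h p.1 hp.1 p.2 hp.2
  hom x hx ξ hξ t ht := by
    rw [h x hx ξ hξ, h x hx _ (smul_ne_zero ht.ne' hξ), ha.hom x hx ξ hξ t ht]

theorem Hom.pd {m : ℝ} {h : Fn ι} (hh : Hom U m h) (d : ι ⊕ ι) :
    Hom U (m - gain d) (pd d h) where
  smooth := hh.smooth.pd (isOpen_pcyl U) d
  hom x hx ξ hξ t ht := by
    cases d with
    | inl i =>
      simp only [CornerPsiDO.pd, dx, gain, sub_zero]
      have e : (fun x' => h x' (t • ξ)) =ᶠ[nhds x] fun x' => ((t ^ m : ℝ) : ℂ) * h x' ξ := by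
        filter_upwards [U.isOpen.mem_nhds hx] with x' hx' using hh.hom x' hx' ξ hξ t ht
      rw [e.fderiv_eq]
      have h1 := fderiv_const_smul_field (𝕜 := ℝ) (f := fun x' => h x' ξ) ((t ^ m : ℝ) : ℂ)
      exact congrArg (fun L => L x (EuclideanSpace.single i 1)) h1
    | inr i =>
      simp only [CornerPsiDO.pd, dxi, gain]
      have hd : DifferentiableAt ℝ (fun ξ' => h x ξ') (t • ξ) := by
        have h1 := hh.smooth.differentiableAt (isOpen_pcyl U) (p := (x, t • ξ))
          ⟨hx, smul_ne_zero ht.ne' hξ⟩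
        have h2 : DifferentiableAt ℝ (fun ξ' : Sp ι => (x, ξ')) (t • ξ) := by fun_prop
        exact DifferentiableAt.comp (g := unc h) (f := fun ξ' => (x, ξ')) (t • ξ) h1 h2
      -- Both sides of the homogeneity relation are differentiated in ξ; the chain rule gives a
      -- factor t on the left, and division by it lowers the degree by one.
      have e : (fun ξ' => h x (t • ξ')) =ᶠ[nhds ξ] fun ξ' => ((t ^ m : ℝ) : ℂ) * h x ξ' := by
        filter_upwards [isOpen_compl_singleton.mem_nhds hξ] with ξ' hξ' using
          hh.hom x hx ξ' hξ' t ht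
      have h3 := e.fderiv_eq (𝕜 := ℝ)
      have h4 : fderiv ℝ (fun ξ' => h x (t • ξ')) ξ =
          (fderiv ℝ (fun ξ' => h x ξ') (t • ξ)).comp (t • ContinuousLinearMap.id ℝ (Sp ι)) :=
        (hd.hasFDerivAt.comp ξ ((hasFDerivAt_id ξ).const_smul t)).fderiv
      have h1 := congrFun (fderiv_const_smul_field (𝕜 := ℝ) (f := fun ξ' => h x ξ')
        ((t ^ m : ℝ) : ℂ)) ξ
      have h5 := congrArg (fun L => L (EuclideanSpace.single i 1)) (h4.symm.trans (h3.trans h1))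
      have h6 : (t : ℂ) * fderiv ℝ (fun ξ' => h x ξ') (t • ξ) (EuclideanSpace.single i 1) =
          ((t ^ m : ℝ) : ℂ) * fderiv ℝ (fun ξ' => h x ξ') ξ (EuclideanSpace.single i 1) := by
        have h7 : fderiv ℝ (fun ξ' => h x ξ') (t • ξ) (t • EuclideanSpace.single i 1) =
          ((t ^ m : ℝ) : ℂ) * fderiv ℝ (fun ξ' => h x ξ') ξ (EuclideanSpace.single i 1) := h5
        rw [map_smul, Complex.real_smul] at h7
        exact h7
      have ht' : (t : ℂ) ≠ 0 := by exact_mod_cast ht.ne'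
      rw [Real.rpow_sub_one ht.ne']
      push_cast
      rw [div_mul_eq_mul_div, ← h6]
      field_simp

theorem exists_excision : ∃ χ : Sp ι → ℂ, ContDiff ℝ ∞ χ ∧ (∀ ξ, ‖ξ‖ ≤ 1 → χ ξ = 0) ∧
    ∀ ξ, 2 ≤ ‖ξ‖ → χ ξ = 1 := by
  let f : ContDiffBump (0 : Sp ι) := ⟨1, 2, one_pos, one_lt_two⟩
  refine ⟨fun ξ => 1 - ((f ξ : ℝ) : ℂ), contDiff_const.sub
    (Complex.ofRealCLM.contDiff.comp f.contDiff), fun ξ hξ => ?_, fun ξ hξ => ?_⟩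
  · change 1 - ((f ξ : ℝ) : ℂ) = 0
    rw [f.one_of_mem_closedBall (mem_closedBall_zero_iff.2 hξ)]; simp
  · change 1 - ((f ξ : ℝ) : ℂ) = 1
    rw [f.zero_of_le_dist (by simpa using hξ)]; simp

theorem smooth_excision_mul {χ : Sp ι → ℂ} (hχ : ContDiff ℝ ∞ χ) {ε : ℝ} (hε : 0 < ε)
    (h0 : ∀ ξ, ‖ξ‖ ≤ ε → χ ξ = 0) {h : Fn ι} (hh : Smooth (pcyl U) h) :
    Smooth (cyl U) fun x ξ => χ ξ * h x ξ := by
  rintro ⟨x, ξ⟩ ⟨hx, -⟩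
  refine ContDiffAt.contDiffWithinAt ?_
  by_cases hξ : ξ = 0
  · refine (contDiffAt_const (c := (0 : ℂ))).congr_of_eventuallyEq ?_
    have : (Prod.snd ⁻¹' Metric.ball 0 ε : Set (Sp ι × Sp ι)) ∈ nhds (x, ξ) :=
      (Metric.isOpen_ball.preimage continuous_snd).mem_nhds (by simp [hξ, hε])
    filter_upwards [this] with p hp
    have hp' : ‖p.2‖ < ε := by simpa using hp
    simp [unc, h0 p.2 hp'.le]
  · exact (hχ.comp contDiff_snd).contDiffAt.mul (hh.contDiffAt (isOpen_pcyl U) ⟨hx, hξ⟩)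

theorem norm_rpow_le_bracket {ξ : Sp ι} (hξ : 1 ≤ ‖ξ‖) (m : ℝ) :
    ‖ξ‖ ^ m ≤ 2 ^ |m| * bracket ξ ^ m := by
  have h0 : 0 < ‖ξ‖ := by linarith
  rcases le_or_gt 0 m with hm | hm
  · calc ‖ξ‖ ^ m ≤ bracket ξ ^ m := Real.rpow_le_rpow h0.le (norm_le_bracket ξ) hm
      _ = 1 * bracket ξ ^ m := (one_mul _).symm
      _ ≤ 2 ^ |m| * bracket ξ ^ m := mul_le_mul_of_nonneg_right
        (Real.one_le_rpow (by norm_num) (abs_nonneg m)) (bracket_rpow_pos ξ m).le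
  · have h1 : bracket ξ / 2 ≤ ‖ξ‖ := by linarith [bracket_le_one_add ξ]
    calc ‖ξ‖ ^ m ≤ (bracket ξ / 2) ^ m :=
          Real.rpow_le_rpow_of_nonpos (by linarith [bracket_pos ξ]) h1 hm.le
      _ = 2 ^ |m| * bracket ξ ^ m := by
        rw [Real.div_rpow (bracket_pos ξ).le (by norm_num), abs_of_neg hm,
          Real.rpow_neg (by norm_num)]
        field_simp

/-- Smooth functions that are homogeneous for large covariables are symbols. -/
theorem Hom.isSymbol {m : ℝ} {a h : Fn ι} (ha : Smooth (cyl U) a) (hh : Hom U m h) {R : ℝ}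
    (hR : ∀ x ∈ U, ∀ ξ, R ≤ ‖ξ‖ → a x ξ = h x ξ) : IsSymbol U m a := by
  refine isSymbol_of_closed (fun m a => Smooth (cyl U) a ∧ ∃ h, Hom U m h ∧ ∃ R : ℝ,
    ∀ x ∈ U, ∀ ξ, R ≤ ‖ξ‖ → a x ξ = h x ξ) (fun m a h => h.1) ?_ ?_ ⟨ha, h, hh, R, hR⟩
  · rintro m a ⟨ha, h, hh, R, hR⟩ L hL hLU
    -- C₁ bounds the homogeneous function on the unit sphere, hence by scaling for large
    -- covariables; C₂ takes care of the remaining ball.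
    obtain ⟨C₁, hC₁⟩ := (hL.prod (isCompact_sphere (0 : Sp ι) 1)).exists_bound_of_continuousOn
      (f := unc h) (hh.smooth.continuousOn.mono fun p hp => ⟨hLU hp.1, fun h0 => by
        have h1 := hp.2
        rw [h0] at h1
        simp at h1⟩)
    obtain ⟨C₂, hC₂⟩ := (hL.prod (isCompact_closedBall (0 : Sp ι) (max R 1))).exists_bound_of_continuousOn
      (f := fun p => unc a p * ((bracket p.2 ^ (-m) : ℝ) : ℂ))
      ((ha.continuousOn.mono fun p hp => ⟨hLU hp.1, trivial⟩).mul
        (Complex.continuous_ofReal.comp ((continuous_bracket_rpow (-m)).comp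
          continuous_snd)).continuousOn)
    refine ⟨max C₂ (C₁ * 2 ^ |m|), fun x hx ξ => ?_⟩
    have hb := bracket_rpow_pos ξ m
    by_cases hξ : ‖ξ‖ ≤ max R 1
    · have h1 := hC₂ (x, ξ) ⟨hx, mem_closedBall_zero_iff.2 hξ⟩
      rw [norm_mul, Complex.norm_real, Real.norm_of_nonneg (bracket_rpow_pos ξ (-m)).le,
        Real.rpow_neg (bracket_pos ξ).le, ← div_eq_mul_inv, div_le_iff₀ hb] at h1
      exact h1.trans (mul_le_mul_of_nonneg_right (le_max_left _ _) hb.le)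
    · have hξ' := not_le.1 hξ
      have h1 : 1 ≤ ‖ξ‖ := (le_max_right R 1).trans hξ'.le
      have h0 : 0 < ‖ξ‖ := by linarith
      have hξ0 : ξ ≠ 0 := norm_pos_iff.1 h0
      have hmem : (x, ‖ξ‖⁻¹ • ξ) ∈ L ×ˢ Metric.sphere (0 : Sp ι) 1 := by
        refine ⟨hx, ?_⟩
        rw [mem_sphere_zero_iff_norm, norm_smul, norm_inv, norm_norm, inv_mul_cancel₀ h0.ne']
      have h2 := hC₁ _ hmem
      have h3 := hh.hom x (hLU hx) (‖ξ‖⁻¹ • ξ) (smul_ne_zero (inv_ne_zero h0.ne') hξ0) ‖ξ‖ h0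
      rw [smul_inv_smul₀ h0.ne'] at h3
      rw [hR x (hLU hx) ξ ((le_max_left R 1).trans hξ'.le), h3, norm_mul, Complex.norm_real,
        Real.norm_of_nonneg (Real.rpow_nonneg h0.le m)]
      have hC₁0 : 0 ≤ C₁ := (norm_nonneg _).trans h2
      calc ‖ξ‖ ^ m * ‖h x (‖ξ‖⁻¹ • ξ)‖ ≤ (2 ^ |m| * bracket ξ ^ m) * C₁ :=
            mul_le_mul (norm_rpow_le_bracket h1 m) h2 (norm_nonneg _) (by positivity)
        _ = C₁ * 2 ^ |m| * bracket ξ ^ m := by ring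
        _ ≤ _ := mul_le_mul_of_nonneg_right (le_max_right _ _) hb.le
  · rintro m a ⟨ha, h, hh, R, hR⟩ d
    refine ⟨ha.pd (isOpen_cyl U) d, _, hh.pd d, R + 1, fun x hx ξ hξ => ?_⟩
    have hO : IsOpen ((U : Set (Sp ι)) ×ˢ {ξ : Sp ι | R < ‖ξ‖}) :=
      U.isOpen.prod (isOpen_lt continuous_const continuous_norm)
    exact pd_congr hO (fun p hp => hR p.1 hp.1 p.2 (le_of_lt hp.2)) d (x, ξ)
      ⟨hx, show R < ‖ξ‖ by linarith⟩

end Tail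

/-! ### Asymptotic expansions -/

section Expansion

variable {ι : Type} [Fintype ι] [DecidableEq ι] {U : Opens (Sp ι)}

/-- A reformulation of `HasExpansion` without excision functions. -/
structure Expands (U : Opens (Sp ι)) (m : ℝ) (p : Fn ι) (h : ℕ → Fn ι) : Prop where
  smooth : Smooth (cyl U) p
  hom : ∀ j : ℕ, Hom U (m - j) (h j)
  tail : ∀ N : ℕ, TailSym U (m - N) fun x ξ => p x ξ - ∑ j ∈ Finset.range N, h j x ξ

/-- All excision functions are one for large covariables, and any of them removes the singularity at
ξ = 0; so the condition concerns only tails and smoothness. -/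
theorem hasExpansion_iff {m : ℝ} {p : Fn ι} {h : ℕ → Fn ι} :
    HasExpansion U m p h ↔ Expands U m p h := by
  constructor
  · rintro ⟨hs, hh, ht⟩
    obtain ⟨χ, hχ, h0, h1⟩ := exists_excision (ι := ι)
    have hex : IsExcision χ := ⟨hχ, ⟨1, one_pos, h0⟩, 2, h1⟩
    refine ⟨?_, fun j => ⟨hs j, hh j⟩, fun N => ?_⟩
    · have := (ht χ hex 0).smooth
      simpa using this
    · exact (ht χ hex N).tail.congr fun L _ _ => ⟨2, fun x _ ξ hξ => by
        rw [h1 ξ hξ, one_mul]⟩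
  · rintro ⟨hs, hh, ht⟩
    refine ⟨fun j => (hh j).smooth, fun j => (hh j).hom, fun χ hχ N => ?_⟩
    obtain ⟨hχs, ⟨ε, hε, h0⟩, R, h1⟩ := hχ
    refine ((ht N).congr fun L _ _ => ⟨R, fun x _ ξ hξ => ?_⟩).isSymbol ?_
    · rw [h1 ξ hξ, one_mul]
    · exact hs.sub (smooth_excision_mul hχs hε h0 (Smooth.sum fun j _ => (hh j).smooth))

theorem Expands.isSymbol {m : ℝ} {p : Fn ι} {h : ℕ → Fn ι} (hp : Expands U m p h) :
    IsSymbol U m p := by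
  have := hp.tail 0
  simp only [Finset.range_zero, Finset.sum_empty, sub_zero, Nat.cast_zero] at this
  exact this.isSymbol hp.smooth

/-- The component is the difference of two consecutive remainders. -/
theorem Expands.tail_comp {m : ℝ} {p : Fn ι} {h : ℕ → Fn ι} (hp : Expands U m p h) (j : ℕ) :
    TailSym U (m - j) (h j) := by
  have h1 := (hp.tail j).sub ((hp.tail (j + 1)).mono (by push_cast; linarith))
  refine h1.congr' fun x _ ξ _ => ?_
  rw [Finset.sum_range_succ]
  ring

theorem Expands.congr_order {m m' : ℝ} {p : Fn ι} {h : ℕ → Fn ι} (hp : Expands U m p h)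
    (e : m = m') : Expands U m' p h := e ▸ hp

theorem Expands.congr {m : ℝ} {p p' : Fn ι} {h h' : ℕ → Fn ι} (hp : Expands U m p h)
    (e : ∀ x ∈ U, ∀ ξ, p' x ξ = p x ξ) (e' : ∀ j, ∀ x ∈ U, ∀ ξ ≠ 0, h' j x ξ = h j x ξ) :
    Expands U m p' h' where
  smooth := hp.smooth.congr fun q hq => e q.1 hq.1 q.2
  hom j := (hp.hom j).congr (e' j)
  tail N := (hp.tail N).congr' fun x hx ξ hξ => by
    rw [e x hx ξ, Finset.sum_congr rfl fun j _ => e' j x hx ξ hξ]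

theorem Expands.add {m : ℝ} {p p' : Fn ι} {h h' : ℕ → Fn ι} (hp : Expands U m p h)
    (hp' : Expands U m p' h') : Expands U m (fun x ξ => p x ξ + p' x ξ)
      fun j x ξ => h j x ξ + h' j x ξ where
  smooth := hp.smooth.add hp'.smooth
  hom j := (hp.hom j).add (hp'.hom j)
  tail N := ((hp.tail N).add (hp'.tail N)).congr' fun x _ ξ _ => by
    rw [Finset.sum_add_distrib]; ring

theorem Expands.zero (m : ℝ) : Expands U m (fun _ _ => 0) fun _ _ _ => 0 where
  smooth := Smooth.const 0
  hom j := Hom.zero _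
  tail N := by simpa using (isSymbol_zero U _).tail

theorem Expands.sum {m : ℝ} {κ : Type*} {s : Finset κ} {p : κ → Fn ι} {h : κ → ℕ → Fn ι}
    (hp : ∀ i ∈ s, Expands U m (p i) (h i)) : Expands U m (fun x ξ => ∑ i ∈ s, p i x ξ)
      fun j x ξ => ∑ i ∈ s, h i j x ξ := by
  classical
  induction s using Finset.induction_on with
  | empty => simpa using Expands.zero m
  | insert j s hj ih =>
    simp only [Finset.sum_insert hj]
    exact (hp j (Finset.mem_insert_self j s)).add (ih fun i hi => hp i (Finset.mem_insert_of_mem hi))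

/-- Multiplication by a homogeneous symbol. -/
theorem Expands.hom_mul {m m' : ℝ} {p a : Fn ι} {h : ℕ → Fn ι} (hp : Expands U m p h)
    (ha : IsSymbol U m' a) (ha' : Hom U m' a) : Expands U (m' + m) (fun x ξ => a x ξ * p x ξ)
      fun j x ξ => a x ξ * h j x ξ where
  smooth := ha.smooth.mul hp.smooth
  hom j := by
    have := ha'.mul (hp.hom j)
    rwa [← add_sub_assoc] at this
  tail N := by
    have := ha.tail.mul (hp.tail N)
    rw [← add_sub_assoc] at this
    refine this.congr' fun x _ ξ _ => ?_
    rw [mul_sub, Finset.mul_sum]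

theorem Expands.fun_mul {m : ℝ} {p : Fn ι} {h : ℕ → Fn ι} (hp : Expands U m p h) {f : Sp ι → ℂ}
    (hf : ContDiffOn ℝ ∞ f U) : Expands U m (fun x ξ => f x * p x ξ) fun j x ξ => f x * h j x ξ :=
  (hp.hom_mul (isSymbol_of_fst hf) (Hom.of_fst hf)).congr_order (zero_add m)

theorem Expands.const_mul {m : ℝ} {p : Fn ι} {h : ℕ → Fn ι} (hp : Expands U m p h) (c : ℂ) :
    Expands U m (fun x ξ => c * p x ξ) fun j x ξ => c * h j x ξ :=
  hp.fun_mul (f := fun _ => c) contDiffOn_const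

theorem Expands.pd {m : ℝ} {p : Fn ι} {h : ℕ → Fn ι} (hp : Expands U m p h) (d : ι ⊕ ι) :
    Expands U (m - gain d) (pd d p) fun j => pd d (h j) where
  smooth := hp.smooth.pd (isOpen_cyl U) d
  hom j := by
    have := (hp.hom j).pd d
    rwa [sub_right_comm] at this
  tail N := by
    have := (hp.tail N).pd d
    rw [sub_right_comm] at this
    refine this.congr' fun x hx ξ hξ => ?_
    have hO := isOpen_pcyl U
    have hmem : (x, ξ) ∈ pcyl U := ⟨hx, hξ⟩
    have e1 := pd_sub hO (hp.smooth.mono (pcyl_subset U))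
      (Smooth.sum (s := Finset.range N) fun j _ => (hp.hom j).smooth) d (x, ξ) hmem
    have e2 := pd_sum hO (s := Finset.range N) (fun j _ => (hp.hom j).smooth) d (x, ξ) hmem
    rw [e2] at e1
    exact e1.symm

theorem sum_range_antidiagonal (f : ℕ → ℕ → ℂ) (N : ℕ) :
    ∑ j ∈ Finset.range N, ∑ q ∈ Finset.HasAntidiagonal.antidiagonal j, f q.1 q.2 =
      ∑ l ∈ Finset.range N, ∑ i ∈ Finset.range (N - l), f l i := by
  induction N with
  | zero => simp
  | succ N ih =>
    rw [Finset.sum_range_succ, ih, Finset.sum_range_succ (fun l => ∑ i ∈ Finset.range (N + 1 - l), f l i),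
      Finset.Nat.sum_antidiagonal_eq_sum_range_succ f, Finset.sum_range_succ]
    have e : ∑ l ∈ Finset.range N, ∑ i ∈ Finset.range (N + 1 - l), f l i =
        ∑ l ∈ Finset.range N, ∑ i ∈ Finset.range (N - l), f l i +
          ∑ l ∈ Finset.range N, f l (N - l) := by
      rw [← Finset.sum_add_distrib]
      refine Finset.sum_congr rfl fun l hl => ?_
      rw [Nat.succ_sub (Finset.mem_range.1 hl).le, Finset.sum_range_succ]
    rw [e]
    simp
    ring

/-- Asymptotic sums of classical symbols are classical. -/
theorem Expands.of_asymptotic {m : ℝ} {c : Fn ι} {p : ℕ → Fn ι} {h : ℕ → ℕ → Fn ι}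
    (hc : Smooth (cyl U) c) (hp : ∀ l : ℕ, Expands U (m - l) (p l) (h l))
    (hcp : ∀ N : ℕ, TailSym U (m - N) fun x ξ => c x ξ - ∑ l ∈ Finset.range N, p l x ξ) :
    Expands U m c fun j x ξ => ∑ q ∈ Finset.HasAntidiagonal.antidiagonal j, h q.1 q.2 x ξ where
  smooth := hc
  hom j := Hom.sum fun q hq => by
    have := (hp q.1).hom q.2
    rw [sub_sub, ← Nat.cast_add, Finset.HasAntidiagonal.mem_antidiagonal.1 hq] at this
    exact this
  tail N := by
    have h1 : TailSym U (m - N) fun x ξ => ∑ l ∈ Finset.range N,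
        (p l x ξ - ∑ i ∈ Finset.range (N - l), h l i x ξ) := TailSym.sum fun l hl => by
      have := (hp l).tail (N - l)
      rwa [Nat.cast_sub (Finset.mem_range.1 hl).le, sub_sub, add_sub_cancel] at this
    refine ((hcp N).add h1).congr' fun x _ ξ _ => ?_
    rw [sum_range_antidiagonal fun l i => h l i x ξ, Finset.sum_sub_distrib]
    ring

theorem Expands.mul {m m' : ℝ} {p p' : Fn ι} {h h' : ℕ → Fn ι} (hp : Expands U m p h)
    (hp' : Expands U m' p' h') : Expands U (m + m') (fun x ξ => p x ξ * p' x ξ)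
      fun j x ξ => ∑ q ∈ Finset.HasAntidiagonal.antidiagonal j, h q.1 x ξ * h' q.2 x ξ where
  smooth := hp.smooth.mul hp'.smooth
  hom j := Hom.sum fun q hq => by
    have := (hp.hom q.1).mul (hp'.hom q.2)
    rw [sub_add_sub_comm, ← Nat.cast_add, Finset.HasAntidiagonal.mem_antidiagonal.1 hq] at this
    exact this
  tail N := by
    -- The remainder is split as (p - ∑_{l<N} h_l) p' + ∑_{l<N} h_l (p' - ∑_{i<N-l} h'_i), where
    -- every term has order m + m' - N.
    have h1 := (hp.tail N).mul hp'.isSymbol.tail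
    have h2 : TailSym U (m + m' - N) fun x ξ => ∑ l ∈ Finset.range N,
        h l x ξ * (p' x ξ - ∑ i ∈ Finset.range (N - l), h' i x ξ) := TailSym.sum fun l hl => by
      have := (hp.tail_comp l).mul (hp'.tail (N - l))
      rwa [Nat.cast_sub (Finset.mem_range.1 hl).le, sub_add_sub_comm, add_sub_cancel] at this
    refine ((h1.mono (by linarith)).add h2).congr' fun x _ ξ _ => ?_
    rw [sum_range_antidiagonal fun l i => h l x ξ * h' i x ξ]
    simp_rw [mul_sub, Finset.mul_sum]
    rw [Finset.sum_sub_distrib, ← Finset.sum_mul]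
    ring

theorem Expands.restrict {V : Opens (Sp ι)} {m : ℝ} {p : Fn ι} {h : ℕ → Fn ι}
    (hp : Expands U m p h) (hV : V ≤ U) : Expands V m p h where
  smooth := hp.smooth.mono (Set.prod_mono hV subset_rfl)
  hom j := ⟨(hp.hom j).smooth.mono (Set.prod_mono hV subset_rfl), fun x hx => (hp.hom j).hom x (hV hx)⟩
  tail N := (hp.tail N).restrict hV

end Expansion

/-! ### Asymptotic summation -/

section Borel

variable {ι : Type} [Fintype ι] [DecidableEq ι] {U : Opens (Sp ι)}

theorem bracket_le_scale {t : ℝ} (ht : 1 ≤ t) (ξ : Sp ι) : bracket ξ ≤ t * bracket (t⁻¹ • ξ) := by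
  have h0 : 0 < t := by linarith
  refine abs_le_of_sq_le_sq' ?_ (by positivity [bracket_pos (t⁻¹ • ξ)]) |>.2
  rw [mul_pow, bracket_sq, bracket_sq, norm_smul, norm_inv, Real.norm_of_nonneg h0.le]
  have : t ^ 2 * (1 + (t⁻¹ * ‖ξ‖) ^ 2) = t ^ 2 + ‖ξ‖ ^ 2 := by field_simp
  rw [this]
  nlinarith

/-- Rescaling a symbol of nonpositive order in the covariables. -/
theorem symBdd_scale {m : ℝ} {b : Fn ι} (hm : m ≤ 0) (hb : IsSymbol U m b) :
    SymBdd U m fun (t : Set.Ici (1 : ℝ)) x ξ =>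
      (((t : ℝ) ^ m : ℝ) : ℂ) * b x ((t : ℝ)⁻¹ • ξ) := by
  -- A derivative in the covariable produces the factor 1/t, which lowers the exponent of t along
  -- with the order, so the class is closed. The bound rests on ⟨ξ⟩ ≤ t ⟨t⁻¹ξ⟩ and m ≤ 0.
  refine symBdd_of_closed (fun m (a : Set.Ici (1 : ℝ) → Fn ι) => m ≤ 0 ∧ ∃ b, IsSymbol U m b ∧
    a = fun (t : Set.Ici (1 : ℝ)) x ξ => (((t : ℝ) ^ m : ℝ) : ℂ) * b x ((t : ℝ)⁻¹ • ξ)) ?_ ?_ ?_ ⟨hm, b, hb, rfl⟩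
  · rintro m _ ⟨hm, b, hb, rfl⟩ t
    have h1 : ContDiff ℝ ∞ fun p : Sp ι × Sp ι => (p.1, (t : ℝ)⁻¹ • p.2) :=
      contDiff_fst.prodMk (contDiff_snd.const_smul _)
    have h2 : Smooth (cyl U) fun x ξ => b x ((t : ℝ)⁻¹ • ξ) :=
      ContDiffOn.comp (g := unc b) hb.smooth h1.contDiffOn fun p hp => ⟨hp.1, trivial⟩
    exact h2.const_mul _
  · rintro m _ ⟨hm, b, hb, rfl⟩ L hL hLU
    obtain ⟨c, hc0, hc⟩ := hb.bound hL hLU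
    refine ⟨c, fun t x hx ξ => ?_⟩
    have ht : (1 : ℝ) ≤ t := t.2
    have h0 : (0 : ℝ) < t := by linarith
    rw [norm_mul, Complex.norm_real, Real.norm_of_nonneg (Real.rpow_nonneg h0.le m)]
    calc (t : ℝ) ^ m * ‖b x ((t : ℝ)⁻¹ • ξ)‖ ≤ (t : ℝ) ^ m * (c * bracket ((t : ℝ)⁻¹ • ξ) ^ m) :=
          mul_le_mul_of_nonneg_left (hc x hx _) (Real.rpow_nonneg h0.le m)
      _ = c * ((t : ℝ) * bracket ((t : ℝ)⁻¹ • ξ)) ^ m := by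
          rw [Real.mul_rpow h0.le (bracket_pos _).le]; ring
      _ ≤ c * bracket ξ ^ m := mul_le_mul_of_nonneg_left
          (Real.rpow_le_rpow_of_nonpos (bracket_pos ξ) (bracket_le_scale ht ξ) hm) hc0
  · rintro m _ ⟨hm, b, hb, rfl⟩ d
    cases d with
    | inl i =>
      refine ⟨by simpa [gain] using hm, _, hb.pd (Sum.inl i), ?_⟩
      funext t x ξ
      simp only [pd, dx, gain, sub_zero]
      have h := congrFun (fderiv_const_smul_field (𝕜 := ℝ) (f := fun x' => b x' ((t : ℝ)⁻¹ • ξ))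
        (((t : ℝ) ^ m : ℝ) : ℂ)) x
      exact congrArg (fun L => L (EuclideanSpace.single i 1)) h
    | inr i =>
      refine ⟨by simp only [gain]; linarith, _, hb.pd (Sum.inr i), ?_⟩
      funext t x ξ
      have ht : (1 : ℝ) ≤ t := t.2
      have h0 : (t : ℝ) ≠ 0 := by linarith
      have ht' : ((t : ℝ) : ℂ) ≠ 0 := by exact_mod_cast h0
      simp only [pd, dxi, gain]
      have h := congrFun (fderiv_const_smul_field (𝕜 := ℝ) (f := fun ξ' => b x ((t : ℝ)⁻¹ • ξ'))
        (((t : ℝ) ^ m : ℝ) : ℂ)) ξ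
      have h2 := congrArg (fun L => L (EuclideanSpace.single i 1)) h
      have h3 : fderiv ℝ (fun ξ' => b x ((t : ℝ)⁻¹ • ξ')) ξ =
          (t : ℝ)⁻¹ • fderiv ℝ (fun ξ' => b x ξ') ((t : ℝ)⁻¹ • ξ) := fderiv_comp_smul ..
      have h4 : fderiv ℝ (fun ξ' => (((t : ℝ) ^ m : ℝ) : ℂ) * b x ((t : ℝ)⁻¹ • ξ')) ξ
          (EuclideanSpace.single i 1) = (((t : ℝ) ^ m : ℝ) : ℂ) *
          fderiv ℝ (fun ξ' => b x ((t : ℝ)⁻¹ • ξ')) ξ (EuclideanSpace.single i 1) := h2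
      rw [h4, h3, smul_apply, Real.rpow_sub_one h0, Complex.real_smul]
      push_cast
      field_simp

theorem IsSymbol.const_family {T : Type} {m : ℝ} {a : Fn ι} (ha : IsSymbol U m a) :
    SymBdd U m fun _ : T => a :=
  ⟨fun _ => ha.1, fun α β L hL hLU => (ha.2 α β L hL hLU).imp fun _ h _ => h⟩

theorem foldr_pd_sum {O : Set (Sp ι × Sp ι)} (hO : IsOpen O) {κ : Type*} {s : Finset κ}
    {a : κ → Fn ι} (ha : ∀ j ∈ s, Smooth O (a j)) (w : List (ι ⊕ ι)) : ∀ p ∈ O,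
    w.foldr pd (fun x ξ => ∑ j ∈ s, a j x ξ) p.1 p.2 = ∑ j ∈ s, w.foldr pd (a j) p.1 p.2 := by
  induction w with
  | nil => intro p _; rfl
  | cons d w ih =>
    intro p hp
    simp only [List.foldr_cons]
    rw [pd_congr hO (b := fun x ξ => ∑ j ∈ s, w.foldr pd (a j) x ξ) ih d p hp]
    exact pd_sum hO (fun j hj => smooth_foldr_pd hO (ha j hj) w) d p hp

theorem mixedDeriv_sum {O : Set (Sp ι × Sp ι)} (hO : IsOpen O) {κ : Type*} {s : Finset κ}
    {a : κ → Fn ι} (ha : ∀ j ∈ s, Smooth O (a j)) (α β : List ι) : ∀ p ∈ O,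
    mixedDeriv α β (fun x ξ => ∑ j ∈ s, a j x ξ) p.1 p.2 =
      ∑ j ∈ s, mixedDeriv α β (a j) p.1 p.2 := by
  simp only [mixedDeriv_eq]
  exact foldr_pd_sum hO ha _

theorem foldr_pd_zero (w : List (ι ⊕ ι)) : w.foldr pd (fun _ _ => 0 : Fn ι) = fun _ _ => 0 := by
  induction w with
  | nil => rfl
  | cons d w ih => rw [List.foldr_cons, ih, pd_zero]

/-- The symbol `a` cut off for covariables of size at most `t`. -/
noncomputable def excised (χ : Sp ι → ℂ) (a : Fn ι) (t : ℝ) : Fn ι := fun x ξ =>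
  χ (t⁻¹ • ξ) * a x ξ

theorem isSymbol_excision {χ : Sp ι → ℂ} (hχ : ContDiff ℝ ∞ χ) (h1 : ∀ ξ, 2 ≤ ‖ξ‖ → χ ξ = 1) :
    IsSymbol U 0 fun _ ξ => χ ξ := by
  have h : IsSymbol U 0 fun (_ : Sp ι) ξ => χ ξ - 1 := by
    refine isSymbol_of_compact ?_ (fun L _ _ => ⟨2, fun x _ ξ hξ => by rw [h1 ξ hξ, sub_self]⟩) 0
    exact ((hχ.sub contDiff_const).comp contDiff_snd).contDiffOn
  exact (h.add (isSymbol_of_fst (f := fun _ => 1) contDiffOn_const)).congr fun x _ ξ => by ring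

theorem symBdd_excised {χ : Sp ι → ℂ} (hχ : ContDiff ℝ ∞ χ) (h1 : ∀ ξ, 2 ≤ ‖ξ‖ → χ ξ = 1)
    {m : ℝ} {a : Fn ι} (ha : IsSymbol U m a) :
    SymBdd U m fun t : Set.Ici (1 : ℝ) => excised χ a t := by
  have h := (symBdd_scale le_rfl (isSymbol_excision (U := U) hχ h1)).mul
    (ha.const_family (T := Set.Ici (1 : ℝ)))
  rw [zero_add] at h
  exact h.congr fun t x _ ξ => by simp [excised]

/-- The excised symbol vanishes for ‖ξ‖ < t, and elsewhere t ≤ ⟨ξ⟩. Allowing one order more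
therefore gains 1/t against constants that do not depend on t; only finitely many words of length at
most n are involved. -/
theorem excised_small {χ : Sp ι → ℂ} (hχ : ContDiff ℝ ∞ χ) (h0 : ∀ ξ, ‖ξ‖ ≤ 1 → χ ξ = 0)
    (h1 : ∀ ξ, 2 ≤ ‖ξ‖ → χ ξ = 1) {m : ℝ} {a : Fn ι} (ha : IsSymbol U m a) {L : Set (Sp ι)}
    (hL : IsCompact L) (hLU : L ⊆ U) (n : ℕ) {ε : ℝ} (hε : 0 < ε) : ∃ t₀ : ℝ, 1 ≤ t₀ ∧
    ∀ t, t₀ ≤ t → ∀ α β : List ι, α.length ≤ n → β.length ≤ n → ∀ x ∈ L, ∀ ξ,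
      ‖mixedDeriv α β (excised χ a t) x ξ‖ ≤ ε * bracket ξ ^ (m + 1 - β.length) := by
  have hb := symBdd_excised hχ h1 ha
  choose c hc using fun α β => hb.2 α β L hL hLU
  have hS : (({α : List ι | α.length ≤ n} ×ˢ {β : List ι | β.length ≤ n}) :
      Set (List ι × List ι)).Finite := (List.finite_length_le ι n).prod (List.finite_length_le ι n)
  obtain ⟨C, hC⟩ := (hS.image fun w => c w.1 w.2).bddAbove
  refine ⟨max 1 (C / ε), le_max_left _ _, fun t ht α β hα hβ x hx ξ => ?_⟩
  have ht1 : 1 ≤ t := (le_max_left _ _).trans ht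
  have ht0 : 0 < t := by linarith
  have htC : C ≤ ε * t := by
    have := (le_max_right 1 (C / ε)).trans ht
    rwa [div_le_iff₀' hε] at this
  have hr := bracket_rpow_pos ξ (m - β.length)
  by_cases hξ : ‖ξ‖ < t
  · have hO : IsOpen ((Set.univ : Set (Sp ι)) ×ˢ {ξ : Sp ι | ‖ξ‖ < t}) :=
      isOpen_univ.prod (isOpen_lt continuous_norm continuous_const)
    have e : mixedDeriv α β (excised χ a t) x ξ = 0 := by
      rw [mixedDeriv_congr hO (b := fun _ _ => 0) (fun p hp => ?_) α β (x, ξ) ⟨trivial, hξ⟩,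
        mixedDeriv_eq, foldr_pd_zero]
      have hp2 : ‖p.2‖ < t := hp.2
      have : ‖t⁻¹ • p.2‖ ≤ 1 := by
        rw [norm_smul, norm_inv, Real.norm_of_nonneg ht0.le, inv_mul_le_iff₀ ht0]
        linarith
      simp [excised, h0 _ this]
    rw [e, norm_zero]
    have := bracket_rpow_pos ξ (m + 1 - β.length)
    positivity
  · have hξ' := not_lt.1 hξ
    have h2 := hc α β ⟨t, ht1⟩ x hx ξ
    have h3 : c α β ≤ C := hC ⟨(α, β), ⟨hα, hβ⟩, rfl⟩
    have h4 : t ≤ bracket ξ := hξ'.trans (norm_le_bracket ξ)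
    calc ‖mixedDeriv α β (excised χ a t) x ξ‖ ≤ c α β * bracket ξ ^ (m - β.length) := h2
      _ ≤ (ε * bracket ξ) * bracket ξ ^ (m - β.length) := by
        refine mul_le_mul_of_nonneg_right (h3.trans (htC.trans ?_)) hr.le
        exact mul_le_mul_of_nonneg_left h4 hε.le
      _ = ε * bracket ξ ^ (m + 1 - β.length) := by
        rw [mul_assoc, mul_comm (bracket ξ), ← Real.rpow_add_one (bracket_pos ξ).ne']
        congr 2
        ring

/-- Every sequence of symbols of decreasing orders has an asymptotic sum. -/
theorem exists_asymptotic_sum {m : ℝ} {a : ℕ → Fn ι} (ha : ∀ l : ℕ, IsSymbol U (m - l) (a l)) :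
    ∃ c : Fn ι, ∀ N : ℕ, IsSymbol U (m - N) fun x ξ => c x ξ - ∑ l ∈ Finset.range N, a l x ξ := by
  obtain ⟨χ, hχ, h0, h1⟩ := exists_excision (ι := ι)
  obtain ⟨κ, hκ⟩ := exists_isExhaustion U
  -- Diagonal choice: the l-th term is bounded by 2^{-l} in order m - l + 1, over {κ ≤ l} and for
  -- words of length at most l.
  choose t₀ ht₀ hsmall using fun l : ℕ => excised_small hχ h0 h1 (ha l) (hκ.compact l)
    (fun x hx => hx.1) l (ε := (1 / 2) ^ l) (by positivity)
  -- Since t l ≥ l, the l-th term vanishes for ‖ξ‖ ≤ l; the infinite sum is locally finite.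
  let t : ℕ → ℝ := fun l => max (t₀ l) l
  have ht1 : ∀ l, 1 ≤ t l := fun l => (ht₀ l).trans (le_max_left _ _)
  have htl : ∀ l : ℕ, (l : ℝ) ≤ t l := fun l => le_max_right _ _
  let b : ℕ → Fn ι := fun l => excised χ (a l) (t l)
  have hbs : ∀ l : ℕ, IsSymbol U (m - l) (b l) := fun l => by
    have := symBdd_excised hχ h1 (ha l)
    exact ⟨this.1 ⟨t l, ht1 l⟩, fun α β L hL hLU => (this.2 α β L hL hLU).imp
      fun c hc => hc ⟨t l, ht1 l⟩⟩
  have hb0 : ∀ (l : ℕ) (x ξ : Sp ι), ‖ξ‖ ≤ l → b l x ξ = 0 := fun l x ξ hξ => by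
    have h0l : 0 < t l := by linarith [ht1 l]
    have : ‖(t l)⁻¹ • ξ‖ ≤ 1 := by
      rw [norm_smul, norm_inv, Real.norm_of_nonneg h0l.le, inv_mul_le_iff₀ h0l, mul_one]
      exact hξ.trans (htl l)
    simp [b, excised, h0 _ this]
  let c : Fn ι := fun x ξ => ∑ l ∈ Finset.range ⌈‖ξ‖⌉₊, b l x ξ
  have hc : ∀ x ξ, ∀ n : ℕ, ‖ξ‖ ≤ n → c x ξ = ∑ l ∈ Finset.range n, b l x ξ := by
    intro x ξ n hn
    refine Finset.sum_subset (Finset.range_mono (Nat.ceil_le.2 hn)) fun l _ hl => hb0 l x ξ ?_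
    exact Nat.ceil_le.1 (by simpa using hl)
  have hrem : ∀ N : ℕ, IsSymbol U (m - N) fun x ξ => c x ξ - ∑ l ∈ Finset.range N, b l x ξ := by
    intro N
    have hO : ∀ n : ℕ, IsOpen ((U : Set (Sp ι)) ×ˢ {ξ : Sp ι | ‖ξ‖ < n}) := fun n =>
      U.isOpen.prod (isOpen_lt continuous_norm continuous_const)
    have hbO : ∀ (n l : ℕ), Smooth ((U : Set (Sp ι)) ×ˢ {ξ : Sp ι | ‖ξ‖ < n}) (b l) := fun n l =>
      (hbs l).smooth.mono (Set.prod_mono subset_rfl (Set.subset_univ _))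
    have e : ∀ n : ℕ, N ≤ n → ∀ p ∈ (U : Set (Sp ι)) ×ˢ {ξ : Sp ι | ‖ξ‖ < n},
        c p.1 p.2 - ∑ l ∈ Finset.range N, b l p.1 p.2 = ∑ l ∈ Finset.Ico N n, b l p.1 p.2 := by
      intro n hn p hp
      rw [hc p.1 p.2 n (le_of_lt hp.2), Finset.sum_Ico_eq_sub _ hn]
    have hex : ∀ ξ : Sp ι, ∃ n : ℕ, N ≤ n ∧ ‖ξ‖ < n := fun ξ => by
      obtain ⟨n, hn⟩ := exists_nat_gt ‖ξ‖
      exact ⟨max n N, le_max_right _ _, hn.trans_le (by exact_mod_cast le_max_left _ _)⟩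
    refine ⟨?_, fun α β L hL hLU => ?_⟩
    · rintro ⟨x, ξ⟩ ⟨hx, -⟩
      obtain ⟨n, hn, hξ⟩ := hex ξ
      refine ContDiffAt.contDiffWithinAt ?_
      have h2 : Smooth _ fun x ξ => ∑ l ∈ Finset.Ico N n, b l x ξ := Smooth.sum fun l _ => hbO n l
      have h3 : Smooth _ fun x ξ => c x ξ - ∑ l ∈ Finset.range N, b l x ξ := h2.congr (e n hn)
      exact h3.contDiffAt (hO n) ⟨hx, hξ⟩
    · obtain ⟨K, hK⟩ := hL.bddAbove_image (hκ.smooth.continuousOn.mono hLU)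
      obtain ⟨k, hk⟩ := exists_nat_ge K
      -- From l₀ on, L lies in {κ ≤ l}, the words α and β are admissible, and m - l + 1 ≤ m - N, so
      -- the geometric bound applies. The finitely many earlier terms are bounded individually.
      let l₀ : ℕ := max (max k (N + 1)) (max α.length β.length)
      have hl1 : k ≤ l₀ := (le_max_left k (N + 1)).trans (le_max_left _ _)
      have hl2 : N + 1 ≤ l₀ := (le_max_right k (N + 1)).trans (le_max_left _ _)
      have hl3 : α.length ≤ l₀ := (le_max_left α.length β.length).trans (le_max_right _ _)
      have hl4 : β.length ≤ l₀ := (le_max_right α.length β.length).trans (le_max_right _ _)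
      choose C hC using fun l => (hbs l).2 α β L hL hLU
      let D : ℕ → ℝ := fun l => (if l ∈ Finset.range l₀ then |C l| else 0) + (1 / 2) ^ l
      have hD0 : ∀ l, 0 ≤ D l := fun l => by
        simp only [D]
        split_ifs <;> positivity
      have hD : Summable D := by
        refine Summable.add ?_ (summable_geometric_of_lt_one (by norm_num) (by norm_num))
        exact summable_of_ne_finset_zero (s := Finset.range l₀) fun l hl => if_neg hl
      refine ⟨∑' l, D l, fun x hx ξ => ?_⟩
      obtain ⟨n, hn, hξ⟩ := hex ξ
      have hmem : (x, ξ) ∈ (U : Set (Sp ι)) ×ˢ {ξ : Sp ι | ‖ξ‖ < n} := ⟨hLU hx, hξ⟩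
      have e2 := mixedDeriv_congr (hO n) (a := fun x ξ => c x ξ - ∑ l ∈ Finset.range N, b l x ξ)
        (b := fun x ξ => ∑ l ∈ Finset.Ico N n, b l x ξ) (e n hn) α β (x, ξ) hmem
      rw [mixedDeriv_sum (hO n) (fun l _ => hbO n l) α β (x, ξ) hmem] at e2
      have e3 : mixedDeriv α β (fun x ξ => c x ξ - ∑ l ∈ Finset.range N, b l x ξ) x ξ =
          ∑ l ∈ Finset.Ico N n, mixedDeriv α β (b l) x ξ := e2
      rw [e3]
      have hr := bracket_rpow_pos ξ (m - N - β.length)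
      have hterm : ∀ l ∈ Finset.Ico N n, ‖mixedDeriv α β (b l) x ξ‖ ≤
          D l * bracket ξ ^ (m - N - β.length) := by
        intro l hl
        have hNl : (N : ℝ) ≤ l := by exact_mod_cast (Finset.mem_Ico.1 hl).1
        by_cases hll : l < l₀
        · have h2 := hC l x hx ξ
          have h3 : |C l| ≤ D l := by
            simp only [D]
            rw [if_pos (Finset.mem_range.2 hll)]
            have : (0 : ℝ) ≤ (1 / 2) ^ l := by positivity
            linarith
          calc _ ≤ C l * bracket ξ ^ (m - l - β.length) := h2
            _ ≤ |C l| * bracket ξ ^ (m - l - β.length) :=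
              mul_le_mul_of_nonneg_right (le_abs_self _) (bracket_rpow_pos ξ _).le
            _ ≤ D l * bracket ξ ^ (m - N - β.length) :=
              mul_le_mul h3 (bracket_rpow_le_rpow ξ (by linarith)) (bracket_rpow_pos ξ _).le (hD0 l)
        · have hll' := not_lt.1 hll
          have hxl : x ∈ {x | x ∈ U ∧ κ x ≤ l} := by
            refine ⟨hLU hx, (hK ⟨x, hx, rfl⟩).trans (hk.trans ?_)⟩
            exact_mod_cast hl1.trans hll'
          have h2 := hsmall l (t l) (le_max_left _ _) α β (hl3.trans hll') (hl4.trans hll') x hxl ξ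
          have h3 : (1 / 2 : ℝ) ^ l ≤ D l := by
            simp only [D]
            split_ifs
            · linarith [abs_nonneg (C l)]
            · linarith
          have hN1 : (N : ℝ) + 1 ≤ l := by exact_mod_cast hl2.trans hll'
          exact h2.trans (mul_le_mul h3 (bracket_rpow_le_rpow ξ (by linarith))
            (bracket_rpow_pos ξ _).le (hD0 l))
      refine (norm_sum_le _ _).trans ((Finset.sum_le_sum hterm).trans ?_)
      rw [← Finset.sum_mul]
      exact mul_le_mul_of_nonneg_right (hD.sum_le_tsum _ fun l _ => hD0 l) hr.le
  refine ⟨c, fun N => ?_⟩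
  have hdiff : ∀ l, IsSymbol U (m - N) fun x ξ => b l x ξ - a l x ξ := by
    intro l
    refine isSymbol_of_compact ((hbs l).smooth.sub (ha l).smooth) (fun L _ _ => ⟨2 * t l,
      fun x _ ξ hξ => ?_⟩) _
    have h0l : 0 < t l := by linarith [ht1 l]
    have : 2 ≤ ‖(t l)⁻¹ • ξ‖ := by
      rw [norm_smul, norm_inv, Real.norm_of_nonneg h0l.le, le_inv_mul_iff₀ h0l]
      linarith
    simp only [b, excised]
    rw [h1 _ this, one_mul, sub_self]
  refine ((hrem N).add (IsSymbol.sum (s := Finset.range N) fun l _ => hdiff l)).congr fun x _ ξ => ?_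
  rw [Finset.sum_sub_distrib]
  ring

/-- Every sequence of homogeneous functions of decreasing orders is the sequence of components of
a classical symbol. -/
theorem exists_expands {m : ℝ} {h : ℕ → Fn ι} (hh : ∀ j : ℕ, Hom U (m - j) (h j)) :
    ∃ p, Expands U m p h := by
  obtain ⟨χ, hχ, h0, h1⟩ := exists_excision (ι := ι)
  have ha : ∀ l : ℕ, IsSymbol U (m - l) fun x ξ => χ ξ * h l x ξ := fun l =>
    (hh l).isSymbol (smooth_excision_mul hχ one_pos h0 (hh l).smooth) (R := 2) fun x _ ξ hξ => by
      rw [h1 ξ hξ, one_mul]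
  obtain ⟨c, hc⟩ := exists_asymptotic_sum ha
  refine ⟨c, ?_, hh, fun N => ?_⟩
  · have := (hc 0).smooth
    simpa using this
  · exact (hc N).tail.congr fun L _ _ => ⟨2, fun x _ ξ hξ => by
      simp_rw [h1 ξ hξ, one_mul]⟩

end Borel

/-! ### First order operators on symbols -/

section FirstOrder

variable {ι : Type} [Fintype ι] [DecidableEq ι] {U : Opens (Sp ι)}

/-- The operator `c₀(x) + ∑ᵢ cᵢ(x) ∂/∂xᵢ + ∑ᵢ dᵢ(x) ξᵢ ∂/∂ξᵢ`, which preserves orders. -/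
noncomputable def firstOrder (c₀ : Sp ι → ℂ) (c d : ι → Sp ι → ℂ) (p : Fn ι) : Fn ι := fun x ξ =>
  c₀ x * p x ξ + ∑ i, c i x * dx i p x ξ + ∑ i, d i x * ((ξ i : ℂ) * dxi i p x ξ)

variable {c₀ : Sp ι → ℂ} {c d : ι → Sp ι → ℂ}

theorem Expands.firstOrder (h₀ : ContDiff ℝ ∞ c₀) (hc : ∀ i, ContDiff ℝ ∞ (c i))
    (hd : ∀ i, ContDiff ℝ ∞ (d i)) {m : ℝ} {p : Fn ι} {h : ℕ → Fn ι} (hp : Expands U m p h) :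
    Expands U m (firstOrder c₀ c d p) fun j => firstOrder c₀ c d (h j) := by
  refine ((hp.fun_mul h₀.contDiffOn).add (Expands.sum (s := Finset.univ) fun i _ => ?_)).add
    (Expands.sum (s := Finset.univ) fun i _ => ?_)
  · exact ((hp.pd (Sum.inl i)).congr_order (sub_zero m)).fun_mul (hc i).contDiffOn
  · exact (((hp.pd (Sum.inr i)).hom_mul (isSymbol_coord U i) (Hom.coord i)).congr_order
      (add_sub_cancel 1 m)).fun_mul (hd i).contDiffOn

theorem Hom.fun_mul {m : ℝ} {h : Fn ι} (hh : Hom U m h) {f : Sp ι → ℂ} (hf : ContDiffOn ℝ ∞ f U) :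
    Hom U m fun x ξ => f x * h x ξ := by
  have := (Hom.of_fst hf).mul hh
  rwa [zero_add] at this

theorem IsSymbol.fun_mul {m : ℝ} {h : Fn ι} (hh : IsSymbol U m h) {f : Sp ι → ℂ}
    (hf : ContDiffOn ℝ ∞ f U) : IsSymbol U m fun x ξ => f x * h x ξ := by
  have := (isSymbol_of_fst hf).mul hh
  rwa [zero_add] at this

theorem Hom.firstOrder (h₀ : ContDiff ℝ ∞ c₀) (hc : ∀ i, ContDiff ℝ ∞ (c i))
    (hd : ∀ i, ContDiff ℝ ∞ (d i)) {m : ℝ} {h : Fn ι} (hh : Hom U m h) :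
    Hom U m (firstOrder c₀ c d h) := by
  refine ((hh.fun_mul h₀.contDiffOn).add (Hom.sum (s := Finset.univ) fun i _ => ?_)).add
    (Hom.sum (s := Finset.univ) fun i _ => ?_)
  · have := hh.pd (Sum.inl i)
    rw [gain, sub_zero] at this
    exact this.fun_mul (hc i).contDiffOn
  · have := (Hom.coord (U := U) i).mul (hh.pd (Sum.inr i))
    rw [gain, add_sub_cancel] at this
    exact this.fun_mul (hd i).contDiffOn

theorem IsSymbol.firstOrder (h₀ : ContDiff ℝ ∞ c₀) (hc : ∀ i, ContDiff ℝ ∞ (c i))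
    (hd : ∀ i, ContDiff ℝ ∞ (d i)) {m : ℝ} {p : Fn ι} (hp : IsSymbol U m p) :
    IsSymbol U m (firstOrder c₀ c d p) := by
  refine ((hp.fun_mul h₀.contDiffOn).add (IsSymbol.sum (s := Finset.univ) fun i _ => ?_)).add
    (IsSymbol.sum (s := Finset.univ) fun i _ => ?_)
  · exact (hp.dx i).fun_mul (hc i).contDiffOn
  · have := (isSymbol_coord U i).mul (hp.dxi i)
    rw [add_sub_cancel] at this
    exact this.fun_mul (hd i).contDiffOn

end FirstOrder

/-! ### Corner-degenerate symbols -/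

section Corner

variable {k n : ℕ} {q : Fin k → ℕ}

/-- The exponents of `r₁, …, r_k` in the weight of a covariable. -/
def wt : Coord k n q → Fin k → ℝ
  | Sum.inl l => fun j => if j ≤ l then 1 else 0
  | Sum.inr (Sum.inl _) => 0
  | Sum.inr (Sum.inr ⟨l, _⟩) => fun j => if j ≤ l then 1 else 0

/-- The weight of a covariable. -/
noncomputable def weight : Coord k n q → Sp (Coord k n q) → ℝ
  | Sum.inl l => fun z => ∏ j ∈ Finset.Iic l, rPart z j
  | Sum.inr (Sum.inl _) => fun _ => 1
  | Sum.inr (Sum.inr ⟨l, _⟩) => fun z => ∏ j ∈ Finset.Iic l, rPart z j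

theorem degenerate_apply (z ζ : Sp (Coord k n q)) (c : Coord k n q) :
    degenerate z ζ c = weight c z * ζ c := by
  rcases c with l | i | ⟨l, i⟩ <;> simp [degenerate, weight]

theorem contDiff_rPart (l : Fin k) : ContDiff ℝ ∞ fun z : Sp (Coord k n q) => rPart z l := by
  unfold rPart
  fun_prop

theorem contDiff_prod_rPart (s : Finset (Fin k)) :
    ContDiff ℝ ∞ fun z : Sp (Coord k n q) => ∏ j ∈ s, rPart z j :=
  contDiff_prod fun j _ => contDiff_rPart j

theorem contDiff_weight (c : Coord k n q) : ContDiff ℝ ∞ (weight c) := by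
  rcases c with l | i | ⟨l, i⟩
  · exact contDiff_prod_rPart _
  · exact contDiff_const
  · exact contDiff_prod_rPart _

theorem contDiff_degenerate :
    ContDiff ℝ ∞ fun p : Sp (Coord k n q) × Sp (Coord k n q) => degenerate p.1 p.2 := by
  rw [contDiff_euclidean]
  intro c
  simp_rw [degenerate_apply]
  have h : ContDiff ℝ ∞ fun p : Sp (Coord k n q) × Sp (Coord k n q) => p.2 c := by fun_prop
  exact ((contDiff_weight c).comp contDiff_fst).mul h

/-- The monomial `r₁^{e₁} ⋯ r_k^{e_k}` for `r₁, …, r_k > 0`. -/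
noncomputable def monom (e : Fin k → ℝ) (z : Sp (Coord k n q)) : ℝ :=
  Real.exp (∑ j, e j * Real.log (rPart z j))

theorem monom_pos (e : Fin k → ℝ) (z : Sp (Coord k n q)) : 0 < monom e z := Real.exp_pos _

theorem monom_add (e e' : Fin k → ℝ) (z : Sp (Coord k n q)) :
    monom (e + e') z = monom e z * monom e' z := by
  rw [monom, monom, monom, ← Real.exp_add, ← Finset.sum_add_distrib]
  simp_rw [Pi.add_apply, add_mul]

theorem monom_zero (z : Sp (Coord k n q)) : monom 0 z = 1 := by simp [monom]

theorem prod_Iic_eq {z : Sp (Coord k n q)} (hz : ∀ l, 0 < rPart z l) (l : Fin k) :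
    ∏ j ∈ Finset.Iic l, rPart z j = monom (fun j => if j ≤ l then 1 else 0) z := by
  rw [monom, Real.exp_sum]
  have : ∀ j : Fin k, Real.exp ((if j ≤ l then 1 else 0) * Real.log (rPart z j)) =
      if j ∈ Finset.Iic l then rPart z j else 1 := by
    intro j
    simp only [Finset.mem_Iic]
    split_ifs
    · rw [one_mul, Real.exp_log (hz j)]
    · simp
  simp_rw [this]
  rw [Finset.prod_ite_mem, Finset.univ_inter]

theorem weight_eq {z : Sp (Coord k n q)} (hz : ∀ l, 0 < rPart z l) (c : Coord k n q) :
    weight c z = monom (wt c) z := by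
  rcases c with l | i | ⟨l, i⟩
  · exact prod_Iic_eq hz l
  · exact (monom_zero z).symm
  · exact prod_Iic_eq hz l

/-- `∂ log r_j / ∂ z_i`. -/
noncomputable def dlog (i : Coord k n q) (j : Fin k) (z : Sp (Coord k n q)) : ℝ :=
  if i = Sum.inl j then (rPart z j)⁻¹ else 0

/-- The product of `weight i` and `dlog i j`, which is smooth up to the boundary. -/
noncomputable def wdlog (i : Coord k n q) (j : Fin k) (z : Sp (Coord k n q)) : ℝ :=
  if i = Sum.inl j then ∏ j' ∈ Finset.Iio j, rPart z j' else 0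

theorem contDiff_wdlog (i : Coord k n q) (j : Fin k) : ContDiff ℝ ∞ (wdlog i j) := by
  unfold wdlog
  split_ifs
  · exact contDiff_prod_rPart _
  · exact contDiff_const

/-- The factor r_j of the weight r₁⋯r_j cancels the pole of ∂ log r_j and leaves r₁⋯r_{j-1}. This
cancellation is the source of all smoothness up to the boundary. -/
theorem wdlog_eq {z : Sp (Coord k n q)} (hz : ∀ l, 0 < rPart z l) (i : Coord k n q) (j : Fin k) :
    wdlog i j z = weight i z * dlog i j z := by
  unfold wdlog dlog
  split_ifs with h
  · subst h
    have : weight (Sum.inl j : Coord k n q) z = ∏ j' ∈ Finset.Iic j, rPart z j' := rfl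
    rw [this, ← Finset.Iio_insert, Finset.prod_insert (by simp)]
    have := (hz j).ne'
    field_simp
  · simp

theorem hasFDerivAt_monom (e : Fin k → ℝ) {z : Sp (Coord k n q)} (hz : ∀ l, 0 < rPart z l) :
    HasFDerivAt (monom e) (monom e z • ∑ j, e j • ((rPart z j)⁻¹ •
      (EuclideanSpace.proj (Sum.inl j) : Sp (Coord k n q) →L[ℝ] ℝ))) z := by
  have h1 : ∀ j, HasFDerivAt (fun z : Sp (Coord k n q) => e j * Real.log (rPart z j))
      (e j • ((rPart z j)⁻¹ • (EuclideanSpace.proj (Sum.inl j) : Sp (Coord k n q) →L[ℝ] ℝ))) z := by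
    intro j
    have h2 : HasFDerivAt (fun z : Sp (Coord k n q) => rPart z j)
      (EuclideanSpace.proj (Sum.inl j) : Sp (Coord k n q) →L[ℝ] ℝ) z :=
      (EuclideanSpace.proj (Sum.inl j) : Sp (Coord k n q) →L[ℝ] ℝ).hasFDerivAt
    exact (h2.log (hz j).ne').const_mul (e j)
  exact (HasFDerivAt.fun_sum fun j _ => h1 j).exp

theorem coordProj_apply (c : Coord k n q) (v : Sp (Coord k n q)) :
    (EuclideanSpace.proj c : Sp (Coord k n q) →L[ℝ] ℝ) v = v c := rfl

theorem fderiv_monom (e : Fin k → ℝ) {z : Sp (Coord k n q)} (hz : ∀ l, 0 < rPart z l)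
    (i : Coord k n q) : fderiv ℝ (monom e) z (EuclideanSpace.single i 1) =
      monom e z * ∑ j, e j * dlog i j z := by
  rw [(hasFDerivAt_monom e hz).fderiv]
  simp only [smul_apply, sum_apply, smul_eq_mul, coordProj_apply, PiLp.single_apply, dlog]
  congr 1
  refine Finset.sum_congr rfl fun j _ => ?_
  by_cases h : i = Sum.inl j
  · simp [h]
  · simp [h, Ne.symm h]

/-- The corner-degenerate function with factor `r₁^{e₁} ⋯ r_k^{e_k}`. -/
noncomputable def theta (e : Fin k → ℝ) (p : Fn (Coord k n q)) : Fn (Coord k n q) := fun z ζ =>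
  ((monom e z : ℝ) : ℂ) * p z (degenerate z ζ)

theorem cornerSymbol_eq {m : ℝ} {p : Fn (Coord k n q)} {z : Sp (Coord k n q)}
    (hz : ∀ l, 0 < rPart z l) (ζ : Sp (Coord k n q)) :
    cornerSymbol m p z ζ = theta (fun _ => -m) p z ζ := by
  have h : ∏ l, rPart z l ^ (-m) = monom (fun _ => -m) z := by
    rw [monom, Real.exp_sum]
    refine Finset.prod_congr rfl fun j _ => ?_
    rw [Real.rpow_def_of_pos (hz j), mul_comm]
  rw [cornerSymbol, theta, h]

/-- The derivative of `p(z, ζ̃)` in `z_i`, in terms of `ζ̃` and multiplied by the weight. -/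
noncomputable def degDeriv (i : Coord k n q) (e : Fin k → ℝ) : Fn (Coord k n q) → Fn (Coord k n q) :=
  firstOrder (fun z => ((∑ j, e j * wdlog i j z : ℝ) : ℂ))
    (fun i' z => (((if i' = i then weight i z else 0 : ℝ)) : ℂ))
    (fun c z => ((∑ j, wt c j * wdlog i j z : ℝ) : ℂ))

theorem contDiff_sum_wdlog (e : Fin k → ℝ) (i : Coord k n q) :
    ContDiff ℝ ∞ fun z => ((∑ j, e j * wdlog i j z : ℝ) : ℂ) := by
  have h : ContDiff ℝ ∞ fun z => ∑ j, e j * wdlog i j z :=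
    ContDiff.sum fun j _ => contDiff_const.mul (contDiff_wdlog i j)
  exact Complex.ofRealCLM.contDiff.comp h

theorem contDiff_ite_weight (i' i : Coord k n q) :
    ContDiff ℝ ∞ fun z => (((if i' = i then weight i z else 0 : ℝ)) : ℂ) := by
  split_ifs
  · exact Complex.ofRealCLM.contDiff.comp (contDiff_weight i)
  · exact contDiff_const

variable {S : Opens (EuclideanSpace ℝ (Fin n))} {Y : (l : Fin k) → Opens (EuclideanSpace ℝ (Fin (q l)))}

theorem rPart_pos {z : Sp (Coord k n q)} (hz : z ∈ cornerInt S Y) (l : Fin k) : 0 < rPart z l :=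
  hz.2 l

theorem cornerInt_le_ambient : cornerInt S Y ≤ ambient S Y := fun _ hz => hz.1

theorem contDiffOn_monom (e : Fin k → ℝ) :
    ContDiffOn ℝ ∞ (monom e) (cornerInt S Y : Set (Sp (Coord k n q))) := by
  refine ContDiffOn.exp (ContDiffOn.sum fun j _ => contDiffOn_const.mul ?_)
  exact (contDiff_rPart j).contDiffOn.log fun z hz => (rPart_pos hz j).ne'

theorem contDiffOn_monom_complex (e : Fin k → ℝ) :
    ContDiffOn ℝ ∞ (fun z => ((monom e z : ℝ) : ℂ)) (cornerInt S Y : Set (Sp (Coord k n q))) :=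
  Complex.ofRealCLM.contDiff.comp_contDiffOn (contDiffOn_monom e)

theorem degenerate_smul (z ζ : Sp (Coord k n q)) (t : ℝ) :
    degenerate z (t • ζ) = t • degenerate z ζ := by
  ext c
  simp [degenerate_apply, mul_left_comm]

theorem degenerate_ne_zero {z ζ : Sp (Coord k n q)} (hz : ∀ l, 0 < rPart z l) (hζ : ζ ≠ 0) :
    degenerate z ζ ≠ 0 := by
  contrapose! hζ
  ext c
  have h := congrArg (fun x : Sp (Coord k n q) => x c) hζ
  simp only [degenerate_apply, weight_eq hz] at h
  exact (mul_eq_zero.1 h).resolve_left (monom_pos _ z).ne'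

theorem contDiff_degenerate_pair :
    ContDiff ℝ ∞ fun p : Sp (Coord k n q) × Sp (Coord k n q) => (p.1, degenerate p.1 p.2) :=
  contDiff_fst.prodMk contDiff_degenerate

theorem smooth_theta (e : Fin k → ℝ) {p : Fn (Coord k n q)} (hp : Smooth (cyl (cornerInt S Y)) p) :
    Smooth (cyl (cornerInt S Y)) (theta e p) := by
  have h1 : Smooth (cyl (cornerInt S Y)) fun z ζ => p z (degenerate z ζ) :=
    ContDiffOn.comp (g := unc p) hp contDiff_degenerate_pair.contDiffOn fun x hx => ⟨hx.1, trivial⟩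
  exact (isSymbol_of_fst (contDiffOn_monom_complex e)).smooth.mul h1

theorem sum_ite_mul {ι : Type} [Fintype ι] [DecidableEq ι] (i : ι) (w : ℝ) (f : ι → ℂ) :
    ∑ x, ((if x = i then w else 0 : ℝ) : ℂ) * f x = (w : ℂ) * f i := by
  rw [Finset.sum_eq_single i]
  · simp
  · intro b _ hb
    simp [hb]
  · simp

/-- The map ζ ↦ ζ̃ is diagonal, so the chain rule only brings out the weight of ζ_i, which joins the
monomial in front. -/
theorem dxi_theta (e : Fin k → ℝ) {p : Fn (Coord k n q)} (hp : Smooth (cyl (cornerInt S Y)) p)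
    (i : Coord k n q) {z : Sp (Coord k n q)} (hz : z ∈ cornerInt S Y) (ζ : Sp (Coord k n q)) :
    dxi i (theta e p) z ζ = theta (e + wt i) (dxi i p) z ζ := by
  have hd : DifferentiableAt ℝ (unc p) (z, degenerate z ζ) :=
    hp.differentiableAt (isOpen_cyl _) ⟨hz, trivial⟩
  have hg : ContDiff ℝ ∞ fun ζ' => degenerate z ζ' :=
    contDiff_degenerate.comp (contDiff_const.prodMk contDiff_id)
  have hg1 := (hg.differentiable (by simp) ζ).hasFDerivAt
  have hcomp : ∀ c, fderiv ℝ (fun ζ' => degenerate z ζ') ζ (EuclideanSpace.single i 1) c =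
      if c = i then weight i z else 0 := by
    intro c
    have h1 := ((EuclideanSpace.proj c : Sp (Coord k n q) →L[ℝ] ℝ).hasFDerivAt.comp ζ hg1).fderiv
    have h2 : ((EuclideanSpace.proj c : Sp (Coord k n q) →L[ℝ] ℝ) ∘ fun ζ' => degenerate z ζ') =
        fun ζ' => weight c z * ζ' c := by
      funext ζ'
      exact degenerate_apply z ζ' c
    have h3 : HasFDerivAt (fun ζ' : Sp (Coord k n q) => weight c z * ζ' c)
        (weight c z • (EuclideanSpace.proj c : Sp (Coord k n q) →L[ℝ] ℝ)) ζ :=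
      ((EuclideanSpace.proj c : Sp (Coord k n q) →L[ℝ] ℝ).hasFDerivAt).const_mul _
    rw [h2, h3.fderiv] at h1
    have h4 := congrArg (fun L : Sp (Coord k n q) →L[ℝ] ℝ => L (EuclideanSpace.single i 1)) h1
    simp only [smul_apply, ContinuousLinearMap.comp_apply, coordProj_apply,
      PiLp.single_apply, smul_eq_mul] at h4
    rw [← h4]
    split_ifs with h
    · rw [h, mul_one]
    · rw [mul_zero]
  have h5 : HasFDerivAt (fun ζ' => p z (degenerate z ζ')) _ ζ :=
    HasFDerivAt.comp (g := unc p) (f := fun ζ' => (z, degenerate z ζ')) ζ hd.hasFDerivAt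
      ((hasFDerivAt_const z ζ).prodMk hg1)
  have h6 := h5.const_mul ((monom e z : ℝ) : ℂ)
  have h7 : dxi i (theta e p) z ζ = ((monom e z : ℝ) : ℂ) * fderiv ℝ (unc p) (z, degenerate z ζ)
      (0, fderiv ℝ (fun ζ' => degenerate z ζ') ζ (EuclideanSpace.single i 1)) := by
    have e1 : dxi i (theta e p) z ζ = fderiv ℝ (fun ζ' => ((monom e z : ℝ) : ℂ) *
      p z (degenerate z ζ')) ζ (EuclideanSpace.single i 1) := rfl
    rw [e1, h6.fderiv]
    rfl
  rw [h7, fderiv_unc_apply hd]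
  simp only [hcomp]
  rw [theta, monom_add, ← weight_eq (rPart_pos hz), sum_ite_mul,
    Finset.sum_eq_zero fun x _ => by simp, zero_add]
  push_cast
  ring

/-- The prefactor and the components of ζ̃ are monomials in r, so each derivative reproduces them
times a logarithmic derivative; for ζ̃_c this gives Euler terms ζ̃_c ∂p/∂ζ̃_c, which keep the order.
Pulling out the inverse of weight i lowers e by wt i and leaves coefficients that are smooth up to
the boundary. -/
theorem dx_theta (e : Fin k → ℝ) {p : Fn (Coord k n q)} (hp : Smooth (cyl (cornerInt S Y)) p)
    (i : Coord k n q) {z : Sp (Coord k n q)} (hz : z ∈ cornerInt S Y) (ζ : Sp (Coord k n q)) :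
    dx i (theta e p) z ζ = theta (e - wt i) (degDeriv i e p) z ζ := by
  have hr := rPart_pos hz
  have hd : DifferentiableAt ℝ (unc p) (z, degenerate z ζ) :=
    hp.differentiableAt (isOpen_cyl _) ⟨hz, trivial⟩
  have hg : ContDiff ℝ ∞ fun z' => degenerate z' ζ :=
    contDiff_degenerate.comp (contDiff_id.prodMk contDiff_const)
  have hg1 := (hg.differentiable (by simp) z).hasFDerivAt
  have hcomp : ∀ c, fderiv ℝ (fun z' => degenerate z' ζ) z (EuclideanSpace.single i 1) c =
      (weight c z * ∑ j, wt c j * dlog i j z) * ζ c := by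
    intro c
    have h1 := ((EuclideanSpace.proj c : Sp (Coord k n q) →L[ℝ] ℝ).hasFDerivAt.comp z hg1).fderiv
    have h2 : ((EuclideanSpace.proj c : Sp (Coord k n q) →L[ℝ] ℝ) ∘ fun z' => degenerate z' ζ) =ᶠ[nhds z]
        fun z' => monom (wt c) z' * ζ c := by
      filter_upwards [(cornerInt S Y).isOpen.mem_nhds hz] with z' hz'
      rw [← weight_eq (rPart_pos hz')]
      exact degenerate_apply z' ζ c
    have h3 := (hasFDerivAt_monom (wt c) hr).mul_const (ζ c)
    rw [h2.fderiv_eq, h3.fderiv, ← (hasFDerivAt_monom (wt c) hr).fderiv] at h1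
    have h4 := congrArg (fun L : Sp (Coord k n q) →L[ℝ] ℝ => L (EuclideanSpace.single i 1)) h1
    simp only [smul_apply, ContinuousLinearMap.comp_apply, coordProj_apply,
      smul_eq_mul, fderiv_monom (wt c) hr] at h4
    rw [← h4, weight_eq hr]
    ring
  have h5 : HasFDerivAt (fun z' => p z' (degenerate z' ζ)) _ z :=
    HasFDerivAt.comp (g := unc p) (f := fun z' => (z', degenerate z' ζ)) z hd.hasFDerivAt
      ((hasFDerivAt_id z).prodMk hg1)
  have h8 : HasFDerivAt (fun z' => ((monom e z' : ℝ) : ℂ)) _ z :=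
    Complex.ofRealCLM.hasFDerivAt.comp z (hasFDerivAt_monom e hr).differentiableAt.hasFDerivAt
  have h6 := h8.mul h5
  have h7 : dx i (theta e p) z ζ = ((monom e z : ℝ) : ℂ) * fderiv ℝ (unc p) (z, degenerate z ζ)
      (EuclideanSpace.single i 1,
        fderiv ℝ (fun z' => degenerate z' ζ) z (EuclideanSpace.single i 1)) +
      p z (degenerate z ζ) * ((fderiv ℝ (monom e) z (EuclideanSpace.single i 1) : ℝ) : ℂ) := by
    have e1 : dx i (theta e p) z ζ = fderiv ℝ ((fun z' => ((monom e z' : ℝ) : ℂ)) *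
      fun z' => p z' (degenerate z' ζ)) z (EuclideanSpace.single i 1) := rfl
    rw [e1, h6.fderiv]
    rfl
  -- One factor weight i is split off the monomial and turns `dlog` into `wdlog`.
  have h9 : monom (e - wt i) z * weight i z = monom e z := by
    rw [weight_eq hr, ← monom_add, sub_add_cancel]
  rw [h7, fderiv_unc_apply hd, fderiv_monom e hr]
  simp only [hcomp]
  rw [theta, degDeriv, firstOrder]
  have s1 : ∀ f : Fin k → ℝ, ∑ j, f j * wdlog i j z = weight i z * ∑ j, f j * dlog i j z := by
    intro f
    rw [Finset.mul_sum]
    refine Finset.sum_congr rfl fun j _ => ?_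
    rw [wdlog_eq hr]
    ring
  simp only [s1, degenerate_apply]
  have s2 : ∑ x, (((EuclideanSpace.single i (1 : ℝ) : Sp (Coord k n q)) x : ℝ) : ℂ) *
      dx x p z (degenerate z ζ) = dx i p z (degenerate z ζ) := by
    rw [Finset.sum_eq_single i]
    · simp
    · intro b _ hb
      simp [hb]
    · simp
  have s4 : ((monom (e - wt i) z * weight i z : ℝ) : ℂ) * ∑ x,
      (((weight x z * (∑ j, wt x j * dlog i j z) * ζ x : ℝ) : ℂ) * dxi x p z (degenerate z ζ)) =
      ((monom (e - wt i) z : ℝ) : ℂ) * ∑ x, (((weight i z * ∑ j, wt x j * dlog i j z : ℝ) : ℂ) *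
        (((weight x z * ζ x : ℝ) : ℂ) * dxi x p z (degenerate z ζ))) := by
    rw [Finset.mul_sum, Finset.mul_sum]
    refine Finset.sum_congr rfl fun x _ => ?_
    push_cast
    ring
  rw [s2, sum_ite_mul i (weight i z) fun x => dx x p z (degenerate z ζ), ← h9, mul_add, s4, mul_add,
    mul_add]
  push_cast
  ring

end Corner

/-! ### Corner-degenerate symbols as symbols over the interior -/

section Theta

variable {k n : ℕ} {q : Fin k → ℕ} {S : Opens (EuclideanSpace ℝ (Fin n))}
  {Y : (l : Fin k) → Opens (EuclideanSpace ℝ (Fin (q l)))}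

theorem norm_le_of_coord_le {ι : Type} [Fintype ι] {x y : Sp ι} {B : ℝ} (hB : 0 ≤ B)
    (h : ∀ c, |x c| ≤ B * |y c|) : ‖x‖ ≤ B * ‖y‖ := by
  refine abs_le_of_sq_le_sq' ?_ (by positivity) |>.2
  rw [mul_pow, EuclideanSpace.norm_sq_eq, EuclideanSpace.norm_sq_eq, Finset.mul_sum]
  refine Finset.sum_le_sum fun c _ => ?_
  rw [Real.norm_eq_abs, Real.norm_eq_abs, ← mul_pow]
  exact pow_le_pow_left₀ (abs_nonneg _) (h c) 2

theorem bracket_le_of_norm_le {ι : Type} [Fintype ι] {x y : Sp ι} {B : ℝ} (hB : 1 ≤ B)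
    (h : ‖x‖ ≤ B * ‖y‖) : bracket x ≤ B * bracket y := by
  refine abs_le_of_sq_le_sq' ?_ (mul_nonneg (by linarith) (bracket_pos y).le) |>.2
  rw [mul_pow, bracket_sq, bracket_sq]
  have h1 : ‖x‖ ^ 2 ≤ (B * ‖y‖) ^ 2 := pow_le_pow_left₀ (norm_nonneg _) h 2
  nlinarith

theorem bracket_rpow_le_of_norm_le {ι : Type} [Fintype ι] {x y : Sp ι} {B : ℝ} (hB : 1 ≤ B)
    (h : ‖x‖ ≤ B * ‖y‖) (h' : ‖y‖ ≤ B * ‖x‖) (m : ℝ) :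
    bracket x ^ m ≤ B ^ |m| * bracket y ^ m := by
  have hB0 : 0 < B := by linarith
  rcases le_or_gt 0 m with hm | hm
  · rw [abs_of_nonneg hm, ← Real.mul_rpow hB0.le (bracket_pos y).le]
    exact Real.rpow_le_rpow (bracket_pos x).le (bracket_le_of_norm_le hB h) hm
  · have h1 : bracket y / B ≤ bracket x := by
      rw [div_le_iff₀' hB0]
      exact bracket_le_of_norm_le hB h'
    calc bracket x ^ m ≤ (bracket y / B) ^ m :=
          Real.rpow_le_rpow_of_nonpos (div_pos (bracket_pos y) hB0) h1 hm.le
      _ = B ^ |m| * bracket y ^ m := by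
        rw [Real.div_rpow (bracket_pos y).le hB0.le, abs_of_neg hm, Real.rpow_neg hB0.le]
        field_simp

/-- Over a compact subset of the interior all weights lie between positive constants, so ζ and ζ̃
have comparable norms; this fails only at the boundary. -/
theorem exists_degenerate_bound {L : Set (Sp (Coord k n q))} (hL : IsCompact L)
    (hLV : L ⊆ cornerInt S Y) : ∃ B : ℝ, 1 ≤ B ∧ ∀ z ∈ L, ∀ ζ,
      ‖degenerate z ζ‖ ≤ B * ‖ζ‖ ∧ ‖ζ‖ ≤ B * ‖degenerate z ζ‖ := by
  have hpos : ∀ z ∈ L, ∀ c : Coord k n q, 0 < weight c z := fun z hz c => by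
    rw [weight_eq (rPart_pos (hLV hz))]
    exact monom_pos _ _
  choose C hC using fun c : Coord k n q => hL.exists_bound_of_continuousOn
    (f := weight c) (contDiff_weight c).continuous.continuousOn
  choose D hD using fun c : Coord k n q => hL.exists_bound_of_continuousOn
    (f := fun z => (weight c z)⁻¹) ((contDiff_weight c).continuous.continuousOn.inv₀
      fun z hz => (hpos z hz c).ne')
  have hsum : ∀ c, |C c| + |D c| ≤ ∑ c, (|C c| + |D c|) := fun c =>
    Finset.single_le_sum (f := fun c => |C c| + |D c|) (fun c _ => by positivity) (Finset.mem_univ c)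
  have hs0 : 0 ≤ ∑ c, (|C c| + |D c|) := Finset.sum_nonneg fun c _ => by positivity
  refine ⟨1 + ∑ c, (|C c| + |D c|), by linarith, fun z hz ζ => ⟨?_, ?_⟩⟩
  · refine norm_le_of_coord_le (by linarith) fun c => ?_
    have hw := hpos z hz c
    have h1 := hC c z hz
    rw [Real.norm_eq_abs, abs_of_pos hw] at h1
    rw [degenerate_apply, abs_mul, abs_of_pos hw]
    refine mul_le_mul_of_nonneg_right ?_ (abs_nonneg _)
    linarith [hsum c, le_abs_self (C c), abs_nonneg (D c)]
  · refine norm_le_of_coord_le (by linarith) fun c => ?_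
    have hw := hpos z hz c
    have h1 := hD c z hz
    rw [Real.norm_eq_abs, abs_of_pos (inv_pos.2 hw)] at h1
    rw [degenerate_apply, abs_mul, abs_of_pos hw, ← mul_assoc]
    have h2 : 1 ≤ (1 + ∑ c, (|C c| + |D c|)) * weight c z := by
      rw [← div_le_iff₀ hw, one_div]
      linarith [hsum c, le_abs_self (D c), abs_nonneg (C c)]
    calc |ζ c| = 1 * |ζ c| := (one_mul _).symm
      _ ≤ _ := mul_le_mul_of_nonneg_right h2 (abs_nonneg _)

variable {U : Opens (Sp (Coord k n q))}

theorem IsSymbol.degDeriv {m : ℝ} {p : Fn (Coord k n q)} (hp : IsSymbol U m p) (i : Coord k n q)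
    (e : Fin k → ℝ) : IsSymbol U m (degDeriv i e p) :=
  hp.firstOrder (contDiff_sum_wdlog e i) (fun i' => contDiff_ite_weight i' i)
    fun c => contDiff_sum_wdlog (wt c) i

theorem Hom.degDeriv {m : ℝ} {p : Fn (Coord k n q)} (hp : Hom U m p) (i : Coord k n q)
    (e : Fin k → ℝ) : Hom U m (degDeriv i e p) :=
  hp.firstOrder (contDiff_sum_wdlog e i) (fun i' => contDiff_ite_weight i' i)
    fun c => contDiff_sum_wdlog (wt c) i

theorem Expands.degDeriv {m : ℝ} {p : Fn (Coord k n q)} {h : ℕ → Fn (Coord k n q)}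
    (hp : Expands U m p h) (i : Coord k n q) (e : Fin k → ℝ) :
    Expands U m (degDeriv i e p) fun j => degDeriv i e (h j) :=
  hp.firstOrder (contDiff_sum_wdlog e i) (fun i' => contDiff_ite_weight i' i)
    fun c => contDiff_sum_wdlog (wt c) i

/-- The exponents e and the symbol p are left free: by `dx_theta` and `dxi_theta` a derivative
changes both but stays in the class. The basic estimate compares ⟨ζ̃⟩ with ⟨ζ⟩. -/
theorem IsSymbol.theta {m : ℝ} {p : Fn (Coord k n q)} (hp : IsSymbol (cornerInt S Y) m p)
    (e : Fin k → ℝ) : IsSymbol (cornerInt S Y) m (theta e p) := by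
  refine isSymbol_of_closed (fun m a => ∃ e p, IsSymbol (cornerInt S Y) m p ∧
    ∀ x ∈ cyl (cornerInt S Y), a x.1 x.2 = CornerPsiDO.theta e p x.1 x.2) ?_ ?_ ?_
    ⟨e, p, hp, fun _ _ => rfl⟩
  · rintro m a ⟨e, p, hp, ha⟩
    exact (smooth_theta e hp.smooth).congr ha
  · rintro m a ⟨e, p, hp, ha⟩ L hL hLV
    obtain ⟨B, hB, hdeg⟩ := exists_degenerate_bound hL hLV
    obtain ⟨c, hc0, hc⟩ := hp.bound hL hLV
    obtain ⟨M, hM⟩ := hL.exists_bound_of_continuousOn ((contDiffOn_monom e).continuousOn.mono hLV)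
    refine ⟨M * (c * B ^ |m|), fun z hz ζ => ?_⟩
    rw [ha (z, ζ) ⟨hLV hz, trivial⟩, CornerPsiDO.theta, norm_mul, Complex.norm_real]
    have h1 := hM z hz
    have h2 := hc z hz (degenerate z ζ)
    have h3 := bracket_rpow_le_of_norm_le hB (hdeg z hz ζ).1 (hdeg z hz ζ).2 m
    have hM0 : 0 ≤ M := (norm_nonneg _).trans h1
    calc ‖monom e z‖ * ‖p z (degenerate z ζ)‖ ≤ M * (c * (B ^ |m| * bracket ζ ^ m)) :=
          mul_le_mul h1 (h2.trans (mul_le_mul_of_nonneg_left h3 hc0)) (norm_nonneg _) hM0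
      _ = M * (c * B ^ |m|) * bracket ζ ^ m := by ring
  · rintro m a ⟨e, p, hp, ha⟩ d
    cases d with
    | inl i =>
      refine ⟨e - wt i, CornerPsiDO.degDeriv i e p, ?_, fun x hx => ?_⟩
      · simpa [gain] using hp.degDeriv i e
      · rw [pd_congr (isOpen_cyl _) ha (Sum.inl i) x hx]
        exact dx_theta e hp.smooth i hx.1 x.2
    | inr i =>
      refine ⟨e + wt i, CornerPsiDO.dxi i p, hp.dxi i, fun x hx => ?_⟩
      rw [pd_congr (isOpen_cyl _) ha (Sum.inr i) x hx]
      exact dxi_theta e hp.smooth i hx.1 x.2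

theorem TailSym.theta {m : ℝ} {p : Fn (Coord k n q)} (hp : TailSym (cornerInt S Y) m p)
    (e : Fin k → ℝ) : TailSym (cornerInt S Y) m (theta e p) := by
  obtain ⟨a, ha, h⟩ := hp
  refine ⟨_, ha.theta e, fun L hL hLV => ?_⟩
  obtain ⟨B, hB, hdeg⟩ := exists_degenerate_bound hL hLV
  obtain ⟨R, hR⟩ := h L hL hLV
  refine ⟨B * R, fun z hz ζ hζ => ?_⟩
  rw [CornerPsiDO.theta, CornerPsiDO.theta, hR z hz]
  have h1 := hζ.trans (hdeg z hz ζ).2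
  exact le_of_mul_le_mul_left h1 (by linarith)

theorem Hom.theta {m : ℝ} {p : Fn (Coord k n q)} (hp : Hom (cornerInt S Y) m p)
    (e : Fin k → ℝ) : Hom (cornerInt S Y) m (theta e p) where
  smooth := by
    have h1 : Smooth (pcyl (cornerInt S Y)) fun z ζ => p z (degenerate z ζ) :=
      ContDiffOn.comp (g := unc p) hp.smooth contDiff_degenerate_pair.contDiffOn
        fun x hx => ⟨hx.1, degenerate_ne_zero (rPart_pos hx.1) hx.2⟩
    exact (Hom.of_fst (contDiffOn_monom_complex e)).smooth.mul h1
  hom z hz ζ hζ t ht := by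
    rw [CornerPsiDO.theta, CornerPsiDO.theta, degenerate_smul,
      hp.hom z hz _ (degenerate_ne_zero (rPart_pos hz) hζ) t ht]
    ring

theorem Expands.theta {m : ℝ} {p : Fn (Coord k n q)} {h : ℕ → Fn (Coord k n q)}
    (hp : Expands (cornerInt S Y) m p h) (e : Fin k → ℝ) :
    Expands (cornerInt S Y) m (theta e p) fun j => theta e (h j) where
  smooth := smooth_theta e hp.smooth
  hom j := (hp.hom j).theta e
  tail N := ((hp.tail N).theta e).congr' fun z _ ζ _ => by
    simp only [CornerPsiDO.theta]
    rw [mul_sub, Finset.mul_sum]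

/-! ### The Leibniz product of corner-degenerate symbols -/

/-- The terms of the Leibniz product in terms of the symbols `p(z, ζ̃)`, where `e` is the vector of
exponents of the second factor. -/
noncomputable def twist : ℕ → (Fin k → ℝ) → Fn (Coord k n q) → Fn (Coord k n q) → Fn (Coord k n q)
  | 0, _, p, p' => fun z ζ => p z ζ * p' z ζ
  -- Only the exponents of the second factor enter, because only that factor is differentiated in z;
  -- each such derivative lowers them by wt i.
  | l + 1, e, p, p' => fun z ζ =>
    ∑ i, twist l (e - wt i) (dxi i p) (fun z ζ => -Complex.I * degDeriv i e p' z ζ) z ζ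

/-- The shift +wt i from the derivative of the first factor cancels the shift -wt i from that of the
second. Every Leibniz term thus carries the same monomial, with exponents e + e'. -/
theorem leibTerm_theta (l : ℕ) : ∀ {m m' : ℝ} {e e' : Fin k → ℝ} {p p' : Fn (Coord k n q)},
    IsSymbol (cornerInt S Y) m p → IsSymbol (cornerInt S Y) m' p' → ∀ z ∈ cornerInt S Y, ∀ ζ,
    leibTerm l (theta e p) (theta e' p') z ζ = theta (e + e') (twist l e' p p') z ζ := by
  induction l with
  | zero =>
    intro m m' e e' p p' _ _ z _ ζ
    simp only [leibTerm, twist, theta, monom_add]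
    push_cast
    ring
  | succ l ih =>
    intro m m' e e' p p' hp hp' z hz ζ
    simp only [leibTerm, twist, theta]
    rw [Finset.mul_sum]
    refine Finset.sum_congr rfl fun i _ => ?_
    have h1 := leibTerm_congr (isOpen_cyl (cornerInt S Y)) l (a := dxi i (theta e p))
      (a' := theta (e + wt i) (dxi i p)) (b := fun x ξ => -Complex.I * dx i (theta e' p') x ξ)
      (b' := theta (e' - wt i) fun z ζ => -Complex.I * degDeriv i e' p' z ζ)
      (fun x hx => dxi_theta e hp.smooth i hx.1 x.2) (fun x hx => by
        rw [dx_theta e' hp'.smooth i hx.1 x.2]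
        simp only [theta]
        ring) (z, ζ) ⟨hz, trivial⟩
    have h2 := ih (e := e + wt i) (e' := e' - wt i) (hp.dxi i)
      ((hp'.degDeriv i e').const_mul (-Complex.I)) z hz ζ
    have h3 : e + wt i + (e' - wt i) = e + e' := by abel
    rw [h3] at h2
    exact h1.trans h2

theorem Hom.twist (l : ℕ) : ∀ {m m' : ℝ} (e : Fin k → ℝ) {p p' : Fn (Coord k n q)}, Hom U m p →
    Hom U m' p' → Hom U (m + m' - l) (twist l e p p') := by
  induction l with
  | zero =>
    intro m m' e p p' hp hp'
    rw [Nat.cast_zero, sub_zero]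
    exact hp.mul hp'
  | succ l ih =>
    intro m m' e p p' hp hp'
    refine Hom.sum fun i _ => ?_
    have := ih (e - wt i) (hp.pd (Sum.inr i)) ((hp'.degDeriv i e).const_mul (-Complex.I))
    have h : m - gain (Sum.inr i) + m' - (l : ℝ) = m + m' - ((l + 1 : ℕ) : ℝ) := by
      simp only [gain]; push_cast; ring
    rwa [h] at this

theorem Expands.twist (l : ℕ) : ∀ {m m' : ℝ} (e : Fin k → ℝ) {p p' : Fn (Coord k n q)}
    {h h' : ℕ → Fn (Coord k n q)}, Expands U m p h → Expands U m' p' h' →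
    Expands U (m + m' - l) (twist l e p p') fun j z ζ =>
      ∑ s ∈ Finset.HasAntidiagonal.antidiagonal j, twist l e (h s.1) (h' s.2) z ζ := by
  induction l with
  | zero =>
    intro m m' e p p' h h' hp hp'
    exact (hp.mul hp').congr_order (by simp)
  | succ l ih =>
    intro m m' e p p' h h' hp hp'
    have h2 : ∀ i : Coord k n q, m - gain (Sum.inr i) + m' - (l : ℝ) = m + m' - ((l + 1 : ℕ) : ℝ) := by
      intro i
      simp only [gain]; push_cast; ring
    have h3 : ∀ i : Coord k n q, Expands U (m + m' - ((l + 1 : ℕ) : ℝ))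
        (CornerPsiDO.twist l (e - wt i) (dxi i p) fun z ζ => -Complex.I * CornerPsiDO.degDeriv i e p' z ζ)
        fun j z ζ => ∑ s ∈ Finset.HasAntidiagonal.antidiagonal j, CornerPsiDO.twist l (e - wt i)
          (dxi i (h s.1)) (fun z ζ => -Complex.I * CornerPsiDO.degDeriv i e (h' s.2) z ζ) z ζ := fun i =>
      (ih (h := fun j => dxi i (h j)) (e - wt i) (hp.pd (Sum.inr i))
        ((hp'.degDeriv i e).const_mul (-Complex.I))).congr_order (h2 i)
    have h4 := Expands.sum (s := Finset.univ) fun (i : Coord k n q) _ => h3 i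
    refine h4.congr (fun x _ ξ => rfl) fun j x _ ξ _ => ?_
    simp only [CornerPsiDO.twist]
    rw [Finset.sum_comm]

/-- The asymptotic sum of the Leibniz product. -/
theorem Expands.exists_product {m m' : ℝ} (e : Fin k → ℝ) {p p' : Fn (Coord k n q)}
    {h h' : ℕ → Fn (Coord k n q)} (hp : Expands U m p h) (hp' : Expands U m' p' h') :
    ∃ c, Expands U (m + m') c (fun j z ζ => ∑ s ∈ Finset.HasAntidiagonal.antidiagonal j,
        ((s.1.factorial : ℂ))⁻¹ * ∑ t ∈ Finset.HasAntidiagonal.antidiagonal s.2,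
          CornerPsiDO.twist s.1 e (h t.1) (h' t.2) z ζ) ∧
      ∀ N : ℕ, IsSymbol U (m + m' - N) fun z ζ => c z ζ - ∑ l ∈ Finset.range N,
        ((l.factorial : ℂ))⁻¹ * CornerPsiDO.twist l e p p' z ζ := by
  have h1 := fun l : ℕ => (Expands.twist l e hp hp').const_mul ((l.factorial : ℂ))⁻¹
  obtain ⟨c, hc⟩ := exists_asymptotic_sum fun l => (h1 l).isSymbol
  refine ⟨c, Expands.of_asymptotic ?_ h1 fun N => (hc N).tail, hc⟩
  have := (hc 0).smooth
  simpa using this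

/-- Carries an asymptotic expansion by `twist` terms to the expansion that `HasLeftSymbol.comp`
requires. -/
theorem isSymbol_theta_sub {m m' : ℝ} {e e' : Fin k → ℝ} {p p' c : Fn (Coord k n q)}
    (hp : IsSymbol (cornerInt S Y) m p) (hp' : IsSymbol (cornerInt S Y) m' p')
    (hc : ∀ N : ℕ, IsSymbol (cornerInt S Y) (m + m' - N) fun z ζ => c z ζ -
      ∑ l ∈ Finset.range N, ((l.factorial : ℂ))⁻¹ * twist l e' p p' z ζ) (N : ℕ) :
    IsSymbol (cornerInt S Y) (m + m' - N) fun z ζ => theta (e + e') c z ζ -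
      ∑ l ∈ Finset.range N, ((l.factorial : ℂ))⁻¹ * leibTerm l (theta e p) (theta e' p') z ζ := by
  refine ((hc N).theta (e + e')).congr fun z hz ζ => ?_
  have h : ∀ l, leibTerm l (theta e p) (theta e' p') z ζ = _ := fun l =>
    leibTerm_theta l hp hp' z hz ζ
  simp_rw [h]
  simp only [theta]
  rw [mul_sub, Finset.mul_sum]
  congr 1
  refine Finset.sum_congr rfl fun l _ => ?_
  ring

end Theta

/-! ### Recursive construction of the homogeneous components of a parametrix -/

/-- The sequence defined by `g j = G j (g 0, …, g (j - 1), 0, 0, …)`. -/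
noncomputable def recSeq {α : Type*} [Zero α] (G : ℕ → (ℕ → α) → α) : ℕ → α
  | j => G j fun i => if _h : i < j then recSeq G i else 0

section Solve

variable {ι : Type} [Fintype ι] [DecidableEq ι] {U : Opens (Sp ι)}

/-- The homogeneous components of a product with expansion `∑ T l / l!`. -/
noncomputable def productTerm (T : ℕ → Fn ι → Fn ι → Fn ι) (h g : ℕ → Fn ι) (j : ℕ) : Fn ι :=
  fun z ζ => ∑ s ∈ Finset.HasAntidiagonal.antidiagonal j, ((s.1.factorial : ℂ))⁻¹ *
    ∑ t ∈ Finset.HasAntidiagonal.antidiagonal s.2, T s.1 (h t.1) (g t.2) z ζ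

variable {T : ℕ → Fn ι → Fn ι → Fn ι}

theorem Hom.productTerm {m m' : ℝ} {h g : ℕ → Fn ι} {j : ℕ} (hT : ∀ (l : ℕ) {d d' : ℝ} {a b : Fn ι},
      Hom U d a → Hom U d' b → Hom U (d + d' - l) (T l a b))
    (hh : ∀ j : ℕ, Hom U (m - j) (h j)) (hg : ∀ i ≤ j, Hom U (m' - i) (g i)) :
    Hom U (m + m' - j) (productTerm T h g j) := by
  refine Hom.sum fun s hs => Hom.const_mul _ (Hom.sum fun t ht => ?_)
  rw [Finset.HasAntidiagonal.mem_antidiagonal] at hs ht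
  have h1 := hT s.1 (hh t.1) (hg t.2 (by omega))
  have h2 : m - t.1 + (m' - t.2) - (s.1 : ℝ) = m + m' - j := by
    have h3 : (j : ℝ) = s.1 + (t.1 + t.2) := by exact_mod_cast (by omega : j = s.1 + (t.1 + t.2))
    rw [h3]; ring
  rwa [h2] at h1

/-- The last component of the second factor enters the product through `T 0` only. -/
theorem productTerm_eq (h0 : ∀ l a, T l a 0 = 0) (h g : ℕ → Fn ι) (j : ℕ) (z ζ : Sp ι) :
    productTerm T h g j z ζ =
      productTerm T h (fun i => if i < j then g i else 0) j z ζ + T 0 (h 0) (g j) z ζ := by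
  have h1 : T 0 (h 0) (g j) z ζ = ∑ s ∈ Finset.HasAntidiagonal.antidiagonal j,
      ((s.1.factorial : ℂ))⁻¹ * ∑ t ∈ Finset.HasAntidiagonal.antidiagonal s.2,
        if s.1 = 0 ∧ t = (0, j) then T 0 (h 0) (g j) z ζ else 0 := by
    rw [Finset.sum_eq_single (0, j), Finset.sum_eq_single (0, j)]
    · simp
    · intro t _ ht
      simp [ht]
    · simp
    · rintro ⟨l, s⟩ hs hne
      rw [Finset.HasAntidiagonal.mem_antidiagonal] at hs
      have hl : l ≠ 0 := by
        rintro rfl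
        exact hne (by simpa using hs)
      simp [hl]
    · simp
  rw [h1, productTerm, productTerm, ← Finset.sum_add_distrib]
  refine Finset.sum_congr rfl fun s hs => ?_
  rw [← mul_add, ← Finset.sum_add_distrib]
  congr 1
  refine Finset.sum_congr rfl fun t ht => ?_
  rw [Finset.HasAntidiagonal.mem_antidiagonal] at hs ht
  by_cases hj : t.2 < j
  · have : ¬ (s.1 = 0 ∧ t = (0, j)) := fun h => by
      rw [h.2] at hj
      exact lt_irrefl _ hj
    rw [if_pos hj, if_neg this, add_zero]
  · have h2 : s.1 = 0 ∧ t = (0, j) := ⟨by omega, by ext <;> simp <;> omega⟩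
    rw [if_neg hj, if_pos h2, h0, h2.1, h2.2]
    simp

/-- As T 0 is pointwise multiplication, the equation of degree j reads h₀ g_j = δ_{j0} minus terms
in g_i with i < j, and is solved by multiplication with w. The g_j are defined everywhere by this
recursion, and w h₀ = 1 is used only at the point considered. Keeping T abstract covers right and
left inverses. -/
theorem exists_inverse_components {m : ℝ} {h : ℕ → Fn ι} {w : Fn ι} (h0 : ∀ l a, T l a 0 = 0)
    (hmul : ∀ a b z ζ, T 0 a b z ζ = a z ζ * b z ζ)
    (hT : ∀ (l : ℕ) {d d' : ℝ} {a b : Fn ι}, Hom U d a → Hom U d' b → Hom U (d + d' - l) (T l a b))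
    (hh : ∀ j : ℕ, Hom U (m - j) (h j)) (hw : Hom U (-m) w) :
    ∃ g : ℕ → Fn ι, (∀ j : ℕ, Hom U (-m - j) (g j)) ∧ ∀ j z ζ, w z ζ * h 0 z ζ = 1 →
      productTerm T h g j z ζ = if j = 0 then 1 else 0 := by
  let G : ℕ → (ℕ → Fn ι) → Fn ι := fun j g z ζ =>
    w z ζ * ((if j = 0 then 1 else 0) - productTerm T h g j z ζ)
  have hrec : ∀ j, recSeq G j = G j fun i => if i < j then recSeq G i else 0 := fun j => by
    rw [recSeq]
    simp only [dite_eq_ite]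
  refine ⟨recSeq G, fun j => ?_, fun j z ζ hz => ?_⟩
  · induction j using Nat.strong_induction_on with
    | _ j ih =>
      rw [hrec]
      have h1 : Hom U (m + -m - j) (CornerPsiDO.productTerm T h
          (fun i => if i < j then recSeq G i else 0) j) := by
        refine Hom.productTerm hT hh fun i _ => ?_
        split_ifs with hi
        · exact ih i hi
        · exact Hom.zero _
      have h2 : Hom U (m + -m - j) fun _ _ => if j = 0 then 1 else 0 := by
        split_ifs with hj
        · have := Hom.of_fst (U := U) (f := fun _ => 1) contDiffOn_const
          rwa [show m + -m - (j : ℝ) = 0 by simp [hj]]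
        · exact Hom.zero _
      have h3 := hw.mul (h2.add (h1.const_mul (-1)))
      rw [show -m + (m + -m - (j : ℝ)) = -m - j by ring] at h3
      exact h3.congr fun z _ ζ _ => by simp only [G]; ring
  · rw [productTerm_eq h0, hmul]
    conv_lhs => rw [hrec]
    simp only [G]
    linear_combination ((if j = 0 then 1 else 0) - productTerm T h
      (fun i => if i < j then recSeq G i else 0) j z ζ) * hz

end Solve

/-! ### Inverse of the elliptic principal symbol, extended across the boundary. -/

section Corner

variable {k n : ℕ} {q : Fin k → ℕ} {S : Opens (EuclideanSpace ℝ (Fin n))}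
  {Y : (l : Fin k) → Opens (EuclideanSpace ℝ (Fin (q l)))}

/-- A smooth function that vanishes exactly on `{r_1, …, r_k ≥ 0}`. -/
theorem exists_smooth_vanishing (k n : ℕ) (q : Fin k → ℕ) :
    ∃ f : Sp (Coord k n q) → ℝ, ContDiff ℝ ∞ f ∧ (∀ z, 0 ≤ f z) ∧
      ∀ z, f z = 0 ↔ ∀ l, 0 ≤ rPart z l := by
  have ho : IsOpen {z : Sp (Coord k n q) | ∃ l, rPart z l < 0} := by
    have : {z : Sp (Coord k n q) | ∃ l, rPart z l < 0} = ⋃ l, {z | rPart z l < 0} := by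
      ext; simp
    rw [this]
    exact isOpen_iUnion fun l => isOpen_lt (continuous_rPart l) continuous_const
  obtain ⟨f, hf, hc, hr⟩ := ho.exists_contDiff_support_eq (n := ⊤)
  refine ⟨f, hc, fun z => (hr (Set.mem_range_self z)).1, fun z => ?_⟩
  have h1 : f z ≠ 0 ↔ ∃ l, rPart z l < 0 := by
    rw [← Function.mem_support, hf]; rfl
  rw [← not_iff_not]
  refine h1.trans ?_
  push Not
  rfl

/-- Ellipticity is known over K only, while w is wanted for all r ∈ ℝ^k. The choice is w = h̄ /
(|h|² + f |ζ|^{2m}), where f ≥ 0 is smooth and vanishes exactly for r₁, …, r_k ≥ 0: the denominator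
is positive everywhere, homogeneous of degree 2m, and equal to |h|² over K. -/
theorem exists_elliptic_inverse {m : ℝ} {h : Fn (Coord k n q)} (hh : Hom (ambient S Y) m h)
    (hne : ∀ z ∈ corner S Y, ∀ ζ ≠ 0, h z ζ ≠ 0) :
    ∃ w, Hom (ambient S Y) (-m) w ∧ ∀ z ∈ corner S Y, ∀ ζ ≠ 0, w z ζ * h z ζ = 1 := by
  obtain ⟨f, hf, hf0, hfz⟩ := exists_smooth_vanishing k n q
  let d : Sp (Coord k n q) → Sp (Coord k n q) → ℝ := fun z ζ =>
    Complex.normSq (h z ζ) + f z * ‖ζ‖ ^ (2 * m)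
  have hd : ∀ z ∈ ambient S Y, ∀ ζ ≠ 0, d z ζ ≠ 0 := by
    intro z hz ζ hζ
    have h1 : 0 < ‖ζ‖ ^ (2 * m) := Real.rpow_pos_of_pos (norm_pos_iff.2 hζ) _
    by_cases hc : ∀ l, 0 ≤ rPart z l
    · have h2 := Complex.normSq_pos.2 (hne z ⟨hz, hc⟩ ζ hζ)
      have := mul_nonneg (hf0 z) h1.le
      exact (add_pos_of_pos_of_nonneg h2 this).ne'
    · have h2 : 0 < f z := (hf0 z).lt_of_ne fun h => hc ((hfz z).1 h.symm)
      exact (add_pos_of_nonneg_of_pos (Complex.normSq_nonneg _) (mul_pos h2 h1)).ne'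
  have hconj : Smooth (pcyl (ambient S Y)) fun z ζ => (starRingEnd ℂ) (h z ζ) :=
    Complex.conjCLE.contDiff.comp_contDiffOn hh.smooth
  have hpow : Smooth (pcyl (ambient S Y)) fun z ζ => ((f z * ‖ζ‖ ^ (2 * m) : ℝ) : ℂ) := by
    intro x hx
    have h1 : ContDiffAt ℝ ∞ (fun x : Sp (Coord k n q) × Sp (Coord k n q) => ‖x.2‖) x :=
      (contDiffAt_norm ℝ hx.2).comp x contDiffAt_snd
    have h2 := h1.rpow_const_of_ne (p := 2 * m) (norm_ne_zero_iff.2 hx.2)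
    have h3 : ContDiffAt ℝ ∞ (fun x : Sp (Coord k n q) × Sp (Coord k n q) => f x.1) x :=
      hf.contDiffAt.comp x contDiffAt_fst
    exact (Complex.ofRealCLM.contDiff.contDiffAt.comp x (h3.mul h2)).contDiffWithinAt
  have hds : Smooth (pcyl (ambient S Y)) fun z ζ => ((d z ζ : ℝ) : ℂ) :=
    ((hconj.mul hh.smooth).add hpow).congr fun x _ => by
      simp only [d]
      push_cast
      rw [Complex.normSq_eq_conj_mul_self]
  refine ⟨fun z ζ => (starRingEnd ℂ) (h z ζ) * ((d z ζ : ℝ) : ℂ)⁻¹,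
    ⟨hconj.mul ?_, fun z hz ζ hζ t ht => ?_⟩, fun z hz ζ hζ => ?_⟩
  · exact ContDiffOn.inv hds fun x hx => Complex.ofReal_ne_zero.2 (hd x.1 hx.1 x.2 hx.2)
  · have hdt : d z (t • ζ) = t ^ (2 * m) * d z ζ := by
      simp only [d]
      rw [hh.hom z hz ζ hζ t ht, Complex.normSq_mul, Complex.normSq_ofReal, norm_smul,
        Real.mul_rpow (norm_nonneg _) (norm_nonneg _), Real.norm_of_nonneg ht.le, ← Real.rpow_add ht,
        ← two_mul]
      ring
    rw [hdt, hh.hom z hz ζ hζ t ht, map_mul, Complex.conj_ofReal]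
    have h1 : t ^ (-m) = t ^ m * (t ^ (2 * m))⁻¹ := by
      rw [← Real.rpow_neg ht.le, ← Real.rpow_add ht]
      congr 1; ring
    rw [h1]
    push_cast
    rw [mul_inv]
    ring
  · have h1 : f z = 0 := (hfz z).2 hz.2
    have h2 : ((d z ζ : ℝ) : ℂ) = (starRingEnd ℂ) (h z ζ) * h z ζ := by
      simp only [d, h1, zero_mul, add_zero]
      exact Complex.normSq_eq_conj_mul_self
    have h3 : ((d z ζ : ℝ) : ℂ) ≠ 0 := Complex.ofReal_ne_zero.2 (hd z hz.1 ζ hζ)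
    rw [mul_right_comm, ← h2, mul_inv_cancel₀ h3]

theorem degDeriv_zero (i : Coord k n q) (e : Fin k → ℝ) : degDeriv i e 0 = 0 := by
  have h1 : ∀ i : Coord k n q, dx i 0 = (0 : Fn (Coord k n q)) := fun i => by ext; simp [dx]
  have h2 : ∀ i : Coord k n q, dxi i 0 = (0 : Fn (Coord k n q)) := fun i => by ext; simp [dxi]
  ext
  simp only [degDeriv, firstOrder, h1, h2, Pi.zero_apply, mul_zero, Finset.sum_const_zero, add_zero]

theorem twist_zero_right (l : ℕ) : ∀ (e : Fin k → ℝ) (p : Fn (Coord k n q)), twist l e p 0 = 0 := by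
  induction l with
  | zero => intro e p; ext; simp [twist]
  | succ l ih =>
    intro e p
    have h : ∀ i : Coord k n q, (fun z ζ => -Complex.I * degDeriv i e 0 z ζ) = (0 : Fn _) :=
      fun i => by ext; simp [degDeriv_zero]
    ext
    simp only [twist, h, ih, Pi.zero_apply, Finset.sum_const_zero]

theorem twist_zero_left (l : ℕ) : ∀ (e : Fin k → ℝ) (p : Fn (Coord k n q)), twist l e 0 p = 0 := by
  induction l with
  | zero => intro e p; ext; simp [twist]
  | succ l ih =>
    intro e p
    have h : ∀ i : Coord k n q, dxi i 0 = (0 : Fn (Coord k n q)) := fun i => by ext; simp [dxi]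
    ext
    simp only [twist, h, ih, Pi.zero_apply, Finset.sum_const_zero]

end Corner

/-! ### Parametrices -/

section Operators

variable {ι : Type} [Fintype ι] [DecidableEq ι] {U : Opens (Sp ι)}

theorem leibTerm_zero_left (l : ℕ) (b : Fn ι) : leibTerm l (fun _ _ => 0) b = fun _ _ => 0 := by
  have := leibTerm_fun_mul l (fun _ => 0) (fun _ _ => 0) b
  simpa only [zero_mul] using this

theorem isSmoothing_zero : IsSmoothing (0 : Operator U) :=
  ⟨fun _ _ => 0, contDiffOn_const, fun u x _ => by simp⟩

theorem hasLeftSymbol_idOp : HasLeftSymbol (idOp U) fun _ _ => 1 :=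
  ⟨0, isSmoothing_zero, fun u x _ => by
    have h := opLeft_fun (φ := fun _ => 1) u.contDiff u.hasCompactSupport x
    have h' : ((0 : Operator U) u : Sp ι → ℂ) x = 0 := rfl
    rw [h, h', one_mul, add_zero]
    rfl⟩

theorem HasLeftSymbol.isSmoothing_sub {A B : Operator U} {m : ℝ} {a : Fn ι} (ha : IsSymbol U m a)
    (hA : HasLeftSymbol A a) (hB : HasLeftSymbol B a) : IsSmoothing (A - B) := by
  rw [← sub_sub_sub_cancel_right A B (opOn a ha)]
  exact ((hasLeftSymbol_iff ha).1 hA).sub ((hasLeftSymbol_iff ha).1 hB)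

/-- Smoothing operators form a two-sided ideal. -/
theorem IsSmoothing.comp_left {A B C : Operator U} {m : ℝ} {b : Fn ι} (hA : IsSmoothing A)
    (hB : HasLeftSymbol B b) (hb : IsSymbol U m b) (hC : IsComposition A B C)
    (hAB : LocComposable A B) : IsSmoothing C := by
  -- A smoothing operator has left symbol 0, so the ideal property is the composition theorem with c
  -- = 0.
  rw [isSmoothing_iff_hasLeftSymbol_zero] at hA ⊢
  refine hA.comp hB (isSymbol_zero U 0) hb hC hAB fun N => ?_
  simp only [leibTerm_zero_left, mul_zero, Finset.sum_const_zero, sub_zero]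
  exact isSymbol_zero U _

theorem IsSmoothing.comp_right {A B C : Operator U} {m : ℝ} {a : Fn ι} (hB : IsSmoothing B)
    (hA : HasLeftSymbol A a) (ha : IsSymbol U m a) (hC : IsComposition A B C)
    (hAB : LocComposable A B) : IsSmoothing C := by
  rw [isSmoothing_iff_hasLeftSymbol_zero] at hB ⊢
  refine hA.comp hB ha (isSymbol_zero U 0) hC hAB fun N => ?_
  simp only [leibTerm_zero_right, mul_zero, Finset.sum_const_zero, sub_zero]
  exact isSymbol_zero U _

/-- A properly supported operator maps `C_0^∞` to itself. -/
theorem IsProperlySupported.exists_test_eq {B : Operator U} (hB : IsProperlySupported B)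
    (u : 𝓓(U, ℂ)) : ∃ T : 𝓓(U, ℂ), ∀ y, T y = (B u : Sp ι → ℂ) y := by
  have hK : IsCompact (Prod.fst '' (kernelSupport B ∩ Prod.snd ⁻¹' tsupport u)) :=
    ((hB _ u.hasCompactSupport.isCompact u.tsupport_subset).2.image continuous_fst)
  obtain ⟨φ, hφ⟩ := exists_cutoff_one (U := U) hK (by rintro _ ⟨p, hp, rfl⟩; exact hp.1.1)
  refine ⟨cutMul φ (B u), fun y => ?_⟩
  rw [cutMul_apply]
  by_cases hy : y ∈ U
  · by_cases hyK : y ∈ Prod.fst '' (kernelSupport B ∩ Prod.snd ⁻¹' tsupport u)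
    · rw [hφ y hyK, one_mul]
    · rw [eq_zero_of_kernelSupport B u hy fun y' hy' h => hyK ⟨(y, y'), ⟨h, hy'⟩, rfl⟩, mul_zero]
  · rw [(B u).2.2 y hy, mul_zero]

/-- The value of a composition if the second factor gives a test function. -/
theorem IsComposition.apply_test {A B C : Operator U} (hC : IsComposition A B C) {u T : 𝓓(U, ℂ)}
    (hT : ∀ y, T y = (B u : Sp ι → ℂ) y) : C u = A T := by
  ext x
  by_cases hx : x ∈ U
  · obtain ⟨L, hL, hLU, h⟩ := hC u x hx
    obtain ⟨φ, hφ⟩ := exists_cutoff_one (U := U)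
      (hL.union T.hasCompactSupport.isCompact) (Set.union_subset hLU T.tsupport_subset)
    have h1 : cutMul φ (B u) = T := by
      ext y
      rw [cutMul_apply, ← hT]
      by_cases hy : y ∈ tsupport T
      · rw [hφ y (Or.inr hy), one_mul]
      · rw [image_eq_zero_of_notMem_tsupport hy, mul_zero]
    rw [← h φ fun y hy => hφ y (Or.inl hy), h1]
  · rw [(C u).2.2 x hx, (A T).2.2 x hx]

/-- With `P' A = C₁` and `A P = C₂`, associativity gives
`P - P' = (1 - C₁) P - P' (1 - C₂)`. -/
theorem sub_eq_of_isComposition {A P P' C₁ C₂ X₁ X₂ : Operator U} (hP : IsProperlySupported P)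
    (h₁ : IsComposition P' A C₁) (h₂ : IsComposition A P C₂) (hX₁ : IsComposition (idOp U - C₁) P X₁)
    (hX₂ : IsComposition P' (idOp U - C₂) X₂) : P - P' = X₁ - X₂ := by
  ext u x
  rw [sub_apply_op, sub_apply_op]
  by_cases hx : x ∈ U
  · obtain ⟨T, hT⟩ := hP.exists_test_eq u
    rw [hX₁.apply_test hT, sub_apply_op]
    have hid : ∀ v : 𝓓(U, ℂ), (idOp U v : Sp ι → ℂ) x = v x := fun _ => rfl
    rw [hid, hT]
    obtain ⟨L, hL, hLU, h⟩ := h₁ T x hx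
    obtain ⟨L', hL', hLU', h'⟩ := hX₂ u x hx
    obtain ⟨φ, hφ⟩ := exists_cutoff_one (U := U) ((hL.union hL').union u.hasCompactSupport.isCompact)
      (Set.union_subset (Set.union_subset hLU hLU') u.tsupport_subset)
    rw [← h φ fun y hy => hφ y (Or.inl (Or.inl hy)), ← h' φ fun y hy => hφ y (Or.inl (Or.inr hy))]
    -- Here T is B u for B = P, a test function; since φ is one on the support of u, only the term A
    -- T needs the cutoff, and P'(φ A T) is also the value of P'A at T.
    have h3 : cutMul φ ((idOp U - C₂) u) = u - cutMul φ (A T) := by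
      ext y
      have h4 : (u - cutMul φ (A T)) y = u y - φ y * (A T : Sp ι → ℂ) y := rfl
      have h5 : (idOp U u : Sp ι → ℂ) y = u y := rfl
      rw [cutMul_apply, sub_apply_op, h₂.apply_test hT, h4, h5, mul_sub]
      congr 1
      by_cases hy : y ∈ tsupport u
      · rw [hφ y (Or.inr hy), one_mul]
      · rw [image_eq_zero_of_notMem_tsupport hy, mul_zero]
    have h6 : (P' (u - cutMul φ (A T)) : Sp ι → ℂ) x =
        (P' u : Sp ι → ℂ) x - (P' (cutMul φ (A T)) : Sp ι → ℂ) x := by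
      rw [map_sub]; rfl
    rw [h3, h6]
    ring
  · rw [(P u).2.2 x hx, (P' u).2.2 x hx, (X₁ u).2.2 x hx, (X₂ u).2.2 x hx]

/-- A left and a right inverse modulo `S^{-∞}` of the symbol give a properly supported two-sided
parametrix. -/
theorem exists_parametrix {A : Operator U} {m : ℝ} {a b b' : Fn ι} (hA : HasLeftSymbol A a)
    (ha : IsSymbol U m a) (hb : IsSymbol U (-m) b) (hb' : IsSymbol U (-m) b')
    (hr : ∀ N : ℕ, IsSymbol U (m + -m - N) fun x ξ => 1 -
      ∑ l ∈ Finset.range N, ((l.factorial : ℂ))⁻¹ * leibTerm l a b x ξ)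
    (hl : ∀ N : ℕ, IsSymbol U (-m + m - N) fun x ξ => 1 -
      ∑ l ∈ Finset.range N, ((l.factorial : ℂ))⁻¹ * leibTerm l b' a x ξ) :
    ∃ P, HasLeftSymbol P b ∧ IsProperlySupported P ∧
      (∃ C, IsComposition P A C ∧ IsSmoothing (idOp U - C)) ∧
      (∃ C, IsComposition A P C ∧ IsSmoothing (idOp U - C)) := by
  have hone : IsSymbol U 0 (fun _ _ => 1 : Fn ι) := isSymbol_of_fst contDiffOn_const
  obtain ⟨P, hP, hPb⟩ := exists_properlySupported hb
  obtain ⟨P', hP', hPb'⟩ := exists_properlySupported hb'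
  have hAP := locComposable_of_right A hP
  obtain ⟨C₂, hC₂⟩ := hAP.exists_isComposition
  have hR₂ := hasLeftSymbol_idOp.isSmoothing_sub hone (hA.comp hPb ha hb hC₂ hAP hr)
  have hPA' := locComposable_of_left hP' A
  obtain ⟨C₁, hC₁⟩ := hPA'.exists_isComposition
  have hR₁ := hasLeftSymbol_idOp.isSmoothing_sub hone (hPb'.comp hA hb' ha hC₁ hPA' hl)
  have hL₁ := locComposable_of_right (idOp U - C₁) hP
  obtain ⟨X₁, hX₁⟩ := hL₁.exists_isComposition
  have hL₂ := locComposable_of_left hP' (idOp U - C₂)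
  obtain ⟨X₂, hX₂⟩ := hL₂.exists_isComposition
  have hPP : IsSmoothing (P - P') := by
    rw [sub_eq_of_isComposition hP hC₁ hC₂ hX₁ hX₂]
    exact (hR₁.comp_left hPb hb hX₁ hL₁).sub (hR₂.comp_right hPb' hb' hX₂ hL₂)
  -- Because P - P' is smoothing, P has the left symbol b' as well as b, and so is also a left
  -- parametrix.
  have hPA := locComposable_of_left hP A
  obtain ⟨C, hC⟩ := hPA.exists_isComposition
  exact ⟨P, hPb, hP, ⟨C, hC, hasLeftSymbol_idOp.isSmoothing_sub hone
    ((hPb'.add_smoothing hPP).comp hA hb' ha hC hPA hl)⟩, C₂, hC₂, hR₂⟩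

end Operators

/-! ### Inverse symbols and the two statements for corner-degenerate operators. -/

section Corner

variable {k n : ℕ} {q : Fin k → ℕ} {S : Opens (EuclideanSpace ℝ (Fin n))}
  {Y : (l : Fin k) → Opens (EuclideanSpace ℝ (Fin (q l)))}

theorem Expands.isSymbol_one_sub {ι : Type} [Fintype ι] [DecidableEq ι] {U : Opens (Sp ι)} {m : ℝ}
    {c : Fn ι} {g : ℕ → Fn ι} (hc : Expands U m c g)
    (hg : ∀ j, ∀ z ∈ U, ∀ ζ ≠ 0, g j z ζ = if j = 0 then 1 else 0) (N : ℕ) :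
    IsSymbol U (m - N) fun z ζ => 1 - c z ζ := by
  have h1 : TailSym U (m - N) fun z ζ => c z ζ - 1 := by
    -- N + 1 terms are removed instead of N, so that the component 1 of degree zero is among them
    -- even for N = 0.
    refine ((hc.tail (N + 1)).mono (by push_cast; linarith)).congr' fun z hz ζ hζ => ?_
    rw [Finset.sum_congr rfl fun j _ => hg j z hz ζ hζ]
    simp
  have h2 := (h1.isSymbol (hc.smooth.sub (Smooth.const 1))).const_mul (-1)
  exact h2.congr fun z _ ζ => by ring

/-- The components of b exist over ℝ^k × Σ × Ω, but the product has the components 1, 0, 0, … only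
where w h₀ = 1. This holds over K, hence over the interior, which is all that the operators see. -/
theorem exists_right_inverse {m : ℝ} (e : Fin k → ℝ) {p w : Fn (Coord k n q)}
    {h : ℕ → Fn (Coord k n q)} (hp : Expands (ambient S Y) m p h) (hw : Hom (ambient S Y) (-m) w)
    (hwh : ∀ z ∈ corner S Y, ∀ ζ ≠ 0, w z ζ * h 0 z ζ = 1) :
    ∃ b g, Expands (ambient S Y) (-m) b g ∧ ∀ N : ℕ, IsSymbol (cornerInt S Y) (m + -m - N)
      fun z ζ => 1 - ∑ l ∈ Finset.range N, ((l.factorial : ℂ))⁻¹ * twist l e p b z ζ := by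
  obtain ⟨g, hg, hgh⟩ := exists_inverse_components (T := fun l => twist l e) (m := m) (h := h)
    (fun l a => twist_zero_right l e a) (fun _ _ _ _ => rfl) (fun l _ _ _ _ ha hb => ha.twist l e hb)
    hp.hom hw
  obtain ⟨b, hb⟩ := exists_expands hg
  obtain ⟨c, hc, hcN⟩ := hp.exists_product e hb
  refine ⟨b, g, hb, fun N => ?_⟩
  have h1 := (hc.restrict cornerInt_le_ambient).isSymbol_one_sub
    (fun j z hz ζ hζ => hgh j z ζ (hwh z ⟨hz.1, fun l => (hz.2 l).le⟩ ζ hζ)) N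
  exact (h1.add ((hcN N).restrict cornerInt_le_ambient)).congr fun z _ ζ => by ring

theorem exists_left_inverse {m : ℝ} (e : Fin k → ℝ) {p w : Fn (Coord k n q)}
    {h : ℕ → Fn (Coord k n q)} (hp : Expands (ambient S Y) m p h) (hw : Hom (ambient S Y) (-m) w)
    (hwh : ∀ z ∈ corner S Y, ∀ ζ ≠ 0, w z ζ * h 0 z ζ = 1) :
    ∃ b g, Expands (ambient S Y) (-m) b g ∧ ∀ N : ℕ, IsSymbol (cornerInt S Y) (-m + m - N)
      fun z ζ => 1 - ∑ l ∈ Finset.range N, ((l.factorial : ℂ))⁻¹ * twist l e b p z ζ := by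
  -- The same recursion with the two factors exchanged; the exponents e now belong to the given
  -- symbol p.
  obtain ⟨g, hg, hgh⟩ := exists_inverse_components (T := fun l a b => twist l e b a) (m := m) (h := h)
    (fun l a => twist_zero_left l e a) (fun _ _ _ _ => mul_comm _ _)
    (fun l d d' _ _ ha hb => by rw [add_comm d d']; exact hb.twist l e ha) hp.hom hw
  obtain ⟨b, hb⟩ := exists_expands hg
  obtain ⟨c, hc, hcN⟩ := hb.exists_product e hp
  refine ⟨b, g, hb, fun N => ?_⟩
  have h1 := (hc.restrict cornerInt_le_ambient).isSymbol_one_sub (fun j z hz ζ hζ => by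
    rw [← hgh j z ζ (hwh z ⟨hz.1, fun l => (hz.2 l).le⟩ ζ hζ)]
    refine Finset.sum_congr rfl fun s _ => ?_
    congr 1
    exact Finset.Nat.sum_antidiagonal_swap (n := s.2)
      (f := fun t => twist s.1 e (g t.2) (h t.1) z ζ)) N
  exact (h1.add ((hcN N).restrict cornerInt_le_ambient)).congr fun z _ ζ => by ring

/-! ### Corner-degenerate operators in terms of `theta` -/

theorem HasExpansionUpToCorner.exists_expands {m : ℝ} {A : Operator (cornerInt S Y)}
    {p : Fn (Coord k n q)} {h : ℕ → Fn (Coord k n q)} (hp : HasExpansionUpToCorner S Y m p h)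
    (hA : HasLeftSymbol A (cornerSymbol m p)) : ∃ p' h', Expands (ambient S Y) m p' h' ∧
      HasLeftSymbol A (theta (fun _ => -m) p') ∧ ∀ z ∈ corner S Y, ∀ ζ ≠ 0, h' 0 z ζ = h 0 z ζ := by
  obtain ⟨p', h', he, hpp, hhh⟩ := hp
  refine ⟨p', h', hasExpansion_iff.1 he, hA.congr fun z hz ζ => ?_, fun z hz ζ hζ =>
    (hhh 0 z hz ζ hζ).symm⟩
  rw [cornerSymbol_eq (rPart_pos hz), theta, theta, hpp z ⟨hz.1, fun l => (hz.2 l).le⟩]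

/-- Since `theta` preserves expansions over the interior, the corner-degenerate symbol is classical
there, which is the first half of the definition. -/
theorem Expands.isCornerPsiDO {m : ℝ} {A : Operator (cornerInt S Y)} {p : Fn (Coord k n q)}
    {h : ℕ → Fn (Coord k n q)} (hp : Expands (ambient S Y) m p h)
    (hA : HasLeftSymbol A (CornerPsiDO.theta (fun _ => -m) p)) : IsCornerPsiDO m A := by
  refine ⟨⟨_, ⟨_, hasExpansion_iff.2 ((hp.restrict cornerInt_le_ambient).theta _)⟩, hA⟩,
    p, h, ⟨p, h, hasExpansion_iff.2 hp, fun _ _ _ => rfl, fun _ _ _ _ _ => rfl⟩,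
    hA.congr fun z hz ζ => (cornerSymbol_eq (rPart_pos hz) ζ).symm⟩

theorem IsCornerPsiDO.exists_comp {μ ν : ℝ} {A B : Operator (cornerInt S Y)}
    (hA : IsCornerPsiDO μ A) (hB : IsCornerPsiDO ν B)
    (hAB : IsProperlySupported A ∨ IsProperlySupported B) :
    ∃ C, IsComposition A B C ∧ IsCornerPsiDO (μ + ν) C := by
  obtain ⟨-, p, h, hp, hA⟩ := hA
  obtain ⟨-, p', h', hp', hB⟩ := hB
  obtain ⟨p, h, hp, hA, -⟩ := hp.exists_expands hA
  obtain ⟨p', h', hp', hB, -⟩ := hp'.exists_expands hB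
  have hL : LocComposable A B :=
    hAB.elim (fun h => locComposable_of_left h B) (locComposable_of_right A)
  obtain ⟨C, hC⟩ := hL.exists_isComposition
  -- The exponents are those of the second factor, the symbol of B.
  obtain ⟨c, hc, hcN⟩ := hp.exists_product (fun _ => -ν) hp'
  have hps := hp.isSymbol.restrict (cornerInt_le_ambient (S := S) (Y := Y))
  have hps' := hp'.isSymbol.restrict (cornerInt_le_ambient (S := S) (Y := Y))
  have h1 := hA.comp hB (hps.theta _) (hps'.theta _) hC hL
    (isSymbol_theta_sub hps hps' fun N => (hcN N).restrict cornerInt_le_ambient)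
  have h2 : ((fun _ => -μ) + fun _ => -ν : Fin k → ℝ) = fun _ => -(μ + ν) := by
    funext
    simp only [Pi.add_apply]
    ring
  rw [h2] at h1
  exact ⟨C, hC, hc.isCornerPsiDO h1⟩

theorem IsElliptic.exists_parametrix {μ : ℝ} {A : Operator (cornerInt S Y)} (hA : IsElliptic μ A) :
    ∃ P, IsCornerPsiDO (-μ) P ∧ IsProperlySupported P ∧
      (∃ C, IsComposition P A C ∧ IsSmoothing (idOp (cornerInt S Y) - C)) ∧
      (∃ C, IsComposition A P C ∧ IsSmoothing (idOp (cornerInt S Y) - C)) := by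
  obtain ⟨p, h, hp, hA, hne⟩ := hA
  obtain ⟨p, h', hp, hA, h0⟩ := hp.exists_expands hA
  obtain ⟨w, hw, hwh⟩ := exists_elliptic_inverse (sub_zero μ ▸ Nat.cast_zero (R := ℝ) ▸ hp.hom 0)
    fun z hz ζ hζ => (h0 z hz ζ hζ).trans_ne (hne z hz ζ hζ)
  -- In A P the second factor has order -μ and hence exponents -(-μ); for the left inverse in the
  -- next line the second factor is the symbol of A.
  obtain ⟨b, g, hb, hbN⟩ := exists_right_inverse (fun _ => - -μ) hp hw hwh
  obtain ⟨b', g', hb', hbN'⟩ := exists_left_inverse (fun _ => -μ) hp hw hwh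
  have hps := hp.isSymbol.restrict (cornerInt_le_ambient (S := S) (Y := Y))
  have hbs := hb.isSymbol.restrict (cornerInt_le_ambient (S := S) (Y := Y))
  have hbs' := hb'.isSymbol.restrict (cornerInt_le_ambient (S := S) (Y := Y))
  have hone : ∀ e e' : Fin k → ℝ, e + e' = 0 → ∀ z ζ : Sp (Coord k n q),
      theta (e + e') (fun _ _ => 1) z ζ = 1 := fun e e' he z ζ => by
    rw [he, theta, monom_zero, Complex.ofReal_one, mul_one]
  obtain ⟨P, hPb, hP, hC, hC'⟩ := CornerPsiDO.exists_parametrix hA (hps.theta _) (hbs.theta _)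
    (hbs'.theta fun _ => - -μ)
    (fun N => (isSymbol_theta_sub (e := fun _ => -μ) (c := fun _ _ => 1) hps hbs hbN N).congr fun z _ ζ => by
      rw [hone _ _ (by funext; simp)])
    (fun N => (isSymbol_theta_sub (e := fun _ => - -μ) (c := fun _ _ => 1) hbs' hps hbN' N).congr fun z _ ζ => by
      rw [hone _ _ (by funext; simp)])
  exact ⟨P, hb.isCornerPsiDO hPb, hP, hC, hC'⟩

end Corner

end CornerPsiDO

/-- On the interior of a stretched corner, (i) corner-degenerate classical pseudo-differential
operators are closed under composition if one factor is properly supported, and (ii) every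
`σ_ψ`-elliptic one has a properly supported parametrix in the class of opposite order. -/
theorem theoremt (k n : ℕ) (q : Fin k → ℕ) (S : TopologicalSpace.Opens (EuclideanSpace ℝ (Fin n)))
    (Y : (l : Fin k) → TopologicalSpace.Opens (EuclideanSpace ℝ (Fin (q l)))) :
    (∀ (μ ν : ℝ) (A B : CornerPsiDO.Operator (CornerPsiDO.cornerInt S Y)),
      CornerPsiDO.IsCornerPsiDO μ A → CornerPsiDO.IsCornerPsiDO ν B →
      (CornerPsiDO.IsProperlySupported A ∨ CornerPsiDO.IsProperlySupported B) →
      ∃ C : CornerPsiDO.Operator (CornerPsiDO.cornerInt S Y),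
        CornerPsiDO.IsComposition A B C ∧ CornerPsiDO.IsCornerPsiDO (μ + ν) C) ∧
    (∀ (μ : ℝ) (A : CornerPsiDO.Operator (CornerPsiDO.cornerInt S Y)),
      CornerPsiDO.IsCornerPsiDO μ A → CornerPsiDO.IsElliptic μ A →
      ∃ P : CornerPsiDO.Operator (CornerPsiDO.cornerInt S Y),
        CornerPsiDO.IsCornerPsiDO (-μ) P ∧ CornerPsiDO.IsProperlySupported P ∧
        (∃ C, CornerPsiDO.IsComposition P A C ∧
          CornerPsiDO.IsSmoothing (CornerPsiDO.idOp (CornerPsiDO.cornerInt S Y) - C)) ∧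
        (∃ C, CornerPsiDO.IsComposition A P C ∧
          CornerPsiDO.IsSmoothing (CornerPsiDO.idOp (CornerPsiDO.cornerInt S Y) - C))) :=
  ⟨fun _ _ _ _ hA hB hAB => hA.exists_comp hB hAB, fun _ _ _ hA => hA.exists_parametrix⟩
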